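/- **Setting.** Write $z=(t,x)\in\mathbb R^2$ and $|z|=|t|^{1/2}+|x|$, let $P(t,x)=\mathbf 1_{t>0}(4\pi t)^{-1/2}e^{-x^2/(4t)}$ be the heat kernel, let a prime denote $\partial_x$ and $*$ space-time convolution. A *mollifier* is a smooth compactly supported $\rho:\mathbb R^2\to\mathbb R$ with $\int\rho=1$ and $\rho(t,-x)=\rho(t,x)$; set $\rho_\varepsilon(t,x)=\varepsilon^{-3}\rho(\varepsilon^{-2}t,\varepsilon^{-1}x)$. A *cutoff kernel* is a function $K:\mathbb R^2\to\mathbb R$ supported in $\{|z|\le1\}$, with $K(t,x)=0$ for $t\le0$ and $K(t,-x)=K(t,x)$, which is smooth outside the origin and equals $P$ on $\{|z|<1/2\}$. Set $K_\varepsilon'=\rho_\varepsilon*K'$ and $$C_0^{(\varepsilon)}=\int K_\varepsilon'(-z)^2\,dz,$$ $$C_2^{(\varepsilon)}=\int K'(-z_1)\,K_\varepsilon'(-z_2)\,K_\varepsilon'(z_1-z_4)\,K'(z_1-z_3)\,K_\varepsilon'(z_3-z_4)\,K_\varepsilon'(z_3-z_2)\,dz_1dz_2dz_3dz_4,$$ $$C_3^{(\varepsilon)}=\int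 K'(-z_1)\,K'(-z_2)\,K_\varepsilon'(z_1-z_3)\,K_\varepsilon'(z_2-z_3)\,K_\varepsilon'(z_1-z_4)\,K_\varepsilon'(z_2-z_4)\,dz_1dz_2dz_3dz_4 .$$ Consider formal expressions built from a symbol $\Psi$ (which stands for $\mathcal I'(\Xi)$, with $\Xi$ the noise) by products, an operator $\mathcal I'$ and an operator $\mathcal E$. Let $\mathscr B$ be the set of all expressions of one of the forms $$\mathcal E^\ell\bigl(\Psi^{2\ell}\,\mathcal I'(\mathcal E^m(\Psi^{2m+2}))\,\mathcal I'(\mathcal E^n(\Psi^{2n+2}))\bigr),\qquad \mathcal E^\ell\bigl(\Psi^{2\ell+1}\,\mathcal I'(\mathcal E^m(\Psi^{2m+1}\,\mathcal I'(\mathcal E^n(\Psi^{2n+2}))))\bigr),$$ with integers $\ell,m,n\ge0$. On linear combinations of expressions let $L$ be the linear map with $L\Psi^j=\binom j2\Psi^{j-2}$, $L(\tau\mathcal I'(\bar\tau))=L(\tau)\mathcal I'(\bar\tau)+\tau\mathcal I'(L\bar\tau)$ and $L\mathcal E(\tau)=\mathcal E(L\tau)$ (here $\bar\tau\ne\Xi$),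 and let $M^{\mathrm{Wick}}=\exp(-C_0^{(\varepsilon)}L)$, a finite sum on each expression. Let $\xi$ be space-time white noise on $\mathbb R^2$, $\xi^{(\varepsilon)}=\rho_\varepsilon*\xi$, and let $\boldsymbol\Pi^{(\varepsilon)}$ be the linear and multiplicative map with $\boldsymbol\Pi^{(\varepsilon)}\Psi=K'*\xi^{(\varepsilon)}$, $\boldsymbol\Pi^{(\varepsilon)}\mathcal I'(\tau)=K'*\boldsymbol\Pi^{(\varepsilon)}\tau$ and $\boldsymbol\Pi^{(\varepsilon)}\mathcal E(\tau)=\varepsilon\,\boldsymbol\Pi^{(\varepsilon)}\tau$. Define $$C_\tau^{(\varepsilon)}=\mathbf E\bigl(\boldsymbol\Pi^{(\varepsilon)}M^{\mathrm{Wick}}\tau\bigr)(0).$$ **Theorem.** Let $\rho$ be a mollifier. 1. For every cutoff kernel $K$ the integrals $C_2^{(\varepsilon)}$ and $C_3^{(\varepsilon)}$ converge absolutely for every $\varepsilon>0$, and there is a constant $c\in\mathbb R$, depending on $K$ and $\rho$, such that $$\lim_{\varepsilon\to0}\bigl(C_3^{(\varepsilon)}+4C_2^{(\varepsilon)}\bigr)=c.$$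 2. For every $\tau\in\mathscr B\setminus\{\mathcal I'(\Psi^2)^2,\ \Psi\mathcal I'(\Psi\mathcal I'(\Psi^2))\}$ there is a constant $c_\tau\in\mathbb R$, independent of the choice of the cutoff kernel $K$, such that for every $K$ the random variable in the definition of $C_\tau^{(\varepsilon)}$ is integrable for every $\varepsilon>0$ and $$\lim_{\varepsilon\to0}C_\tau^{(\varepsilon)}=c_\tau .$$ -/

import Mathlib

open MeasureTheory ProbabilityTheory Filter Topology
open scoped SchwartzMap

noncomputable section

namespace KPZLogs

/-! ### Kernels on space-time -/

/-- Space-time `ℝ²`; a point is `z = (t, x)`. -/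
abbrev SpaceTime : Type := ℝ × ℝ

/-- The parabolic norm `|z| = |t|^{1/2} + |x|`. -/
def paraNorm (z : SpaceTime) : ℝ := Real.sqrt |z.1| + |z.2|

/-- The heat kernel on the line, i.e. the fundamental solution of `∂ₜ - ∂ₓ²`, extended by `0` to
non-positive times. -/
def heatKernel (z : SpaceTime) : ℝ :=
  if 0 < z.1 then Real.exp (-z.2 ^ 2 / (4 * z.1)) / Real.sqrt (4 * Real.pi * z.1) else 0

/-- The cutoff kernels: compactly supported in the parabolic unit ball, non-anticipative,
symmetric in space, smooth away from the origin, equal to the heat kernel near the origin. -/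
structure CutoffKernel where
  toFun : SpaceTime → ℝ
  supported : ∀ z, 1 < paraNorm z → toFun z = 0
  causal : ∀ t x : ℝ, t ≤ 0 → toFun (t, x) = 0
  even_space : ∀ t x : ℝ, toFun (t, -x) = toFun (t, x)
  eq_heatKernel : ∀ z, paraNorm z < 1 / 2 → toFun z = heatKernel z
  smooth : ContDiffOn ℝ ((⊤ : ℕ∞) : WithTop ℕ∞) toFun {(0 : SpaceTime)}ᶜ

/-- The spatial derivative `K'` of the kernel `K`. -/
def CutoffKernel.deriv (K : CutoffKernel) (z : SpaceTime) : ℝ :=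
  _root_.deriv (fun x : ℝ => K.toFun (z.1, x)) z.2

/-- Mollifiers: smooth, compactly supported, of integral `1`, symmetric in space. -/
structure Mollifier where
  toFun : SpaceTime → ℝ
  smooth : ContDiff ℝ ((⊤ : ℕ∞) : WithTop ℕ∞) toFun
  compact : HasCompactSupport toFun
  integral_eq_one : ∫ z, toFun z = 1
  even_space : ∀ t x : ℝ, toFun (t, -x) = toFun (t, x)

/-- `ρ_ε(t, x) = ε⁻³ ρ(ε⁻² t, ε⁻¹ x)`. -/
def Mollifier.scaled (ρ : Mollifier) (ε : ℝ) (z : SpaceTime) : ℝ :=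
  (ε ^ 3)⁻¹ * ρ.toFun ((ε ^ 2)⁻¹ * z.1, ε⁻¹ * z.2)

/-- Space-time convolution of two functions. -/
def conv (f g : SpaceTime → ℝ) : SpaceTime → ℝ :=
  convolution f g (ContinuousLinearMap.mul ℝ ℝ) volume

/-- The regularised kernel `K'_ε = ρ_ε * K'`. -/
def epsKernel (ρ : Mollifier) (K : CutoffKernel) (ε : ℝ) : SpaceTime → ℝ :=
  conv (ρ.scaled ε) K.deriv

/-- The factor associated with an arrow from `a` to `b` that represents the kernel `F`. -/
def arrow (F : SpaceTime → ℝ) (a b : SpaceTime) : ℝ := F (b - a)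

/-! ### The constants given by Feynman graphs -/

/-- The Wick constant `C_0^{(ε)}`: two regularised arrows from an integrated vertex to `0`. -/
def C0 (ρ : Mollifier) (K : CutoffKernel) (ε : ℝ) : ℝ :=
  ∫ z : SpaceTime, arrow (epsKernel ρ K ε) z 0 * arrow (epsKernel ρ K ε) z 0

/-- Product of the kernels over the edges of the graph that defines `C_2^{(ε)}`; the argument is
`(z₁, z₂, z₃, z₄)`. -/
def C2Integrand (ρ : Mollifier) (K : CutoffKernel) (ε : ℝ)
    (z : SpaceTime × SpaceTime × SpaceTime × SpaceTime) : ℝ :=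
  arrow K.deriv z.1 0 * arrow (epsKernel ρ K ε) z.2.1 0 *
    arrow (epsKernel ρ K ε) z.2.2.2 z.1 * arrow K.deriv z.2.2.1 z.1 *
    arrow (epsKernel ρ K ε) z.2.2.2 z.2.2.1 * arrow (epsKernel ρ K ε) z.2.1 z.2.2.1

/-- The constant `C_2^{(ε)}`. -/
def C2 (ρ : Mollifier) (K : CutoffKernel) (ε : ℝ) : ℝ := ∫ z, C2Integrand ρ K ε z

/-- Product of the kernels over the edges of the graph that defines `C_3^{(ε)}`; the argument is
`(z₁, z₂, z₃, z₄)`. -/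
def C3Integrand (ρ : Mollifier) (K : CutoffKernel) (ε : ℝ)
    (z : SpaceTime × SpaceTime × SpaceTime × SpaceTime) : ℝ :=
  arrow K.deriv z.1 0 * arrow K.deriv z.2.1 0 *
    arrow (epsKernel ρ K ε) z.2.2.1 z.1 * arrow (epsKernel ρ K ε) z.2.2.1 z.2.1 *
    arrow (epsKernel ρ K ε) z.2.2.2 z.1 * arrow (epsKernel ρ K ε) z.2.2.2 z.2.1

/-- The constant `C_3^{(ε)}`. -/
def C3 (ρ : Mollifier) (K : CutoffKernel) (ε : ℝ) : ℝ := ∫ z, C3Integrand ρ K ε z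

/-! ### White noise and its regularisation -/

/-- `ξ` is space-time white noise on `ℝ²`: a random tempered distribution such that each `ξ(φ)` is
centred Gaussian with variance `‖φ‖²` in `L²`. By linearity the family `(ξ(φ))_φ` is then jointly
Gaussian with covariance the `L²` inner product. -/
structure IsWhiteNoise {Ω : Type*} [MeasurableSpace Ω] (P : Measure Ω)
    (ξ : Ω → (𝓢(SpaceTime, ℝ) →L[ℝ] ℝ)) : Prop where
  measurable : ∀ φ : 𝓢(SpaceTime, ℝ), Measurable fun ω => ξ ω φ
  law : ∀ φ : 𝓢(SpaceTime, ℝ),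
    P.map (fun ω => ξ ω φ) = gaussianReal 0 (Real.toNNReal (∫ z, φ z ^ 2))

theorem Mollifier.contDiff_test (ρ : Mollifier) (ε : ℝ) (z : SpaceTime) :
    ContDiff ℝ ((⊤ : ℕ∞) : WithTop ℕ∞) fun w : SpaceTime => ρ.scaled ε (z - w) := by
  unfold Mollifier.scaled
  refine contDiff_const.mul (ρ.smooth.comp ?_)
  fun_prop

theorem Mollifier.hasCompactSupport_test (ρ : Mollifier) (ε : ℝ) (z : SpaceTime) :
    HasCompactSupport fun w : SpaceTime => ρ.scaled ε (z - w) := by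
  by_cases hε : ε = 0
  · subst hε
    have : (fun w : SpaceTime => ρ.scaled 0 (z - w)) = 0 := by
      funext w; simp [Mollifier.scaled]
    rw [this]
    exact HasCompactSupport.zero
  · obtain ⟨S, hS, hS'⟩ := exists_compact_iff_hasCompactSupport.mpr ρ.compact
    let g : SpaceTime → SpaceTime := fun u => (z.1 - ε ^ 2 * u.1, z.2 - ε * u.2)
    refine HasCompactSupport.intro (K := g '' S) (hS.image (by fun_prop)) fun w hw => ?_
    have hnot : ((ε ^ 2)⁻¹ * (z - w).1, ε⁻¹ * (z - w).2) ∉ S := by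
      intro h
      refine hw ⟨_, h, ?_⟩
      ext <;> simp [g] <;> field_simp <;> ring
    rw [Mollifier.scaled, hS' _ hnot, mul_zero]

/-- The test function `w ↦ ρ_ε(z - w)`. -/
def Mollifier.test (ρ : Mollifier) (ε : ℝ) (z : SpaceTime) : 𝓢(SpaceTime, ℝ) :=
  (ρ.hasCompactSupport_test ε z).toSchwartzMap (ρ.contDiff_test ε z)

/-- A realisation of the regularised noise `ξ^{(ε)} = ρ_ε * ξ`, where `ξ` is a distribution. -/
def regularise (ρ : Mollifier) (ε : ℝ) (ξ : 𝓢(SpaceTime, ℝ) →L[ℝ] ℝ) (z : SpaceTime) : ℝ :=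
  ξ (ρ.test ε z)

/-! ### Symbols -/

/-- Formal expressions built from `Ψ = I'(Ξ)`. The noise symbol `Ξ` enters only through `Ψ`, so that
`I'` is otherwise applied only to expressions different from `Ξ`. Expressions that
differ by the order of the factors are not identified; this affects none of the maps below. -/
inductive Symb : Type
  /-- `psiPow j` is `Ψ ^ j`; in particular `psiPow 0` is the unit symbol. -/
  | psiPow (j : ℕ) : Symb
  /-- `mulI τ σ` is `τ I'(σ)`. -/
  | mulI (τ σ : Symb) : Symb
  /-- `eps τ` is `E(τ)`, where `E` represents multiplication by `ε`. -/
  | eps (τ : Symb) : Symb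

namespace Symb

/-- `E^k(τ)`. -/
def epsPow (k : ℕ) (τ : Symb) : Symb := eps^[k] τ

/-- `E^ℓ(Ψ^{2ℓ} I'(E^m(Ψ^{2m+2})) I'(E^n(Ψ^{2n+2})))`. -/
def typeA (ℓ m n : ℕ) : Symb :=
  epsPow ℓ (mulI (mulI (psiPow (2 * ℓ)) (epsPow m (psiPow (2 * m + 2))))
    (epsPow n (psiPow (2 * n + 2))))

/-- `E^ℓ(Ψ^{2ℓ+1} I'(E^m(Ψ^{2m+1} I'(E^n(Ψ^{2n+2})))))`. -/
def typeB (ℓ m n : ℕ) : Symb :=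
  epsPow ℓ (mulI (psiPow (2 * ℓ + 1))
    (epsPow m (mulI (psiPow (2 * m + 1)) (epsPow n (psiPow (2 * n + 2))))))

/-- The set `𝓑` of symbols whose renormalisation only shifts the average speed. -/
def setB : Set Symb := {τ | ∃ ℓ m n : ℕ, τ = typeA ℓ m n ∨ τ = typeB ℓ m n}

/-- The symbol `I'(Ψ²)²`. -/
def tree22 : Symb := mulI (mulI (psiPow 0) (psiPow 2)) (psiPow 2)

/-- The symbol `Ψ I'(Ψ I'(Ψ²))`. -/
def tree211 : Symb := mulI (psiPow 1) (mulI (psiPow 1) (psiPow 2))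

/-! ### Wick renormalisation -/

/-- The generator `L` of Wick renormalisation on symbols:
`L Ψ^j = (j choose 2) Ψ^{j-2}`, `L(τ I'(σ)) = L(τ) I'(σ) + τ I'(L σ)`, `L E(τ) = E(L τ)`. -/
def wickGenSymb : Symb → (Symb →₀ ℝ)
  | psiPow j => Finsupp.single (psiPow (j - 2)) (j.choose 2 : ℝ)
  | mulI τ σ =>
      (wickGenSymb τ).mapDomain (fun τ' => mulI τ' σ) +
        (wickGenSymb σ).mapDomain (fun σ' => mulI τ σ')
  | eps τ => (wickGenSymb τ).mapDomain eps

/-- The generator `L` as a linear map on the span of the symbols. -/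
def wickGen : (Symb →₀ ℝ) →ₗ[ℝ] (Symb →₀ ℝ) := Finsupp.linearCombination ℝ wickGenSymb

/-- The Wick renormalisation map `M = exp(-C L) = ∑ₖ (-C)^k / k! L^k`. The sum is finite when applied to
any given element, since `L` is locally nilpotent (see `wickGen_pow_support_finite`). -/
def wickMap (C : ℝ) (u : Symb →₀ ℝ) : Symb →₀ ℝ :=
  ∑ᶠ k : ℕ, ((-C) ^ k / (k.factorial : ℝ)) • (wickGen ^ k) u

/-- The number of occurrences of `Ψ`. -/
def psiCount : Symb → ℕ
  | psiPow j => j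
  | mulI τ σ => psiCount τ + psiCount σ
  | eps τ => psiCount τ

theorem psiCount_of_wickGenSymb_ne_zero (τ σ : Symb) (h : wickGenSymb τ σ ≠ 0) :
    psiCount σ + 2 = psiCount τ := by
  induction τ generalizing σ with
  | psiPow j =>
    classical
    rw [wickGenSymb, Finsupp.single_apply] at h
    split_ifs at h with h1
    · subst h1
      have : 2 ≤ j := by
        by_contra hj
        exact h (by simp [Nat.choose_eq_zero_of_lt (by omega : j < 2)])
      simp only [psiCount]; omega
    · exact absurd rfl h
  | mulI a b iha ihb =>
    classical
    rw [wickGenSymb] at h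
    have h' := Finsupp.support_add (Finsupp.mem_support_iff.mpr h)
    rcases Finset.mem_union.mp h' with h' | h'
    · obtain ⟨c, hc, rfl⟩ := Finset.mem_image.mp (Finsupp.mapDomain_support h')
      have := iha c (Finsupp.mem_support_iff.mp hc)
      simp only [psiCount]; omega
    · obtain ⟨c, hc, rfl⟩ := Finset.mem_image.mp (Finsupp.mapDomain_support h')
      have := ihb c (Finsupp.mem_support_iff.mp hc)
      simp only [psiCount]; omega
  | eps a iha =>
    classical
    rw [wickGenSymb] at h
    obtain ⟨c, hc, rfl⟩ :=
      Finset.mem_image.mp (Finsupp.mapDomain_support (Finsupp.mem_support_iff.mpr h))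
    have := iha c (Finsupp.mem_support_iff.mp hc)
    simpa only [psiCount] using this

theorem wickGen_pow_apply_eq_zero (N k : ℕ) (hk : N < k) (u : Symb →₀ ℝ)
    (hu : ∀ τ ∈ u.support, psiCount τ ≤ N) : (wickGen ^ k) u = 0 := by
  induction N using Nat.strong_induction_on generalizing k u with
  | _ N ih =>
    obtain ⟨k, rfl⟩ : ∃ k', k = k' + 1 := ⟨k - 1, by omega⟩
    rw [pow_succ, Module.End.mul_apply]
    have key : ∀ σ ∈ (wickGen u).support, psiCount σ + 2 ≤ N := by
      intro σ hσ
      rw [Finsupp.mem_support_iff, wickGen, Finsupp.linearCombination_apply,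
        Finsupp.sum_apply] at hσ
      obtain ⟨τ, hτ, hne⟩ := Finset.exists_ne_zero_of_sum_ne_zero hσ
      have h1 := psiCount_of_wickGenSymb_ne_zero τ σ
        (fun h0 => hne (by simp [h0]))
      have h2 := hu τ hτ
      omega
    by_cases hN : N = 0
    · have : wickGen u = 0 := by
        rw [← Finsupp.support_eq_empty, Finset.eq_empty_iff_forall_notMem]
        intro σ hσ
        have := key σ hσ
        omega
      rw [this, map_zero]
    · exact ih (N - 1) (by omega) k (by omega) _ fun σ hσ => by
        have := key σ hσ
        omega

theorem wickGen_pow_support_finite (C : ℝ) (u : Symb →₀ ℝ) :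
    (Function.support fun k : ℕ =>
      ((-C) ^ k / (k.factorial : ℝ)) • (wickGen ^ k) u).Finite := by
  refine (Set.finite_Iic (u.support.sup psiCount)).subset fun k hk => ?_
  by_contra h
  refine hk ?_
  simp only
  rw [wickGen_pow_apply_eq_zero (u.support.sup psiCount) k (by simpa using h) u
    fun τ hτ => Finset.le_sup (f := psiCount) hτ, smul_zero]

/-! ### Canonical realisation of symbols -/

/-- The realisation `Π^{(ε)} τ` of a symbol for the driving noise `ζ`:
`Π I'(τ) = K' * Π τ`, `Π E(τ) = ε Π τ`, multiplicative, with `Π Ξ = ζ`. -/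
def realise (K : CutoffKernel) (ε : ℝ) (ζ : SpaceTime → ℝ) : Symb → SpaceTime → ℝ
  | psiPow j => fun z => conv K.deriv ζ z ^ j
  | mulI τ σ => fun z => realise K ε ζ τ z * conv K.deriv (realise K ε ζ σ) z
  | eps τ => fun z => ε * realise K ε ζ τ z

/-- Linear extension of `realise` to the span of the symbols. -/
def realiseLin (K : CutoffKernel) (ε : ℝ) (ζ : SpaceTime → ℝ) (u : Symb →₀ ℝ) (z : SpaceTime) : ℝ :=
  u.sum fun τ a => a * realise K ε ζ τ z

end Symb

/-- The random variable `(Π^{(ε)} M^{Wick} τ)(0)`, with Wick constant `C_0^{(ε)}` and driving noise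
`ξ^{(ε)} = ρ_ε * ξ`. -/
def renormVariable (ρ : Mollifier) (K : CutoffKernel) (ε : ℝ) (τ : Symb)
    (ξ : 𝓢(SpaceTime, ℝ) →L[ℝ] ℝ) : ℝ :=
  Symb.realiseLin K ε (regularise ρ ε ξ)
    (Symb.wickMap (C0 ρ K ε) (Finsupp.single τ 1)) 0

/-- The constant `C_τ^{(ε)} = 𝐄 (Π^{(ε)} M^{Wick} τ)(0)`. -/
def Ctau {Ω : Type*} [MeasurableSpace Ω] (P : Measure Ω) (ξ : Ω → (𝓢(SpaceTime, ℝ) →L[ℝ] ℝ))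
    (ρ : Mollifier) (K : CutoffKernel) (ε : ℝ) (τ : Symb) : ℝ :=
  ∫ ω, renormVariable ρ K ε τ (ξ ω) ∂P

end KPZLogs

end

open scoped ENNReal NNReal

noncomputable section

namespace KPZLogs

/-! ### The parabolic norm and parabolic dilations -/

/-! Everything is brought to one scale. Under the parabolic rescaling `scaleKer ε`, the mollifier at
scale ε becomes the mollifier at scale 1, the kernel K' becomes k(t, x) = ε² K'(ε² t, ε x), and the
covariance of the regularised field becomes Q = `ρ.cov k`. The kernels k satisfy |k| ≲ |z|⁻² and a
Hölder bound of exponent 1/2, uniformly in ε, and they converge pointwise to `heatDeriv`, the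
derivative P' of the heat kernel, which is invariant under the rescaling. Hence |Q| ≲ min(1, |z|⁻¹),
and every integral that is dominated uniformly in ε has a limit in which only P' and ρ remain; this
is why the limits do not see the cutoff.

Second assertion. `wickMap` is the exponential of a derivation, so it replaces each power of Ψ by
the Hermite polynomial whose variance C₀ is that of K' * ξ_ε. The expectation of a product of three
such Wick powers contains no self-contractions and is a single monomial in the three covariances
(`tripleWick_eq`). Homogeneity absorbs the powers of ε, and the constant equals κ ∫∫ k k Q^a Q^b Q^c
over two vertices (`Ctau_typeA_eq`, `Ctau_typeB_eq`). The parabolic dimension being 3, the order 4 +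
a + b + c at infinity competes with 6; the two excluded symbols are those with a + b + c = 2. For
the others, power counting (`lintegral_triWeight_lt_top`) gives domination, with two exceptions in
the second family: if b = 0 the integral vanishes because k is odd in x, and if a = 0, b = 1 the
integral over one vertex is logarithmic by power counting but converges once it is antisymmetrised
in x (`symConv`).

First assertion. Integrating out all vertices but one gives C₃ + 4 C₂ = ∫ ((k ⋆ k) Q² + 4 F k Q) dw,
with ⋆ the correlation and F = `symConv k Q` (`C3_add_four_C2`). Each summand has order exactly 3 at
infinity, hence a logarithmic divergence. For |t| ≥ 1, replacing Q by the unmollified k ⋆ k costs an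
integrable error of order 7/2; the slab |t| < 1 converges as it is (`exists_tendsto_logInt_sub`). By
scale invariance what remains is the unmollified integral for K' over |t| ≥ ε². There K' may be
replaced by P' on ε² ≤ |t| < 1 with an error of order 11/4 < 3 at the origin, and for P' the
integral vanishes identically: P' ⋆ P' = P(|t|, ·)/2 and ∂ₓF = P/4 for t > 0, so that the sum of the
integrand at t and at -t is P³/4 + 2 F P P' = ∂ₓ(F P²) (`integral_bareLogInt_heatDeriv_add`). The
factor 4 is exactly the one that completes this derivative. -/

theorem paraNorm_nonneg (z : SpaceTime) : 0 ≤ paraNorm z := by unfold paraNorm; positivity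

theorem paraNorm_zero : paraNorm 0 = 0 := by simp [paraNorm]

theorem paraNorm_pos {z : SpaceTime} (hz : z ≠ 0) : 0 < paraNorm z := by
  unfold paraNorm
  by_cases h : z.1 = 0
  · have : z.2 ≠ 0 := fun h2 => hz (Prod.ext h h2)
    positivity
  · have : 0 < |z.1| := abs_pos.mpr h
    have := Real.sqrt_pos.mpr this
    positivity

theorem paraNorm_neg (z : SpaceTime) : paraNorm (-z) = paraNorm z := by simp [paraNorm]

theorem paraNorm_add_le (z w : SpaceTime) : paraNorm (z + w) ≤ paraNorm z + paraNorm w := by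
  unfold paraNorm
  have h1 : Real.sqrt |(z + w).1| ≤ Real.sqrt |z.1| + Real.sqrt |w.1| := by
    refine Real.sqrt_le_iff.mpr ⟨by positivity, ?_⟩
    have := abs_add_le z.1 w.1
    have h1 := Real.sq_sqrt (abs_nonneg z.1)
    have h2 := Real.sq_sqrt (abs_nonneg w.1)
    have h3 := mul_nonneg (Real.sqrt_nonneg |z.1|) (Real.sqrt_nonneg |w.1|)
    simp only [Prod.fst_add]
    nlinarith
  have h2 : |(z + w).2| ≤ |z.2| + |w.2| := abs_add_le z.2 w.2
  linarith

theorem paraNorm_sub_comm (z w : SpaceTime) : paraNorm (z - w) = paraNorm (w - z) := by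
  rw [← paraNorm_neg, neg_sub]

theorem paraNorm_le_add_sub (z w : SpaceTime) : paraNorm z ≤ paraNorm w + paraNorm (z - w) := by
  simpa using paraNorm_add_le w (z - w)

theorem continuous_paraNorm : Continuous paraNorm := by unfold paraNorm; fun_prop

theorem measurable_paraNorm : Measurable paraNorm := continuous_paraNorm.measurable

/-- The parabolic dilation `(t, x) ↦ (l² t, l x)`. -/
def dil (l : ℝ) (z : SpaceTime) : SpaceTime := (l ^ 2 * z.1, l * z.2)

theorem paraNorm_dil {l : ℝ} (hl : 0 ≤ l) (z : SpaceTime) :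
    paraNorm (dil l z) = l * paraNorm z := by
  simp only [paraNorm, dil, abs_mul, abs_of_nonneg hl, abs_of_nonneg (sq_nonneg l)]
  rw [Real.sqrt_mul (sq_nonneg l), Real.sqrt_sq hl]
  ring

theorem dil_sub (l : ℝ) (z w : SpaceTime) : dil l (z - w) = dil l z - dil l w := by
  ext <;> simp [dil] <;> ring

theorem dil_add (l : ℝ) (z w : SpaceTime) : dil l (z + w) = dil l z + dil l w := by
  ext <;> simp [dil] <;> ring

theorem dil_neg (l : ℝ) (z : SpaceTime) : dil l (-z) = -dil l z := by
  ext <;> simp [dil]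

theorem dil_dil (l m : ℝ) (z : SpaceTime) : dil l (dil m z) = dil (l * m) z := by
  ext <;> simp [dil] <;> ring

theorem dil_one (z : SpaceTime) : dil 1 z = z := by ext <;> simp [dil]

theorem measurable_dil (l : ℝ) : Measurable (dil l) := by unfold dil; fun_prop

/-- Parabolic dilations as measurable equivalences. -/
def dilEquiv (l : ℝ) (hl : l ≠ 0) : SpaceTime ≃ᵐ SpaceTime where
  toFun := dil l
  invFun := dil l⁻¹
  left_inv z := by rw [dil_dil, inv_mul_cancel₀ hl, dil_one]
  right_inv z := by rw [dil_dil, mul_inv_cancel₀ hl, dil_one]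
  measurable_toFun := measurable_dil l
  measurable_invFun := measurable_dil l⁻¹

/-- The Jacobian l² · l makes 3 the parabolic dimension, the threshold in every power count below.
-/
theorem map_dil_volume {l : ℝ} (hl : 0 < l) :
    (volume : Measure SpaceTime).map (dil l) = ENNReal.ofReal (l ^ 3)⁻¹ • volume := by
  have h1 : Measure.map (l ^ 2 * ·) (volume : Measure ℝ) = ENNReal.ofReal |(l ^ 2)⁻¹| • volume :=
    Real.map_volume_mul_left (by positivity)
  have h2 : Measure.map (l * ·) (volume : Measure ℝ) = ENNReal.ofReal |l⁻¹| • volume :=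
    Real.map_volume_mul_left (by positivity)
  have h3 := Measure.map_prod_map (volume : Measure ℝ) (volume : Measure ℝ)
    (f := (l ^ 2 * ·)) (g := (l * ·)) (by fun_prop) (by fun_prop)
  rw [h1, h2, Measure.prod_smul_left, Measure.prod_smul_right, smul_smul] at h3
  rw [show dil l = Prod.map (l ^ 2 * ·) (l * ·) from rfl, Measure.volume_eq_prod, ← h3,
    ← ENNReal.ofReal_mul (by positivity), abs_of_pos (by positivity), abs_of_pos (by positivity)]
  congr 2
  field_simp

theorem lintegral_comp_dil {l : ℝ} (hl : 0 < l) (f : SpaceTime → ℝ≥0∞) :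
    ∫⁻ z, f (dil l z) = ENNReal.ofReal (l ^ 3)⁻¹ * ∫⁻ z, f z := by
  have := lintegral_map_equiv (μ := (volume : Measure SpaceTime)) f (dilEquiv l hl.ne')
  rw [show ⇑(dilEquiv l hl.ne') = dil l from rfl, map_dil_volume hl, lintegral_smul_measure] at this
  exact this.symm

theorem integral_comp_dil {l : ℝ} (hl : 0 < l) (f : SpaceTime → ℝ) :
    ∫ z, f (dil l z) = (l ^ 3)⁻¹ * ∫ z, f z := by
  have := MeasureTheory.integral_map_equiv (μ := (volume : Measure SpaceTime))
    (dilEquiv l hl.ne') f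
  rw [show ⇑(dilEquiv l hl.ne') = dil l from rfl, map_dil_volume hl, integral_smul_measure,
    ENNReal.toReal_ofReal (by positivity)] at this
  exact this.symm

theorem integral_prod_comp_dil {l : ℝ} (hl : 0 < l) (f : SpaceTime × SpaceTime → ℝ) :
    ∫ p : SpaceTime × SpaceTime, f (dil l p.1, dil l p.2) = (l ^ 6)⁻¹ * ∫ p, f p := by
  have hm : Measurable (dil l) := (dilEquiv l hl.ne').measurable
  have h3 := Measure.map_prod_map (volume : Measure SpaceTime) (volume : Measure SpaceTime) hm hm
  rw [map_dil_volume hl, Measure.prod_smul_left, Measure.prod_smul_right, smul_smul,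
    ← ENNReal.ofReal_mul (by positivity)] at h3
  have := MeasureTheory.integral_map_equiv (μ := (volume : Measure (SpaceTime × SpaceTime)))
    ((dilEquiv l hl.ne').prodCongr (dilEquiv l hl.ne')) f
  rw [show ⇑((dilEquiv l hl.ne').prodCongr (dilEquiv l hl.ne')) = Prod.map (dil l) (dil l) from rfl,
    Measure.volume_eq_prod, ← h3, integral_smul_measure,
    ENNReal.toReal_ofReal (by positivity)] at this
  rw [Measure.volume_eq_prod]
  refine this.symm.trans ?_
  rw [smul_eq_mul]
  congr 1
  field_simp

/-- The spatial reflection `(t, x) ↦ (t, -x)`. -/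
def reflect (z : SpaceTime) : SpaceTime := (z.1, -z.2)

theorem paraNorm_reflect (z : SpaceTime) : paraNorm (reflect z) = paraNorm z := by
  simp [paraNorm, reflect]

theorem reflect_reflect (z : SpaceTime) : reflect (reflect z) = z := by simp [reflect]

theorem reflect_add (z w : SpaceTime) : reflect (z + w) = reflect z + reflect w := by
  ext <;> simp [reflect]; ring

theorem reflect_sub (z w : SpaceTime) : reflect (z - w) = reflect z - reflect w := by
  ext <;> simp [reflect]; ring

theorem reflect_neg (z : SpaceTime) : reflect (-z) = -reflect z := by
  ext <;> simp [reflect]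

theorem dil_reflect (l : ℝ) (z : SpaceTime) : dil l (reflect z) = reflect (dil l z) := by
  ext <;> simp [reflect, dil]

theorem measurePreserving_reflect : MeasurePreserving reflect volume volume := by
  have := (MeasurePreserving.id (volume : Measure ℝ)).prod
    (Measure.measurePreserving_neg (volume : Measure ℝ))
  exact this

theorem measurable_reflect : Measurable reflect := by unfold reflect; fun_prop

/-- `reflect` as a measurable equivalence. -/
def reflectEquiv : SpaceTime ≃ᵐ SpaceTime where
  toFun := reflect
  invFun := reflect
  left_inv := reflect_reflect
  right_inv := reflect_reflect
  measurable_toFun := measurable_reflect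
  measurable_invFun := measurable_reflect

theorem integral_comp_reflect (f : SpaceTime → ℝ) : ∫ z, f (reflect z) = ∫ z, f z :=
  measurePreserving_reflect.integral_comp reflectEquiv.measurableEmbedding f

/-! ### Powers of the parabolic norm -/

/-- The weight `|z|^{-a}` with values in `[0, ∞]`. -/
def pw (a : ℝ) (z : SpaceTime) : ℝ≥0∞ := ENNReal.ofReal (paraNorm z) ^ (-a)

theorem measurable_pw (a : ℝ) : Measurable (pw a) := by
  unfold pw
  exact (ENNReal.measurable_ofReal.comp measurable_paraNorm).pow_const _

theorem pw_at_zero {a : ℝ} (ha : 0 < a) : pw a 0 = ⊤ := by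
  simp [pw, paraNorm_zero, ha]

theorem pw_of_ne {z : SpaceTime} (hz : z ≠ 0) (a : ℝ) :
    pw a z = ENNReal.ofReal (paraNorm z ^ (-a)) :=
  ENNReal.ofReal_rpow_of_pos (paraNorm_pos hz)

theorem pw_ne_top {z : SpaceTime} (hz : z ≠ 0) (a : ℝ) : pw a z ≠ ⊤ := by
  rw [pw_of_ne hz]; exact ENNReal.ofReal_ne_top

theorem ofReal_paraNorm_ne_zero {z : SpaceTime} (hz : z ≠ 0) :
    ENNReal.ofReal (paraNorm z) ≠ 0 := by
  simpa using paraNorm_pos hz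

/-- The signs matter only at the origin, where exponents of opposite sign would give `⊤ * 0`;
`pw_mul_pw_of_ne` covers that case away from the origin. -/
theorem pw_mul_pw {a b : ℝ} (ha : 0 ≤ a) (hb : 0 ≤ b) (z : SpaceTime) :
    pw a z * pw b z = pw (a + b) z := by
  by_cases hz : z = 0
  · subst hz
    rcases ha.eq_or_lt with rfl | ha
    · simp [pw]
    rcases hb.eq_or_lt with rfl | hb
    · simp [pw]
    rw [pw_at_zero ha, pw_at_zero hb, pw_at_zero (by positivity)]
    simp
  · rw [pw, pw, pw, neg_add, ENNReal.rpow_add _ _ (ofReal_paraNorm_ne_zero hz)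
      ENNReal.ofReal_ne_top]

theorem pw_nat_pow {a : ℝ} (z : SpaceTime) (n : ℕ) :
    pw a z ^ n = pw (n * a) z := by
  rw [pw, pw, ← ENNReal.rpow_natCast, ← ENNReal.rpow_mul]
  congr 1; ring

theorem pw_zero_exp (z : SpaceTime) : pw 0 z = 1 := by simp [pw]

theorem pw_neg (a : ℝ) (z : SpaceTime) : pw a (-z) = pw a z := by simp [pw, paraNorm_neg]

theorem pw_reflect (a : ℝ) (z : SpaceTime) : pw a (reflect z) = pw a z := by
  simp [pw, paraNorm_reflect]

theorem pw_dil {l : ℝ} (hl : 0 < l) (a : ℝ) (z : SpaceTime) :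
    pw a (dil l z) = ENNReal.ofReal l ^ (-a) * pw a z := by
  by_cases hz : z = 0
  · subst hz
    have : dil l 0 = 0 := by ext <;> simp [dil]
    rw [this]
    rcases lt_trichotomy a 0 with h | h | h
    · have : pw a 0 = 0 := by simp [pw, paraNorm_zero, h]
      simp [this]
    · subst h; simp [pw]
    · rw [pw_at_zero h, ENNReal.mul_top]
      simp [ENNReal.rpow_eq_zero_iff, h.le]
  · rw [pw, pw, paraNorm_dil hl.le, ENNReal.ofReal_mul hl.le, ENNReal.mul_rpow_of_ne_top
      ENNReal.ofReal_ne_top ENNReal.ofReal_ne_top]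

theorem pw_le_of_paraNorm_le {a c : ℝ} (ha : 0 ≤ a) (hc : 0 < c) {z w : SpaceTime}
    (h : paraNorm w ≤ c * paraNorm z) : pw a z ≤ ENNReal.ofReal c ^ a * pw a w := by
  unfold pw
  rw [ENNReal.rpow_neg, ENNReal.rpow_neg]
  have h1 : ENNReal.ofReal (paraNorm w) ^ a
      ≤ ENNReal.ofReal c ^ a * ENNReal.ofReal (paraNorm z) ^ a := by
    rw [← ENNReal.mul_rpow_of_nonneg _ _ ha, ← ENNReal.ofReal_mul hc.le]
    exact ENNReal.rpow_le_rpow (ENNReal.ofReal_le_ofReal h) ha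
  have hc0 : ENNReal.ofReal c ^ a ≠ 0 := by
    simp [ENNReal.rpow_eq_zero_iff, hc]
  have hct : ENNReal.ofReal c ^ a ≠ ⊤ := ENNReal.rpow_ne_top_of_nonneg ha ENNReal.ofReal_ne_top
  calc (ENNReal.ofReal (paraNorm z) ^ a)⁻¹
      = ENNReal.ofReal c ^ a * (ENNReal.ofReal c ^ a * ENNReal.ofReal (paraNorm z) ^ a)⁻¹ := by
        rw [ENNReal.mul_inv (Or.inl hc0) (Or.inl hct), ← mul_assoc,
          ENNReal.mul_inv_cancel hc0 hct, one_mul]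
    _ ≤ _ := by gcongr

theorem pw_le_const {a c : ℝ} (ha : 0 ≤ a) {z : SpaceTime}
    (h : c ≤ paraNorm z) : pw a z ≤ ENNReal.ofReal c ^ (-a) := by
  unfold pw
  rw [ENNReal.rpow_neg, ENNReal.rpow_neg]
  gcongr

theorem one_le_pw {a : ℝ} (ha : 0 ≤ a) {z : SpaceTime} (h : paraNorm z ≤ 1) : 1 ≤ pw a z := by
  unfold pw
  rw [ENNReal.rpow_neg]
  refine ENNReal.one_le_inv.mpr ?_
  calc _ ≤ (1 : ℝ≥0∞) ^ a := ENNReal.rpow_le_rpow (by simpa using h) ha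
    _ = 1 := by simp

theorem pw_le_pw_of_one_le {a b : ℝ} (hab : a ≤ b) {z : SpaceTime}
    (h : 1 ≤ paraNorm z) : pw b z ≤ pw a z := by
  unfold pw
  exact ENNReal.rpow_le_rpow_of_exponent_le (by simpa using h) (by linarith)

theorem pw_le_pw_of_le_one {a b : ℝ} (hab : a ≤ b) {z : SpaceTime}
    (h : paraNorm z ≤ 1) : pw a z ≤ pw b z := by
  unfold pw
  exact ENNReal.rpow_le_rpow_of_exponent_ge (by simpa using h) (by linarith)

/-- The regularised weight `min(1, |z|^{-1})`. -/
def qw (z : SpaceTime) : ℝ≥0∞ := min 1 (pw 1 z)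

theorem measurable_qw : Measurable qw := measurable_const.min (measurable_pw 1)

theorem qw_le_one (z : SpaceTime) : qw z ≤ 1 := min_le_left _ _

theorem qw_neg (z : SpaceTime) : qw (-z) = qw z := by simp [qw, pw_neg]

/-- Inside the unit ball the left side is at most 1 and the right side at least 1; outside, a ≤ n.
So powers of the regularised weight can be exchanged for any weaker order, singular or not. -/
theorem qw_pow_le_pw {n : ℕ} {a : ℝ} (ha : 0 ≤ a) (han : a ≤ n) (z : SpaceTime) :
    qw z ^ n ≤ pw a z := by
  rcases le_total (paraNorm z) 1 with h | h
  · exact (pow_le_one' (qw_le_one z) n).trans (one_le_pw ha h)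
  · calc qw z ^ n ≤ pw 1 z ^ n := by gcongr; exact min_le_right _ _
      _ = pw n z := by rw [pw_nat_pow, mul_one]
      _ ≤ pw a z := pw_le_pw_of_one_le han h

/-! ### Integrals of powers of the parabolic norm -/

/-- Since |z| dominates both |t|^{1/2} and |x|, splitting the exponent as 2a/3 + a/3 gives |z|^{-a}
≤ |t|^{-a/3} |x|^{-a/3}, and each factor is integrable near 0 precisely when a < 3. -/
theorem lintegral_ball_pw_lt_top {a : ℝ} (ha : 0 ≤ a) (ha3 : a < 3) :
    ∫⁻ z in {z | paraNorm z ≤ 1}, pw a z < ⊤ := by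
  have hint : ∫⁻ s in Set.Icc (-1 : ℝ) 1, ENNReal.ofReal |s| ^ (-(a / 3)) < ⊤ := by
    have h1 : IntegrableOn (fun s : ℝ => |s| ^ (-(a / 3))) (Set.Icc (-1 : ℝ) 1) := by
      have h0 : IntervalIntegrable (fun s : ℝ => s ^ (-(a / 3))) volume 0 1 :=
        intervalIntegral.intervalIntegrable_rpow' (by linarith)
      have h01 : IntegrableOn (fun s : ℝ => |s| ^ (-(a / 3))) (Set.Ioc 0 1) := by
        rw [intervalIntegrable_iff_integrableOn_Ioc_of_le zero_le_one] at h0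
        refine h0.congr_fun (fun s hs => ?_) measurableSet_Ioc
        simp only [abs_of_pos hs.1]
      have h02 : IntervalIntegrable (fun s : ℝ => |s| ^ (-(a / 3))) volume 0 1 :=
        (intervalIntegrable_iff_integrableOn_Ioc_of_le zero_le_one).mpr h01
      have h03 : IntervalIntegrable (fun s : ℝ => |s| ^ (-(a / 3))) volume (-1) 0 := by
        have := ((IntervalIntegrable.iff_comp_neg).mp h02).symm
        simpa using this
      have := (h03.trans h02)
      rwa [intervalIntegrable_iff_integrableOn_Icc_of_le (by norm_num)] at this
    have h2 := h1.2
    rw [hasFiniteIntegral_iff_enorm] at h2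
    refine lt_of_le_of_lt (lintegral_mono_ae ?_) h2
    have : ∀ᵐ s : ℝ ∂(volume.restrict (Set.Icc (-1 : ℝ) 1)), s ≠ 0 :=
      ae_restrict_of_ae (by simp [ae_iff])
    filter_upwards [this] with s hs
    rw [ENNReal.ofReal_rpow_of_pos (abs_pos.mpr hs), Real.enorm_of_nonneg (by positivity)]
  have hsub : ({z | paraNorm z ≤ 1} : Set SpaceTime) ⊆ Set.Icc (-1 : ℝ) 1 ×ˢ Set.Icc (-1 : ℝ) 1 := by
    intro z hz
    have hz' : Real.sqrt |z.1| + |z.2| ≤ 1 := hz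
    have h1 := Real.sqrt_nonneg |z.1|
    have h2 := abs_nonneg z.2
    have h3 : |z.1| ≤ 1 := by
      rw [← Real.sqrt_le_one]; linarith
    have h4 : |z.2| ≤ 1 := by linarith
    exact ⟨abs_le.mp h3, abs_le.mp h4⟩
  have hbd : ∀ z : SpaceTime, pw a z ≤
      ENNReal.ofReal |z.1| ^ (-(a / 3)) * ENNReal.ofReal |z.2| ^ (-(a / 3)) := by
    intro z
    have e1 : ENNReal.ofReal |z.1| ^ (1 / 2 : ℝ) ≤ ENNReal.ofReal (paraNorm z) := by
      rw [ENNReal.ofReal_rpow_of_nonneg (abs_nonneg _) (by norm_num), ← Real.sqrt_eq_rpow]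
      exact ENNReal.ofReal_le_ofReal (by unfold paraNorm; linarith [abs_nonneg z.2])
    have e2 : ENNReal.ofReal |z.2| ≤ ENNReal.ofReal (paraNorm z) :=
      ENNReal.ofReal_le_ofReal (by unfold paraNorm; linarith [Real.sqrt_nonneg |z.1|])
    have e3 : pw a z = pw (2 * (a / 3)) z * pw (a / 3) z := by
      rw [pw_mul_pw (by positivity) (by positivity)]; congr 1; ring
    rw [e3]
    refine mul_le_mul' ?_ ?_
    · rw [pw, ENNReal.rpow_neg, ENNReal.rpow_neg]
      refine ENNReal.inv_le_inv.mpr ?_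
      calc ENNReal.ofReal |z.1| ^ (a / 3)
          = (ENNReal.ofReal |z.1| ^ (1 / 2 : ℝ)) ^ (2 * (a / 3)) := by
            rw [← ENNReal.rpow_mul]; congr 1; ring
        _ ≤ _ := ENNReal.rpow_le_rpow e1 (by positivity)
    · rw [pw, ENNReal.rpow_neg, ENNReal.rpow_neg]
      exact ENNReal.inv_le_inv.mpr (ENNReal.rpow_le_rpow e2 (by positivity))
  calc ∫⁻ z in {z | paraNorm z ≤ 1}, pw a z
      ≤ ∫⁻ z in Set.Icc (-1 : ℝ) 1 ×ˢ Set.Icc (-1 : ℝ) 1, 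
          ENNReal.ofReal |z.1| ^ (-(a / 3)) * ENNReal.ofReal |z.2| ^ (-(a / 3)) :=
        (lintegral_mono_set hsub).trans (lintegral_mono hbd)
    _ = (∫⁻ s in Set.Icc (-1 : ℝ) 1, ENNReal.ofReal |s| ^ (-(a / 3))) *
        (∫⁻ s in Set.Icc (-1 : ℝ) 1, ENNReal.ofReal |s| ^ (-(a / 3))) := by
        rw [Measure.volume_eq_prod, ← Measure.prod_restrict]
        exact lintegral_prod_mul (f := fun s : ℝ => ENNReal.ofReal |s| ^ (-(a / 3)))
          (g := fun s : ℝ => ENNReal.ofReal |s| ^ (-(a / 3))) (by fun_prop) (by fun_prop)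
    _ < ⊤ := ENNReal.mul_lt_top hint hint

/-- The same splitting of the exponent at infinity: both factors decay like the power a/3 > 1 of a
real variable. -/
theorem lintegral_one_add_paraNorm_lt_top {a : ℝ} (ha : 3 < a) :
    ∫⁻ z, ENNReal.ofReal ((1 + paraNorm z) ^ (-a)) < ⊤ := by
  have hint : ∫⁻ s : ℝ, ENNReal.ofReal ((1 + ‖s‖) ^ (-(a / 3))) < ⊤ := by
    have := (integrable_one_add_norm (E := ℝ) (μ := volume) (r := a / 3) (by simp; linarith)).2
    rw [hasFiniteIntegral_iff_enorm] at this
    refine lt_of_le_of_lt (lintegral_mono fun s => ?_) this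
    rw [Real.enorm_of_nonneg (by positivity)]
  have hbd : ∀ z : SpaceTime, ENNReal.ofReal ((1 + paraNorm z) ^ (-a)) ≤
      ENNReal.ofReal ((1 + ‖z.1‖) ^ (-(a / 3))) * ENNReal.ofReal ((1 + ‖z.2‖) ^ (-(a / 3))) := by
    intro z
    rw [← ENNReal.ofReal_mul (by positivity)]
    refine ENNReal.ofReal_le_ofReal ?_
    have h0 := paraNorm_nonneg z
    have e1 : (1 + ‖z.1‖) ^ (1 / 2 : ℝ) ≤ 1 + paraNorm z := by
      rw [← Real.sqrt_eq_rpow]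
      refine Real.sqrt_le_iff.mpr ⟨by positivity, ?_⟩
      have := Real.sq_sqrt (abs_nonneg z.1)
      have h4 := Real.sqrt_nonneg |z.1|
      rw [Real.norm_eq_abs]; unfold paraNorm
      nlinarith [abs_nonneg z.2, mul_nonneg h4 (abs_nonneg z.2)]
    have e2 : 1 + ‖z.2‖ ≤ 1 + paraNorm z := by
      rw [Real.norm_eq_abs]; unfold paraNorm; linarith [Real.sqrt_nonneg |z.1|]
    have e3 : (1 + paraNorm z) ^ (-a) =
        (1 + paraNorm z) ^ (-(2 * (a / 3))) * (1 + paraNorm z) ^ (-(a / 3)) := by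
      rw [← Real.rpow_add (by positivity)]; congr 1; ring
    have e4 : (1 + ‖z.1‖) ^ (-(a / 3)) = ((1 + ‖z.1‖) ^ (1 / 2 : ℝ)) ^ (-(2 * (a / 3))) := by
      rw [← Real.rpow_mul (by positivity)]; congr 1; ring
    rw [e3, e4]
    refine mul_le_mul ?_ ?_ (by positivity) (by positivity)
    · exact Real.rpow_le_rpow_of_nonpos (by positivity) e1 (by linarith)
    · exact Real.rpow_le_rpow_of_nonpos (by positivity) e2 (by linarith)
  calc ∫⁻ z, ENNReal.ofReal ((1 + paraNorm z) ^ (-a))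
      ≤ ∫⁻ z : ℝ × ℝ, 
        ENNReal.ofReal ((1 + ‖z.1‖) ^ (-(a / 3))) * ENNReal.ofReal ((1 + ‖z.2‖) ^ (-(a / 3))) :=
        lintegral_mono hbd
    _ = (∫⁻ s : ℝ, ENNReal.ofReal ((1 + ‖s‖) ^ (-(a / 3)))) *
        (∫⁻ s : ℝ, ENNReal.ofReal ((1 + ‖s‖) ^ (-(a / 3)))) := by
        rw [Measure.volume_eq_prod]
        exact lintegral_prod_mul (f := fun s : ℝ => ENNReal.ofReal ((1 + ‖s‖) ^ (-(a / 3))))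
          (g := fun s : ℝ => ENNReal.ofReal ((1 + ‖s‖) ^ (-(a / 3)))) (by fun_prop) (by fun_prop)
    _ < ⊤ := ENNReal.mul_lt_top hint hint

theorem lintegral_compl_ball_pw_lt_top {a : ℝ} (ha : 3 < a) :
    ∫⁻ z in {z | 1 / 2 ≤ paraNorm z}, pw a z < ⊤ := by
  have hm : MeasurableSet {z : SpaceTime | 1 / 2 ≤ paraNorm z} :=
    measurableSet_le measurable_const measurable_paraNorm
  calc ∫⁻ z in {z | 1 / 2 ≤ paraNorm z}, pw a z
      ≤ ∫⁻ z in {z | 1 / 2 ≤ paraNorm z},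
          ENNReal.ofReal (3 ^ a) * ENNReal.ofReal ((1 + paraNorm z) ^ (-a)) := by
        refine setLIntegral_mono' hm fun z hz => ?_
        have hz' : 1 / 2 ≤ paraNorm z := hz
        have hz0 : z ≠ 0 := by
          rintro rfl; rw [paraNorm_zero] at hz'; norm_num at hz'
        rw [pw_of_ne hz0, ← ENNReal.ofReal_mul (by positivity)]
        refine ENNReal.ofReal_le_ofReal ?_
        have hp := paraNorm_pos hz0
        have : (3 : ℝ) ^ a = (3⁻¹) ^ (-a) := by
          rw [Real.inv_rpow (by norm_num), Real.rpow_neg (by norm_num), inv_inv]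
        rw [this, ← Real.mul_rpow (by norm_num) (by positivity)]
        exact Real.rpow_le_rpow_of_nonpos (by positivity) (by linarith) (by linarith)
    _ ≤ ∫⁻ z, ENNReal.ofReal (3 ^ a) * ENNReal.ofReal ((1 + paraNorm z) ^ (-a)) :=
        setLIntegral_le_lintegral _ _
    _ < ⊤ := by
        rw [lintegral_const_mul' _ _ ENNReal.ofReal_ne_top]
        exact ENNReal.mul_lt_top ENNReal.ofReal_lt_top (lintegral_one_add_paraNorm_lt_top ha)

/-- Two separate counts: the order is a < 3 at the origin, where `qw` is bounded, and a + n > 3 at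
infinity. -/
theorem lintegral_pw_mul_qw_pow_lt_top {a : ℝ} {n : ℕ} (ha : 0 ≤ a) (ha3 : a < 3) (han : 3 < a + n) :
    ∫⁻ z, pw a z * qw z ^ n < ⊤ := by
  have hm : MeasurableSet {z : SpaceTime | paraNorm z ≤ 1} :=
    measurableSet_le measurable_paraNorm measurable_const
  rw [← lintegral_add_compl _ hm]
  refine ENNReal.add_lt_top.mpr ⟨?_, ?_⟩
  · refine lt_of_le_of_lt (lintegral_mono fun z => ?_) (lintegral_ball_pw_lt_top ha ha3)
    exact mul_le_of_le_one_right' (pow_le_one' (qw_le_one z) n)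
  · have hsub : ({z : SpaceTime | paraNorm z ≤ 1}ᶜ) ⊆ {z | 1 / 2 ≤ paraNorm z} := by
      intro z hz
      have : 1 < paraNorm z := not_le.mp hz
      show 1 / 2 ≤ paraNorm z
      linarith
    refine lt_of_le_of_lt ((lintegral_mono_set hsub).trans (lintegral_mono fun z => ?_))
      (lintegral_compl_ball_pw_lt_top han)
    rw [← pw_mul_pw ha (by positivity)]
    gcongr
    exact qw_pow_le_pw (by positivity) le_rfl z

/-- Convolution of two powers of the parabolic norm. -/
theorem exists_lintegral_pw_mul_pw_le {a b : ℝ} (ha : 0 < a) (ha3 : a < 3) (hb : 0 < b) (hb3 : b < 3)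
    (hab : 3 < a + b) : ∃ C : ℝ≥0, ∀ w : SpaceTime,
      ∫⁻ z, pw a z * pw b (w - z) ≤ C * pw (a + b - 3) w := by
  have h2 : ENNReal.ofReal 2 ≠ ⊤ := ENNReal.ofReal_ne_top
  have hm1 : MeasurableSet {z : SpaceTime | paraNorm z ≤ 1} :=
    measurableSet_le measurable_paraNorm measurable_const
  have hm2 : MeasurableSet {z : SpaceTime | 1 / 2 ≤ paraNorm z} :=
    measurableSet_le measurable_const measurable_paraNorm
  set f1 : SpaceTime → ℝ≥0∞ := fun z => ENNReal.ofReal 2 ^ b * {z | paraNorm z ≤ 1}.indicator (pw a) z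
    with hf1
  set f2 : SpaceTime → ℝ≥0∞ := fun z => ENNReal.ofReal 2 ^ a * {z | paraNorm z ≤ 1}.indicator (pw b) z
    with hf2
  set f3 : SpaceTime → ℝ≥0∞ := {z : SpaceTime | 1 / 2 ≤ paraNorm z}.indicator (pw (a + b)) with hf3
  have m1 : Measurable f1 := ((measurable_pw a).indicator hm1).const_mul _
  have m2 : Measurable f2 := ((measurable_pw b).indicator hm1).const_mul _
  have m3 : Measurable f3 := (measurable_pw _).indicator hm2
  have i1 : ∫⁻ z, f1 z < ⊤ := by
    rw [hf1, lintegral_const_mul' _ _ (ENNReal.rpow_ne_top_of_nonneg hb.le h2),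
      lintegral_indicator hm1]
    exact ENNReal.mul_lt_top (ENNReal.rpow_lt_top_of_nonneg hb.le h2)
      (lintegral_ball_pw_lt_top ha.le ha3)
  have i2 : ∫⁻ z, f2 z < ⊤ := by
    rw [hf2, lintegral_const_mul' _ _ (ENNReal.rpow_ne_top_of_nonneg ha.le h2),
      lintegral_indicator hm1]
    exact ENNReal.mul_lt_top (ENNReal.rpow_lt_top_of_nonneg ha.le h2)
      (lintegral_ball_pw_lt_top hb.le hb3)
  have i3 : ∫⁻ z, f3 z < ⊤ := by
    rw [hf3, lintegral_indicator hm2]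
    exact lintegral_compl_ball_pw_lt_top hab
  -- Both sides are homogeneous in w, so the bound need only be proved on the unit sphere; the
  -- rescaling is undone at the end.
  have key : ∀ w : SpaceTime, paraNorm w = 1 → ∫⁻ z, pw a z * pw b (w - z) ≤
      (∫⁻ z, f1 z) + (∫⁻ z, f2 z) + ((∫⁻ z, f3 z) + ∫⁻ z, f3 z) := by
    intro w hw
    -- Three regions: z near 0, z near w, and z far from both. In the first two the other factor is
    -- bounded because |w| = 1; in the third the smaller of |z| and |w - z| controls both factors.
    have hle : ∀ z, pw a z * pw b (w - z) ≤ f1 z + f2 (w - z) + (f3 z + f3 (w - z)) := by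
      intro z
      have t1 := paraNorm_le_add_sub w z
      rcases le_total (paraNorm z) (1 / 2) with h1 | h1
      · refine le_trans ?_ (le_add_right (le_add_right le_rfl))
        rw [hf1]; simp only
        rw [Set.indicator_of_mem (show z ∈ {z | paraNorm z ≤ 1} from
          show paraNorm z ≤ 1 by linarith), mul_comm]
        gcongr
        calc pw b (w - z) ≤ ENNReal.ofReal 2 ^ b * pw b w :=
              pw_le_of_paraNorm_le hb.le (by norm_num) (by linarith)
          _ = ENNReal.ofReal 2 ^ b := by simp [pw, hw]
      rcases le_total (paraNorm (w - z)) (1 / 2) with h2 | h2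
      · refine le_trans ?_ (le_add_right (le_add_left le_rfl))
        rw [hf2]; simp only
        rw [Set.indicator_of_mem (show w - z ∈ {z | paraNorm z ≤ 1} from
          show paraNorm (w - z) ≤ 1 by linarith)]
        gcongr
        calc pw a z ≤ ENNReal.ofReal 2 ^ a * pw a w :=
              pw_le_of_paraNorm_le ha.le (by norm_num) (by linarith)
          _ = ENNReal.ofReal 2 ^ a := by simp [pw, hw]
      · refine le_trans ?_ (le_add_left le_rfl)
        rw [hf3, Set.indicator_of_mem (show z ∈ {z | 1 / 2 ≤ paraNorm z} from h1),
          Set.indicator_of_mem (show w - z ∈ {z | 1 / 2 ≤ paraNorm z} from h2)]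
        rcases le_total (paraNorm z) (paraNorm (w - z)) with h3 | h3
        · refine le_trans ?_ (le_add_right le_rfl)
          rw [← pw_mul_pw ha.le hb.le]
          gcongr
          simpa using pw_le_of_paraNorm_le hb.le one_pos (z := w - z) (w := z) (by linarith)
        · refine le_trans ?_ (le_add_left le_rfl)
          rw [← pw_mul_pw ha.le hb.le]
          gcongr
          simpa using pw_le_of_paraNorm_le ha.le one_pos (z := z) (w := w - z) (by linarith)
    calc ∫⁻ z, pw a z * pw b (w - z) ≤ ∫⁻ z, f1 z + f2 (w - z) + (f3 z + f3 (w - z)) :=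
          lintegral_mono hle
      _ = _ := by
          have hsub : Measurable fun z : SpaceTime => w - z := by fun_prop
          have m12 : Measurable fun z => f1 z + f2 (w - z) := m1.add (m2.comp hsub)
          rw [lintegral_add_left m12, lintegral_add_left m1,
            lintegral_add_left m3, lintegral_sub_left_eq_self f2, lintegral_sub_left_eq_self f3]
  set D := (∫⁻ z, f1 z) + (∫⁻ z, f2 z) + ((∫⁻ z, f3 z) + ∫⁻ z, f3 z) with hD
  have hDtop : D ≠ ⊤ := by
    simp only [hD]
    exact (ENNReal.add_lt_top.mpr ⟨ENNReal.add_lt_top.mpr ⟨i1, i2⟩,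
      ENNReal.add_lt_top.mpr ⟨i3, i3⟩⟩).ne
  -- The summand 1 keeps the constant nonzero, so that the right side really is `⊤` at w = 0.
  refine ⟨D.toNNReal + 1, fun w => ?_⟩
  have hDle : D ≤ ((D.toNNReal + 1 : ℝ≥0) : ℝ≥0∞) := by
    rw [ENNReal.coe_add, ENNReal.coe_toNNReal hDtop]; exact le_self_add
  by_cases hw : w = 0
  · subst hw
    rw [pw_at_zero (by linarith), ENNReal.mul_top (by simp)]
    exact le_top
  · have hl := paraNorm_pos hw
    set l := paraNorm w with hl'
    set v := dil l⁻¹ w with hv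
    have hv1 : paraNorm v = 1 := by
      rw [hv, paraNorm_dil (by positivity), ← hl', inv_mul_cancel₀ hl.ne']
    have hwv : w = dil l v := by rw [hv, dil_dil, mul_inv_cancel₀ hl.ne', dil_one]
    have e1 : ∫⁻ z, pw a (dil l z) * pw b (w - dil l z) =
        ENNReal.ofReal (l ^ 3)⁻¹ * ∫⁻ z, pw a z * pw b (w - z) :=
      lintegral_comp_dil hl (fun z => pw a z * pw b (w - z))
    have e2 : ∫⁻ z, pw a (dil l z) * pw b (w - dil l z) =
        ENNReal.ofReal l ^ (-a) * ENNReal.ofReal l ^ (-b) * ∫⁻ z, pw a z * pw b (v - z) := by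
      have hl0 : ENNReal.ofReal l ≠ 0 := by simpa using hl
      rw [← lintegral_const_mul' _ _ (ENNReal.mul_ne_top
        (ENNReal.rpow_ne_top_of_ne_zero hl0 ENNReal.ofReal_ne_top)
        (ENNReal.rpow_ne_top_of_ne_zero hl0 ENNReal.ofReal_ne_top))]
      congr 1; ext z
      conv_lhs => rw [hwv, ← dil_sub, pw_dil hl, pw_dil hl]
      ring
    have e3 : ∫⁻ z, pw a z * pw b (w - z) =
        pw (a + b - 3) w * ∫⁻ z, pw a z * pw b (v - z) := by
      have : ∫⁻ z, pw a z * pw b (w - z) = ENNReal.ofReal (l ^ 3) *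
          (ENNReal.ofReal (l ^ 3)⁻¹ * ∫⁻ z, pw a z * pw b (w - z)) := by
        rw [← mul_assoc, ← ENNReal.ofReal_mul (by positivity), mul_inv_cancel₀ (by positivity)]
        simp
      rw [this, ← e1, e2, ← mul_assoc]
      congr 1
      rw [pw, ENNReal.ofReal_rpow_of_pos hl, ENNReal.ofReal_rpow_of_pos hl,
        ENNReal.ofReal_rpow_of_pos (by rwa [← hl']), ← hl', ← ENNReal.ofReal_mul (by positivity),
        ← ENNReal.ofReal_mul (by positivity)]
      congr 1
      rw [← Real.rpow_natCast, ← Real.rpow_add hl, ← Real.rpow_add hl]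
      congr 1; push_cast; ring
    rw [e3, mul_comm]
    gcongr
    exact (key v hv1).trans hDle

/-! ### The spatial derivative of the heat kernel -/

/-- The spatial derivative of the heat kernel. -/
def heatDeriv (z : SpaceTime) : ℝ := deriv (fun x : ℝ => heatKernel (z.1, x)) z.2

theorem heatDeriv_of_nonpos {z : SpaceTime} (hz : z.1 ≤ 0) : heatDeriv z = 0 := by
  have : (fun x : ℝ => heatKernel (z.1, x)) = fun _ => 0 := by
    funext x; simp [heatKernel, not_lt.mpr hz]
  simp [heatDeriv, this]

theorem hasDerivAt_heatKernel {t : ℝ} (ht : 0 < t) (x : ℝ) :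
    HasDerivAt (fun x : ℝ => heatKernel (t, x)) (-x / (2 * t) * heatKernel (t, x)) x := by
  have h1 : (fun x : ℝ => heatKernel (t, x)) =
      fun x : ℝ => Real.exp (-x ^ 2 / (4 * t)) / Real.sqrt (4 * Real.pi * t) := by
    funext x; simp [heatKernel, ht]
  rw [h1]
  have h2 : HasDerivAt (fun x : ℝ => -x ^ 2 / (4 * t)) (-(2 * x) / (4 * t)) x := by
    have := ((hasDerivAt_pow 2 x).neg).div_const (4 * t)
    simpa using this
  have h3 := (h2.exp).div_const (Real.sqrt (4 * Real.pi * t))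
  refine h3.congr_deriv ?_
  simp only [heatKernel, ht, if_true]
  field_simp
  ring

theorem heatDeriv_of_pos {z : SpaceTime} (hz : 0 < z.1) :
    heatDeriv z = -z.2 / (2 * z.1) * heatKernel z :=
  (hasDerivAt_heatKernel hz z.2).deriv

theorem heatKernel_dil {l : ℝ} (hl : 0 < l) (z : SpaceTime) :
    heatKernel (dil l z) = l⁻¹ * heatKernel z := by
  unfold heatKernel dil
  by_cases h : 0 < z.1
  · have h' : 0 < l ^ 2 * z.1 := by positivity
    simp only [h, h', if_true]
    have e1 : -(l * z.2) ^ 2 / (4 * (l ^ 2 * z.1)) = -z.2 ^ 2 / (4 * z.1) := by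
      field_simp
    have e2 : Real.sqrt (4 * Real.pi * (l ^ 2 * z.1)) = l * Real.sqrt (4 * Real.pi * z.1) := by
      rw [show 4 * Real.pi * (l ^ 2 * z.1) = l ^ 2 * (4 * Real.pi * z.1) by ring,
        Real.sqrt_mul (sq_nonneg l), Real.sqrt_sq hl.le]
    rw [e1, e2]
    field_simp
  · have h' : ¬ 0 < l ^ 2 * z.1 := by
      have := mul_nonneg (sq_nonneg l) (neg_nonneg.mpr (not_lt.mp h))
      linarith
    simp [h, h']

/-- The parabolic rescaling of a kernel of homogeneity `-2`. -/
def scaleKer (l : ℝ) (k : SpaceTime → ℝ) (z : SpaceTime) : ℝ := l ^ 2 * k (dil l z)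

/-- P has order 1 and each x-derivative adds 1, so P' is a fixed point of the rescaling of order 2.
This makes it the limit of all rescaled cutoff kernels. -/
theorem scaleKer_heatDeriv {l : ℝ} (hl : 0 < l) : scaleKer l heatDeriv = heatDeriv := by
  funext z
  unfold scaleKer
  by_cases h : 0 < z.1
  · have h' : 0 < (dil l z).1 := by simp only [dil]; positivity
    rw [heatDeriv_of_pos h, heatDeriv_of_pos h', heatKernel_dil hl]
    simp only [dil]
    field_simp
  · have h' : (dil l z).1 ≤ 0 := by
      have := mul_nonneg (sq_nonneg l) (neg_nonneg.mpr (not_lt.mp h))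
      simp only [dil]; linarith
    rw [heatDeriv_of_nonpos h', heatDeriv_of_nonpos (not_lt.mp h), mul_zero]

theorem heatKernel_reflect (z : SpaceTime) : heatKernel (reflect z) = heatKernel z := by
  simp [heatKernel, reflect]

theorem heatDeriv_reflect (z : SpaceTime) : heatDeriv (reflect z) = -heatDeriv z := by
  by_cases h : 0 < z.1
  · rw [heatDeriv_of_pos h, heatDeriv_of_pos (show 0 < (reflect z).1 from h), heatKernel_reflect]
    simp only [reflect]; ring
  · rw [heatDeriv_of_nonpos (not_lt.mp h),
      heatDeriv_of_nonpos (show (reflect z).1 ≤ 0 from not_lt.mp h), neg_zero]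

theorem measurable_heatKernel : Measurable heatKernel := by
  unfold heatKernel
  refine Measurable.ite (measurableSet_lt measurable_const measurable_fst) ?_ measurable_const
  fun_prop

theorem measurable_heatDeriv : Measurable heatDeriv := by
  have : heatDeriv = fun z => if 0 < z.1 then -z.2 / (2 * z.1) * heatKernel z else 0 := by
    funext z
    split_ifs with h
    · exact heatDeriv_of_pos h
    · exact heatDeriv_of_nonpos (not_lt.mp h)
  rw [this]
  refine Measurable.ite (measurableSet_lt measurable_const measurable_fst) ?_ measurable_const
  have := measurable_heatKernel
  fun_prop

/-! ### The spatial derivative of a cutoff kernel -/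

namespace CutoffKernel

variable (K : CutoffKernel)

theorem deriv_of_nonpos {z : SpaceTime} (hz : z.1 ≤ 0) : K.deriv z = 0 := by
  have : (fun x : ℝ => K.toFun (z.1, x)) = fun _ => 0 := by
    funext x; exact K.causal _ _ hz
  simp [CutoffKernel.deriv, this]

theorem deriv_reflect (z : SpaceTime) : K.deriv (reflect z) = -K.deriv z := by
  have h : (fun x : ℝ => K.toFun (z.1, x)) = fun x : ℝ => K.toFun (z.1, -x) := by
    funext x; exact (K.even_space _ _).symm
  simp only [CutoffKernel.deriv, reflect]
  conv_rhs => rw [h, deriv_comp_neg (fun x => K.toFun (z.1, x))]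
  simp

theorem deriv_eq_heatDeriv {z : SpaceTime} (hz : paraNorm z < 1 / 2) :
    K.deriv z = heatDeriv z := by
  refine Filter.EventuallyEq.deriv_eq ?_
  have : ∀ᶠ x in 𝓝 z.2, paraNorm (z.1, x) < 1 / 2 := by
    have hc : Continuous fun x : ℝ => paraNorm (z.1, x) := continuous_paraNorm.comp (by fun_prop)
    exact hc.continuousAt.eventually_lt continuousAt_const hz
  filter_upwards [this] with x hx using K.eq_heatKernel _ hx

theorem deriv_of_one_lt {z : SpaceTime} (hz : 1 < paraNorm z) : K.deriv z = 0 := by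
  have : ∀ᶠ x in 𝓝 z.2, 1 < paraNorm (z.1, x) := by
    have hc : Continuous fun x : ℝ => paraNorm (z.1, x) := continuous_paraNorm.comp (by fun_prop)
    exact continuousAt_const.eventually_lt hc.continuousAt hz
  have h2 : (fun x : ℝ => K.toFun (z.1, x)) =ᶠ[𝓝 z.2] fun _ => 0 := by
    filter_upwards [this] with x hx using K.supported _ hx
  exact h2.deriv_eq.trans (deriv_const _ _)

theorem contDiffOn_deriv : ContDiffOn ℝ ((⊤ : ℕ∞) : WithTop ℕ∞) K.deriv {(0 : SpaceTime)}ᶜ := by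
  have ho : IsOpen ({(0 : SpaceTime)}ᶜ) := isOpen_compl_singleton
  have h1 : ContDiffOn ℝ ((⊤ : ℕ∞) : WithTop ℕ∞)
      (fun z => fderiv ℝ K.toFun z (0, 1)) {(0 : SpaceTime)}ᶜ :=
    (K.smooth.fderiv_of_isOpen ho (by simp)).clm_apply contDiffOn_const
  refine h1.congr fun z hz => ?_
  have hd : DifferentiableAt ℝ K.toFun z :=
    (K.smooth.contDiffAt (ho.mem_nhds hz)).differentiableAt (by simp)
  have hl : HasDerivAt (fun x : ℝ => ((z.1, x) : SpaceTime)) (0, 1) z.2 :=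
    (hasDerivAt_const _ _).prodMk (hasDerivAt_id _)
  exact (HasFDerivAt.comp_hasDerivAt_of_eq z.2 hd.hasFDerivAt hl rfl).deriv

theorem measurable_deriv : Measurable K.deriv := by
  have h : ContinuousOn K.deriv {(0 : SpaceTime)}ᶜ := K.contDiffOn_deriv.continuousOn
  have h0 : K.deriv 0 = 0 := K.deriv_of_nonpos le_rfl
  have : K.deriv = Set.indicator ({(0 : SpaceTime)}ᶜ : Set SpaceTime) K.deriv := by
    funext z
    by_cases hz : z = 0
    · simp [hz, h0]
    · rw [Set.indicator_of_mem (by simpa using hz)]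
  rw [this]
  have := h.measurable_piecewise (g := fun _ => (0 : ℝ)) continuousOn_const
    (measurableSet_singleton (0 : SpaceTime)).compl
  rwa [← Set.piecewise_eq_indicator]

theorem norm_le_one_of_paraNorm_le_one {z : SpaceTime} (h : paraNorm z ≤ 1) : ‖z‖ ≤ 1 := by
  have h' : Real.sqrt |z.1| + |z.2| ≤ 1 := h
  have h1 := Real.sqrt_nonneg |z.1|
  have h2 := abs_nonneg z.2
  have h3 : |z.1| ≤ 1 := by rw [← Real.sqrt_le_one]; linarith
  exact max_le h3 (by rw [Real.norm_eq_abs]; linarith)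

/-- Multiplying by 1 - χ with a bump χ at the origin leaves a smooth compactly supported function
that agrees with K' where |z| ≥ 1/8. It is bounded and Lipschitz, and for increments of parabolic
size at most 1 a Lipschitz bound is stronger than a parabolic Hölder bound of exponent 1/2. -/
theorem exists_bound_away : ∃ M : ℝ≥0,
    (∀ z, 1 / 8 ≤ paraNorm z → ‖K.deriv z‖ₑ ≤ M) ∧
    ∀ z w, 1 / 8 ≤ paraNorm z → 1 / 8 ≤ paraNorm w →
      ‖K.deriv z - K.deriv w‖ₑ ≤ M * ENNReal.ofReal (paraNorm (z - w)) ^ (1 / 2 : ℝ) := by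
  -- The radius 1/256 is chosen so that the support lies in |z| < 1/8: there √|t| < 1/16 and |x| <
  -- 1/256.
  let χ : ContDiffBump (0 : SpaceTime) := ⟨1 / 512, 1 / 256, by norm_num, by norm_num⟩
  set f : SpaceTime → ℝ := fun z => (1 - χ z) * K.deriv z with hf
  have hfK : ∀ z, 1 / 8 ≤ paraNorm z → f z = K.deriv z := by
    intro z hz
    have : χ z = 0 := by
      refine χ.zero_of_le_dist ?_
      rw [dist_zero_right]
      show (1 / 256 : ℝ) ≤ ‖z‖
      by_contra hlt
      push Not at hlt
      have h1 : |z.1| < 1 / 256 := lt_of_le_of_lt (norm_fst_le z) hlt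
      have h2 : |z.2| < 1 / 256 := lt_of_le_of_lt (norm_snd_le z) hlt
      have h3 : Real.sqrt |z.1| < 1 / 16 := by
        rw [Real.sqrt_lt' (by norm_num)]; norm_num; linarith
      unfold paraNorm at hz
      linarith
    simp [hf, this]
  have hsm : ContDiff ℝ ((⊤ : ℕ∞) : WithTop ℕ∞) f := by
    rw [contDiff_iff_contDiffAt]
    intro z
    by_cases hz : z = 0
    · have : f =ᶠ[𝓝 z] fun _ => 0 := by
        have h1 := χ.eventuallyEq_one
        rw [hz]
        filter_upwards [h1] with w hw
        simp [hf, hw]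
      exact contDiffAt_const.congr_of_eventuallyEq this
    · have h1 : ContDiffAt ℝ ((⊤ : ℕ∞) : WithTop ℕ∞) K.deriv z :=
        K.contDiffOn_deriv.contDiffAt (isOpen_compl_singleton.mem_nhds hz)
      exact (contDiffAt_const.sub χ.contDiffAt).mul h1
  have hcs : HasCompactSupport f := by
    refine HasCompactSupport.intro (isCompact_closedBall (0 : SpaceTime) 1) fun z hz => ?_
    have : 1 < paraNorm z := by
      by_contra h
      exact hz (by simpa using norm_le_one_of_paraNorm_le_one (not_lt.mp h))
    simp [hf, K.deriv_of_one_lt this]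
  obtain ⟨L, hL⟩ := ContDiff.lipschitzWith_of_hasCompactSupport hcs hsm (by simp)
  obtain ⟨B, hB⟩ := hcs.exists_bound_of_continuous hsm.continuous
  have hB0 : 0 ≤ B := (norm_nonneg _).trans (hB 0)
  lift B to ℝ≥0 using hB0
  refine ⟨B + B + L, fun z hz => ?_, fun z w hz hw => ?_⟩
  · rw [← hfK z hz, Real.enorm_eq_ofReal_abs, ← ENNReal.ofReal_coe_nnreal]
    refine ENNReal.ofReal_le_ofReal ?_
    have := hB z
    rw [Real.norm_eq_abs] at this
    push_cast
    linarith [L.coe_nonneg, B.coe_nonneg]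
  · rw [← hfK z hz, ← hfK w hw, Real.enorm_eq_ofReal_abs, ← ENNReal.ofReal_coe_nnreal,
      ENNReal.ofReal_rpow_of_nonneg (paraNorm_nonneg _) (by norm_num),
      ← ENNReal.ofReal_mul (NNReal.coe_nonneg _)]
    refine ENNReal.ofReal_le_ofReal ?_
    have h1 := hL.dist_le_mul z w
    rw [Real.dist_eq, dist_eq_norm] at h1
    have h2 : |f z - f w| ≤ B + B := by
      have := norm_sub_le (f z) (f w)
      rw [Real.norm_eq_abs] at this
      linarith [hB z, hB w]
    have hn := paraNorm_nonneg (z - w)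
    push_cast
    rcases le_total (paraNorm (z - w)) 1 with h | h
    · have h3 : ‖z - w‖ ≤ paraNorm (z - w) := by
        have hs0 := Real.sqrt_nonneg |(z - w).1|
        have ha0 := abs_nonneg (z - w).2
        have hs1 : Real.sqrt |(z - w).1| ≤ 1 := by unfold paraNorm at h; linarith
        have hs2 := Real.sq_sqrt (abs_nonneg (z - w).1)
        refine max_le ?_ ?_
        · rw [Real.norm_eq_abs]; unfold paraNorm; nlinarith
        · rw [Real.norm_eq_abs]; unfold paraNorm; linarith
      have h4 : paraNorm (z - w) ≤ paraNorm (z - w) ^ (1 / 2 : ℝ) := by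
        rw [← Real.sqrt_eq_rpow]
        exact Real.le_sqrt_of_sq_le (by nlinarith)
      have h5 : 0 ≤ paraNorm (z - w) ^ (1 / 2 : ℝ) := by positivity
      have h6 : (L : ℝ) * ‖z - w‖ ≤ L * paraNorm (z - w) ^ (1 / 2 : ℝ) :=
        mul_le_mul_of_nonneg_left (h3.trans h4) L.coe_nonneg
      nlinarith
    · have h4 : 1 ≤ paraNorm (z - w) ^ (1 / 2 : ℝ) := Real.one_le_rpow h (by norm_num)
      have : (B + B + L) * 1 ≤ (B + B + L) * paraNorm (z - w) ^ (1 / 2 : ℝ) :=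
        mul_le_mul_of_nonneg_left h4 (by positivity)
      linarith [L.coe_nonneg]

end CutoffKernel

/-! ### Kernels with a singularity of order `a` at the origin -/

/-- Measurable kernels, odd in space, bounded by `C |z|^{-a}` with a matching Hölder bound of
exponent `1/2`. -/
structure IsKer (C : ℝ≥0) (a : ℝ) (k : SpaceTime → ℝ) : Prop where
  measurable : Measurable k
  odd : ∀ z, k (reflect z) = -k z
  bound : ∀ z, ‖k z‖ₑ ≤ C * pw a z
  holder : ∀ z w, ‖k z - k w‖ₑ ≤
    C * (ENNReal.ofReal (paraNorm (z - w)) ^ (1 / 2 : ℝ) * (pw (a + 1 / 2) z + pw (a + 1 / 2) w))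

theorem pw_le_mul_pw_add_half {a c : ℝ} (ha : 0 ≤ a) (hc : 0 < c) {z u : SpaceTime} (hu : u ≠ 0)
    (h : paraNorm z ≤ c * paraNorm u) :
    pw a z ≤ ENNReal.ofReal c ^ (1 / 2 : ℝ) *
      (ENNReal.ofReal (paraNorm u) ^ (1 / 2 : ℝ) * pw (a + 1 / 2) z) := by
  by_cases hz : z = 0
  · subst hz
    have h1 : ENNReal.ofReal c ^ (1 / 2 : ℝ) ≠ 0 := by simp [ENNReal.rpow_eq_zero_iff, hc]
    have h2 : ENNReal.ofReal (paraNorm u) ^ (1 / 2 : ℝ) ≠ 0 := by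
      simp [ENNReal.rpow_eq_zero_iff, paraNorm_pos hu]
    rw [pw_at_zero (a := a + 1 / 2) (by linarith), ENNReal.mul_top h2, ENNReal.mul_top h1]
    exact le_top
  · have e : pw a z = ENNReal.ofReal (paraNorm z) ^ (1 / 2 : ℝ) * pw (a + 1 / 2) z := by
      rw [pw, pw, ← ENNReal.rpow_add _ _ (ofReal_paraNorm_ne_zero hz) ENNReal.ofReal_ne_top]
      congr 1; ring
    rw [e, ← mul_assoc]
    gcongr
    rw [← ENNReal.mul_rpow_of_nonneg _ _ (by norm_num), ← ENNReal.ofReal_mul hc.le]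
    exact ENNReal.rpow_le_rpow (ENNReal.ofReal_le_ofReal h) (by norm_num)

/-- If z - w is not small compared with z and w, the triangle inequality and the size bound already
give the Hölder bound. Only nearby points then need regularity of the kernel. -/
theorem enorm_sub_le_of_far {a : ℝ} (ha : 0 ≤ a) {C : ℝ≥0} {k : SpaceTime → ℝ}
    (hk : ∀ z, ‖k z‖ₑ ≤ C * pw a z) {z w : SpaceTime}
    (hz : paraNorm z ≤ 2 * paraNorm (z - w)) (hw : paraNorm w ≤ 2 * paraNorm (z - w)) :
    ‖k z - k w‖ₑ ≤ ((2 * C : ℝ≥0) : ℝ≥0∞) *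
      (ENNReal.ofReal (paraNorm (z - w)) ^ (1 / 2 : ℝ) * (pw (a + 1 / 2) z + pw (a + 1 / 2) w)) := by
  by_cases h : z = w
  · subst h; simp
  have hu : z - w ≠ 0 := sub_ne_zero.mpr h
  have h2 : ENNReal.ofReal 2 ^ (1 / 2 : ℝ) ≤ 2 := by
    calc ENNReal.ofReal 2 ^ (1 / 2 : ℝ) ≤ ENNReal.ofReal 2 ^ (1 : ℝ) :=
          ENNReal.rpow_le_rpow_of_exponent_le (by simp) (by norm_num)
      _ = 2 := by simp
  have e1 := pw_le_mul_pw_add_half ha two_pos hu hz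
  have e2 := pw_le_mul_pw_add_half ha two_pos hu hw
  calc ‖k z - k w‖ₑ ≤ ‖k z‖ₑ + ‖k w‖ₑ := enorm_sub_le
    _ ≤ C * pw a z + C * pw a w := add_le_add (hk z) (hk w)
    _ ≤ C * (2 * (ENNReal.ofReal (paraNorm (z - w)) ^ (1 / 2 : ℝ) * pw (a + 1 / 2) z)) +
        C * (2 * (ENNReal.ofReal (paraNorm (z - w)) ^ (1 / 2 : ℝ) * pw (a + 1 / 2) w)) := by
        gcongr
        · exact e1.trans (by gcongr)
        · exact e2.trans (by gcongr)
    _ = _ := by push_cast; ring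

theorem ofReal_sq_mul_pw_dil {l : ℝ} (hl : 0 < l) (z : SpaceTime) :
    ENNReal.ofReal (l ^ 2) * pw 2 (dil l z) = pw 2 z := by
  rw [pw_dil hl, ← mul_assoc, ENNReal.ofReal_rpow_of_pos hl, ← ENNReal.ofReal_mul (by positivity),
    ← Real.rpow_natCast, ← Real.rpow_add hl]
  norm_num

theorem enorm_scaleKer_le {C : ℝ≥0} {k : SpaceTime → ℝ} {l : ℝ} (hl : 0 < l) {z : SpaceTime}
    (h : ‖k (dil l z)‖ₑ ≤ C * pw 2 (dil l z)) : ‖scaleKer l k z‖ₑ ≤ C * pw 2 z := by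
  rw [scaleKer, enorm_mul, Real.enorm_of_nonneg (by positivity)]
  calc _ ≤ ENNReal.ofReal (l ^ 2) * (C * pw 2 (dil l z)) := by gcongr
    _ = C * (ENNReal.ofReal (l ^ 2) * pw 2 (dil l z)) := by ring
    _ = _ := by rw [ofReal_sq_mul_pw_dil hl]

theorem enorm_scaleKer_sub_le {C : ℝ≥0} {k : SpaceTime → ℝ} {l : ℝ} (hl : 0 < l) {z w : SpaceTime}
    (h : ‖k (dil l z) - k (dil l w)‖ₑ ≤ C * (ENNReal.ofReal (paraNorm (dil l z - dil l w)) ^ (1 / 2 : ℝ)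
      * (pw (2 + 1 / 2) (dil l z) + pw (2 + 1 / 2) (dil l w)))) :
    ‖scaleKer l k z - scaleKer l k w‖ₑ ≤ C * (ENNReal.ofReal (paraNorm (z - w)) ^ (1 / 2 : ℝ)
      * (pw (2 + 1 / 2) z + pw (2 + 1 / 2) w)) := by
  rw [scaleKer, scaleKer, ← mul_sub, enorm_mul, Real.enorm_of_nonneg (by positivity)]
  refine (mul_le_mul_right h (ENNReal.ofReal (l ^ 2))).trans (le_of_eq ?_)
  rw [← dil_sub, paraNorm_dil hl.le, pw_dil hl, pw_dil hl, ENNReal.ofReal_mul hl.le,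
    ENNReal.mul_rpow_of_nonneg _ _ (by norm_num), ← mul_add]
  have : ENNReal.ofReal (l ^ 2) * (ENNReal.ofReal l ^ (1 / 2 : ℝ) *
      ENNReal.ofReal l ^ (-(2 + 1 / 2) : ℝ)) = 1 := by
    rw [ENNReal.ofReal_rpow_of_pos hl, ENNReal.ofReal_rpow_of_pos hl,
      ← ENNReal.ofReal_mul (by positivity), ← ENNReal.ofReal_mul (by positivity),
      ← Real.rpow_natCast, ← Real.rpow_add hl, ← Real.rpow_add hl]
    norm_num
  calc _ = (ENNReal.ofReal (l ^ 2) * (ENNReal.ofReal l ^ (1 / 2 : ℝ) *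
      ENNReal.ofReal l ^ (-(2 + 1 / 2) : ℝ))) * (C * (ENNReal.ofReal (paraNorm (z - w)) ^ (1 / 2 : ℝ)
      * (pw (2 + 1 / 2) z + pw (2 + 1 / 2) w))) := by ring
    _ = _ := by rw [this, one_mul]

theorem IsKer.scaleKer {C : ℝ≥0} {k : SpaceTime → ℝ} (hk : IsKer C 2 k) {l : ℝ} (hl : 0 < l) :
    IsKer C 2 (scaleKer l k) where
  measurable := (hk.measurable.comp (measurable_dil l)).const_mul _
  odd z := by simp only [KPZLogs.scaleKer, dil_reflect, hk.odd]; ring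
  bound z := enorm_scaleKer_le hl (hk.bound _)
  holder z w := enorm_scaleKer_sub_le hl (hk.holder _ _)

theorem IsKer.mono {C D : ℝ≥0} (h : C ≤ D) {a : ℝ} {k : SpaceTime → ℝ} (hk : IsKer C a k) :
    IsKer D a k where
  measurable := hk.measurable
  odd := hk.odd
  bound z := (hk.bound z).trans (by gcongr)
  holder z w := (hk.holder z w).trans (by gcongr)

theorem CutoffKernel.exists_isKer_heatDeriv (K : CutoffKernel) : ∃ C : ℝ≥0, IsKer C 2 heatDeriv := by
  obtain ⟨M, hM1, hM2⟩ := K.exists_bound_away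
  have hb : ∀ z, ‖heatDeriv z‖ₑ ≤ M * pw 2 z := by
    intro z
    by_cases hz : z = 0
    · subst hz
      rw [heatDeriv_of_nonpos le_rfl]; simp
    · have hN := paraNorm_pos hz
      -- Scale invariance moves z to the sphere of radius 1/4, where P' coincides with K' and the
      -- bounds away from the origin apply.
      have hl : 0 < (4 * paraNorm z)⁻¹ := by positivity
      have hd : paraNorm (dil (4 * paraNorm z)⁻¹ z) = 1 / 4 := by
        rw [paraNorm_dil hl.le]; field_simp
      rw [← scaleKer_heatDeriv hl]
      refine enorm_scaleKer_le hl ?_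
      rw [← K.deriv_eq_heatDeriv (by rw [hd]; norm_num)]
      refine (hM1 _ (by rw [hd]; norm_num)).trans ?_
      exact le_mul_of_one_le_right' (one_le_pw (by norm_num) (by rw [hd]; norm_num))
  have hb' : ∀ z, ‖heatDeriv z‖ₑ ≤ (M : ℝ≥0∞) * pw 2 z := hb
  refine ⟨2 * M, measurable_heatDeriv, heatDeriv_reflect, fun z => (hb z).trans ?_, fun z w => ?_⟩
  · gcongr
    exact le_mul_of_one_le_left zero_le one_le_two
  · by_cases hzw : z = w
    · subst hzw; simp
    set m := max (paraNorm z) (paraNorm w) with hm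
    have hm0 : 0 < m := by
      by_cases hz : z = 0
      · have : w ≠ 0 := fun h => hzw (hz.trans h.symm)
        exact lt_max_of_lt_right (paraNorm_pos this)
      · exact lt_max_of_lt_left (paraNorm_pos hz)
    have hl : 0 < (4 * m)⁻¹ := by positivity
    rw [← scaleKer_heatDeriv hl]
    refine enorm_scaleKer_sub_le hl ?_
    set z' := dil (4 * m)⁻¹ z with hz'
    set w' := dil (4 * m)⁻¹ w with hw'
    have hmax : max (paraNorm z') (paraNorm w') = 1 / 4 := by
      rw [hz', hw', paraNorm_dil hl.le, paraNorm_dil hl.le, ← mul_max_of_nonneg _ _ hl.le, ← hm]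
      field_simp
    have h1 : paraNorm z' ≤ 1 / 4 := hmax ▸ le_max_left _ _
    have h2 : paraNorm w' ≤ 1 / 4 := hmax ▸ le_max_right _ _
    -- After rescaling the larger of the two points has norm 1/4. Either both stay away from the
    -- origin, where K' is regular, or they are at distance at least 1/8 and the size bound
    -- suffices.
    by_cases hc : 1 / 8 ≤ paraNorm z' ∧ 1 / 8 ≤ paraNorm w'
    · rw [← K.deriv_eq_heatDeriv (by linarith), ← K.deriv_eq_heatDeriv (by linarith)]
      refine (hM2 _ _ hc.1 hc.2).trans ?_
      gcongr
      · exact le_mul_of_one_le_left zero_le one_le_two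
      · exact le_mul_of_one_le_right'
          ((one_le_pw (by norm_num) (by linarith)).trans le_self_add)
    · have t1 := paraNorm_le_add_sub z' w'
      have t2 := paraNorm_le_add_sub w' z'
      rw [paraNorm_sub_comm w' z'] at t2
      have h3 : 1 / 8 ≤ paraNorm (z' - w') := by
        rw [not_and_or, not_le, not_le] at hc
        rcases max_choice (paraNorm z') (paraNorm w') with h | h <;> rw [h] at hmax <;>
          rcases hc with hc | hc <;> linarith
      exact enorm_sub_le_of_far (by norm_num) hb (by linarith) (by linarith)

/-- Inside radius 1/2 the kernel is P'; outside radius 1/8 it is regular with compact support. The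
only remaining pairs have one point outside 1/2 and the other inside 1/8, hence are far apart. -/
theorem CutoffKernel.exists_isKer_deriv (K : CutoffKernel) : ∃ C : ℝ≥0, IsKer C 2 K.deriv := by
  obtain ⟨M, hM1, hM2⟩ := K.exists_bound_away
  obtain ⟨C, hC⟩ := K.exists_isKer_heatDeriv
  have hb : ∀ z, ‖K.deriv z‖ₑ ≤ ((M + C : ℝ≥0) : ℝ≥0∞) * pw 2 z := by
    intro z
    rcases lt_or_ge (paraNorm z) (1 / 2) with h | h
    · rw [K.deriv_eq_heatDeriv h]
      refine (hC.bound z).trans ?_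
      gcongr
      exact le_add_self
    · rcases le_or_gt (paraNorm z) 1 with h1 | h1
      · refine (hM1 z (by linarith)).trans ?_
        calc (M : ℝ≥0∞) ≤ ((M + C : ℝ≥0) : ℝ≥0∞) := by gcongr; exact le_self_add
          _ ≤ _ := le_mul_of_one_le_right' (one_le_pw (by norm_num) h1)
      · rw [K.deriv_of_one_lt h1]; simp
  refine ⟨2 * (M + C), K.measurable_deriv, K.deriv_reflect, fun z => (hb z).trans ?_, fun z w => ?_⟩
  · gcongr
    exact le_mul_of_one_le_left zero_le one_le_two
  · by_cases h1 : paraNorm z < 1 / 2 ∧ paraNorm w < 1 / 2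
    · rw [K.deriv_eq_heatDeriv h1.1, K.deriv_eq_heatDeriv h1.2]
      refine (hC.holder z w).trans ?_
      gcongr
      exact le_add_self.trans (le_mul_of_one_le_left zero_le one_le_two)
    by_cases h2 : 1 / 8 ≤ paraNorm z ∧ 1 / 8 ≤ paraNorm w
    · by_cases h3 : 1 < paraNorm z ∧ 1 < paraNorm w
      · rw [K.deriv_of_one_lt h3.1, K.deriv_of_one_lt h3.2]; simp
      · refine (hM2 _ _ h2.1 h2.2).trans ?_
        gcongr
        · exact le_self_add.trans (le_mul_of_one_le_left zero_le one_le_two)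
        · refine le_mul_of_one_le_right' ?_
          rw [not_and_or, not_lt, not_lt] at h3
          rcases h3 with h3 | h3
          · exact (one_le_pw (by norm_num) h3).trans le_self_add
          · exact (one_le_pw (by norm_num) h3).trans le_add_self
    · have t1 := paraNorm_le_add_sub z w
      have t2 := paraNorm_le_add_sub w z
      rw [paraNorm_sub_comm w z] at t2
      have : paraNorm z ≤ 2 * paraNorm (z - w) ∧ paraNorm w ≤ 2 * paraNorm (z - w) := by
        rw [not_and_or, not_lt, not_lt] at h1
        rw [not_and_or, not_le, not_le] at h2
        rcases h1 with h1 | h1 <;> rcases h2 with h2 | h2 <;> constructor <;> linarith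
      exact enorm_sub_le_of_far (by norm_num) hb this.1 this.2

theorem pw_add_quarter_le {a : ℝ} (ha : 0 ≤ a) {z : SpaceTime} (h : 1 / 4 ≤ paraNorm z) :
    pw (a + 1 / 4) z ≤ 4 * pw a z := by
  rw [← pw_mul_pw ha (by norm_num), mul_comm]
  gcongr
  calc pw (1 / 4) z ≤ ENNReal.ofReal (1 / 4) ^ (-(1 / 4) : ℝ) := pw_le_const (by norm_num) h
    _ ≤ ENNReal.ofReal (1 / 4) ^ (-1 : ℝ) :=
        ENNReal.rpow_le_rpow_of_exponent_ge (by simp) (by norm_num)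
    _ = 4 := by
        rw [ENNReal.rpow_neg_one, ENNReal.ofReal_div_of_pos (by norm_num)]; simp

/-- The difference vanishes for |z| < 1/2 and has order 2 elsewhere, so it satisfies the weaker
order 7/4 globally. The gain of 1/4 near the origin is what turns the borderline order 3 into the
integrable order 11/4. -/
theorem CutoffKernel.exists_isKer_deriv_sub (K : CutoffKernel) :
    ∃ C : ℝ≥0, IsKer C (7 / 4) (fun z => K.deriv z - heatDeriv z) := by
  obtain ⟨C, hC⟩ := K.exists_isKer_deriv
  obtain ⟨D, hD⟩ := K.exists_isKer_heatDeriv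
  have hb : ∀ z, ‖K.deriv z - heatDeriv z‖ₑ ≤ ((4 * (C + D) : ℝ≥0) : ℝ≥0∞) * pw (7 / 4) z := by
    intro z
    rcases lt_or_ge (paraNorm z) (1 / 2) with h | h
    · rw [K.deriv_eq_heatDeriv h]; simp
    · calc ‖K.deriv z - heatDeriv z‖ₑ ≤ C * pw 2 z + D * pw 2 z :=
            enorm_sub_le.trans (add_le_add (hC.bound z) (hD.bound z))
        _ = (C + D) * pw (7 / 4 + 1 / 4) z := by rw [← add_mul]; norm_num
        _ ≤ (C + D) * (4 * pw (7 / 4) z) := by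
            gcongr; exact pw_add_quarter_le (by norm_num) (by linarith)
        _ = _ := by push_cast; ring
  have hle : 4 * (C + D) ≤ 2 * (4 * (C + D)) := le_mul_of_one_le_left zero_le one_le_two
  refine ⟨2 * (4 * (C + D)), hC.measurable.sub hD.measurable, fun z => ?_,
    fun z => (hb z).trans ?_, fun z w => ?_⟩
  · rw [hC.odd, hD.odd]; ring
  · exact mul_le_mul_left (ENNReal.coe_le_coe.mpr hle) _
  · by_cases h1 : paraNorm z < 1 / 2 ∧ paraNorm w < 1 / 2
    · rw [K.deriv_eq_heatDeriv h1.1, K.deriv_eq_heatDeriv h1.2]; simp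
    by_cases h2 : 1 / 4 ≤ paraNorm z ∧ 1 / 4 ≤ paraNorm w
    · have e1 := hC.holder z w
      have e2 := hD.holder z w
      calc ‖K.deriv z - heatDeriv z - (K.deriv w - heatDeriv w)‖ₑ
          = ‖(K.deriv z - K.deriv w) - (heatDeriv z - heatDeriv w)‖ₑ := by congr 1; ring
        _ ≤ _ := enorm_sub_le.trans (add_le_add e1 e2)
        _ = (C + D) * (ENNReal.ofReal (paraNorm (z - w)) ^ (1 / 2 : ℝ) *
            (pw (7 / 4 + 1 / 2 + 1 / 4) z + pw (7 / 4 + 1 / 2 + 1 / 4) w)) := by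
            rw [← add_mul]; norm_num
        _ ≤ (C + D) * (ENNReal.ofReal (paraNorm (z - w)) ^ (1 / 2 : ℝ) *
            (4 * pw (7 / 4 + 1 / 2) z + 4 * pw (7 / 4 + 1 / 2) w)) := by
            gcongr
            · exact pw_add_quarter_le (by norm_num) h2.1
            · exact pw_add_quarter_le (by norm_num) h2.2
        _ = ((4 * (C + D) : ℝ≥0) : ℝ≥0∞) * (ENNReal.ofReal (paraNorm (z - w)) ^ (1 / 2 : ℝ) *
            (pw (7 / 4 + 1 / 2) z + pw (7 / 4 + 1 / 2) w)) := by push_cast; ring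
        _ ≤ _ := mul_le_mul_left (ENNReal.coe_le_coe.mpr hle) _
    · have t1 := paraNorm_le_add_sub z w
      have t2 := paraNorm_le_add_sub w z
      rw [paraNorm_sub_comm w z] at t2
      have : paraNorm z ≤ 2 * paraNorm (z - w) ∧ paraNorm w ≤ 2 * paraNorm (z - w) := by
        rw [not_and_or, not_lt, not_lt] at h1
        rw [not_and_or, not_le, not_le] at h2
        rcases h1 with h1 | h1 <;> rcases h2 with h2 | h2 <;> constructor <;> linarith
      exact enorm_sub_le_of_far (k := fun z => K.deriv z - heatDeriv z) (by norm_num) hb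
        this.1 this.2

/-- The rescaled derivatives of a cutoff kernel are eventually equal to that of the heat kernel. -/
theorem CutoffKernel.tendsto_scaleKer (K : CutoffKernel) (z : SpaceTime) :
    Tendsto (fun l => scaleKer l K.deriv z) (𝓝[>] 0) (𝓝 (heatDeriv z)) := by
  refine tendsto_const_nhds.congr' ?_
  have h1 : ∀ᶠ l : ℝ in 𝓝[>] 0, l * paraNorm z < 1 / 2 := by
    refine nhdsWithin_le_nhds ?_
    have : Tendsto (fun l : ℝ => l * paraNorm z) (𝓝 0) (𝓝 (0 * paraNorm z)) :=
      (continuous_id.mul continuous_const).tendsto 0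
    rw [zero_mul] at this
    exact this.eventually_lt_const (by norm_num)
  filter_upwards [h1, self_mem_nhdsWithin] with l hl hl0
  have hl0' : 0 < l := hl0
  rw [scaleKer, K.deriv_eq_heatDeriv (by rwa [paraNorm_dil hl0'.le])]
  exact (congrFun (scaleKer_heatDeriv hl0') z).symm

/-! ### Integration with weights in `[0, ∞]` -/

/-- Dominated convergence with a bound in [0, ∞]: the weights are infinite at singular points, and
finiteness of their integral confines those to a null set. -/
theorem tendsto_integral_of_enorm_le {α ι : Type*} [MeasurableSpace α] {μ : Measure α}
    {l : Filter ι} [l.IsCountablyGenerated] {F : ι → α → ℝ} {f : α → ℝ} {g : α → ℝ≥0∞}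
    (hg : Measurable g) (hfin : ∫⁻ a, g a ∂μ ≠ ⊤)
    (hF : ∀ᶠ n in l, AEStronglyMeasurable (F n) μ)
    (hle : ∀ᶠ n in l, ∀ᵐ a ∂μ, ‖F n a‖ₑ ≤ g a)
    (hlim : ∀ᵐ a ∂μ, Tendsto (fun n => F n a) l (𝓝 (f a))) :
    Tendsto (fun n => ∫ a, F n a ∂μ) l (𝓝 (∫ a, f a ∂μ)) := by
  refine tendsto_integral_filter_of_dominated_convergence (fun a => (g a).toReal) hF ?_
    (integrable_toReal_of_lintegral_ne_top hg.aemeasurable hfin) hlim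
  filter_upwards [hle] with n hn
  filter_upwards [hn, ae_lt_top hg hfin] with a ha hlt
  rw [← ENNReal.ofReal_le_ofReal_iff ENNReal.toReal_nonneg, ofReal_norm,
    ENNReal.ofReal_toReal hlt.ne]
  exact ha

theorem integrable_of_enorm_le {α : Type*} [MeasurableSpace α] {μ : Measure α} {f : α → ℝ}
    {g : α → ℝ≥0∞} (hf : AEStronglyMeasurable f μ) (hle : ∀ᵐ a ∂μ, ‖f a‖ₑ ≤ g a)
    (hfin : ∫⁻ a, g a ∂μ ≠ ⊤) : Integrable f μ :=
  ⟨hf, lt_of_le_of_lt (lintegral_mono_ae hle) hfin.lt_top⟩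

theorem ae_ne_zero : ∀ᵐ z : SpaceTime, z ≠ 0 := by simp [ae_iff]

theorem le_mul_qw_pow {x D : ℝ≥0∞} {n : ℕ} {z : SpaceTime} (h1 : x ≤ D)
    (h2 : x ≤ D * pw n z) : x ≤ D * qw z ^ n := by
  rcases le_total 1 (pw 1 z) with h | h
  · simpa [qw, min_eq_left h] using h1
  · rw [qw, min_eq_right h, pw_nat_pow, mul_one]; exact h2

/-- A bound off the origin becomes global because the right side is `⊤` at 0, provided the constant
is not 0; hence the summand 1. -/
theorem bound_of_bound_ne_zero {f : SpaceTime → ℝ} {D : ℝ≥0} {a : ℝ} (ha : 0 < a)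
    (h : ∀ z, z ≠ 0 → ‖f z‖ₑ ≤ D * pw a z) (z : SpaceTime) :
    ‖f z‖ₑ ≤ ((D + 1 : ℝ≥0) : ℝ≥0∞) * pw a z := by
  by_cases hz : z = 0
  · subst hz
    rw [pw_at_zero ha, ENNReal.mul_top (by simp)]; exact le_top
  · refine (h z hz).trans ?_
    gcongr
    exact le_self_add

/-! ### Correlations of kernels -/

/-- The correlation `z ↦ ∫ f(z + w) g(w) dw`. -/
def corr (f g : SpaceTime → ℝ) (z : SpaceTime) : ℝ := ∫ w, f (z + w) * g w

theorem measurable_corr {f g : SpaceTime → ℝ} (hf : Measurable f) (hg : Measurable g) :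
    Measurable (corr f g) := by
  have : StronglyMeasurable (fun p : SpaceTime × SpaceTime => f (p.1 + p.2) * g p.2) :=
    Measurable.stronglyMeasurable (by fun_prop)
  exact this.integral_prod_right.measurable

theorem corr_neg (f : SpaceTime → ℝ) (z : SpaceTime) : corr f f (-z) = corr f f z := by
  unfold corr
  rw [← integral_add_left_eq_self (fun w => f (-z + w) * f w) z]
  congr 1; ext w
  rw [mul_comm]; simp

theorem corr_reflect {f : SpaceTime → ℝ} (hf : ∀ z, f (reflect z) = -f z) (z : SpaceTime) :
    corr f f (reflect z) = corr f f z := by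
  unfold corr
  rw [← integral_comp_reflect]
  congr 1; ext w
  rw [← reflect_add, hf, hf]; ring

/-- Two kernels of order 2 in dimension 3 correlate to order 2 + 2 - 3 = 1. -/
theorem corr_scale {f : SpaceTime → ℝ} {l : ℝ} (hl : 0 < l) (z : SpaceTime) :
    corr (scaleKer l f) (scaleKer l f) z = l * corr f f (dil l z) := by
  unfold corr
  have h := integral_comp_dil hl (fun w => f (dil l z + w) * f w)
  simp only [← dil_add] at h
  calc ∫ w, scaleKer l f (z + w) * scaleKer l f w
      = ∫ w, l ^ 4 * (f (dil l (z + w)) * f (dil l w)) := by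
        congr 1; ext w; simp only [scaleKer]; ring
    _ = _ := by
        rw [integral_const_mul, h]
        field_simp

theorem lintegral_pw_add_mul_pw (a b : ℝ) (z : SpaceTime) :
    ∫⁻ w, pw a (z + w) * pw b w = ∫⁻ w, pw b w * pw a (z - w) := by
  rw [← lintegral_neg_eq_self]
  congr 1; ext w
  rw [pw_neg, mul_comm, sub_eq_add_neg]

theorem exists_lintegral_corr_le {a b : ℝ} (ha : 0 < a) (ha3 : a < 3) (hb : 0 < b) (hb3 : b < 3)
    (hab : 3 < a + b) : ∃ E : ℝ≥0, ∀ (C D : ℝ≥0) (f g : SpaceTime → ℝ),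
      (∀ z, ‖f z‖ₑ ≤ C * pw a z) → (∀ z, ‖g z‖ₑ ≤ D * pw b z) →
      ∀ z, ∫⁻ w, ‖f (z + w) * g w‖ₑ ≤ ((C * D * E : ℝ≥0) : ℝ≥0∞) * pw (a + b - 3) z := by
  obtain ⟨E, hE⟩ := exists_lintegral_pw_mul_pw_le hb hb3 ha ha3 (by linarith)
  refine ⟨E, fun C D f g hf hg z => ?_⟩
  calc ∫⁻ w, ‖f (z + w) * g w‖ₑ ≤ ∫⁻ w, (C * D : ℝ≥0∞) * (pw a (z + w) * pw b w) := by
        refine lintegral_mono fun w => ?_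
        rw [enorm_mul]
        calc _ ≤ (C * pw a (z + w)) * (D * pw b w) := mul_le_mul' (hf _) (hg _)
          _ = _ := by ring
    _ = (C * D : ℝ≥0∞) * ∫⁻ w, pw b w * pw a (z - w) := by
        rw [lintegral_const_mul' _ _ (by finiteness), lintegral_pw_add_mul_pw]
    _ ≤ (C * D : ℝ≥0∞) * (E * pw (b + a - 3) z) := by gcongr; exact hE z
    _ = _ := by push_cast; rw [add_comm b a]; ring

theorem integrable_corr {a b : ℝ} (ha : 0 < a) (ha3 : a < 3) (hb : 0 < b) (hb3 : b < 3)
    (hab : 3 < a + b) {C D : ℝ≥0} {f g : SpaceTime → ℝ} (mf : Measurable f) (mg : Measurable g)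
    (hf : ∀ z, ‖f z‖ₑ ≤ C * pw a z) (hg : ∀ z, ‖g z‖ₑ ≤ D * pw b z) {z : SpaceTime} (hz : z ≠ 0) :
    Integrable (fun w => f (z + w) * g w) := by
  obtain ⟨E, hE⟩ := exists_lintegral_corr_le ha ha3 hb hb3 hab
  refine ⟨Measurable.aestronglyMeasurable (by fun_prop), lt_of_le_of_lt (hE C D f g hf hg z) ?_⟩
  exact ENNReal.mul_lt_top ENNReal.coe_lt_top (pw_ne_top hz _).lt_top

theorem exists_corr_le {a b : ℝ} (ha : 0 < a) (ha3 : a < 3) (hb : 0 < b) (hb3 : b < 3)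
    (hab : 3 < a + b) : ∃ E : ℝ≥0, ∀ (C D : ℝ≥0) (f g : SpaceTime → ℝ),
      (∀ z, ‖f z‖ₑ ≤ C * pw a z) → (∀ z, ‖g z‖ₑ ≤ D * pw b z) →
      ∀ z, ‖corr f g z‖ₑ ≤ ((C * D * E : ℝ≥0) : ℝ≥0∞) * pw (a + b - 3) z := by
  obtain ⟨E, hE⟩ := exists_lintegral_corr_le ha ha3 hb hb3 hab
  exact ⟨E, fun C D f g hf hg z => (enorm_integral_le_lintegral_enorm _).trans (hE C D f g hf hg z)⟩

/-- By bilinearity the difference is the correlation of f - g with f plus that of g with f - g, so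
an error of order c yields an error of order c + 2 - 3. The origin is excluded because the integrals
to be split need not converge there. -/
theorem exists_corr_sub_le {c : ℝ} (hc : 1 < c) (hc3 : c < 3) :
    ∃ E : ℝ≥0, ∀ (C D : ℝ≥0) (f g : SpaceTime → ℝ), Measurable f → Measurable g →
      (∀ z, ‖f z‖ₑ ≤ C * pw 2 z) → (∀ z, ‖g z‖ₑ ≤ C * pw 2 z) →
      (∀ z, ‖f z - g z‖ₑ ≤ D * pw c z) →
      ∀ z, z ≠ 0 → ‖corr f f z - corr g g z‖ₑ ≤ ((C * D * E : ℝ≥0) : ℝ≥0∞) * pw (c - 1) z := by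
  obtain ⟨E1, hE1⟩ := exists_corr_le (a := c) (b := 2) (by linarith) hc3 (by norm_num) (by norm_num)
    (by linarith)
  obtain ⟨E2, hE2⟩ := exists_corr_le (a := 2) (b := c) (by norm_num) (by norm_num) (by linarith) hc3
    (by linarith)
  refine ⟨E1 + E2, fun C D f g mf mg hf hg hfg z hz => ?_⟩
  have i1 := integrable_corr (a := 2) (b := 2) (by norm_num) (by norm_num) (by norm_num)
    (by norm_num) (by norm_num) mf mf hf hf hz
  have i2 := integrable_corr (a := 2) (b := 2) (by norm_num) (by norm_num) (by norm_num)
    (by norm_num) (by norm_num) mg mf hg hf hz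
  have i3 := integrable_corr (a := 2) (b := 2) (by norm_num) (by norm_num) (by norm_num)
    (by norm_num) (by norm_num) mg mg hg hg hz
  have e : corr f f z - corr g g z =
      corr (fun z => f z - g z) f z + corr g (fun z => f z - g z) z := by
    unfold corr
    simp only [sub_mul, mul_sub]
    rw [integral_sub i1 i2, integral_sub i2 i3]
    ring
  rw [e]
  refine (enorm_add_le _ _).trans ((add_le_add (hE1 D C _ _ hfg hf z) (hE2 C D _ _ hg hfg z)).trans
    (le_of_eq ?_))
  rw [show c + 2 - 3 = c - 1 by ring, show 2 + c - 3 = c - 1 by ring]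
  push_cast; ring

theorem tendsto_corr {ι : Type*} {l : Filter ι} [l.IsCountablyGenerated] {C : ℝ≥0}
    {f : ι → SpaceTime → ℝ} {g : SpaceTime → ℝ} (mf : ∀ᶠ n in l, Measurable (f n))
    (hf : ∀ᶠ n in l, ∀ z, ‖f n z‖ₑ ≤ C * pw 2 z)
    (hlim : ∀ z, Tendsto (fun n => f n z) l (𝓝 (g z))) {z : SpaceTime} (hz : z ≠ 0) :
    Tendsto (fun n => corr (f n) (f n) z) l (𝓝 (corr g g z)) := by
  obtain ⟨E, hE⟩ := exists_lintegral_pw_mul_pw_le (a := 2) (b := 2) (by norm_num) (by norm_num)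
    (by norm_num) (by norm_num) (by norm_num)
  have mp := measurable_pw 2
  refine tendsto_integral_of_enorm_le (g := fun w => (C * C : ℝ≥0∞) * (pw 2 (z + w) * pw 2 w))
    (by fun_prop) ?_ ?_ ?_ ?_
  · rw [lintegral_const_mul' _ _ (by finiteness), lintegral_pw_add_mul_pw]
    refine ENNReal.mul_ne_top (by finiteness) (ne_top_of_le_ne_top ?_ (hE z))
    exact ENNReal.mul_ne_top ENNReal.coe_ne_top (pw_ne_top hz _)
  · filter_upwards [mf] with n hn
    exact Measurable.aestronglyMeasurable (by fun_prop)
  · filter_upwards [hf] with n hn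
    refine Eventually.of_forall fun w => ?_
    rw [enorm_mul]
    calc _ ≤ (C * pw 2 (z + w)) * (C * pw 2 w) := mul_le_mul' (hn _) (hn _)
      _ = _ := by ring
  · exact Eventually.of_forall fun w => (hlim _).mul (hlim _)

/-! ### Mollification of kernels -/

theorem conv_apply (f g : SpaceTime → ℝ) (z : SpaceTime) : conv f g z = ∫ u, f u * g (z - u) := rfl

namespace Mollifier

variable (ρ : Mollifier)

theorem continuous : Continuous ρ.toFun := ρ.smooth.continuous

theorem exists_support : ∃ r : ℝ, 0 < r ∧ ∀ z, ρ.toFun z ≠ 0 → paraNorm z ≤ r := by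
  obtain ⟨S, hS, hS'⟩ := exists_compact_iff_hasCompactSupport.mpr ρ.compact
  obtain ⟨r, hr⟩ := hS.bddAbove_image continuous_paraNorm.continuousOn
  refine ⟨max r 1, by positivity, fun z hz => le_max_of_le_left (hr ⟨z, ?_, rfl⟩)⟩
  by_contra h
  exact hz (hS' z h)

theorem lintegral_lt_top : ∫⁻ u, ‖ρ.toFun u‖ₑ < ⊤ :=
  (ρ.continuous.integrable_of_hasCompactSupport ρ.compact).2

/-- Uniform boundedness is local integrability of |z|^{-a} against a bounded compactly supported
function. For |z| ≥ 2r every point z - u with u in the support has norm at least |z|/2; for smaller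
z the weight is bounded below, and the first bound implies the second. -/
theorem exists_lintegral_mul_pw_le {a : ℝ} (ha : 0 ≤ a) (ha3 : a < 3) :
    ∃ E : ℝ≥0, ∀ z, ∫⁻ u, ‖ρ.toFun u‖ₑ * pw a (z - u) ≤ E ∧
      ∫⁻ u, ‖ρ.toFun u‖ₑ * pw a (z - u) ≤ E * pw a z := by
  obtain ⟨r, hr, hsupp⟩ := ρ.exists_support
  obtain ⟨M, hM⟩ := ρ.compact.exists_bound_of_continuous ρ.continuous
  have mρ : Measurable ρ.toFun := ρ.continuous.measurable
  have mp := measurable_pw a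
  have hm : MeasurableSet {z : SpaceTime | paraNorm z ≤ 1} :=
    measurableSet_le measurable_paraNorm measurable_const
  set I := ∫⁻ u, ‖ρ.toFun u‖ₑ with hI
  have hIt : I < ⊤ := ρ.lintegral_lt_top
  set J := ∫⁻ z in {z | paraNorm z ≤ 1}, pw a z with hJ
  have hJt : J < ⊤ := lintegral_ball_pw_lt_top ha ha3
  have h1 : ∀ z, ∫⁻ u, ‖ρ.toFun u‖ₑ * pw a (z - u) ≤ I + ENNReal.ofReal M * J := by
    intro z
    calc ∫⁻ u, ‖ρ.toFun u‖ₑ * pw a (z - u)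
        ≤ ∫⁻ u, (‖ρ.toFun u‖ₑ + ENNReal.ofReal M * {z | paraNorm z ≤ 1}.indicator (pw a) (z - u)) := by
          refine lintegral_mono fun u => ?_
          rcases le_or_gt (paraNorm (z - u)) 1 with h | h
          · rw [Set.indicator_of_mem (show z - u ∈ {z | paraNorm z ≤ 1} from h)]
            refine le_add_left ?_
            gcongr
            rw [← ofReal_norm]
            exact ENNReal.ofReal_le_ofReal (hM u)
          · refine le_add_right (mul_le_of_le_one_right' ?_)
            calc pw a (z - u) ≤ pw 0 (z - u) := pw_le_pw_of_one_le ha h.le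
              _ = 1 := pw_zero_exp _
      _ = _ := by
          rw [lintegral_add_left (by fun_prop), lintegral_const_mul' _ _ ENNReal.ofReal_ne_top,
            lintegral_sub_left_eq_self ({z : SpaceTime | paraNorm z ≤ 1}.indicator (pw a)),
            lintegral_indicator hm]
  set E1 := I + ENNReal.ofReal M * J with hE1
  have hE1t : E1 ≠ ⊤ :=
    (ENNReal.add_lt_top.mpr ⟨hIt, ENNReal.mul_lt_top ENNReal.ofReal_lt_top hJt⟩).ne
  have h2t : ENNReal.ofReal 2 ^ a ≠ ⊤ := ENNReal.rpow_ne_top_of_nonneg ha ENNReal.ofReal_ne_top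
  have hrt : ENNReal.ofReal (2 * r) ^ a ≠ ⊤ := ENNReal.rpow_ne_top_of_nonneg ha ENNReal.ofReal_ne_top
  set E := E1 + I * ENNReal.ofReal 2 ^ a + E1 * ENNReal.ofReal (2 * r) ^ a with hE
  have hEt : E ≠ ⊤ := ENNReal.add_ne_top.mpr ⟨ENNReal.add_ne_top.mpr
    ⟨hE1t, ENNReal.mul_ne_top hIt.ne h2t⟩, ENNReal.mul_ne_top hE1t hrt⟩
  refine ⟨E.toNNReal, fun z => ?_⟩
  rw [ENNReal.coe_toNNReal hEt]
  refine ⟨(h1 z).trans (le_add_right (le_add_right le_rfl)), ?_⟩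
  rcases le_total (2 * r) (paraNorm z) with h | h
  · calc ∫⁻ u, ‖ρ.toFun u‖ₑ * pw a (z - u)
        ≤ ∫⁻ u, ‖ρ.toFun u‖ₑ * (ENNReal.ofReal 2 ^ a * pw a z) := by
          refine lintegral_mono fun u => ?_
          by_cases hu : ρ.toFun u = 0
          · simp [hu]
          · have := hsupp u hu
            have t := paraNorm_le_add_sub z u
            dsimp only
            gcongr
            exact pw_le_of_paraNorm_le ha two_pos (by linarith)
      _ = I * (ENNReal.ofReal 2 ^ a * pw a z) := by
          rw [lintegral_mul_const _ (by fun_prop)]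
      _ = (I * ENNReal.ofReal 2 ^ a) * pw a z := by ring
      _ ≤ E * pw a z := by
          gcongr
          exact le_add_right (le_add_left le_rfl)
  · have h3 : 1 ≤ ENNReal.ofReal (2 * r) ^ a * pw a z := by
      have hpos : (0 : ℝ) < 2 * r := by linarith
      have h0 : ENNReal.ofReal (2 * r) ^ a ≠ 0 := by simp [ENNReal.rpow_eq_zero_iff, hr, ha]
      calc (1 : ℝ≥0∞) = ENNReal.ofReal (2 * r) ^ a * (ENNReal.ofReal (2 * r) ^ a)⁻¹ :=
            (ENNReal.mul_inv_cancel h0 hrt).symm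
        _ ≤ _ := by
            unfold pw
            rw [ENNReal.rpow_neg]
            gcongr
    calc ∫⁻ u, ‖ρ.toFun u‖ₑ * pw a (z - u) ≤ E1 := h1 z
      _ ≤ E1 * (ENNReal.ofReal (2 * r) ^ a * pw a z) := le_mul_of_one_le_right' h3
      _ = (E1 * ENNReal.ofReal (2 * r) ^ a) * pw a z := by ring
      _ ≤ E * pw a z := by
          gcongr
          exact le_add_left le_rfl

/-- The mollification `ρ * k`. -/
def moll (k : SpaceTime → ℝ) : SpaceTime → ℝ := conv ρ.toFun k

theorem measurable_moll {k : SpaceTime → ℝ} (hk : Measurable k) : Measurable (ρ.moll k) := by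
  have mρ : Measurable ρ.toFun := ρ.continuous.measurable
  have : StronglyMeasurable (fun p : SpaceTime × SpaceTime => ρ.toFun p.2 * k (p.1 - p.2)) :=
    Measurable.stronglyMeasurable (by fun_prop)
  exact this.integral_prod_right.measurable

theorem moll_reflect {k : SpaceTime → ℝ} (hk : ∀ z, k (reflect z) = -k z) (z : SpaceTime) :
    ρ.moll k (reflect z) = -ρ.moll k z := by
  rw [moll, conv_apply, conv_apply, ← integral_comp_reflect, ← integral_neg]
  congr 1; ext u
  rw [← reflect_sub, hk, show ρ.toFun (reflect u) = ρ.toFun u from ρ.even_space u.1 u.2]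
  ring

/-- Mollification removes the singularity and keeps the decay. Since ρ has integral 1, the
mollification error is an average of increments over bounded distances, and the Hölder bound gives
it order 2 + 1/2: half a power better at infinity. -/
theorem exists_moll_bounds (C : ℝ≥0) : ∃ D : ℝ≥0, ∀ k, IsKer C 2 k →
    (∀ z, ‖ρ.moll k z‖ₑ ≤ D * qw z ^ 2) ∧ (∀ z, ‖ρ.moll k z‖ₑ ≤ D * pw 2 z) ∧
    ∀ z, ‖ρ.moll k z - k z‖ₑ ≤ D * pw (5 / 2) z := by
  obtain ⟨E, hE⟩ := ρ.exists_lintegral_mul_pw_le (a := 2) (by norm_num) (by norm_num)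
  obtain ⟨E', hE'⟩ := ρ.exists_lintegral_mul_pw_le (a := 5 / 2) (by norm_num) (by norm_num)
  obtain ⟨r, hr, hsupp⟩ := ρ.exists_support
  have mρ : Measurable ρ.toFun := ρ.continuous.measurable
  set I := ∫⁻ u, ‖ρ.toFun u‖ₑ with hI
  have hIt : I ≠ ⊤ := ρ.lintegral_lt_top.ne
  set R := ENNReal.ofReal r ^ (1 / 2 : ℝ) with hR
  have hRt : R ≠ ⊤ := ENNReal.rpow_ne_top_of_nonneg (by norm_num) ENNReal.ofReal_ne_top
  set D' := (C : ℝ≥0∞) * R * (E' + I) with hD'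
  have hDt' : D' ≠ ⊤ := ENNReal.mul_ne_top (ENNReal.mul_ne_top ENNReal.coe_ne_top hRt)
    (ENNReal.add_ne_top.mpr ⟨ENNReal.coe_ne_top, hIt⟩)
  refine ⟨C * E + D'.toNNReal + 1, fun k hk => ?_⟩
  have hlin : ∀ z, ∫⁻ u, ‖ρ.toFun u * k (z - u)‖ₑ ≤
      C * ∫⁻ u, ‖ρ.toFun u‖ₑ * pw 2 (z - u) := by
    intro z
    rw [← lintegral_const_mul' _ _ ENNReal.coe_ne_top]
    refine lintegral_mono fun u => ?_
    rw [enorm_mul]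
    calc _ ≤ ‖ρ.toFun u‖ₑ * (C * pw 2 (z - u)) := by gcongr; exact hk.bound _
      _ = _ := by ring
  have hCE : (C * E : ℝ≥0∞) ≤ ((C * E + D'.toNNReal + 1 : ℝ≥0) : ℝ≥0∞) := by
    push_cast
    exact le_add_right (le_add_right le_rfl)
  have hb1 : ∀ z, ‖ρ.moll k z‖ₑ ≤ (C * E : ℝ≥0∞) := fun z =>
    (enorm_integral_le_lintegral_enorm _).trans ((hlin z).trans (by gcongr; exact (hE z).1))
  have hb2 : ∀ z, ‖ρ.moll k z‖ₑ ≤ (C * E : ℝ≥0∞) * pw 2 z := fun z =>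
    (enorm_integral_le_lintegral_enorm _).trans ((hlin z).trans
      (by rw [mul_assoc]; gcongr; exact (hE z).2))
  have hb2' : ∀ z, ‖ρ.moll k z‖ₑ ≤ ((C * E + D'.toNNReal + 1 : ℝ≥0) : ℝ≥0∞) * pw 2 z := fun z =>
    (hb2 z).trans (mul_le_mul_left hCE _)
  refine ⟨fun z => le_mul_qw_pow ((hb1 z).trans hCE) (by exact_mod_cast hb2' z), hb2', fun z => ?_⟩
  have mk := hk.measurable
  have hint : Integrable fun u => ρ.toFun u * k (z - u) := by
    refine ⟨Measurable.aestronglyMeasurable (by fun_prop), lt_of_le_of_lt (hlin z) ?_⟩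
    exact ENNReal.mul_lt_top ENNReal.coe_lt_top (lt_of_le_of_lt (hE z).1 ENNReal.coe_lt_top)
  have hρ : Integrable ρ.toFun := ρ.continuous.integrable_of_hasCompactSupport ρ.compact
  have e : ρ.moll k z - k z = ∫ u, ρ.toFun u * (k (z - u) - k z) := by
    simp only [mul_sub]
    rw [integral_sub hint (hρ.mul_const _), integral_mul_const, ρ.integral_eq_one, one_mul]
    rfl
  rw [e]
  calc ‖∫ u, ρ.toFun u * (k (z - u) - k z)‖ₑ ≤ ∫⁻ u, ‖ρ.toFun u * (k (z - u) - k z)‖ₑ :=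
        enorm_integral_le_lintegral_enorm _
    _ ≤ ∫⁻ u, (C * R) * (‖ρ.toFun u‖ₑ * pw (5 / 2) (z - u) + ‖ρ.toFun u‖ₑ * pw (5 / 2) z) := by
        refine lintegral_mono fun u => ?_
        by_cases hu : ρ.toFun u = 0
        · simp [hu]
        · have hle := hk.holder (z - u) z
          rw [enorm_mul]
          have hn : paraNorm (z - u - z) ≤ r := by
            rw [show z - u - z = -u by abel, paraNorm_neg]; exact hsupp u hu
          calc _ ≤ ‖ρ.toFun u‖ₑ * (C * (R * (pw (5 / 2) (z - u) + pw (5 / 2) z))) := by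
                gcongr
                refine hle.trans ?_
                rw [show (2 : ℝ) + 1 / 2 = 5 / 2 by norm_num]
                gcongr
                exact ENNReal.rpow_le_rpow (ENNReal.ofReal_le_ofReal hn) (by norm_num)
            _ = _ := by ring
    _ = (C * R) * ((∫⁻ u, ‖ρ.toFun u‖ₑ * pw (5 / 2) (z - u)) + I * pw (5 / 2) z) := by
        have mp := measurable_pw (5 / 2)
        rw [lintegral_const_mul' _ _ (ENNReal.mul_ne_top ENNReal.coe_ne_top hRt),
          lintegral_add_left (by fun_prop), lintegral_mul_const _ (by fun_prop)]
    _ ≤ (C * R) * (E' * pw (5 / 2) z + I * pw (5 / 2) z) := by gcongr; exact (hE' z).2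
    _ = D' * pw (5 / 2) z := by rw [hD']; ring
    _ ≤ _ := by
        gcongr
        push_cast
        rw [ENNReal.coe_toNNReal hDt']
        exact le_add_right (le_add_left le_rfl)

theorem tendsto_moll {ι : Type*} {l : Filter ι} [l.IsCountablyGenerated] {C : ℝ≥0}
    {k : ι → SpaceTime → ℝ} {g : SpaceTime → ℝ} (hk : ∀ᶠ n in l, IsKer C 2 (k n))
    (hlim : ∀ z, Tendsto (fun n => k n z) l (𝓝 (g z))) (z : SpaceTime) :
    Tendsto (fun n => ρ.moll (k n) z) l (𝓝 (ρ.moll g z)) := by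
  obtain ⟨E, hE⟩ := ρ.exists_lintegral_mul_pw_le (a := 2) (by norm_num) (by norm_num)
  have mp := measurable_pw 2
  have mρ : Measurable ρ.toFun := ρ.continuous.measurable
  refine tendsto_integral_of_enorm_le (g := fun u => C * (‖ρ.toFun u‖ₑ * pw 2 (z - u)))
    (by fun_prop) ?_ ?_ ?_ ?_
  · rw [lintegral_const_mul' _ _ ENNReal.coe_ne_top]
    exact ENNReal.mul_ne_top ENNReal.coe_ne_top (ne_top_of_le_ne_top ENNReal.coe_ne_top (hE z).1)
  · filter_upwards [hk] with n hn
    have := hn.measurable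
    refine Measurable.aestronglyMeasurable ?_
    show Measurable fun u => ρ.toFun u * k n (z - u)
    fun_prop
  · filter_upwards [hk] with n hn
    refine Eventually.of_forall fun u => ?_
    show ‖ρ.toFun u * k n (z - u)‖ₑ ≤ _
    rw [enorm_mul]
    calc _ ≤ ‖ρ.toFun u‖ₑ * (C * pw 2 (z - u)) := by gcongr; exact hn.bound _
      _ = _ := by ring
  · exact Eventually.of_forall fun u => (hlim _).const_mul _

/-- The covariance kernel of the mollified field. -/
def cov (k : SpaceTime → ℝ) : SpaceTime → ℝ := corr (ρ.moll k) (ρ.moll k)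

theorem measurable_cov {k : SpaceTime → ℝ} (hk : Measurable k) : Measurable (ρ.cov k) :=
  measurable_corr (ρ.measurable_moll hk) (ρ.measurable_moll hk)

theorem cov_neg (k : SpaceTime → ℝ) (z : SpaceTime) : ρ.cov k (-z) = ρ.cov k z := corr_neg _ z

theorem cov_reflect {k : SpaceTime → ℝ} (hk : ∀ z, k (reflect z) = -k z) (z : SpaceTime) :
    ρ.cov k (reflect z) = ρ.cov k z := corr_reflect (ρ.moll_reflect hk) z

/-- The order 1 is 2 + 2 - 3, and the error order 3/2 is 5/2 + 2 - 3. Boundedness of the covariance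
at the origin does not follow from such a count; it comes from square integrability of the mollified
kernel, via the inequality |xy| ≤ x² + y². -/
theorem exists_cov_bounds (C : ℝ≥0) : ∃ D : ℝ≥0, ∀ k, IsKer C 2 k →
    (∀ z, ‖ρ.cov k z‖ₑ ≤ D * qw z) ∧ (∀ z, ‖corr k k z‖ₑ ≤ D * pw 1 z) ∧
    ∀ z, ‖ρ.cov k z - corr k k z‖ₑ ≤ D * pw (3 / 2) z := by
  obtain ⟨D, hD⟩ := ρ.exists_moll_bounds C
  obtain ⟨E1, hE1⟩ := exists_corr_le (a := 2) (b := 2) (by norm_num) (by norm_num) (by norm_num)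
    (by norm_num) (by norm_num)
  obtain ⟨E2, hE2⟩ := exists_corr_sub_le (c := 5 / 2) (by norm_num) (by norm_num)
  set J := ∫⁻ z, pw 0 z * qw z ^ 4 with hJ
  have hJt : J < ⊤ := lintegral_pw_mul_qw_pow_lt_top le_rfl (by norm_num) (by norm_num)
  set F : ℝ≥0 := D ^ 2 * (2 * J.toNNReal) with hF
  refine ⟨(D * D * E1 + F + C * C * E1 + (D + C) * D * E2) + 1, fun k hk => ?_⟩
  obtain ⟨h1, h2, h3⟩ := hD k hk
  have mA := ρ.measurable_moll hk.measurable
  refine ⟨fun z => ?_, fun z => ?_, bound_of_bound_ne_zero (by norm_num) fun z hz => ?_⟩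
  · rw [← pow_one (qw z)]
    refine le_mul_qw_pow ?_ ?_
    · have : ‖ρ.cov k z‖ₑ ≤ F := by
        calc ‖ρ.cov k z‖ₑ ≤ ∫⁻ w, ‖ρ.moll k (z + w) * ρ.moll k w‖ₑ :=
              enorm_integral_le_lintegral_enorm _
          _ ≤ ∫⁻ w, (‖ρ.moll k (z + w)‖ₑ ^ 2 + ‖ρ.moll k w‖ₑ ^ 2) := by
              refine lintegral_mono fun w => ?_
              rw [enorm_mul]
              rcases le_total ‖ρ.moll k (z + w)‖ₑ ‖ρ.moll k w‖ₑ with h | h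
              · refine le_add_left ?_
                rw [sq]; gcongr
              · refine le_add_right ?_
                rw [sq]; gcongr
          _ = (∫⁻ w, ‖ρ.moll k w‖ₑ ^ 2) + ∫⁻ w, ‖ρ.moll k w‖ₑ ^ 2 := by
              rw [lintegral_add_left (by fun_prop),
                lintegral_add_left_eq_self (fun w => ‖ρ.moll k w‖ₑ ^ 2)]
          _ ≤ (D ^ 2 * J) + D ^ 2 * J := by
              have : ∫⁻ w, ‖ρ.moll k w‖ₑ ^ 2 ≤ D ^ 2 * J := by
                rw [hJ, ← lintegral_const_mul' _ _ (by finiteness)]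
                refine lintegral_mono fun w => ?_
                calc ‖ρ.moll k w‖ₑ ^ 2 ≤ (D * qw w ^ 2) ^ 2 := by gcongr; exact h1 w
                  _ = _ := by rw [pw_zero_exp]; ring
              gcongr
          _ = F := by
              rw [hF]; push_cast; rw [ENNReal.coe_toNNReal hJt.ne]; ring
      refine this.trans (ENNReal.coe_le_coe.mpr ?_)
      exact le_add_right (le_add_right (le_add_right le_add_self))
    · have := hE1 D D _ _ h2 h2 z
      norm_num at this ⊢
      refine this.trans ?_
      gcongr
      exact le_add_right (le_add_right (le_add_right le_self_add))
  · have := hE1 C C _ _ hk.bound hk.bound z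
    rw [show (2 : ℝ) + 2 - 3 = 1 by norm_num] at this
    refine this.trans (mul_le_mul_left (ENNReal.coe_le_coe.mpr ?_) _)
    exact le_add_right (le_add_right le_add_self)
  · have hA : ∀ z, ‖ρ.moll k z‖ₑ ≤ ((D + C : ℝ≥0) : ℝ≥0∞) * pw 2 z := fun z =>
      (h2 z).trans (mul_le_mul_left (ENNReal.coe_le_coe.mpr le_self_add) _)
    have hk' : ∀ z, ‖k z‖ₑ ≤ ((D + C : ℝ≥0) : ℝ≥0∞) * pw 2 z := fun z =>
      (hk.bound z).trans (mul_le_mul_left (ENNReal.coe_le_coe.mpr le_add_self) _)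
    have := hE2 (D + C) D _ _ mA hk.measurable hA hk' h3 z hz
    rw [show (5 / 2 : ℝ) - 1 = 3 / 2 by norm_num] at this
    refine this.trans (mul_le_mul_left (ENNReal.coe_le_coe.mpr ?_) _)
    exact le_add_self

theorem tendsto_cov {ι : Type*} {l : Filter ι} [l.IsCountablyGenerated] {C : ℝ≥0}
    {k : ι → SpaceTime → ℝ} {g : SpaceTime → ℝ} (hk : ∀ᶠ n in l, IsKer C 2 (k n))
    (hlim : ∀ z, Tendsto (fun n => k n z) l (𝓝 (g z))) {z : SpaceTime} (hz : z ≠ 0) :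
    Tendsto (fun n => ρ.cov (k n) z) l (𝓝 (ρ.cov g z)) := by
  obtain ⟨D, hD⟩ := ρ.exists_moll_bounds C
  refine tendsto_corr (C := D) ?_ ?_ (ρ.tendsto_moll hk hlim) hz
  · filter_upwards [hk] with n hn using ρ.measurable_moll hn.measurable
  · filter_upwards [hk] with n hn using (hD _ hn).2.1

end Mollifier

/-! ### Convolution of an odd kernel with an even function -/

/-- The convolution `∫ k(-w - z) Q(z) dz`, antisymmetrised in space so that it converges absolutely
for a kernel of order `2` and a function of order `1`. -/
def symConv (k Q : SpaceTime → ℝ) (w : SpaceTime) : ℝ :=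
  (1 / 2) * ∫ z, (k (-w - z) - k (-reflect w - z)) * Q z

/-- The weight that dominates the integrand of `symConv`. -/
def symWeight (a b : ℝ) (w z : SpaceTime) : ℝ≥0∞ :=
  ENNReal.ofReal (paraNorm (reflect w - w)) ^ (1 / 2 : ℝ) *
    (pw (a + 1 / 2) (-w - z) + pw (a + 1 / 2) (-reflect w - z)) * pw b z

theorem measurable_symWeight (a b : ℝ) (w : SpaceTime) : Measurable (symWeight a b w) := by
  have := measurable_pw (a + 1 / 2)
  have := measurable_pw b
  unfold symWeight
  fun_prop

theorem measurable_symConv {k Q : SpaceTime → ℝ} (hk : Measurable k) (hQ : Measurable Q) :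
    Measurable (symConv k Q) := by
  have hr := measurable_reflect
  have : StronglyMeasurable (fun p : SpaceTime × SpaceTime =>
      (k (-p.1 - p.2) - k (-reflect p.1 - p.2)) * Q p.2) :=
    Measurable.stronglyMeasurable (by fun_prop)
  exact this.integral_prod_right.measurable.const_mul _

/-- The two arguments -w - z and -`reflect w` - z differ by a vector of size at most 2|w|, so the
Hölder bound replaces order a by a + 1/2 at the price of |w|^{1/2}. Convergence at infinity then
needs a + b > 5/2 only, which admits the borderline pair a = 2, b = 1. -/
theorem exists_lintegral_symWeight_le {a b : ℝ} (ha : 0 ≤ a) (ha3 : a < 5 / 2) (hb : 0 < b)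
    (hb3 : b < 3) (hab : 5 / 2 < a + b) : ∃ E : ℝ≥0, ∀ w, w ≠ 0 →
      ∫⁻ z, symWeight a b w z ≤ E * pw (a + b - 3) w := by
  obtain ⟨E, hE⟩ := exists_lintegral_pw_mul_pw_le (a := b) (b := a + 1 / 2) hb hb3 (by linarith)
    (by linarith) (by linarith)
  have m1 := measurable_pw (a + 1 / 2)
  have m2 := measurable_pw b
  refine ⟨4 * E, fun w hw => ?_⟩
  set T := ENNReal.ofReal (paraNorm (reflect w - w)) ^ (1 / 2 : ℝ) with hT
  have hTt : T ≠ ⊤ := ENNReal.rpow_ne_top_of_nonneg (by norm_num) ENNReal.ofReal_ne_top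
  have hT2 : T ≤ 2 * ENNReal.ofReal (paraNorm w) ^ (1 / 2 : ℝ) := by
    have h1 : paraNorm (reflect w - w) ≤ 2 * paraNorm w := by
      have := paraNorm_add_le (reflect w) (-w)
      rw [paraNorm_neg, paraNorm_reflect, ← sub_eq_add_neg] at this
      linarith
    calc T ≤ ENNReal.ofReal (2 * paraNorm w) ^ (1 / 2 : ℝ) :=
          ENNReal.rpow_le_rpow (ENNReal.ofReal_le_ofReal h1) (by norm_num)
      _ = ENNReal.ofReal 2 ^ (1 / 2 : ℝ) * ENNReal.ofReal (paraNorm w) ^ (1 / 2 : ℝ) := by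
          rw [ENNReal.ofReal_mul (by norm_num), ENNReal.mul_rpow_of_nonneg _ _ (by norm_num)]
      _ ≤ _ := by
          gcongr
          calc ENNReal.ofReal 2 ^ (1 / 2 : ℝ) ≤ ENNReal.ofReal 2 ^ (1 : ℝ) :=
                ENNReal.rpow_le_rpow_of_exponent_le (by simp) (by norm_num)
            _ = 2 := by simp
  have e1 : ∫⁻ z, symWeight a b w z = T * ((∫⁻ z, pw b z * pw (a + 1 / 2) (-w - z)) +
      ∫⁻ z, pw b z * pw (a + 1 / 2) (-reflect w - z)) := by
    rw [← lintegral_add_left (by fun_prop), ← lintegral_const_mul' _ _ hTt]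
    congr 1; ext z
    rw [symWeight, ← hT]; ring
  rw [e1]
  calc _ ≤ (2 * ENNReal.ofReal (paraNorm w) ^ (1 / 2 : ℝ)) *
        (E * pw (b + (a + 1 / 2) - 3) (-w) + E * pw (b + (a + 1 / 2) - 3) (-reflect w)) :=
        mul_le_mul' hT2 (add_le_add (hE _) (hE _))
    _ = ((4 * E : ℝ≥0) : ℝ≥0∞) * (ENNReal.ofReal (paraNorm w) ^ (1 / 2 : ℝ) *
        pw (b + (a + 1 / 2) - 3) w) := by
        rw [pw_neg, pw_neg, pw_reflect]; push_cast; ring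
    _ = _ := by
        congr 1
        rw [pw, pw, ← ENNReal.rpow_add _ _ (ofReal_paraNorm_ne_zero hw) ENNReal.ofReal_ne_top]
        congr 1; ring

theorem enorm_symConv_integrand_le {a b : ℝ} {C D : ℝ≥0} {k Q : SpaceTime → ℝ} (hk : IsKer C a k)
    (hQ : ∀ z, ‖Q z‖ₑ ≤ D * pw b z) (w z : SpaceTime) :
    ‖(k (-w - z) - k (-reflect w - z)) * Q z‖ₑ ≤ (C * D : ℝ≥0∞) * symWeight a b w z := by
  rw [enorm_mul]
  have h := hk.holder (-w - z) (-reflect w - z)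
  rw [show -w - z - (-reflect w - z) = reflect w - w by abel] at h
  calc _ ≤ _ := mul_le_mul' h (hQ z)
    _ = _ := by rw [symWeight]; ring

theorem reflect_zero : reflect 0 = 0 := by ext <;> simp [reflect]

theorem symConv_zero (k Q : SpaceTime → ℝ) : symConv k Q 0 = 0 := by
  simp [symConv, reflect_zero]

theorem integrable_symConv {a b : ℝ} (ha : 0 ≤ a) (ha3 : a < 5 / 2) (hb : 0 < b)
    (hb3 : b < 3) (hab : 5 / 2 < a + b) {C D : ℝ≥0} {k Q : SpaceTime → ℝ} (hk : IsKer C a k)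
    (mQ : Measurable Q) (hQ : ∀ z, ‖Q z‖ₑ ≤ D * pw b z) (w : SpaceTime) :
    Integrable fun z => (k (-w - z) - k (-reflect w - z)) * Q z := by
  have mk := hk.measurable
  by_cases hw : w = 0
  · subst hw; simp [reflect_zero]
  obtain ⟨E, hE⟩ := exists_lintegral_symWeight_le ha ha3 hb hb3 hab
  refine integrable_of_enorm_le (Measurable.aestronglyMeasurable (by fun_prop))
    (Eventually.of_forall (enorm_symConv_integrand_le hk hQ w)) ?_
  rw [lintegral_const_mul' _ _ (by finiteness)]
  exact ENNReal.mul_ne_top (by finiteness) (ne_top_of_le_ne_top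
    (ENNReal.mul_ne_top ENNReal.coe_ne_top (pw_ne_top hw _)) (hE w hw))

theorem exists_symConv_le {a b : ℝ} (ha : 0 ≤ a) (ha3 : a < 5 / 2) (hb : 0 < b)
    (hb3 : b < 3) (hab : 5 / 2 < a + b) : ∃ E : ℝ≥0, ∀ (C D : ℝ≥0) (k Q : SpaceTime → ℝ),
      IsKer C a k → (∀ z, ‖Q z‖ₑ ≤ D * pw b z) →
      ∀ w, ‖symConv k Q w‖ₑ ≤ ((C * D * E : ℝ≥0) : ℝ≥0∞) * pw (a + b - 3) w := by
  obtain ⟨E, hE⟩ := exists_lintegral_symWeight_le ha ha3 hb hb3 hab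
  refine ⟨E, fun C D k Q hk hQ w => ?_⟩
  by_cases hw : w = 0
  · subst hw; simp [symConv_zero]
  calc ‖symConv k Q w‖ₑ ≤ ‖∫ z, (k (-w - z) - k (-reflect w - z)) * Q z‖ₑ := by
        rw [symConv, enorm_mul]
        refine mul_le_of_le_one_left' ?_
        rw [Real.enorm_of_nonneg (by norm_num)]
        exact ENNReal.ofReal_le_one.mpr (by norm_num)
    _ ≤ ∫⁻ z, (C * D : ℝ≥0∞) * symWeight a b w z :=
        (enorm_integral_le_lintegral_enorm _).trans
          (lintegral_mono (enorm_symConv_integrand_le hk hQ w))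
    _ ≤ (C * D : ℝ≥0∞) * (E * pw (a + b - 3) w) := by
        rw [lintegral_const_mul' _ _ (by finiteness)]
        gcongr
        exact hE w hw
    _ = _ := by push_cast; ring

theorem tendsto_symConv {ι : Type*} {l : Filter ι} [l.IsCountablyGenerated] {C D : ℝ≥0}
    {k Q : ι → SpaceTime → ℝ} {k' Q' : SpaceTime → ℝ} (hk : ∀ᶠ n in l, IsKer C 2 (k n))
    (mQ : ∀ᶠ n in l, Measurable (Q n)) (hQ : ∀ᶠ n in l, ∀ z, ‖Q n z‖ₑ ≤ D * pw 1 z)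
    (hlim : ∀ z, Tendsto (fun n => k n z) l (𝓝 (k' z)))
    (hlimQ : ∀ z, z ≠ 0 → Tendsto (fun n => Q n z) l (𝓝 (Q' z))) (w : SpaceTime) :
    Tendsto (fun n => symConv (k n) (Q n) w) l (𝓝 (symConv k' Q' w)) := by
  by_cases hw : w = 0
  · subst hw; simpa [symConv_zero] using tendsto_const_nhds
  obtain ⟨E, hE⟩ := exists_lintegral_symWeight_le (a := 2) (b := 1) (by norm_num) (by norm_num)
    (by norm_num) (by norm_num) (by norm_num)
  refine Tendsto.const_mul _ ?_
  refine tendsto_integral_of_enorm_le (g := fun z => (C * D : ℝ≥0∞) * symWeight 2 1 w z)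
    ((measurable_symWeight _ _ _).const_mul _) ?_ ?_ ?_ ?_
  · rw [lintegral_const_mul' _ _ (by finiteness)]
    exact ENNReal.mul_ne_top (by finiteness) (ne_top_of_le_ne_top
      (ENNReal.mul_ne_top ENNReal.coe_ne_top (pw_ne_top hw _)) (hE w hw))
  · filter_upwards [hk, mQ] with n h1 h2
    have := h1.measurable
    exact Measurable.aestronglyMeasurable (by fun_prop)
  · filter_upwards [hk, hQ] with n h1 h2
    exact Eventually.of_forall (enorm_symConv_integrand_le h1 h2 w)
  · filter_upwards [ae_ne_zero] with z hz
    exact ((hlim _).sub (hlim _)).mul (hlimQ z hz)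

theorem symConv_scale {k Q : SpaceTime → ℝ} {l : ℝ} (hl : 0 < l) (w : SpaceTime) :
    symConv (scaleKer l k) (fun z => l * Q (dil l z)) w = symConv k Q (dil l w) := by
  have h := integral_comp_dil hl
    (fun z => (k (-dil l w - z) - k (-reflect (dil l w) - z)) * Q z)
  unfold symConv
  congr 1
  calc _ = ∫ z, l ^ 3 * ((k (-dil l w - dil l z) - k (-reflect (dil l w) - dil l z)) * Q (dil l z)) := by
        congr 1; ext z
        simp only [scaleKer, dil_sub, dil_neg, dil_reflect]; ring
    _ = _ := by
        rw [integral_const_mul, h]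
        field_simp

/-- When the plain convolution converges absolutely, reflecting w changes its sign because the
kernel is odd and the function even, so the antisymmetrisation gives back the same value. -/
theorem symConv_eq {k Q : SpaceTime → ℝ} (hk : ∀ z, k (reflect z) = -k z)
    (hQ : ∀ z, Q (reflect z) = Q z) {w : SpaceTime} (hint : Integrable fun z => k (-w - z) * Q z) :
    symConv k Q w = ∫ z, k (-w - z) * Q z := by
  have e : ∀ z, k (-reflect w - reflect z) * Q (reflect z) = -(k (-w - z) * Q z) := by
    intro z
    rw [← reflect_neg, ← reflect_sub, hk, hQ]; ring
  have hint2 : Integrable fun z => k (-reflect w - z) * Q z := by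
    rw [← measurePreserving_reflect.integrable_comp_emb reflectEquiv.measurableEmbedding]
    exact hint.neg.congr (Eventually.of_forall fun z => (e z).symm)
  have h2 : ∫ z, k (-reflect w - z) * Q z = -∫ z, k (-w - z) * Q z := by
    rw [← integral_comp_reflect, ← integral_neg]
    congr 1; ext z; exact e z
  unfold symConv
  simp only [sub_mul]
  rw [integral_sub hint hint2, h2]
  ring

/-! ### Integrability of the kernels -/

theorem CutoffKernel.integrable_deriv (K : CutoffKernel) : Integrable K.deriv := by
  obtain ⟨C, hC⟩ := K.exists_isKer_deriv
  have hm : MeasurableSet {z : SpaceTime | paraNorm z ≤ 1} :=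
    measurableSet_le measurable_paraNorm measurable_const
  refine integrable_of_enorm_le (g := fun z => C * {z | paraNorm z ≤ 1}.indicator (pw 2) z)
    K.measurable_deriv.aestronglyMeasurable (Eventually.of_forall fun z => ?_) ?_
  · rcases le_or_gt (paraNorm z) 1 with h | h
    · rw [Set.indicator_of_mem (show z ∈ {z | paraNorm z ≤ 1} from h)]
      exact hC.bound z
    · rw [K.deriv_of_one_lt h]; simp
  · rw [lintegral_const_mul' _ _ ENNReal.coe_ne_top, lintegral_indicator hm]
    exact ENNReal.mul_ne_top ENNReal.coe_ne_top
      (lintegral_ball_pw_lt_top (by norm_num) (by norm_num)).ne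

theorem integrable_scaleKer {k : SpaceTime → ℝ} (hk : Integrable k) {l : ℝ} (hl : 0 < l) :
    Integrable (scaleKer l k) := by
  refine Integrable.const_mul ?_ _
  have h : Integrable k ((volume : Measure SpaceTime).map (dil l)) := by
    rw [map_dil_volume hl]; exact hk.smul_measure ENNReal.ofReal_ne_top
  exact (integrable_map_equiv (dilEquiv l hl.ne') k).mp h

/-! ### Weights for pairs of kernels -/

/-- Integrating the inner vertex leaves a weight of order a + b - 3 on the outer one. The thresholds
are therefore 6 = 2 · 3: total order below 6 near the origin, above 6 at infinity. -/
theorem lintegral_pair_lt_top_of_outer {f g h : SpaceTime → ℝ≥0∞} {a b c : ℝ} {n : ℕ}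
    (ha : 0 < a) (ha3 : a < 3) (hb : 0 < b) (hb3 : b < 3) (hab : 3 < a + b)
    (hf : ∀ z, f z ≤ pw a z) (hg : ∀ z, g z ≤ pw b z) (hc : 0 ≤ c)
    (hh : ∀ z, h z ≤ pw c z * qw z ^ n) (h1 : a + b + c < 6) (h2 : 6 < a + b + c + n) :
    ∫⁻ w, h w * ∫⁻ z, f z * g (w - z) < ⊤ := by
  obtain ⟨E, hE⟩ := exists_lintegral_pw_mul_pw_le ha ha3 hb hb3 hab
  calc ∫⁻ w, h w * ∫⁻ z, f z * g (w - z)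
      ≤ ∫⁻ w, E * (pw (a + b + c - 3) w * qw w ^ n) := by
        refine lintegral_mono fun w => ?_
        calc h w * ∫⁻ z, f z * g (w - z) ≤ (pw c w * qw w ^ n) * (E * pw (a + b - 3) w) := by
              gcongr
              · exact hh w
              · exact (lintegral_mono fun z => mul_le_mul' (hf z) (hg _)).trans (hE w)
          _ = E * ((pw c w * pw (a + b - 3) w) * qw w ^ n) := by ring
          _ = _ := by rw [pw_mul_pw hc (by linarith)]; congr 3; ring
    _ < ⊤ := by
        rw [lintegral_const_mul' _ _ ENNReal.coe_ne_top]
        exact ENNReal.mul_lt_top ENNReal.coe_lt_top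
          (lintegral_pw_mul_qw_pow_lt_top (by linarith) (by linarith) (by linarith))

theorem lintegral_prod_sub {f g h : SpaceTime → ℝ≥0∞}
    (mf : Measurable f) (mg : Measurable g) (mh : Measurable h) :
    ∫⁻ p : SpaceTime × SpaceTime, f p.1 * g p.2 * h (p.1 - p.2) =
      ∫⁻ w, h w * ∫⁻ z, f z * g (-(w - z)) := by
  rw [Measure.volume_eq_prod, lintegral_prod _ (by fun_prop)]
  calc ∫⁻ x, ∫⁻ y, f x * g y * h (x - y) = ∫⁻ x, ∫⁻ w, h w * (f x * g (-(w - x))) := by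
        congr 1; ext x
        rw [← lintegral_sub_left_eq_self _ x]
        congr 1; ext w
        rw [sub_sub_cancel, neg_sub]; ring
    _ = ∫⁻ w, ∫⁻ x, h w * (f x * g (-(w - x))) :=
        lintegral_lintegral_swap (Measurable.aemeasurable (by fun_prop))
    _ = _ := by
        congr 1; ext w
        rw [lintegral_const_mul _ (by fun_prop)]

/-- The weight of a triangle with two singular edges. -/
def triWeight (a b c : ℕ) (p : SpaceTime × SpaceTime) : ℝ≥0∞ :=
  pw 2 p.1 * qw p.1 ^ a * (pw 2 p.2 * qw p.2 ^ b) * qw (p.1 - p.2) ^ c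

theorem measurable_triWeight (a b c : ℕ) : Measurable (triWeight a b c) := by
  have := measurable_pw 2
  have := measurable_qw
  unfold triWeight; fun_prop

theorem pw_two_mul_qw_pow_le {n : ℕ} (z : SpaceTime) : pw 2 z * qw z ^ n ≤ pw 2 z :=
  mul_le_of_le_one_right' (pow_le_one' (qw_le_one z) n)

/-- Half a power of decay is borrowed from the covariance factor; it makes the otherwise borderline
count 2 + 2 + 2 = 6 strict. -/
theorem pw_two_mul_qw_pow_le' {n : ℕ} (hn : 1 ≤ n) (z : SpaceTime) :
    pw 2 z * qw z ^ n ≤ pw (5 / 2) z := by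
  rw [show (5 / 2 : ℝ) = 2 + 1 / 2 by norm_num, ← pw_mul_pw (by norm_num) (by norm_num)]
  gcongr
  refine qw_pow_le_pw (by norm_num) ?_ z
  have : (1 : ℝ) ≤ n := by exact_mod_cast hn
  linarith

/-- The only issue is decay at infinity, globally and along each single edge. Up to symmetry: with c
≥ 3 the total is at least 7; with c = 2 one more factor suffices; with a, b ≥ 2 the edge c can be
dropped and the two vertices decouple; with all three factors present the loss is distributed among
the edges. -/
theorem lintegral_triWeight_lt_top {a b c : ℕ} (h : 3 ≤ c ∨ (1 ≤ a ∧ 2 ≤ c) ∨ (1 ≤ b ∧ 2 ≤ c) ∨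
    (2 ≤ a ∧ 2 ≤ b) ∨ (1 ≤ a ∧ 1 ≤ b ∧ 1 ≤ c)) : ∫⁻ p, triWeight a b c p < ⊤ := by
  have mp := measurable_pw 2
  have mq := measurable_qw
  have m1 : ∀ n : ℕ, Measurable fun z => pw 2 z * qw z ^ n := fun n => by fun_prop
  have m2 : ∀ n : ℕ, Measurable fun z => qw z ^ n := fun n => by fun_prop
  have hq : ∀ z, qw z ^ c ≤ pw 0 z * qw z ^ c := fun z => by rw [pw_zero_exp, one_mul]
  have key : ∫⁻ p, triWeight a b c p = ∫⁻ w, qw w ^ c *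
      ∫⁻ z, (pw 2 z * qw z ^ a) * (pw 2 (w - z) * qw (w - z) ^ b) := by
    have := lintegral_prod_sub (m1 a) (m1 b) (m2 c)
    simp only [pw_neg, qw_neg] at this
    exact this
  have hcast : ∀ n : ℕ, n ≤ c → (n : ℝ) ≤ c := fun n hn => by exact_mod_cast hn
  rcases h with h | h | h | h | h
  · rw [key]
    have := hcast 3 h
    refine lintegral_pair_lt_top_of_outer (a := 2) (b := 2) (c := 0) (n := c)
      ?_ ?_ ?_ ?_ ?_ pw_two_mul_qw_pow_le pw_two_mul_qw_pow_le le_rfl hq ?_ ?_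
    all_goals push_cast at *
    all_goals linarith
  · rw [key]
    have := hcast 2 h.2
    refine lintegral_pair_lt_top_of_outer (a := 5 / 2) (b := 2) (c := 0) (n := c)
      ?_ ?_ ?_ ?_ ?_ (pw_two_mul_qw_pow_le' h.1) pw_two_mul_qw_pow_le le_rfl hq ?_ ?_
    all_goals push_cast at *
    all_goals linarith
  · rw [key]
    have := hcast 2 h.2
    refine lintegral_pair_lt_top_of_outer (a := 2) (b := 5 / 2) (c := 0) (n := c)
      ?_ ?_ ?_ ?_ ?_ pw_two_mul_qw_pow_le (pw_two_mul_qw_pow_le' h.1) le_rfl hq ?_ ?_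
    all_goals push_cast at *
    all_goals linarith
  · have hfin : ∀ n : ℕ, 2 ≤ n → ∫⁻ z, pw 2 z * qw z ^ n < ⊤ := fun n hn => by
      have : (2 : ℝ) ≤ n := by exact_mod_cast hn
      exact lintegral_pw_mul_qw_pow_lt_top (by norm_num) (by norm_num) (by linarith)
    calc ∫⁻ p, triWeight a b c p
        ≤ ∫⁻ p : SpaceTime × SpaceTime, (pw 2 p.1 * qw p.1 ^ a) * (pw 2 p.2 * qw p.2 ^ b) :=
          lintegral_mono fun p => mul_le_of_le_one_right' (pow_le_one' (qw_le_one _) c)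
      _ = (∫⁻ z, pw 2 z * qw z ^ a) * ∫⁻ z, pw 2 z * qw z ^ b := by
          rw [Measure.volume_eq_prod]
          exact lintegral_prod_mul (f := fun z => pw 2 z * qw z ^ a)
            (g := fun z => pw 2 z * qw z ^ b) (by fun_prop) (by fun_prop)
      _ < ⊤ := ENNReal.mul_lt_top (hfin a h.1) (hfin b h.2)
  -- Here the vertex p.1 is integrated first, against the covariance edge: orders 5/2 and 1 leave
  -- 1/2, and the other vertex then carries 2 + 1/2 + b > 3 at infinity and 5/2 < 3 at the origin.
  · have hsw : ∫⁻ p, triWeight a b c p = ∫⁻ w, (pw 2 w * qw w ^ b) *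
        ∫⁻ z, (pw 2 z * qw z ^ a) * qw (w - z) ^ c := by
      rw [Measure.volume_eq_prod, lintegral_prod_symm _ (measurable_triWeight a b c).aemeasurable]
      congr 1; ext w
      rw [← lintegral_const_mul _ (by fun_prop)]
      congr 1; ext z
      rw [triWeight, ← qw_neg (w - z), neg_sub]; ring
    rw [hsw]
    have hb1 : (1 : ℝ) ≤ b := by exact_mod_cast h.2.1
    have hc1 : (1 : ℝ) ≤ c := by exact_mod_cast h.2.2
    refine lintegral_pair_lt_top_of_outer (a := 5 / 2) (b := 1) (c := 2) (n := b)
      ?_ ?_ ?_ ?_ ?_ (pw_two_mul_qw_pow_le' h.1) (fun z => qw_pow_le_pw (by norm_num) hc1 z)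
      (by norm_num) (fun z => le_rfl) ?_ ?_
    all_goals linarith

/-! ### Convergence of the rescaled constants -/

/-- Product of the kernels over the edges of the graph of the first family of symbols. -/
def triA (k Q : SpaceTime → ℝ) (a b c : ℕ) (p : SpaceTime × SpaceTime) : ℝ :=
  k p.1 * k p.2 * (Q p.1 ^ a * Q p.2 ^ b * Q (p.1 - p.2) ^ c)

/-- Product of the kernels over the edges of the graph of the second family of symbols. -/
def triB (k Q : SpaceTime → ℝ) (a b c : ℕ) (p : SpaceTime × SpaceTime) : ℝ :=
  k p.1 * k p.2 * (Q p.1 ^ a * Q (p.1 + p.2) ^ b * Q p.2 ^ c)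

theorem measurable_triA {k Q : SpaceTime → ℝ} (hk : Measurable k) (hQ : Measurable Q) (a b c : ℕ) :
    Measurable (triA k Q a b c) := by unfold triA; fun_prop

theorem measurable_triB {k Q : SpaceTime → ℝ} (hk : Measurable k) (hQ : Measurable Q) (a b c : ℕ) :
    Measurable (triB k Q a b c) := by unfold triB; fun_prop

theorem enorm_triA_le {k Q : SpaceTime → ℝ} {C D : ℝ≥0} (hk : ∀ z, ‖k z‖ₑ ≤ C * pw 2 z)
    (hQ : ∀ z, ‖Q z‖ₑ ≤ D * qw z) (a b c : ℕ) (p : SpaceTime × SpaceTime) :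
    ‖triA k Q a b c p‖ₑ ≤ (C * C * D ^ (a + b + c) : ℝ≥0∞) * triWeight a b c p := by
  simp only [triA, enorm_mul, enorm_pow]
  calc _ ≤ (C * pw 2 p.1) * (C * pw 2 p.2) *
        ((D * qw p.1) ^ a * (D * qw p.2) ^ b * (D * qw (p.1 - p.2)) ^ c) := by
        gcongr <;> first | exact hk _ | exact hQ _
    _ = _ := by rw [triWeight]; ring

/-- Changing the sign of p.2 turns the edge p.1 + p.2 into p.1 - p.2, so both families are
controlled by the same weight, with b and c exchanged. -/
theorem enorm_triB_le {k Q : SpaceTime → ℝ} {C D : ℝ≥0} (hk : ∀ z, ‖k z‖ₑ ≤ C * pw 2 z)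
    (hQ : ∀ z, ‖Q z‖ₑ ≤ D * qw z) (a b c : ℕ) (p : SpaceTime × SpaceTime) :
    ‖triB k Q a b c p‖ₑ ≤ (C * C * D ^ (a + b + c) : ℝ≥0∞) * triWeight a c b (p.1, -p.2) := by
  simp only [triB, enorm_mul, enorm_pow]
  calc _ ≤ (C * pw 2 p.1) * (C * pw 2 p.2) *
        ((D * qw p.1) ^ a * (D * qw (p.1 + p.2)) ^ b * (D * qw p.2) ^ c) := by
        gcongr <;> first | exact hk _ | exact hQ _
    _ = _ := by
        rw [triWeight]
        simp only [pw_neg, qw_neg, sub_neg_eq_add]; ring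

theorem lintegral_prod_neg_snd (f : SpaceTime × SpaceTime → ℝ≥0∞) :
    ∫⁻ p : SpaceTime × SpaceTime, f (p.1, -p.2) = ∫⁻ p, f p := by
  have h := (MeasurePreserving.id (volume : Measure SpaceTime)).prod
    (Measure.measurePreserving_neg (volume : Measure SpaceTime))
  exact h.lintegral_comp_emb
    ((MeasurableEquiv.refl SpaceTime).prodCongr (MeasurableEquiv.neg SpaceTime)).measurableEmbedding f

/-! ### Uniform domination and the limits of the two-vertex integrals. -/

section ScalingLimits

variable (ρ : Mollifier) (K : CutoffKernel)

theorem CutoffKernel.exists_isKer_scaleKer : ∃ C : ℝ≥0, IsKer C 2 heatDeriv ∧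
    ∀ l : ℝ, 0 < l → IsKer C 2 (scaleKer l K.deriv) := by
  obtain ⟨C, hC⟩ := K.exists_isKer_heatDeriv
  obtain ⟨D, hD⟩ := K.exists_isKer_deriv
  exact ⟨C + D, hC.mono le_self_add, fun l hl => (hD.mono le_add_self).scaleKer hl⟩

theorem CutoffKernel.exists_eventually_isKer : ∃ C : ℝ≥0, IsKer C 2 heatDeriv ∧
    ∀ᶠ l : ℝ in 𝓝[>] 0, IsKer C 2 (scaleKer l K.deriv) := by
  obtain ⟨C, h1, h2⟩ := K.exists_isKer_scaleKer
  exact ⟨C, h1, by filter_upwards [self_mem_nhdsWithin] with l hl using h2 l hl⟩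

theorem ae_prod_ne_zero : ∀ᵐ p : SpaceTime × SpaceTime,
    p.1 ≠ 0 ∧ p.2 ≠ 0 ∧ p.1 - p.2 ≠ 0 ∧ p.1 + p.2 ≠ 0 := by
  have hq1 : ∀ᵐ p : SpaceTime × SpaceTime, p.1 ≠ 0 := Measure.quasiMeasurePreserving_fst.ae ae_ne_zero
  have hq2 : ∀ᵐ p : SpaceTime × SpaceTime, p.2 ≠ 0 := Measure.quasiMeasurePreserving_snd.ae ae_ne_zero
  have hq3 : ∀ᵐ p : SpaceTime × SpaceTime, p.1 - p.2 ≠ 0 :=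
    (Measure.quasiMeasurePreserving_snd.comp
      (measurePreserving_prod_sub_swap volume volume).quasiMeasurePreserving).ae ae_ne_zero
  have hq4 : ∀ᵐ p : SpaceTime × SpaceTime, p.1 + p.2 ≠ 0 :=
    (Measure.quasiMeasurePreserving_snd.comp
      (measurePreserving_prod_add volume volume).quasiMeasurePreserving).ae ae_ne_zero
  filter_upwards [hq1, hq2, hq3, hq4] with p h1 h2 h3 h4 using ⟨h1, h2, h3, h4⟩

theorem tendsto_integral_triA {a b c : ℕ} (h : 3 ≤ c ∨ (1 ≤ a ∧ 2 ≤ c) ∨ (1 ≤ b ∧ 2 ≤ c) ∨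
    (2 ≤ a ∧ 2 ≤ b) ∨ (1 ≤ a ∧ 1 ≤ b ∧ 1 ≤ c)) :
    Tendsto (fun l => ∫ p, triA (scaleKer l K.deriv) (ρ.cov (scaleKer l K.deriv)) a b c p) (𝓝[>] 0)
      (𝓝 (∫ p, triA heatDeriv (ρ.cov heatDeriv) a b c p)) := by
  obtain ⟨C, -, hC⟩ := K.exists_eventually_isKer
  obtain ⟨D, hD⟩ := ρ.exists_cov_bounds C
  refine tendsto_integral_of_enorm_le
    (g := fun p => (C * C * D ^ (a + b + c) : ℝ≥0∞) * triWeight a b c p)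
    ((measurable_triWeight a b c).const_mul _) ?_ ?_ ?_ ?_
  · rw [lintegral_const_mul' _ _ (by finiteness)]
    exact ENNReal.mul_ne_top (by finiteness) (lintegral_triWeight_lt_top h).ne
  · filter_upwards [hC] with l hl
    exact (measurable_triA hl.measurable (ρ.measurable_cov hl.measurable) a b c).aestronglyMeasurable
  · filter_upwards [hC] with l hl
    exact Eventually.of_forall (enorm_triA_le hl.bound (hD _ hl).1 a b c)
  · filter_upwards [ae_prod_ne_zero] with p hp
    have h1 := K.tendsto_scaleKer
    have h2 : ∀ z : SpaceTime, z ≠ 0 → Tendsto (fun l => ρ.cov (scaleKer l K.deriv) z) (𝓝[>] 0)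
        (𝓝 (ρ.cov heatDeriv z)) := fun z hz => ρ.tendsto_cov hC h1 hz
    exact ((h1 _).mul (h1 _)).mul ((((h2 _ hp.1).pow a).mul ((h2 _ hp.2.1).pow b)).mul
      ((h2 _ hp.2.2.1).pow c))

theorem tendsto_integral_triB {a b c : ℕ} (h : 3 ≤ b ∨ (1 ≤ a ∧ 2 ≤ b) ∨ (1 ≤ c ∧ 2 ≤ b) ∨
    (2 ≤ a ∧ 2 ≤ c) ∨ (1 ≤ a ∧ 1 ≤ c ∧ 1 ≤ b)) :
    Tendsto (fun l => ∫ p, triB (scaleKer l K.deriv) (ρ.cov (scaleKer l K.deriv)) a b c p) (𝓝[>] 0)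
      (𝓝 (∫ p, triB heatDeriv (ρ.cov heatDeriv) a b c p)) := by
  obtain ⟨C, -, hC⟩ := K.exists_eventually_isKer
  obtain ⟨D, hD⟩ := ρ.exists_cov_bounds C
  have mw := measurable_triWeight a c b
  refine tendsto_integral_of_enorm_le
    (g := fun p => (C * C * D ^ (a + b + c) : ℝ≥0∞) * triWeight a c b (p.1, -p.2))
    (by fun_prop) ?_ ?_ ?_ ?_
  · rw [lintegral_const_mul' _ _ (by finiteness), lintegral_prod_neg_snd]
    exact ENNReal.mul_ne_top (by finiteness) (lintegral_triWeight_lt_top h).ne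
  · filter_upwards [hC] with l hl
    exact (measurable_triB hl.measurable (ρ.measurable_cov hl.measurable) a b c).aestronglyMeasurable
  · filter_upwards [hC] with l hl
    exact Eventually.of_forall (enorm_triB_le hl.bound (hD _ hl).1 a b c)
  · filter_upwards [ae_prod_ne_zero] with p hp
    have h1 := K.tendsto_scaleKer
    have h2 : ∀ z : SpaceTime, z ≠ 0 → Tendsto (fun l => ρ.cov (scaleKer l K.deriv) z) (𝓝[>] 0)
        (𝓝 (ρ.cov heatDeriv z)) := fun z hz => ρ.tendsto_cov hC h1 hz
    exact ((h1 _).mul (h1 _)).mul ((((h2 _ hp.1).pow a).mul ((h2 _ hp.2.2.2).pow b)).mul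
      ((h2 _ hp.2.1).pow c))

theorem integral_odd_eq_zero {f : SpaceTime → ℝ} (hf : ∀ z, f (reflect z) = -f z) :
    ∫ z, f z = 0 := by
  have h := integral_comp_reflect f
  simp only [hf, integral_neg] at h
  linarith

/-- Without the edge p.1 + p.2 the integral factorises, and each factor is the integral of a
function odd in x. -/
theorem integral_triB_zero {k Q : SpaceTime → ℝ} (hk : ∀ z, k (reflect z) = -k z)
    (hQ : ∀ z, Q (reflect z) = Q z) (a c : ℕ) : ∫ p, triB k Q a 0 c p = 0 := by
  have : triB k Q a 0 c = fun p => (k p.1 * Q p.1 ^ a) * (k p.2 * Q p.2 ^ c) := by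
    funext p; simp only [triB]; ring
  rw [this, Measure.volume_eq_prod, integral_prod_mul (fun z => k z * Q z ^ a)
    (fun z => k z * Q z ^ c), integral_odd_eq_zero (fun z => by rw [hk, hQ]; ring), zero_mul]

theorem qw_le_pw (z : SpaceTime) : qw z ≤ pw 1 z := min_le_right _ _

/-- For an integrable kernel, integrating out one vertex gives the antisymmetrised convolution. -/
theorem integral_triB_one {C D : ℝ≥0} {k Q : SpaceTime → ℝ} (hk : IsKer C 2 k) (hi : Integrable k)
    (mQ : Measurable Q) (hQ : ∀ z, ‖Q z‖ₑ ≤ D * qw z) (hQr : ∀ z, Q (reflect z) = Q z)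
    (hQn : ∀ z, Q (-z) = Q z) (c : ℕ) :
    ∫ p, triB k Q 0 1 c p = ∫ w, symConv k Q w * (k w * Q w ^ c) := by
  have mk := hk.measurable
  have hQb : ∀ z, ‖Q z‖ ≤ D := by
    intro z
    have h1 : ‖Q z‖ₑ ≤ D := (hQ z).trans (mul_le_of_le_one_right' (qw_le_one z))
    rw [← enorm_norm, Real.enorm_of_nonneg (norm_nonneg _)] at h1
    exact ENNReal.ofReal_le_coe.mp h1
  have hint : Integrable (triB k Q 0 1 c) ((volume : Measure SpaceTime).prod volume) := by
    have h1 : Integrable (fun p : SpaceTime × SpaceTime => k p.1 * k p.2)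
        ((volume : Measure SpaceTime).prod volume) := hi.mul_prod hi
    refine h1.mul_bdd (c := D * D ^ c) (Measurable.aestronglyMeasurable (by fun_prop))
      (Eventually.of_forall fun p => ?_)
    simp only [pow_zero, one_mul, pow_one, norm_mul, norm_pow]
    gcongr <;> exact hQb _
  rw [Measure.volume_eq_prod, integral_prod_symm _ hint]
  congr 1; ext w
  have hi2 : Integrable fun z => k (-w - z) * Q z :=
    (hi.comp_sub_left (-w)).mul_bdd (c := D) mQ.aestronglyMeasurable (Eventually.of_forall hQb)
  rw [symConv_eq hk.odd hQr hi2, ← integral_sub_left_eq_self (fun z => k (-w - z) * Q z) volume (-w),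
    ← integral_mul_const]
  congr 1; ext z
  simp only [triB, sub_sub_cancel, pow_zero, one_mul, pow_one]
  rw [show -w - z = -(z + w) by abel, hQn]; ring

/-- Here k(p.1) Q(p.1 + p.2) has order 3 in p.1 at infinity, so absolute domination fails.
Integrating that vertex out with the antisymmetrised kernel gives a function bounded uniformly in l
(order 2 + 1 - 3 = 0), after which the weight |w|⁻² `qw w ^ c` is integrable. -/
theorem tendsto_integral_triB_one {c : ℕ} (hc : 3 ≤ c) :
    Tendsto (fun l => ∫ p, triB (scaleKer l K.deriv) (ρ.cov (scaleKer l K.deriv)) 0 1 c p) (𝓝[>] 0)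
      (𝓝 (∫ w, symConv heatDeriv (ρ.cov heatDeriv) w * (heatDeriv w * ρ.cov heatDeriv w ^ c))) := by
  obtain ⟨C, -, hC⟩ := K.exists_eventually_isKer
  obtain ⟨D, hD⟩ := ρ.exists_cov_bounds C
  obtain ⟨E, hE⟩ := exists_symConv_le (a := 2) (b := 1) (by norm_num) (by norm_num)
    (by norm_num) (by norm_num) (by norm_num)
  have h1 := K.tendsto_scaleKer
  have hpw : ∀ {k}, IsKer C 2 k → ∀ z, ‖ρ.cov k z‖ₑ ≤ D * pw 1 z := fun hk z =>
    ((hD _ hk).1 z).trans (by gcongr; exact qw_le_pw z)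
  have : Tendsto (fun l => ∫ w, symConv (scaleKer l K.deriv) (ρ.cov (scaleKer l K.deriv)) w *
      (scaleKer l K.deriv w * ρ.cov (scaleKer l K.deriv) w ^ c)) (𝓝[>] 0)
      (𝓝 (∫ w, symConv heatDeriv (ρ.cov heatDeriv) w * (heatDeriv w * ρ.cov heatDeriv w ^ c))) := by
    have mp := measurable_pw 2
    have mq := measurable_qw
    have hc' : (3 : ℝ) ≤ c := by exact_mod_cast hc
    refine tendsto_integral_of_enorm_le
      (g := fun w => ((C * D * E : ℝ≥0) : ℝ≥0∞) * (C * D ^ c) * (pw 2 w * qw w ^ c))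
      (by fun_prop) ?_ ?_ ?_ ?_
    · rw [lintegral_const_mul' _ _ (by finiteness)]
      exact ENNReal.mul_ne_top (by finiteness)
        (lintegral_pw_mul_qw_pow_lt_top (by norm_num) (by norm_num) (by linarith)).ne
    · filter_upwards [hC] with l hl
      have m1 := hl.measurable
      have m2 := ρ.measurable_cov m1
      have m3 := measurable_symConv m1 m2
      exact Measurable.aestronglyMeasurable (by fun_prop)
    · filter_upwards [hC] with l hl
      refine Eventually.of_forall fun w => ?_
      rw [enorm_mul, enorm_mul, enorm_pow]
      have e1 := hE C D _ _ hl (hpw hl) w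
      rw [show (2 : ℝ) + 1 - 3 = 0 by norm_num, pw_zero_exp, mul_one] at e1
      calc _ ≤ ((C * D * E : ℝ≥0) : ℝ≥0∞) * ((C * pw 2 w) * (D * qw w) ^ c) := by
            gcongr
            · exact hl.bound w
            · exact (hD _ hl).1 w
        _ = _ := by ring
    · filter_upwards [ae_ne_zero] with w hw
      refine Tendsto.mul ?_ ((h1 w).mul ((ρ.tendsto_cov hC h1 hw).pow c))
      refine tendsto_symConv (C := C) (D := D) hC ?_ ?_ h1 (fun z hz => ρ.tendsto_cov hC h1 hz) w
      · filter_upwards [hC] with l hl using ρ.measurable_cov hl.measurable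
      · filter_upwards [hC] with l hl using hpw hl
  refine this.congr' ?_
  filter_upwards [hC, self_mem_nhdsWithin] with l hl hl0
  exact (integral_triB_one hl (integrable_scaleKer K.integrable_deriv hl0)
    (ρ.measurable_cov hl.measurable) (hD _ hl).1 (ρ.cov_reflect hl.odd) (ρ.cov_neg _) c).symm

end ScalingLimits

/-! ### The logarithmically divergent constants -/

/-- The integrand of `C₃ + 4 C₂` after integrating out all vertices but one, for a kernel `k` and a
covariance `Q`. -/
def logInt (k Q : SpaceTime → ℝ) (w : SpaceTime) : ℝ :=
  corr k k w * Q w ^ 2 + 4 * (symConv k Q w * (k w * Q w))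

theorem measurable_logInt {k Q : SpaceTime → ℝ} (hk : Measurable k) (hQ : Measurable Q) :
    Measurable (logInt k Q) := by
  have m1 := measurable_corr hk hk
  have m2 := measurable_symConv hk hQ
  unfold logInt; fun_prop

/-- Both summands have order 3, the parabolic dimension: this is the logarithmic criticality of C₃ +
4 C₂. -/
theorem logInt_scale {k Q : SpaceTime → ℝ} {l : ℝ} (hl : 0 < l) (w : SpaceTime) :
    logInt (scaleKer l k) (fun z => l * Q (dil l z)) w = l ^ 3 * logInt k Q (dil l w) := by
  simp only [logInt, corr_scale hl, symConv_scale hl, scaleKer]; ring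

/-- Integrable weight on the slab `|t| < 1`, of order `11/4` at the origin. -/
def slabWeight (z : SpaceTime) : ℝ≥0∞ :=
  {z : SpaceTime | paraNorm z ≤ 1}.indicator (pw (11 / 4)) z +
    {z : SpaceTime | 1 < paraNorm z}.indicator (pw 3) z

theorem measurableSet_slab (s : ℝ) : MeasurableSet {z : SpaceTime | |z.1| < s} :=
  measurableSet_lt (by fun_prop) measurable_const

theorem measurableSet_ball : MeasurableSet {z : SpaceTime | paraNorm z ≤ 1} :=
  measurableSet_le measurable_paraNorm measurable_const

theorem measurableSet_compl_ball : MeasurableSet {z : SpaceTime | 1 < paraNorm z} :=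
  measurableSet_lt measurable_const measurable_paraNorm

theorem measurable_slabWeight : Measurable slabWeight :=
  ((measurable_pw _).indicator measurableSet_ball).add
    ((measurable_pw _).indicator measurableSet_compl_ball)

theorem slabWeight_of_le {z : SpaceTime} (h : paraNorm z ≤ 1) : slabWeight z = pw (11 / 4) z := by
  rw [slabWeight, Set.indicator_of_mem (show z ∈ {z | paraNorm z ≤ 1} from h),
    Set.indicator_of_notMem (show z ∉ {z | 1 < paraNorm z} from not_lt.mpr h), add_zero]

theorem slabWeight_of_lt {z : SpaceTime} (h : 1 < paraNorm z) : slabWeight z = pw 3 z := by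
  rw [slabWeight, Set.indicator_of_notMem (show z ∉ {z | paraNorm z ≤ 1} from not_le.mpr h),
    Set.indicator_of_mem (show z ∈ {z | 1 < paraNorm z} from h), zero_add]

/-- In the slab, |z|⁻³ ≲ (1 + |x|)⁻³ away from the unit ball, which is integrable in x alone.
Cutting in time rather than in |z| costs nothing here and later allows integration over the whole
x-axis at fixed t. -/
theorem lintegral_slabWeight_lt_top : ∫⁻ z in {z : SpaceTime | |z.1| < 1}, slabWeight z < ⊤ := by
  have m1 := (measurable_pw (11 / 4)).indicator measurableSet_ball
  unfold slabWeight
  rw [lintegral_add_left m1]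
  refine ENNReal.add_lt_top.mpr ⟨?_, ?_⟩
  · refine lt_of_le_of_lt (setLIntegral_le_lintegral _ _) ?_
    rw [lintegral_indicator measurableSet_ball]
    exact lintegral_ball_pw_lt_top (by norm_num) (by norm_num)
  · have hint : ∫⁻ s : ℝ, ENNReal.ofReal ((1 + ‖s‖) ^ (-3 : ℝ)) < ⊤ := by
      have := (integrable_one_add_norm (E := ℝ) (μ := volume) (r := 3) (by simp)).2
      rw [hasFiniteIntegral_iff_enorm] at this
      refine lt_of_le_of_lt (lintegral_mono fun s => ?_) this
      rw [Real.enorm_of_nonneg (by positivity)]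
    have hslab : {z : SpaceTime | |z.1| < 1} = {t : ℝ | |t| < 1} ×ˢ Set.univ := by
      ext z; simp
    calc ∫⁻ z in {z : SpaceTime | |z.1| < 1}, {z : SpaceTime | 1 < paraNorm z}.indicator (pw 3) z
        ≤ ∫⁻ z in {z : SpaceTime | |z.1| < 1},
            1 * (ENNReal.ofReal 8 * ENNReal.ofReal ((1 + ‖z.2‖) ^ (-3 : ℝ))) := by
          refine lintegral_mono (Set.indicator_le fun z hz => ?_)
          have hz' : 1 < paraNorm z := hz
          have hz0 : z ≠ 0 := by
            rintro rfl; rw [paraNorm_zero] at hz'; norm_num at hz'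
          rw [pw_of_ne hz0, one_mul, ← ENNReal.ofReal_mul (by norm_num)]
          refine ENNReal.ofReal_le_ofReal ?_
          have hp := paraNorm_pos hz0
          have h8 : (8 : ℝ) = (2⁻¹) ^ (-3 : ℝ) := by
            rw [Real.inv_rpow (by norm_num), Real.rpow_neg (by norm_num), inv_inv]; norm_num
          have hx : ‖z.2‖ ≤ paraNorm z := by
            rw [Real.norm_eq_abs]; unfold paraNorm; linarith [Real.sqrt_nonneg |z.1|]
          rw [h8, ← Real.mul_rpow (by norm_num) (by positivity)]
          exact Real.rpow_le_rpow_of_nonpos (by positivity) (by linarith) (by norm_num)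
      _ = (∫⁻ t in {t : ℝ | |t| < 1}, 1) *
          ∫⁻ s : ℝ, ENNReal.ofReal 8 * ENNReal.ofReal ((1 + ‖s‖) ^ (-3 : ℝ)) := by
          rw [hslab, Measure.volume_eq_prod, ← Measure.prod_restrict, Measure.restrict_univ]
          exact lintegral_prod_mul (f := fun _ : ℝ => (1 : ℝ≥0∞))
            (g := fun s : ℝ => ENNReal.ofReal 8 * ENNReal.ofReal ((1 + ‖s‖) ^ (-3 : ℝ)))
            (by fun_prop) (by fun_prop)
      _ < ⊤ := by
          refine ENNReal.mul_lt_top ?_ ?_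
          · have : {t : ℝ | |t| < 1} = Set.Ioo (-1) 1 := by ext t; simp [abs_lt]
            simp [this]
          · rw [lintegral_const_mul' _ _ ENNReal.ofReal_ne_top]
            exact ENNReal.mul_lt_top ENNReal.ofReal_lt_top hint

theorem le_paraNorm_of_le_abs {z : SpaceTime} {s : ℝ} (h : s ^ 2 ≤ |z.1|) :
    s ≤ paraNorm z := by
  have : s ≤ Real.sqrt |z.1| := Real.le_sqrt_of_sq_le h
  unfold paraNorm; linarith [abs_nonneg z.2]

theorem symConv_sub_right {a b b' : ℝ} (ha : 0 ≤ a) (ha3 : a < 5 / 2) (hb : 0 < b)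
    (hb3 : b < 3) (hab : 5 / 2 < a + b) (hb' : 0 < b') (hb3' : b' < 3) (hab' : 5 / 2 < a + b')
    {C D D' : ℝ≥0} {k Q R : SpaceTime → ℝ} (hk : IsKer C a k)
    (mQ : Measurable Q) (hQ : ∀ z, ‖Q z‖ₑ ≤ D * pw b z)
    (mR : Measurable R) (hR : ∀ z, ‖R z‖ₑ ≤ D' * pw b' z) (w : SpaceTime) :
    symConv k Q w - symConv k R w = symConv k (fun z => Q z - R z) w := by
  unfold symConv
  rw [← mul_sub, ← integral_sub (integrable_symConv ha ha3 hb hb3 hab hk mQ hQ w)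
    (integrable_symConv ha ha3 hb' hb3' hab' hk mR hR w)]
  congr 2; ext z; ring

/-- Constants that control a kernel together with its correlation and its covariance. -/
structure LogBounds (ρ : Mollifier) (C D : ℝ≥0) : Prop where
  cov_le : ∀ k, IsKer C 2 k → ∀ z, ‖ρ.cov k z‖ₑ ≤ D * qw z
  corr_le : ∀ k, IsKer C 2 k → ∀ z, ‖corr k k z‖ₑ ≤ D * pw 1 z
  cov_sub_le : ∀ k, IsKer C 2 k → ∀ z, ‖ρ.cov k z - corr k k z‖ₑ ≤ D * pw (3 / 2) z
  symConv_cov_le : ∀ k, IsKer C 2 k → ∀ z, ‖symConv k (ρ.cov k) z‖ₑ ≤ D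
  symConv_corr_le : ∀ k, IsKer C 2 k → ∀ z, ‖symConv k (corr k k) z‖ₑ ≤ D
  symConv_sub_le : ∀ k, IsKer C 2 k → ∀ z,
    ‖symConv k (ρ.cov k) z - symConv k (corr k k) z‖ₑ ≤ D * pw (1 / 2) z

theorem exists_logBounds (ρ : Mollifier) (C : ℝ≥0) : ∃ D : ℝ≥0, LogBounds ρ C D := by
  obtain ⟨D, hD⟩ := ρ.exists_cov_bounds C
  obtain ⟨E, hE⟩ := exists_symConv_le (a := 2) (b := 1) (by norm_num) (by norm_num)
    (by norm_num) (by norm_num) (by norm_num)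
  obtain ⟨F, hF⟩ := exists_symConv_le (a := 2) (b := 3 / 2) (by norm_num) (by norm_num)
    (by norm_num) (by norm_num) (by norm_num)
  have hcov : ∀ k, IsKer C 2 k → ∀ z, ‖ρ.cov k z‖ₑ ≤ D * pw 1 z := fun k hk z =>
    ((hD k hk).1 z).trans (by gcongr; exact qw_le_pw z)
  have l1 : (D : ℝ≥0∞) ≤ ((D + C * D * E + C * D * F : ℝ≥0) : ℝ≥0∞) :=
    ENNReal.coe_le_coe.mpr (le_add_right le_self_add)
  have l2 : ((C * D * E : ℝ≥0) : ℝ≥0∞) ≤ ((D + C * D * E + C * D * F : ℝ≥0) : ℝ≥0∞) :=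
    ENNReal.coe_le_coe.mpr (le_add_right le_add_self)
  have l3 : ((C * D * F : ℝ≥0) : ℝ≥0∞) ≤ ((D + C * D * E + C * D * F : ℝ≥0) : ℝ≥0∞) :=
    ENNReal.coe_le_coe.mpr le_add_self
  refine ⟨D + C * D * E + C * D * F, ⟨fun k hk z => ?_, fun k hk z => ?_, fun k hk z => ?_,
    fun k hk z => ?_, fun k hk z => ?_, fun k hk z => ?_⟩⟩
  · exact ((hD k hk).1 z).trans (mul_le_mul_left l1 _)
  · exact ((hD k hk).2.1 z).trans (mul_le_mul_left l1 _)
  · exact ((hD k hk).2.2 z).trans (mul_le_mul_left l1 _)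
  · have := hE C D _ _ hk (hcov k hk) z
    rw [show (2 : ℝ) + 1 - 3 = 0 by norm_num, pw_zero_exp, mul_one] at this
    exact this.trans l2
  · have := hE C D _ _ hk (hD k hk).2.1 z
    rw [show (2 : ℝ) + 1 - 3 = 0 by norm_num, pw_zero_exp, mul_one] at this
    exact this.trans l2
  · have := hF C D _ _ hk (hD k hk).2.2 z
    rw [show (2 : ℝ) + 3 / 2 - 3 = 1 / 2 by norm_num] at this
    rw [symConv_sub_right (b := 1) (b' := 1) (D := D) (D' := D) (by norm_num) (by norm_num)
      (by norm_num) (by norm_num) (by norm_num) (by norm_num) (by norm_num) (by norm_num) hk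
      (ρ.measurable_cov hk.measurable) (hcov k hk)
      (measurable_corr hk.measurable hk.measurable) (hD k hk).2.1]
    exact this.trans (mul_le_mul_left l3 _)

/-- The mollified covariance is bounded, so the singularity at the origin has order at most 2; at
infinity the order is 3. Both are covered by `slabWeight`. -/
theorem LogBounds.logInt_cov_le {ρ : Mollifier} {C D : ℝ≥0} (H : LogBounds ρ C D)
    {k : SpaceTime → ℝ} (hk : IsKer C 2 k) (w : SpaceTime) :
    ‖logInt k (ρ.cov k) w‖ₑ ≤ (D ^ 3 + 4 * (D * (C * D)) : ℝ≥0∞) * slabWeight w := by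
  have h1 : ‖logInt k (ρ.cov k) w‖ₑ ≤
      (D * pw 1 w) * (D * qw w) ^ 2 + 4 * (D * ((C * pw 2 w) * (D * qw w))) := by
    rw [logInt]
    refine (enorm_add_le _ _).trans ?_
    rw [enorm_mul, enorm_pow, enorm_mul, enorm_mul, enorm_mul,
      show ‖(4 : ℝ)‖ₑ = 4 by rw [Real.enorm_of_nonneg (by norm_num)]; norm_num]
    gcongr
    · exact H.corr_le k hk w
    · exact H.cov_le k hk w
    · exact H.symConv_cov_le k hk w
    · exact hk.bound w
    · exact H.cov_le k hk w
  have h2 : pw 1 w * qw w ^ 2 ≤ slabWeight w := by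
    rcases le_or_gt (paraNorm w) 1 with h | h
    · rw [slabWeight_of_le h]
      exact (mul_le_of_le_one_right' (pow_le_one' (qw_le_one w) 2)).trans
        (pw_le_pw_of_le_one (by norm_num) h)
    · rw [slabWeight_of_lt h, show (3 : ℝ) = 1 + 2 by norm_num,
        ← pw_mul_pw (by norm_num) (by norm_num)]
      gcongr
      exact qw_pow_le_pw (by norm_num) (by norm_num) w
  have h3 : pw 2 w * qw w ≤ slabWeight w := by
    rcases le_or_gt (paraNorm w) 1 with h | h
    · rw [slabWeight_of_le h]
      exact (mul_le_of_le_one_right' (qw_le_one w)).trans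
        (pw_le_pw_of_le_one (by norm_num) h)
    · rw [slabWeight_of_lt h, show (3 : ℝ) = 2 + 1 by norm_num,
        ← pw_mul_pw (by norm_num) (by norm_num)]
      gcongr
      exact qw_le_pw w
  calc _ ≤ _ := h1
    _ = D ^ 3 * (pw 1 w * qw w ^ 2) + 4 * (D * (C * D)) * (pw 2 w * qw w) := by ring
    _ ≤ D ^ 3 * slabWeight w + 4 * (D * (C * D)) * slabWeight w := by gcongr
    _ = _ := by ring

theorem LogBounds.logInt_corr_le {ρ : Mollifier} {C D : ℝ≥0} (H : LogBounds ρ C D)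
    {k : SpaceTime → ℝ} (hk : IsKer C 2 k) (w : SpaceTime) :
    ‖logInt k (corr k k) w‖ₑ ≤ (D ^ 3 + 4 * (D * (C * D)) : ℝ≥0∞) * pw 3 w := by
  have h1 : ‖logInt k (corr k k) w‖ₑ ≤
      (D * pw 1 w) * (D * pw 1 w) ^ 2 + 4 * (D * ((C * pw 2 w) * (D * pw 1 w))) := by
    rw [logInt]
    refine (enorm_add_le _ _).trans ?_
    rw [enorm_mul, enorm_pow, enorm_mul, enorm_mul, enorm_mul,
      show ‖(4 : ℝ)‖ₑ = 4 by rw [Real.enorm_of_nonneg (by norm_num)]; norm_num]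
    gcongr
    · exact H.corr_le k hk w
    · exact H.corr_le k hk w
    · exact H.symConv_corr_le k hk w
    · exact hk.bound w
    · exact H.corr_le k hk w
  have e1 : pw 1 w * pw 1 w ^ 2 = pw 3 w := by
    rw [pw_nat_pow, pw_mul_pw (by norm_num) (by norm_num)]; norm_num
  have e2 : pw 2 w * pw 1 w = pw 3 w := by
    rw [pw_mul_pw (by norm_num) (by norm_num)]; norm_num
  calc _ ≤ _ := h1
    _ = D ^ 3 * (pw 1 w * pw 1 w ^ 2) + 4 * (D * (C * D)) * (pw 2 w * pw 1 w) := by ring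
    _ = _ := by rw [e1, e2]; ring

/-- After telescoping, each term contains one mollification error, of the covariance or of its
symmetrised convolution, and each such error is half a power better than the quantity itself: 3 +
1/2 in total, integrable at infinity. -/
theorem LogBounds.logInt_sub_le {ρ : Mollifier} {C D : ℝ≥0} (H : LogBounds ρ C D)
    {k : SpaceTime → ℝ} (hk : IsKer C 2 k) (w : SpaceTime) :
    ‖logInt k (ρ.cov k) w - logInt k (corr k k) w‖ₑ ≤
      (2 * D ^ 3 + 8 * (D * (C * D)) : ℝ≥0∞) * pw (7 / 2) w := by
  set c := corr k k w with hc
  set v := ρ.cov k w with hv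
  set F := symConv k (ρ.cov k) w with hF
  set G := symConv k (corr k k) w with hG
  have b1 : ‖c‖ₑ ≤ D * pw 1 w := H.corr_le k hk w
  have b2 : ‖v‖ₑ ≤ D * pw 1 w := (H.cov_le k hk w).trans (by gcongr; exact qw_le_pw w)
  have b3 : ‖v - c‖ₑ ≤ D * pw (3 / 2) w := H.cov_sub_le k hk w
  have b4 : ‖G‖ₑ ≤ D := H.symConv_corr_le k hk w
  have b5 : ‖F - G‖ₑ ≤ D * pw (1 / 2) w := H.symConv_sub_le k hk w
  have b6 := hk.bound w
  have b7 : ‖v + c‖ₑ ≤ 2 * (D * pw 1 w) :=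
    (enorm_add_le _ _).trans ((add_le_add b2 b1).trans (le_of_eq (by ring)))
  have e : logInt k (ρ.cov k) w - logInt k (corr k k) w =
      c * ((v - c) * (v + c)) + 4 * ((F - G) * (k w * v) + G * (k w * (v - c))) := by
    simp only [logInt, ← hc, ← hv, ← hF, ← hG]; ring
  rw [e]
  have h1 : ‖c * ((v - c) * (v + c)) + 4 * ((F - G) * (k w * v) + G * (k w * (v - c)))‖ₑ ≤
      (D * pw 1 w) * ((D * pw (3 / 2) w) * (2 * (D * pw 1 w))) +
      4 * ((D * pw (1 / 2) w) * ((C * pw 2 w) * (D * pw 1 w)) +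
        D * ((C * pw 2 w) * (D * pw (3 / 2) w))) := by
    refine (enorm_add_le _ _).trans ?_
    rw [enorm_mul c, enorm_mul (v - c), enorm_mul 4, Real.enorm_of_nonneg (by norm_num : (0 : ℝ) ≤ 4)]
    refine add_le_add (mul_le_mul' b1 (mul_le_mul' b3 b7)) ?_
    norm_num
    gcongr
    refine (enorm_add_le _ _).trans ?_
    rw [enorm_mul, enorm_mul, enorm_mul, enorm_mul]
    gcongr
  have e1 : pw 1 w * (pw (3 / 2) w * pw 1 w) = pw (7 / 2) w := by
    rw [pw_mul_pw (by norm_num) (by norm_num), pw_mul_pw (by norm_num) (by norm_num)]; norm_num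
  have e2 : pw (1 / 2) w * (pw 2 w * pw 1 w) = pw (7 / 2) w := by
    rw [pw_mul_pw (by norm_num) (by norm_num), pw_mul_pw (by norm_num) (by norm_num)]; norm_num
  have e3 : pw 2 w * pw (3 / 2) w = pw (7 / 2) w := by
    rw [pw_mul_pw (by norm_num) (by norm_num)]; norm_num
  calc _ ≤ _ := h1
    _ = 2 * D ^ 3 * (pw 1 w * (pw (3 / 2) w * pw 1 w)) + 4 * (D * (C * D)) *
        (pw (1 / 2) w * (pw 2 w * pw 1 w)) + 4 * (D * (C * D)) * (pw 2 w * pw (3 / 2) w) := by ring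
    _ = _ := by rw [e1, e2, e3]; ring

theorem corr_eq_zero_of_support {k : SpaceTime → ℝ} {R : ℝ} (hk : ∀ z, R < paraNorm z → k z = 0)
    {w : SpaceTime} (hw : 2 * R < paraNorm w) : corr k k w = 0 := by
  unfold corr
  rw [← integral_zero SpaceTime ℝ (μ := volume)]
  congr 1; ext z
  rcases lt_or_ge R (paraNorm z) with h | h
  · rw [hk z h, mul_zero]
  · rw [hk (w + z) ?_, zero_mul]
    have := paraNorm_add_le (w + z) (-z)
    rw [paraNorm_neg, add_neg_cancel_right] at this
    linarith

theorem CutoffKernel.scaleKer_eq_zero (K : CutoffKernel) {l : ℝ} (hl : 0 < l) {z : SpaceTime}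
    (hz : l⁻¹ < paraNorm z) : scaleKer l K.deriv z = 0 := by
  rw [scaleKer, K.deriv_of_one_lt, mul_zero]
  rw [paraNorm_dil hl.le]
  rwa [inv_lt_iff_one_lt_mul₀' hl] at hz

/-- Every summand has a factor `corr k k`, which vanishes for |w| > 2R. On the remaining bounded
region |w|⁻³ ≤ 2R |w|⁻⁴, and the latter is integrable away from the origin. -/
theorem LogBounds.integrableOn_logInt_corr {ρ : Mollifier} {C D : ℝ≥0} (H : LogBounds ρ C D)
    {k : SpaceTime → ℝ} (hk : IsKer C 2 k) {R : ℝ}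
    (hk0 : ∀ z, R < paraNorm z → k z = 0) :
    IntegrableOn (logInt k (corr k k)) {z : SpaceTime | 1 ≤ |z.1|} := by
  have mk := hk.measurable
  have mp := measurable_pw 4
  have hm : MeasurableSet {z : SpaceTime | 1 / 2 ≤ paraNorm z} :=
    measurableSet_le measurable_const measurable_paraNorm
  have hms : MeasurableSet {z : SpaceTime | 1 ≤ |z.1|} := measurableSet_le measurable_const (by fun_prop)
  refine integrable_of_enorm_le (g := fun w => (D ^ 3 + 4 * (D * (C * D)) : ℝ≥0∞) *
    (ENNReal.ofReal (2 * R) * {z : SpaceTime | 1 / 2 ≤ paraNorm z}.indicator (pw 4) w))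
    (measurable_logInt mk (measurable_corr mk mk)).aestronglyMeasurable ?_ ?_
  · filter_upwards [ae_restrict_mem hms] with w hw
    have hw1 : 1 ≤ paraNorm w := le_paraNorm_of_le_abs (by simpa using hw)
    rcases lt_or_ge (2 * R) (paraNorm w) with h | h
    · rw [logInt, corr_eq_zero_of_support hk0 h]; simp
    · refine (H.logInt_corr_le hk w).trans ?_
      rw [Set.indicator_of_mem (show w ∈ {z | 1 / 2 ≤ paraNorm z} from
        show 1 / 2 ≤ paraNorm w by linarith)]
      gcongr
      have hw0 : w ≠ 0 := by
        rintro rfl; rw [paraNorm_zero] at hw1; norm_num at hw1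
      calc pw 3 w = ENNReal.ofReal (paraNorm w) * pw 4 w := by
            conv_rhs => rw [pw, ← ENNReal.rpow_one (ENNReal.ofReal (paraNorm w)),
              ← ENNReal.rpow_mul, ← ENNReal.rpow_add _ _ (ofReal_paraNorm_ne_zero hw0)
              ENNReal.ofReal_ne_top]
            rw [pw]; norm_num
        _ ≤ _ := by gcongr
  · refine ne_top_of_le_ne_top ?_ (setLIntegral_le_lintegral _ _)
    rw [lintegral_const_mul' _ _ (by finiteness), lintegral_const_mul' _ _ (by finiteness),
      lintegral_indicator hm]
    exact ENNReal.mul_ne_top (by finiteness) (ENNReal.mul_ne_top (by finiteness)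
      (lintegral_compl_ball_pw_lt_top (by norm_num)).ne)

theorem lintegral_pw_far_lt_top :
    ∫⁻ z in {z : SpaceTime | 1 ≤ |z.1|}, pw (7 / 2) z < ⊤ := by
  refine lt_of_le_of_lt (lintegral_mono_set fun z hz => ?_)
    (lintegral_compl_ball_pw_lt_top (a := 7 / 2) (by norm_num))
  have : 1 ≤ paraNorm z := le_paraNorm_of_le_abs (by simpa using hz)
  show 1 / 2 ≤ paraNorm z
  linarith

/-- Up to a convergent term, the divergence of `C₃ + 4 C₂` is that of the integral over `|t| ≥ 1` of
the expression without mollifier. -/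
theorem exists_tendsto_logInt_sub (ρ : Mollifier) (K : CutoffKernel) : ∃ c : ℝ, Tendsto
    (fun l => (∫ w, logInt (scaleKer l K.deriv) (ρ.cov (scaleKer l K.deriv)) w) -
      ∫ w in {z : SpaceTime | 1 ≤ |z.1|},
        logInt (scaleKer l K.deriv) (corr (scaleKer l K.deriv) (scaleKer l K.deriv)) w)
    (𝓝[>] 0) (𝓝 c) := by
  obtain ⟨C, hC0, hC⟩ := K.exists_eventually_isKer
  obtain ⟨D, H⟩ := exists_logBounds ρ C
  have hlim := K.tendsto_scaleKer
  have hms : MeasurableSet {z : SpaceTime | 1 ≤ |z.1|} := measurableSet_le measurable_const (by fun_prop)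
  have hcov1 : ∀ k, IsKer C 2 k → ∀ z, ‖ρ.cov k z‖ₑ ≤ D * pw 1 z := fun k hk z =>
    (H.cov_le k hk z).trans (by gcongr; exact qw_le_pw z)
  have hlcov : ∀ z, z ≠ 0 → Tendsto (fun l => ρ.cov (scaleKer l K.deriv) z) (𝓝[>] 0)
      (𝓝 (ρ.cov heatDeriv z)) := fun z hz => ρ.tendsto_cov hC hlim hz
  have hlcorr : ∀ z, z ≠ 0 → Tendsto (fun l => corr (scaleKer l K.deriv) (scaleKer l K.deriv) z)
      (𝓝[>] 0) (𝓝 (corr heatDeriv heatDeriv z)) := fun z hz => by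
    refine tendsto_corr (C := C) ?_ ?_ hlim hz
    · filter_upwards [hC] with l hl using hl.measurable
    · filter_upwards [hC] with l hl using hl.bound
  have hs1 : ∀ w, Tendsto (fun l => symConv (scaleKer l K.deriv) (ρ.cov (scaleKer l K.deriv)) w)
      (𝓝[>] 0) (𝓝 (symConv heatDeriv (ρ.cov heatDeriv) w)) := fun w => by
    refine tendsto_symConv (C := C) (D := D) hC ?_ ?_ hlim hlcov w
    · filter_upwards [hC] with l hl using ρ.measurable_cov hl.measurable
    · filter_upwards [hC] with l hl using hcov1 _ hl
  have hs2 : ∀ w, Tendsto (fun l => symConv (scaleKer l K.deriv)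
      (corr (scaleKer l K.deriv) (scaleKer l K.deriv)) w)
      (𝓝[>] 0) (𝓝 (symConv heatDeriv (corr heatDeriv heatDeriv) w)) := fun w => by
    refine tendsto_symConv (C := C) (D := D) hC ?_ ?_ hlim hlcorr w
    · filter_upwards [hC] with l hl using measurable_corr hl.measurable hl.measurable
    · filter_upwards [hC] with l hl using H.corr_le _ hl
  have hL1 : ∀ w, w ≠ 0 → Tendsto (fun l => logInt (scaleKer l K.deriv)
      (ρ.cov (scaleKer l K.deriv)) w) (𝓝[>] 0) (𝓝 (logInt heatDeriv (ρ.cov heatDeriv) w)) :=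
    fun w hw => ((hlcorr w hw).mul ((hlcov w hw).pow 2)).add
      (((hs1 w).mul ((hlim w).mul (hlcov w hw))).const_mul 4)
  have hL2 : ∀ w, w ≠ 0 → Tendsto (fun l => logInt (scaleKer l K.deriv)
      (corr (scaleKer l K.deriv) (scaleKer l K.deriv)) w) (𝓝[>] 0)
      (𝓝 (logInt heatDeriv (corr heatDeriv heatDeriv) w)) :=
    fun w hw => ((hlcorr w hw).mul ((hlcorr w hw).pow 2)).add
      (((hs2 w).mul ((hlim w).mul (hlcorr w hw))).const_mul 4)
  -- On the slab |t| < 1 there is no divergence, and the full expression converges without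
  -- subtraction.
  have T1 : Tendsto (fun l => ∫ w in {z : SpaceTime | |z.1| < 1},
      logInt (scaleKer l K.deriv) (ρ.cov (scaleKer l K.deriv)) w) (𝓝[>] 0)
      (𝓝 (∫ w in {z : SpaceTime | |z.1| < 1}, logInt heatDeriv (ρ.cov heatDeriv) w)) := by
    refine tendsto_integral_of_enorm_le
      (g := fun w => (D ^ 3 + 4 * (D * (C * D)) : ℝ≥0∞) * slabWeight w)
      (measurable_slabWeight.const_mul _) ?_ ?_ ?_ ?_
    · rw [lintegral_const_mul' _ _ (by finiteness)]
      exact ENNReal.mul_ne_top (by finiteness) lintegral_slabWeight_lt_top.ne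
    · filter_upwards [hC] with l hl
      exact (measurable_logInt hl.measurable
        (ρ.measurable_cov hl.measurable)).aestronglyMeasurable
    · filter_upwards [hC] with l hl
      exact Eventually.of_forall (H.logInt_cov_le hl)
    · filter_upwards [ae_restrict_of_ae ae_ne_zero] with w hw using hL1 w hw
  -- For |t| ≥ 1 only the difference from the unmollified expression is dominated uniformly in l.
  have T2 : Tendsto (fun l => ∫ w in {z : SpaceTime | 1 ≤ |z.1|},
      (logInt (scaleKer l K.deriv) (ρ.cov (scaleKer l K.deriv)) w -
        logInt (scaleKer l K.deriv) (corr (scaleKer l K.deriv) (scaleKer l K.deriv)) w)) (𝓝[>] 0)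
      (𝓝 (∫ w in {z : SpaceTime | 1 ≤ |z.1|}, (logInt heatDeriv (ρ.cov heatDeriv) w -
        logInt heatDeriv (corr heatDeriv heatDeriv) w))) := by
    refine tendsto_integral_of_enorm_le
      (g := fun w => (2 * D ^ 3 + 8 * (D * (C * D)) : ℝ≥0∞) * pw (7 / 2) w)
      ((measurable_pw _).const_mul _) ?_ ?_ ?_ ?_
    · rw [lintegral_const_mul' _ _ (by finiteness)]
      exact ENNReal.mul_ne_top (by finiteness) lintegral_pw_far_lt_top.ne
    · filter_upwards [hC] with l hl
      exact ((measurable_logInt hl.measurable (ρ.measurable_cov hl.measurable)).sub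
        (measurable_logInt hl.measurable
          (measurable_corr hl.measurable hl.measurable))).aestronglyMeasurable
    · filter_upwards [hC] with l hl
      exact Eventually.of_forall (H.logInt_sub_le hl)
    · filter_upwards [ae_restrict_of_ae ae_ne_zero] with w hw using (hL1 w hw).sub (hL2 w hw)
  refine ⟨_, (T1.add T2).congr' ?_⟩
  filter_upwards [hC, self_mem_nhdsWithin] with l hl hl0
  have m1 := measurable_logInt hl.measurable (ρ.measurable_cov hl.measurable)
  have m2 := measurable_logInt hl.measurable (measurable_corr hl.measurable hl.measurable)
  have i1 : IntegrableOn (logInt (scaleKer l K.deriv) (ρ.cov (scaleKer l K.deriv)))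
      {z : SpaceTime | |z.1| < 1} := by
    refine integrable_of_enorm_le m1.aestronglyMeasurable
      (Eventually.of_forall (H.logInt_cov_le hl)) ?_
    rw [lintegral_const_mul' _ _ (by finiteness)]
    exact ENNReal.mul_ne_top (by finiteness) lintegral_slabWeight_lt_top.ne
  have i2 : IntegrableOn (fun w => logInt (scaleKer l K.deriv) (ρ.cov (scaleKer l K.deriv)) w -
      logInt (scaleKer l K.deriv) (corr (scaleKer l K.deriv) (scaleKer l K.deriv)) w)
      {z : SpaceTime | 1 ≤ |z.1|} := by
    refine integrable_of_enorm_le (m1.sub m2).aestronglyMeasurable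
      (Eventually.of_forall (H.logInt_sub_le hl)) ?_
    rw [lintegral_const_mul' _ _ (by finiteness)]
    exact ENNReal.mul_ne_top (by finiteness) lintegral_pw_far_lt_top.ne
  have i3 : IntegrableOn (logInt (scaleKer l K.deriv)
      (corr (scaleKer l K.deriv) (scaleKer l K.deriv))) {z : SpaceTime | 1 ≤ |z.1|} :=
    H.integrableOn_logInt_corr hl fun z hz => K.scaleKer_eq_zero hl0 hz
  have i4 : IntegrableOn (logInt (scaleKer l K.deriv) (ρ.cov (scaleKer l K.deriv)))
      {z : SpaceTime | 1 ≤ |z.1|} := by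
    refine (i2.add i3).congr (Eventually.of_forall fun w => ?_)
    simp
  have hcompl : {z : SpaceTime | 1 ≤ |z.1|} = {z : SpaceTime | |z.1| < 1}ᶜ := by
    ext z; simp
  have i5 : Integrable (logInt (scaleKer l K.deriv) (ρ.cov (scaleKer l K.deriv))) := by
    rw [← integrableOn_univ, ← Set.union_compl_self {z : SpaceTime | |z.1| < 1}, ← hcompl]
    exact i1.union i4
  rw [← integral_add_compl (measurableSet_slab 1) i5, ← hcompl, integral_sub i4 i3]
  ring

/-- The unmollified expression has order 3 and the volume has dimension 3, so rescaling only moves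
the time cutoff from 1 to l². -/
theorem integral_logInt_corr_scale {k : SpaceTime → ℝ} {l : ℝ} (hl : 0 < l) :
    ∫ w in {z : SpaceTime | 1 ≤ |z.1|}, logInt (scaleKer l k) (corr (scaleKer l k) (scaleKer l k)) w =
      ∫ w in {z : SpaceTime | l ^ 2 ≤ |z.1|}, logInt k (corr k k) w := by
  have hms : ∀ s : ℝ, MeasurableSet {z : SpaceTime | s ≤ |z.1|} :=
    fun s => measurableSet_le measurable_const (by fun_prop)
  have h := integral_comp_dil hl ({z : SpaceTime | l ^ 2 ≤ |z.1|}.indicator (logInt k (corr k k)))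
  rw [integral_indicator (hms _)] at h
  have e : corr (scaleKer l k) (scaleKer l k) = fun z => l * corr k k (dil l z) :=
    funext (corr_scale hl)
  rw [← integral_indicator (hms 1), e]
  calc _ = ∫ z, l ^ 3 * {z : SpaceTime | l ^ 2 ≤ |z.1|}.indicator (logInt k (corr k k)) (dil l z) := by
        congr 1; ext w
        have hiff : (dil l w ∈ {z : SpaceTime | l ^ 2 ≤ |z.1|}) ↔ w ∈ {z : SpaceTime | 1 ≤ |z.1|} := by
          simp only [Set.mem_ofPred_eq, dil, abs_mul, abs_of_pos (pow_pos hl 2)]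
          constructor
          · intro h; exact le_of_mul_le_mul_left (by linarith) (pow_pos hl 2)
          · intro h; nlinarith [pow_pos hl 2]
        by_cases hw : w ∈ {z : SpaceTime | 1 ≤ |z.1|}
        · rw [Set.indicator_of_mem hw, Set.indicator_of_mem (hiff.mpr hw), logInt_scale hl]
        · rw [Set.indicator_of_notMem hw, Set.indicator_of_notMem (fun h => hw (hiff.mp h)), mul_zero]
    _ = _ := by
        rw [integral_const_mul, h]
        field_simp

/-! ### Gaussian integrals -/

theorem heatKernel_eq_gaussianPDFReal {t : ℝ} (ht : 0 < t) (x : ℝ) :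
    heatKernel (t, x) = gaussianPDFReal 0 (Real.toNNReal (2 * t)) x := by
  rw [gaussianPDFReal, Real.coe_toNNReal _ (by positivity)]
  simp only [heatKernel, ht, if_true, sub_zero]
  rw [div_eq_inv_mul, show 2 * Real.pi * (2 * t) = 4 * Real.pi * t by ring,
    show 2 * (2 * t) = 4 * t by ring]

theorem heatKernel_nonneg (z : SpaceTime) : 0 ≤ heatKernel z := by
  unfold heatKernel; split_ifs <;> positivity

theorem toNNReal_two_mul_ne_zero {t : ℝ} (ht : 0 < t) : Real.toNNReal (2 * t) ≠ 0 := by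
  simp [ht]

theorem integral_heatKernel {t : ℝ} (ht : 0 < t) : ∫ x, heatKernel (t, x) = 1 := by
  simp_rw [heatKernel_eq_gaussianPDFReal ht]
  exact integral_gaussianPDFReal_eq_one 0 (toNNReal_two_mul_ne_zero ht)

theorem integral_gaussian_mul {t : ℝ} (ht : 0 < t) (f : ℝ → ℝ) :
    ∫ x, f x * heatKernel (t, x) = ∫ x, f x ∂(gaussianReal 0 (Real.toNNReal (2 * t))) := by
  rw [integral_gaussianReal_eq_integral_smul (toNNReal_two_mul_ne_zero ht)]
  congr 1; ext x
  rw [heatKernel_eq_gaussianPDFReal ht, smul_eq_mul, mul_comm]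

theorem integral_mul_heatKernel {t : ℝ} (ht : 0 < t) : ∫ x, x * heatKernel (t, x) = 0 := by
  rw [integral_gaussian_mul ht (fun x => x), integral_id_gaussianReal]

theorem integral_sq_mul_heatKernel {t : ℝ} (ht : 0 < t) :
    ∫ x, x ^ 2 * heatKernel (t, x) = 2 * t := by
  rw [integral_gaussian_mul ht (fun x => x ^ 2)]
  have h := variance_fun_id_gaussianReal (μ := 0) (v := Real.toNNReal (2 * t))
  rw [variance_of_integral_eq_zero aemeasurable_id' integral_id_gaussianReal] at h
  rw [h, Real.coe_toNNReal _ (by positivity)]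

theorem integrable_pow_mul_heatKernel {t : ℝ} (ht : 0 < t) (n : ℕ) :
    Integrable fun x => x ^ n * heatKernel (t, x) := by
  have h1 : Integrable (fun x : ℝ => x ^ n) (gaussianReal 0 (Real.toNNReal (2 * t))) := by
    have := (memLp_id_gaussianReal (μ := 0) (v := Real.toNNReal (2 * t)) n)
    rcases Nat.eq_zero_or_pos n with rfl | hn
    · simp
    · have h2 := this.integrable_norm_pow (by omega)
      refine (integrable_norm_iff (by fun_prop)).mp ?_
      simpa using h2
  rw [gaussianReal_of_var_ne_zero _ (toNNReal_two_mul_ne_zero ht)] at h1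
  rw [integrable_withDensity_iff (measurable_gaussianPDF _ _)
    (Eventually.of_forall fun x => ENNReal.ofReal_lt_top)] at h1
  refine h1.congr (Eventually.of_forall fun x => ?_)
  simp only [toReal_gaussianPDF, heatKernel_eq_gaussianPDFReal ht]

theorem integrable_heatKernel {t : ℝ} (ht : 0 < t) : Integrable fun x => heatKernel (t, x) := by
  simpa using integrable_pow_mul_heatKernel ht 0

/-- Completing the square: a product of two Gaussians in y is a Gaussian in y with variance
parameter as/(a+s), times the convolution evaluated at x. It reduces the Gaussian integrals below to
moments of order at most 2. -/
theorem heatKernel_mul {a s : ℝ} (ha : 0 < a) (hs : 0 < s) (x y : ℝ) :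
    heatKernel (a, y - x) * heatKernel (s, y) =
      heatKernel (a + s, x) * heatKernel (a * s / (a + s), y - x * s / (a + s)) := by
  have h1 : 0 < a + s := by positivity
  have h2 : 0 < a * s / (a + s) := by positivity
  simp only [heatKernel, ha, hs, h1, h2, if_true]
  rw [div_mul_div_comm, div_mul_div_comm, ← Real.exp_add, ← Real.exp_add,
    ← Real.sqrt_mul (by positivity), ← Real.sqrt_mul (by positivity)]
  congr 1
  · congr 1
    field_simp
    ring
  · congr 1
    field_simp

/-- The spatial derivatives of two heat kernels correlate to the time derivative. -/
theorem integral_heatDeriv_mul_heatDeriv {a s : ℝ} (ha : 0 < a) (hs : 0 < s) (x : ℝ) :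
    ∫ y, heatDeriv (a, x + y) * heatDeriv (s, y) =
      (1 / (2 * (a + s)) - x ^ 2 / (4 * (a + s) ^ 2)) * heatKernel (a + s, x) := by
  have h1 : 0 < a + s := by positivity
  have h2 : 0 < a * s / (a + s) := by positivity
  set τ := a * s / (a + s) with hτ
  set m := -x * s / (a + s) with hm
  have e1 : ∀ y, heatDeriv (a, x + y) * heatDeriv (s, y) =
      (heatKernel (a + s, x) / (4 * a * s)) * ((x + y) * y * heatKernel (τ, y - m)) := by
    intro y
    rw [heatDeriv_of_pos (show 0 < ((a, x + y) : SpaceTime).1 from ha),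
      heatDeriv_of_pos (show 0 < ((s, y) : SpaceTime).1 from hs)]
    have := heatKernel_mul ha hs (-x) y
    rw [show y - -x = x + y by ring, show heatKernel (a + s, -x) = heatKernel (a + s, x) from
      heatKernel_reflect (a + s, x), ← hτ, ← hm] at this
    calc _ = (x + y) * y / (4 * a * s) * (heatKernel (a, x + y) * heatKernel (s, y)) := by
          simp only; field_simp; ring
      _ = _ := by rw [this]; ring
  simp_rw [e1]
  rw [integral_const_mul, ← integral_add_right_eq_self _ m]
  have e2 : ∀ u, (x + (u + m)) * (u + m) * heatKernel (τ, u + m - m) =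
      u ^ 2 * heatKernel (τ, u) + (x + 2 * m) * (u * heatKernel (τ, u)) +
        (x * m + m ^ 2) * heatKernel (τ, u) := by
    intro u; rw [add_sub_cancel_right]; ring
  simp_rw [e2]
  have i1 : Integrable fun u => u * heatKernel (τ, u) := by
    simpa using integrable_pow_mul_heatKernel h2 1
  have i2 := integrable_pow_mul_heatKernel h2 2
  have i0 := integrable_heatKernel h2
  have i12 : Integrable fun u => u ^ 2 * heatKernel (τ, u) + (x + 2 * m) * (u * heatKernel (τ, u)) :=
    i2.add (i1.const_mul _)
  rw [integral_add i12 (i0.const_mul _), integral_add i2 (i1.const_mul _),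
    integral_const_mul, integral_const_mul, integral_heatKernel h2, integral_mul_heatKernel h2,
    integral_sq_mul_heatKernel h2, hm, hτ]
  field_simp
  ring

theorem integral_heatDeriv_mul_heatKernel {a s : ℝ} (ha : 0 < a) (hs : 0 < s) (x : ℝ) :
    ∫ y, heatDeriv (a, y - x) * heatKernel (s, y) = x / (2 * (a + s)) * heatKernel (a + s, x) := by
  have h1 : 0 < a + s := by positivity
  have h2 : 0 < a * s / (a + s) := by positivity
  set τ := a * s / (a + s) with hτ
  set m := x * s / (a + s) with hm
  have e1 : ∀ y, heatDeriv (a, y - x) * heatKernel (s, y) =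
      (-heatKernel (a + s, x) / (2 * a)) * ((y - x) * heatKernel (τ, y - m)) := by
    intro y
    rw [heatDeriv_of_pos (show 0 < ((a, y - x) : SpaceTime).1 from ha)]
    have := heatKernel_mul ha hs x y
    rw [← hτ, ← hm] at this
    calc _ = -(y - x) / (2 * a) * (heatKernel (a, y - x) * heatKernel (s, y)) := by
          simp only; ring
      _ = _ := by rw [this]; ring
  simp_rw [e1]
  rw [integral_const_mul, ← integral_add_right_eq_self _ m]
  have e2 : ∀ u, (u + m - x) * heatKernel (τ, u + m - m) =
      u * heatKernel (τ, u) + (m - x) * heatKernel (τ, u) := by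
    intro u; rw [add_sub_cancel_right]; ring
  simp_rw [e2]
  have i1 : Integrable fun u => u * heatKernel (τ, u) := by
    simpa using integrable_pow_mul_heatKernel h2 1
  have i0 := integrable_heatKernel h2
  rw [integral_add i1 (i0.const_mul _), integral_const_mul, integral_heatKernel h2,
    integral_mul_heatKernel h2, hm]
  field_simp
  ring

/-- The heat equation. -/
theorem hasDerivAt_heatKernel_time {u : ℝ} (hu : 0 < u) (x : ℝ) :
    HasDerivAt (fun u => heatKernel (u, x))
      (-((1 / (2 * u) - x ^ 2 / (4 * u ^ 2)) * heatKernel (u, x))) u := by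
  have h1 : (fun u => heatKernel (u, x)) =ᶠ[𝓝 u]
      fun u => Real.exp (-x ^ 2 / (4 * u)) / Real.sqrt (4 * Real.pi * u) := by
    filter_upwards [lt_mem_nhds hu] with v hv
    simp [heatKernel, hv]
  refine HasDerivAt.congr_of_eventuallyEq ?_ h1
  have h2 : HasDerivAt (fun u : ℝ => -x ^ 2 / (4 * u)) (x ^ 2 / (4 * u ^ 2)) u := by
    have := ((hasDerivAt_id u).const_mul 4).fun_inv (by simp [hu.ne'])
    have h3 := this.const_mul (-x ^ 2)
    simp only [id] at h3
    refine h3.congr_deriv ?_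
    field_simp
  have h3 : HasDerivAt (fun u : ℝ => Real.sqrt (4 * Real.pi * u))
      (4 * Real.pi / (2 * Real.sqrt (4 * Real.pi * u))) u := by
    have := ((hasDerivAt_id u).const_mul (4 * Real.pi)).sqrt (by simp; positivity)
    simpa using this
  have hs : 0 < Real.sqrt (4 * Real.pi * u) := by positivity
  refine (h2.exp.div h3 hs.ne').congr_deriv ?_
  simp only [heatKernel, hu, if_true]
  have hsq : Real.sqrt (4 * Real.pi * u) ^ 2 = 4 * Real.pi * u := Real.sq_sqrt (by positivity)
  set S := Real.sqrt (4 * Real.pi * u) with hS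
  have hS3 : S ^ 3 = S * (4 * Real.pi * u) := by rw [← hsq]; ring
  have hpi : 4 * Real.pi = S ^ 2 / u := by rw [hsq]; field_simp
  rw [hpi]
  field_simp
  ring

theorem heatKernel_le {u : ℝ} (hu : 0 < u) (x : ℝ) :
    heatKernel (u, x) ≤ 1 / Real.sqrt u := by
  simp only [heatKernel, hu, if_true]
  have h1 : Real.exp (-x ^ 2 / (4 * u)) ≤ 1 := by
    rw [Real.exp_le_one_iff]
    exact div_nonpos_of_nonpos_of_nonneg (by nlinarith [sq_nonneg x]) (by positivity)
  have h2 : Real.sqrt u ≤ Real.sqrt (4 * Real.pi * u) := by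
    refine Real.sqrt_le_sqrt ?_
    nlinarith [Real.pi_gt_three]
  have := Real.sqrt_pos.mpr hu
  gcongr

theorem tendsto_heatKernel_atTop (x : ℝ) : Tendsto (fun u => heatKernel (u, x)) atTop (𝓝 0) := by
  have h : Tendsto (fun u : ℝ => 1 / Real.sqrt u) atTop (𝓝 0) := by
    simp_rw [one_div]
    exact tendsto_inv_atTop_zero.comp Real.tendsto_sqrt_atTop
  refine squeeze_zero' (Eventually.of_forall fun u => heatKernel_nonneg _) ?_ h
  filter_upwards [eventually_gt_atTop 0] with u hu using heatKernel_le hu x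

/-- By the heat equation the integrand is the s-derivative of -P(t + 2s, x)/2, and P vanishes as
time tends to infinity. -/
theorem integral_Ioi_time_deriv {t : ℝ} (x : ℝ) (s₀ : ℝ) (h0 : t + 2 * s₀ > 0)
    (hint : IntegrableOn (fun s => (1 / (2 * (t + 2 * s)) - x ^ 2 / (4 * (t + 2 * s) ^ 2)) *
      heatKernel (t + 2 * s, x)) (Set.Ioi s₀)) :
    ∫ s in Set.Ioi s₀, (1 / (2 * (t + 2 * s)) - x ^ 2 / (4 * (t + 2 * s) ^ 2)) *
      heatKernel (t + 2 * s, x) = (1 / 2) * heatKernel (t + 2 * s₀, x) := by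
  have hd : ∀ s ∈ Set.Ici s₀, HasDerivAt (fun s => -(1 / 2) * heatKernel (t + 2 * s, x))
      ((1 / (2 * (t + 2 * s)) - x ^ 2 / (4 * (t + 2 * s) ^ 2)) * heatKernel (t + 2 * s, x)) s := by
    intro s hs
    have hs' : 0 < t + 2 * s := by
      have : s₀ ≤ s := hs
      linarith
    have h1 := hasDerivAt_heatKernel_time hs' x
    have h2 : HasDerivAt (fun s : ℝ => t + 2 * s) 2 s := by
      simpa using ((hasDerivAt_id s).const_mul 2).const_add t
    have h3 := (h1.comp s h2).const_mul (-(1 / 2))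
    refine h3.congr_deriv ?_
    ring
  have hlim : Tendsto (fun s => -(1 / 2) * heatKernel (t + 2 * s, x)) atTop (𝓝 (-(1 / 2) * 0)) := by
    refine Tendsto.const_mul _ ((tendsto_heatKernel_atTop x).comp ?_)
    exact tendsto_atTop_add_const_left _ _ (tendsto_id.const_mul_atTop two_pos)
  rw [integral_Ioi_of_hasDerivAt_of_tendsto' hd hint hlim]
  ring

/-! ### The correlation and the symmetrised convolution of the heat kernel in closed form. -/

theorem ne_zero_of_fst_ne {t x : ℝ} (ht : t ≠ 0) : ((t, x) : SpaceTime) ≠ 0 :=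
  fun h => ht (congrArg Prod.fst h)

/-- The integral in y equals -∂ₓ²P(t + 2s, x), which is -1/2 times the s-derivative of P(t + 2s, x);
integrating over s > 0 leaves the boundary term P(t, x)/2. -/
theorem corr_heatDeriv_of_pos {C : ℝ≥0} (hP : IsKer C 2 heatDeriv) {t : ℝ} (ht : 0 < t) (x : ℝ) :
    corr heatDeriv heatDeriv (t, x) = (1 / 2) * heatKernel (t, x) := by
  have hint := integrable_corr (a := 2) (b := 2) (by norm_num) (by norm_num) (by norm_num)
    (by norm_num) (by norm_num) hP.measurable hP.measurable hP.bound hP.bound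
    (ne_zero_of_fst_ne (x := x) ht.ne')
  rw [Measure.volume_eq_prod] at hint
  have hI := hint.integral_prod_left
  have e : ∀ s, ∫ y, heatDeriv ((t, x) + (s, y)) * heatDeriv (s, y) =
      (Set.Ioi 0).indicator (fun s => (1 / (2 * (t + 2 * s)) - x ^ 2 / (4 * (t + 2 * s) ^ 2)) *
      heatKernel (t + 2 * s, x)) s := by
    intro s
    by_cases hs : 0 < s
    · rw [Set.indicator_of_mem (show s ∈ Set.Ioi 0 from hs)]
      have := integral_heatDeriv_mul_heatDeriv (show 0 < t + s by positivity) hs x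
      rw [show t + s + s = t + 2 * s by ring] at this
      exact this
    · rw [Set.indicator_of_notMem (show s ∉ Set.Ioi 0 from hs)]
      simp [heatDeriv_of_nonpos (show ((s, _) : SpaceTime).1 ≤ 0 from not_lt.mp hs)]
  simp_rw [e] at hI
  rw [integrable_indicator_iff measurableSet_Ioi] at hI
  unfold corr
  rw [Measure.volume_eq_prod, integral_prod _ hint]
  simp_rw [e]
  rw [integral_indicator measurableSet_Ioi, integral_Ioi_time_deriv x 0 (by simpa using ht) hI]
  simp

theorem corr_heatDeriv {C : ℝ≥0} (hP : IsKer C 2 heatDeriv) {t : ℝ} (ht : t ≠ 0) (x : ℝ) :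
    corr heatDeriv heatDeriv (t, x) = (1 / 2) * heatKernel (|t|, x) := by
  rcases lt_or_gt_of_ne ht with h | h
  · rw [← corr_neg, show -((t, x) : SpaceTime) = (-t, -x) from rfl,
      corr_heatDeriv_of_pos hP (by linarith), abs_of_neg h]
    congr 1
    exact heatKernel_reflect (-t, x)
  · rw [corr_heatDeriv_of_pos hP h, abs_of_pos h]

/-- For t > 0, causality restricts the heat kernel to times a > 0, where the correlation is P(t + a,
·)/2. The two reflected Gaussian convolutions contribute equally, which gives 1/2 · 1/2 · 2 · 1/2 =
1/4. Antisymmetrisation is used for absolute convergence in space-time only; at fixed a each term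
converges on its own. -/
theorem symConv_heatDeriv {C : ℝ≥0} (hP : IsKer C 2 heatDeriv) {D : ℝ≥0}
    (hQ : ∀ z, ‖corr heatDeriv heatDeriv z‖ₑ ≤ D * pw 1 z) {t : ℝ} (ht : 0 < t) (x : ℝ) :
    symConv heatDeriv (corr heatDeriv heatDeriv) (t, x) =
      (1 / 4) * ∫ a in Set.Ioi 0, x / (t + 2 * a) * heatKernel (t + 2 * a, x) := by
  have mQ := measurable_corr hP.measurable hP.measurable
  have hint := integrable_symConv (a := 2) (b := 1) (by norm_num) (by norm_num) (by norm_num)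
    (by norm_num) (by norm_num) hP mQ hQ (t, x)
  have hint' := hint.comp_sub_left (-((t, x) : SpaceTime))
  have e0 : ∀ z : SpaceTime, (heatDeriv (-((t, x) : SpaceTime) - (-((t, x) : SpaceTime) - z)) -
      heatDeriv (-reflect (t, x) - (-((t, x) : SpaceTime) - z))) *
      corr heatDeriv heatDeriv (-((t, x) : SpaceTime) - z) =
      (heatDeriv (z.1, z.2) - heatDeriv (z.1, z.2 + 2 * x)) *
        corr heatDeriv heatDeriv (t + z.1, x + z.2) := by
    intro z
    have h1 : -((t, x) : SpaceTime) - (-((t, x) : SpaceTime) - z) = (z.1, z.2) := by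
      ext <;> simp
    have h2 : -reflect (t, x) - (-((t, x) : SpaceTime) - z) = (z.1, z.2 + 2 * x) := by
      ext <;> simp [reflect]; ring
    have h3 : -((t, x) : SpaceTime) - z = -(t + z.1, x + z.2) := by
      ext <;> simp <;> ring
    rw [h1, h2, h3, corr_neg]
  simp_rw [e0] at hint'
  rw [Measure.volume_eq_prod] at hint'
  have hval : ∀ a, 0 < a → ∀ y, (heatDeriv (a, y) - heatDeriv (a, y + 2 * x)) *
      corr heatDeriv heatDeriv (t + a, x + y) = (1 / 2) *
      (heatDeriv (a, (x + y) - x) * heatKernel (t + a, x + y)) - (1 / 2) *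
      (heatDeriv (a, (x + y) - -x) * heatKernel (t + a, x + y)) := by
    intro a ha y
    rw [corr_heatDeriv_of_pos hP (by positivity), show x + y - x = y by ring,
      show x + y - -x = y + 2 * x by ring]
    ring
  have hintk : ∀ a, 0 < a → ∀ x' : ℝ,
      Integrable fun y => heatDeriv (a, y - x') * heatKernel (t + a, y) := by
    intro a ha x'
    have h1 : 0 < a + (t + a) := by positivity
    have h2 : 0 < a * (t + a) / (a + (t + a)) := by positivity
    have i0 : Integrable fun u => heatKernel (a * (t + a) / (a + (t + a)), u) :=
      integrable_heatKernel h2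
    have i1 : Integrable fun u => u * heatKernel (a * (t + a) / (a + (t + a)), u) := by
      simpa using integrable_pow_mul_heatKernel h2 1
    set m := x' * (t + a) / (a + (t + a)) with hm
    have i3 := ((i1.add (i0.const_mul (m - x'))).comp_sub_right m).const_mul
      (-heatKernel (a + (t + a), x') / (2 * a))
    refine i3.congr (Eventually.of_forall fun y => ?_)
    simp only [Pi.add_apply]
    rw [heatDeriv_of_pos (show 0 < ((a, y - x') : SpaceTime).1 from ha)]
    have hk := heatKernel_mul ha (show 0 < t + a by positivity) x' y
    rw [← hm] at hk
    simp only
    rw [mul_assoc, hk]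
    ring
  have e : ∀ a, ∫ y, (heatDeriv (a, y) - heatDeriv (a, y + 2 * x)) *
      corr heatDeriv heatDeriv (t + a, x + y) =
      (Set.Ioi 0).indicator (fun a => (1 / 2) * (x / (t + 2 * a) * heatKernel (t + 2 * a, x))) a := by
    intro a
    by_cases ha : 0 < a
    · rw [Set.indicator_of_mem (show a ∈ Set.Ioi 0 from ha)]
      simp_rw [hval a ha]
      rw [integral_add_left_eq_self (fun y => (1 / 2) * (heatDeriv (a, y - x) *
        heatKernel (t + a, y)) - (1 / 2) * (heatDeriv (a, y - -x) * heatKernel (t + a, y))) x,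
        integral_sub ((hintk a ha x).const_mul _) ((hintk a ha (-x)).const_mul _),
        integral_const_mul, integral_const_mul,
        integral_heatDeriv_mul_heatKernel ha (by positivity),
        integral_heatDeriv_mul_heatKernel ha (by positivity),
        show heatKernel (a + (t + a), -x) = heatKernel (a + (t + a), x) from
          heatKernel_reflect (a + (t + a), x), show a + (t + a) = t + 2 * a by ring]
      field_simp
      ring
    · rw [Set.indicator_of_notMem (show a ∉ Set.Ioi 0 from ha)]
      simp [heatDeriv_of_nonpos (show ((a, _) : SpaceTime).1 ≤ 0 from not_lt.mp ha)]
  unfold symConv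
  rw [← integral_sub_left_eq_self _ volume (-((t, x) : SpaceTime))]
  simp_rw [e0]
  rw [Measure.volume_eq_prod, integral_prod _ hint']
  simp only
  simp_rw [e]
  rw [integral_indicator measurableSet_Ioi, integral_const_mul]
  ring

theorem integrableOn_rpow_shift {t : ℝ} (ht : 0 < t) :
    IntegrableOn (fun a => (t + 2 * a) ^ (-(3 / 2) : ℝ)) (Set.Ioi 0) := by
  have h1 : IntegrableOn (fun u : ℝ => u ^ (-(3 / 2) : ℝ)) (Set.Ioi t) :=
    integrableOn_Ioi_rpow_of_lt (by norm_num) ht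
  have h2 : IntegrableOn (fun v : ℝ => (t + v) ^ (-(3 / 2) : ℝ)) (Set.Ioi 0) := by
    rw [← integrable_indicator_iff measurableSet_Ioi] at h1 ⊢
    refine (h1.comp_add_left t).congr (Eventually.of_forall fun a => ?_)
    simp [Set.indicator]
  rw [← integrable_indicator_iff measurableSet_Ioi] at h2 ⊢
  have h3 := h2.comp_mul_left' (g := _) (R := 2) two_ne_zero
  refine h3.congr (Eventually.of_forall fun a => ?_)
  simp [Set.indicator]

/-- Differentiating under the integral turns (x/u) P(u, x), u = t + 2a, into minus the a-derivative
of P(t + 2a, x), which integrates to P(t, x). Domination is by u^{-3/2}, locally uniformly in x.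
This identity is the source of the cancellation. -/
theorem hasDerivAt_symConv_heatDeriv {C : ℝ≥0} (hP : IsKer C 2 heatDeriv) {D : ℝ≥0}
    (hQ : ∀ z, ‖corr heatDeriv heatDeriv z‖ₑ ≤ D * pw 1 z) {t : ℝ} (ht : 0 < t) (x : ℝ) :
    HasDerivAt (fun x => symConv heatDeriv (corr heatDeriv heatDeriv) (t, x))
      ((1 / 4) * heatKernel (t, x)) x := by
  have hfun : (fun x => symConv heatDeriv (corr heatDeriv heatDeriv) (t, x)) = fun x =>
      (1 / 4) * ∫ a in Set.Ioi 0, x / (t + 2 * a) * heatKernel (t + 2 * a, x) :=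
    funext fun x => symConv_heatDeriv hP hQ ht x
  rw [hfun]
  have hpos : ∀ a ∈ Set.Ioi (0 : ℝ), 0 < t + 2 * a := fun a ha => by
    have : 0 < a := ha
    positivity
  have mF : ∀ x, Measurable fun a => x / (t + 2 * a) * heatKernel (t + 2 * a, x) := fun x => by
    have := measurable_heatKernel
    fun_prop
  set F' : ℝ → ℝ → ℝ := fun x a =>
    2 * ((1 / (2 * (t + 2 * a)) - x ^ 2 / (4 * (t + 2 * a) ^ 2)) * heatKernel (t + 2 * a, x)) with hF'
  have mF' : ∀ x, Measurable (F' x) := fun x => by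
    have := measurable_heatKernel
    rw [hF']; fun_prop
  have hrp : ∀ u : ℝ, 0 < u → 1 / u * (1 / Real.sqrt u) = u ^ (-(3 / 2) : ℝ) := by
    intro u hu
    rw [Real.sqrt_eq_rpow, one_div, one_div, ← Real.rpow_neg hu.le, ← Real.rpow_neg_one,
      ← Real.rpow_add hu]
    norm_num
  have hbF : ∀ x a, a ∈ Set.Ioi (0 : ℝ) → ‖x / (t + 2 * a) * heatKernel (t + 2 * a, x)‖ ≤
      |x| * (t + 2 * a) ^ (-(3 / 2) : ℝ) := by
    intro x a ha
    have hu := hpos a ha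
    rw [norm_mul, Real.norm_eq_abs, abs_div, abs_of_pos hu, Real.norm_of_nonneg (heatKernel_nonneg _),
      ← hrp _ hu]
    calc _ ≤ |x| / (t + 2 * a) * (1 / Real.sqrt (t + 2 * a)) := by
          gcongr; exact heatKernel_le hu x
      _ = _ := by ring
  have hbF' : ∀ a ∈ Set.Ioi (0 : ℝ), ∀ y ∈ Metric.ball x 1, ‖F' y a‖ ≤
      (1 + (|x| + 1) ^ 2 / t) * (t + 2 * a) ^ (-(3 / 2) : ℝ) := by
    intro a ha y hy
    have hu := hpos a ha
    have hut : t ≤ t + 2 * a := by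
      have : 0 < a := ha
      linarith
    have hy' : |y| ≤ |x| + 1 := by
      have h1 : |y - x| < 1 := by simpa [Real.dist_eq] using hy
      have h2 := abs_sub_abs_le_abs_sub y x
      linarith
    set u := t + 2 * a with hu'
    have h1 : F' y a = (1 / u * heatKernel (u, y)) * (1 - y ^ 2 / (2 * u)) := by
      simp only [hF', ← hu']; field_simp; ring
    have h2 : |1 - y ^ 2 / (2 * u)| ≤ 1 + (|x| + 1) ^ 2 / t := by
      have hsq : y ^ 2 ≤ (|x| + 1) ^ 2 := by
        rw [← sq_abs y]; gcongr
      have h3 : y ^ 2 / (2 * u) ≤ (|x| + 1) ^ 2 / t := by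
        gcongr; linarith
      have h4 : 0 ≤ y ^ 2 / (2 * u) := by positivity
      rw [abs_le]; constructor <;> linarith
    rw [h1, norm_mul, norm_mul, Real.norm_of_nonneg (by positivity),
      Real.norm_of_nonneg (heatKernel_nonneg _), Real.norm_eq_abs, ← hrp _ hu, mul_comm]
    refine mul_le_mul h2 (mul_le_mul_of_nonneg_left (heatKernel_le hu y) (by positivity))
      (mul_nonneg (by positivity) (heatKernel_nonneg _)) (by positivity)
  have hI := integrableOn_rpow_shift ht
  have key := hasDerivAt_integral_of_dominated_loc_of_deriv_le
    (μ := volume.restrict (Set.Ioi (0 : ℝ))) (x₀ := x) (s := Metric.ball x 1)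
    (F := fun x a => x / (t + 2 * a) * heatKernel (t + 2 * a, x)) (F' := F')
    (bound := fun a => (1 + (|x| + 1) ^ 2 / t) * (t + 2 * a) ^ (-(3 / 2) : ℝ))
    (Metric.ball_mem_nhds x one_pos)
    (Eventually.of_forall fun y => (mF y).aestronglyMeasurable)
    (by
      refine Integrable.mono' (hI.const_mul |x|) (mF x).aestronglyMeasurable ?_
      filter_upwards [ae_restrict_mem measurableSet_Ioi] with a ha using hbF x a ha)
    (mF' x).aestronglyMeasurable
    (by filter_upwards [ae_restrict_mem measurableSet_Ioi] with a ha using hbF' a ha)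
    (hI.const_mul _)
    (by
      filter_upwards [ae_restrict_mem measurableSet_Ioi] with a ha y _
      have hu := hpos a ha
      have h1 := ((hasDerivAt_id y).div_const (t + 2 * a)).mul (hasDerivAt_heatKernel hu y)
      refine h1.congr_deriv ?_
      simp only [hF', id]
      field_simp
      ring)
  have hint' : IntegrableOn (fun s => (1 / (2 * (t + 2 * s)) - x ^ 2 / (4 * (t + 2 * s) ^ 2)) *
      heatKernel (t + 2 * s, x)) (Set.Ioi 0) := by
    refine (key.1.const_mul (1 / 2)).congr (Eventually.of_forall fun a => ?_)
    simp only [hF']; ring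
  have hv : ∫ a in Set.Ioi 0, F' x a = heatKernel (t, x) := by
    simp only [hF']
    rw [integral_const_mul, integral_Ioi_time_deriv x 0 (by simpa using ht) hint']
    simp
  have := key.2.const_mul (1 / 4)
  rwa [hv] at this

/-! ### Cancellation of the logarithmic divergence -/

/-- The expression without mollifier, for the kernel `k`. -/
def bareLogInt (k : SpaceTime → ℝ) : SpaceTime → ℝ := logInt k (corr k k)

theorem measurable_bareLogInt {k : SpaceTime → ℝ} (hk : Measurable k) : Measurable (bareLogInt k) :=
  measurable_logInt hk (measurable_corr hk hk)

/-- The correlation is even in time, so the cubic term occurs twice; the kernel is causal, so the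
other term occurs only at the positive time. -/
theorem bareLogInt_heatDeriv_add {C : ℝ≥0} (hP : IsKer C 2 heatDeriv) {t : ℝ} (ht : 0 < t) (x : ℝ) :
    bareLogInt heatDeriv (t, x) + bareLogInt heatDeriv (-t, x) =
      (1 / 4) * heatKernel (t, x) * heatKernel (t, x) ^ 2 +
        symConv heatDeriv (corr heatDeriv heatDeriv) (t, x) *
          (2 * heatKernel (t, x) * (-x / (2 * t) * heatKernel (t, x))) := by
  rw [bareLogInt, logInt, logInt, corr_heatDeriv hP ht.ne', corr_heatDeriv hP (neg_ne_zero.mpr ht.ne'),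
    abs_neg, abs_of_pos ht, heatDeriv_of_nonpos (show ((-t, x) : SpaceTime).1 ≤ 0 by simp [ht.le]),
    heatDeriv_of_pos (show 0 < ((t, x) : SpaceTime).1 from ht)]
  ring

/-- The integrand is the x-derivative of F P², where F is the symmetrised convolution and ∂ₓF = P/4.
As F is bounded and P is Gaussian, function and derivative are integrable, so the integral is 0. -/
theorem integral_bareLogInt_heatDeriv_add {C : ℝ≥0} (hP : IsKer C 2 heatDeriv) {D : ℝ≥0}
    (hQ : ∀ z, ‖corr heatDeriv heatDeriv z‖ₑ ≤ D * pw 1 z)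
    (hF : ∀ z, ‖symConv heatDeriv (corr heatDeriv heatDeriv) z‖ₑ ≤ D) {t : ℝ} (ht : t ≠ 0) :
    ∫ x, (bareLogInt heatDeriv (t, x) + bareLogInt heatDeriv (-t, x)) = 0 := by
  wlog h : 0 < t with H
  · have := H hP hQ hF (neg_ne_zero.mpr ht) (by
      rcases lt_or_gt_of_ne ht with h' | h'
      · linarith
      · exact absurd h' h)
    simpa [add_comm] using this
  simp_rw [bareLogInt_heatDeriv_add hP h]
  have mF : Measurable fun x => symConv heatDeriv (corr heatDeriv heatDeriv) (t, x) :=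
    (measurable_symConv hP.measurable (measurable_corr hP.measurable hP.measurable)).comp
      measurable_prodMk_left
  have hF' : ∀ x, ‖symConv heatDeriv (corr heatDeriv heatDeriv) (t, x)‖ ≤ D := fun x => by
    have := hF (t, x)
    rw [← ENNReal.toReal_le_toReal (by simp) (by simp)] at this
    simpa using this
  have mP : Measurable fun x => heatKernel (t, x) := measurable_heatKernel.comp measurable_prodMk_left
  have hPle : ∀ x, ‖heatKernel (t, x)‖ ≤ 1 / Real.sqrt t := fun x => by
    rw [Real.norm_of_nonneg (heatKernel_nonneg _)]; exact heatKernel_le h x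
  have iP := integrable_heatKernel h
  have iP1 : Integrable fun x => x * heatKernel (t, x) := by
    simpa using integrable_pow_mul_heatKernel h 1
  have iP2 : Integrable fun x => heatKernel (t, x) * heatKernel (t, x) :=
    iP.bdd_mul mP.aestronglyMeasurable (Eventually.of_forall hPle)
  have iP3 : Integrable fun x => heatKernel (t, x) * (heatKernel (t, x) * heatKernel (t, x)) :=
    iP2.bdd_mul mP.aestronglyMeasurable (Eventually.of_forall hPle)
  have iP4 : Integrable fun x => heatKernel (t, x) * (x * heatKernel (t, x)) :=
    iP1.bdd_mul mP.aestronglyMeasurable (Eventually.of_forall hPle)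
  have iF4 := iP4.bdd_mul mF.aestronglyMeasurable (Eventually.of_forall hF')
  have iF2 := iP2.bdd_mul mF.aestronglyMeasurable (Eventually.of_forall hF')
  refine integral_eq_zero_of_hasDerivAt_of_integrable
    (f := fun x => symConv heatDeriv (corr heatDeriv heatDeriv) (t, x) * heatKernel (t, x) ^ 2)
    (fun x => ?_) ?_ ?_
  · refine ((hasDerivAt_symConv_heatDeriv hP hQ h x).mul
      ((hasDerivAt_heatKernel h x).fun_pow 2)).congr_deriv ?_
    norm_num
  · refine ((iP3.const_mul (1 / 4)).add (iF4.const_mul (-1 / t))).congr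
      (Eventually.of_forall fun x => ?_)
    simp only [Pi.add_apply]
    field_simp
  · refine iF2.congr (Eventually.of_forall fun x => ?_)
    simp only; ring

theorem pw_mul_pw_of_ne {z : SpaceTime} (hz : z ≠ 0) (a b : ℝ) : pw a z * pw b z = pw (a + b) z := by
  rw [pw, pw, pw, ← ENNReal.rpow_add _ _ (ofReal_paraNorm_ne_zero hz) ENNReal.ofReal_ne_top]
  congr 1; ring

/-- On this set |w| ≥ l, so |w|⁻³ ≤ l^{-1/4} |w|^{-11/4} inside the unit ball; outside it the slab
weight already has order 3. -/
theorem integrableOn_bareLogInt_slab {k : SpaceTime → ℝ} (mk : Measurable k) {M : ℝ≥0}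
    (hk : ∀ w, ‖bareLogInt k w‖ₑ ≤ M * pw 3 w) {l : ℝ} (hl : 0 < l) :
    IntegrableOn (bareLogInt k) {z : SpaceTime | l ^ 2 ≤ |z.1| ∧ |z.1| < 1} := by
  have hms' : MeasurableSet {z : SpaceTime | l ^ 2 ≤ |z.1|} :=
    measurableSet_le measurable_const (by fun_prop)
  have hms : MeasurableSet {z : SpaceTime | l ^ 2 ≤ |z.1| ∧ |z.1| < 1} :=
    hms'.inter (measurableSet_slab 1)
  refine integrable_of_enorm_le (g := fun w => (M * (ENNReal.ofReal l ^ (-(1 / 4) : ℝ) + 1)) * slabWeight w)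
    (measurable_bareLogInt mk).aestronglyMeasurable ?_ ?_
  · filter_upwards [ae_restrict_mem hms] with w hw
    have hw' : l ≤ paraNorm w := le_paraNorm_of_le_abs hw.1
    have hw0 : w ≠ 0 := by
      rintro rfl; rw [paraNorm_zero] at hw'; linarith
    refine (hk w).trans ?_
    rw [mul_assoc]
    gcongr
    rcases le_or_gt (paraNorm w) 1 with h | h
    · rw [slabWeight_of_le h, show (3 : ℝ) = 1 / 4 + 11 / 4 by norm_num,
        ← pw_mul_pw (by norm_num) (by norm_num)]
      gcongr
      exact (pw_le_const (by norm_num) hw').trans le_self_add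
    · rw [slabWeight_of_lt h]
      exact le_mul_of_one_le_left' le_add_self
  · have hfin : ENNReal.ofReal l ^ (-(1 / 4) : ℝ) ≠ ⊤ :=
      ENNReal.rpow_ne_top_of_ne_zero (by simpa using hl) ENNReal.ofReal_ne_top
    rw [lintegral_const_mul' _ _ (by finiteness)]
    refine ENNReal.mul_ne_top (by finiteness) (ne_top_of_le_ne_top lintegral_slabWeight_lt_top.ne ?_)
    exact lintegral_mono_set fun z hz => hz.2

theorem measurePreserving_timeNeg :
    MeasurePreserving (fun z : SpaceTime => ((-z.1, z.2) : SpaceTime)) volume volume := by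
  rw [Measure.volume_eq_prod]
  exact (Measure.measurePreserving_neg volume).prod (MeasurePreserving.id volume)

theorem measurableEmbedding_timeNeg :
    MeasurableEmbedding (fun z : SpaceTime => ((-z.1, z.2) : SpaceTime)) :=
  (MeasurableEquiv.prodCongr (MeasurableEquiv.neg ℝ) (MeasurableEquiv.refl ℝ)).measurableEmbedding

/-- The set is invariant under t ↦ -t. Averaging over this reflection and integrating in x first
reduces the claim to the vanishing at fixed time. -/
theorem setIntegral_bareLogInt_heatDeriv {C : ℝ≥0} (hP : IsKer C 2 heatDeriv) {D : ℝ≥0}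
    (hQ : ∀ z, ‖corr heatDeriv heatDeriv z‖ₑ ≤ D * pw 1 z)
    (hF : ∀ z, ‖symConv heatDeriv (corr heatDeriv heatDeriv) z‖ₑ ≤ D) {M : ℝ≥0}
    (hM : ∀ w, ‖bareLogInt heatDeriv w‖ₑ ≤ M * pw 3 w) {l : ℝ} (hl : 0 < l) :
    ∫ w in {z : SpaceTime | l ^ 2 ≤ |z.1| ∧ |z.1| < 1}, bareLogInt heatDeriv w = 0 := by
  set A := {z : SpaceTime | l ^ 2 ≤ |z.1| ∧ |z.1| < 1} with hA
  have hi : IntegrableOn (bareLogInt heatDeriv) A := integrableOn_bareLogInt_slab hP.measurable hM hl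
  have hpre : (fun z : SpaceTime => ((-z.1, z.2) : SpaceTime)) ⁻¹' A = A := by
    ext z; simp [hA]
  have hi' : IntegrableOn (fun z => bareLogInt heatDeriv (-z.1, z.2)) A := by
    have := (measurePreserving_timeNeg.integrableOn_comp_preimage measurableEmbedding_timeNeg).mpr hi
    rwa [hpre] at this
  have h1 : ∫ w in A, bareLogInt heatDeriv (-w.1, w.2) = ∫ w in A, bareLogInt heatDeriv w := by
    have := measurePreserving_timeNeg.setIntegral_preimage_emb measurableEmbedding_timeNeg
      (bareLogInt heatDeriv) A
    rwa [hpre] at this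
  have hprod : A = {t : ℝ | l ^ 2 ≤ |t| ∧ |t| < 1} ×ˢ Set.univ := by
    ext z; simp [hA]
  have h2 : ∫ w in A, (bareLogInt heatDeriv w + bareLogInt heatDeriv (-w.1, w.2)) = 0 := by
    have hsum : IntegrableOn (fun w => bareLogInt heatDeriv w + bareLogInt heatDeriv (-w.1, w.2)) A :=
      hi.add hi'
    rw [hprod, Measure.volume_eq_prod] at hsum ⊢
    rw [setIntegral_prod _ hsum]
    have hmt1 : MeasurableSet {t : ℝ | l ^ 2 ≤ |t|} := measurableSet_le measurable_const (by fun_prop)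
    have hmt2 : MeasurableSet {t : ℝ | |t| < 1} := measurableSet_lt (by fun_prop) measurable_const
    have hmt : MeasurableSet {t : ℝ | l ^ 2 ≤ |t| ∧ |t| < 1} := hmt1.inter hmt2
    rw [setIntegral_congr_fun hmt (g := fun _ => (0 : ℝ))]
    · simp
    · intro t ht
      have ht0 : t ≠ 0 := by
        rintro rfl
        have : l ^ 2 ≤ |(0 : ℝ)| := ht.1
        rw [abs_zero] at this
        nlinarith [pow_pos hl 2]
      simp only [Measure.restrict_univ]
      exact integral_bareLogInt_heatDeriv_add hP hQ hF ht0
  rw [integral_add hi hi', h1] at h2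
  linarith

/-! ### Comparison of a cutoff kernel with the heat kernel at the origin. -/

theorem symConv_sub_left {C D : ℝ≥0} {k p Q : SpaceTime → ℝ} (hk : IsKer C 2 k) (hp : IsKer C 2 p)
    (mQ : Measurable Q) (hQ : ∀ z, ‖Q z‖ₑ ≤ D * pw 1 z) (w : SpaceTime) :
    symConv k Q w - symConv p Q w = symConv (fun z => k z - p z) Q w := by
  have h1 := integrable_symConv (by norm_num) (by norm_num) (by norm_num) (by norm_num)
    (by norm_num) hk mQ hQ w
  have h2 := integrable_symConv (by norm_num) (by norm_num) (by norm_num) (by norm_num)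
    (by norm_num) hp mQ hQ w
  unfold symConv
  rw [← mul_sub, ← integral_sub h1 h2]
  congr 2; ext z; ring

/-- Telescoping again: the kernel, its correlation and the symmetrised convolution have orders 2, 1
and 0, and the corresponding differences have orders 7/4, 3/4 and -1/4. Each term thus gains 1/4
over the critical order 3. -/
theorem exists_bareLogInt_sub_le (ρ : Mollifier) {C C' : ℝ≥0} {k p : SpaceTime → ℝ} (hk : IsKer C 2 k)
    (hp : IsKer C 2 p) (hr : IsKer C' (7 / 4) fun z => k z - p z) :
    ∃ M : ℝ≥0, ∀ w, w ≠ 0 → ‖bareLogInt k w - bareLogInt p w‖ₑ ≤ M * pw (11 / 4) w := by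
  obtain ⟨D, H⟩ := exists_logBounds ρ C
  obtain ⟨E1, hE1⟩ := exists_corr_sub_le (c := 7 / 4) (by norm_num) (by norm_num)
  have hcd0 := hE1 C C' k p hk.measurable hp.measurable hk.bound hp.bound hr.bound
  obtain ⟨B, hB⟩ : ∃ B : ℝ≥0, ∀ z, ‖corr k k z - corr p p z‖ₑ ≤ B * pw (3 / 4) z :=
    ⟨_, bound_of_bound_ne_zero (by norm_num) fun z hz => by
      have := hcd0 z hz; norm_num at this ⊢; exact this⟩
  obtain ⟨E2, hE2⟩ := exists_symConv_le (a := 2) (b := 3 / 4) (by norm_num) (by norm_num)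
    (by norm_num) (by norm_num) (by norm_num)
  obtain ⟨E3, hE3⟩ := exists_symConv_le (a := 7 / 4) (b := 1) (by norm_num) (by norm_num)
    (by norm_num) (by norm_num) (by norm_num)
  have mk := measurable_corr hk.measurable hk.measurable
  have mp := measurable_corr hp.measurable hp.measurable
  have hFH : ∀ w, ‖symConv k (corr k k) w - symConv p (corr p p) w‖ₑ ≤
      ((C * B * E2 + C' * D * E3 : ℝ≥0) : ℝ≥0∞) * pw (-(1 / 4)) w := by
    intro w
    have e1 := symConv_sub_right (a := 2) (b := 1) (b' := 1) (by norm_num) (by norm_num) (by norm_num)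
      (by norm_num) (by norm_num) (by norm_num) (by norm_num) (by norm_num) hk mk (H.corr_le k hk)
      mp (H.corr_le p hp) w
    have e2 := symConv_sub_left hk hp mp (H.corr_le p hp) w
    have e : symConv k (corr k k) w - symConv p (corr p p) w =
        symConv k (fun z => corr k k z - corr p p z) w +
          symConv (fun z => k z - p z) (corr p p) w := by
      rw [← e1, ← e2]; ring
    rw [e]
    refine (enorm_add_le _ _).trans ?_
    have b1 := hE2 C B k _ hk hB w
    have b2 := hE3 C' D _ _ hr (H.corr_le p hp) w
    rw [show (2 + 3 / 4 - 3 : ℝ) = -(1 / 4) by norm_num] at b1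
    rw [show (7 / 4 + 1 - 3 : ℝ) = -(1 / 4) by norm_num] at b2
    rw [ENNReal.coe_add, add_mul]
    exact add_le_add b1 b2
  set S := C * B * E2 + C' * D * E3 with hS
  refine ⟨3 * (B * D ^ 2) + 4 * (S * C * D + D * C' * D + D * C * B), fun w hw => ?_⟩
  set c := corr k k w with hc
  set d := corr p p w with hd
  set F := symConv k (corr k k) w with hF
  set G := symConv p (corr p p) w with hG
  have b1 : ‖c‖ₑ ≤ D * pw 1 w := H.corr_le k hk w
  have b2 : ‖d‖ₑ ≤ D * pw 1 w := H.corr_le p hp w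
  have b3 : ‖c - d‖ₑ ≤ B * pw (3 / 4) w := hB w
  have b4 : ‖G‖ₑ ≤ D := H.symConv_corr_le p hp w
  have b5 : ‖F - G‖ₑ ≤ S * pw (-(1 / 4)) w := hFH w
  have b6 := hk.bound w
  have b7 := hp.bound w
  have b8 : ‖k w - p w‖ₑ ≤ C' * pw (7 / 4) w := hr.bound w
  have e : bareLogInt k w - bareLogInt p w =
      (c - d) * c ^ 2 + (c - d) * (c * d) + (c - d) * d ^ 2 +
      4 * ((F - G) * (k w * c) + G * ((k w - p w) * c) + G * (p w * (c - d))) := by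
    simp only [bareLogInt, logInt, ← hc, ← hd, ← hF, ← hG]; ring
  rw [e]
  have h1 : ‖(c - d) * c ^ 2 + (c - d) * (c * d) + (c - d) * d ^ 2 +
      4 * ((F - G) * (k w * c) + G * ((k w - p w) * c) + G * (p w * (c - d)))‖ₑ ≤
      (B * pw (3 / 4) w) * (D * pw 1 w) ^ 2 + (B * pw (3 / 4) w) * ((D * pw 1 w) * (D * pw 1 w)) +
        (B * pw (3 / 4) w) * (D * pw 1 w) ^ 2 +
      4 * ((S * pw (-(1 / 4)) w) * ((C * pw 2 w) * (D * pw 1 w)) +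
        D * ((C' * pw (7 / 4) w) * (D * pw 1 w)) + D * ((C * pw 2 w) * (B * pw (3 / 4) w))) := by
    refine (enorm_add_le _ _).trans (add_le_add ?_ ?_)
    · refine (enorm_add_le _ _).trans (add_le_add ((enorm_add_le _ _).trans (add_le_add ?_ ?_)) ?_)
      · rw [enorm_mul, enorm_pow]; gcongr
      · rw [enorm_mul, enorm_mul]; gcongr
      · rw [enorm_mul, enorm_pow]; gcongr
    · rw [enorm_mul, show ‖(4 : ℝ)‖ₑ = 4 by rw [Real.enorm_of_nonneg (by norm_num)]; norm_num]
      gcongr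
      refine (enorm_add_le _ _).trans (add_le_add ((enorm_add_le _ _).trans (add_le_add ?_ ?_)) ?_)
      · rw [enorm_mul, enorm_mul]; gcongr
      · rw [enorm_mul, enorm_mul]; gcongr
      · rw [enorm_mul, enorm_mul]; gcongr
  have e1 : pw (3 / 4) w * (pw 1 w * pw 1 w) = pw (11 / 4) w := by
    simp only [pw_mul_pw_of_ne hw]; norm_num
  have e2 : pw (-(1 / 4)) w * (pw 2 w * pw 1 w) = pw (11 / 4) w := by
    simp only [pw_mul_pw_of_ne hw]; norm_num
  have e3 : pw (7 / 4) w * pw 1 w = pw (11 / 4) w := by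
    simp only [pw_mul_pw_of_ne hw]; norm_num
  have e4 : pw 2 w * pw (3 / 4) w = pw (11 / 4) w := by
    simp only [pw_mul_pw_of_ne hw]; norm_num
  refine h1.trans (le_of_eq ?_)
  calc _ = 3 * (B * D ^ 2) * (pw (3 / 4) w * (pw 1 w * pw 1 w)) +
        4 * (S * C * D * (pw (-(1 / 4)) w * (pw 2 w * pw 1 w)) + D * C' * D * (pw (7 / 4) w * pw 1 w) +
          D * C * B * (pw 2 w * pw (3 / 4) w)) := by ring
    _ = _ := by
      rw [e1, e2, e3, e4]
      push_cast
      ring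

theorem tendsto_indicator_annulus {f : SpaceTime → ℝ} {w : SpaceTime} (hw : w.1 ≠ 0) :
    Tendsto (fun l : ℝ => {z : SpaceTime | l ^ 2 ≤ |z.1|}.indicator f w) (𝓝[>] 0) (𝓝 (f w)) := by
  refine tendsto_const_nhds.congr' ?_
  have h : ∀ᶠ l : ℝ in 𝓝 0, l ^ 2 < |w.1| := by
    have : Tendsto (fun l : ℝ => l ^ 2) (𝓝 0) (𝓝 0) := by
      simpa using (continuous_pow 2).tendsto (0 : ℝ)
    exact this.eventually_lt_const (by positivity)
  filter_upwards [h.filter_mono nhdsWithin_le_nhds] with l hl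
  rw [Set.indicator_of_mem (show w ∈ {z : SpaceTime | l ^ 2 ≤ |z.1|} from hl.le)]

theorem ae_fst_ne_zero : ∀ᵐ z : SpaceTime, z.1 ≠ 0 := by
  rw [Measure.volume_eq_prod]
  refine Measure.quasiMeasurePreserving_fst.ae (p := fun t : ℝ => t ≠ 0) ?_
  exact Measure.ae_ne volume 0

/-- The part |t| ≥ 1 does not depend on l. On l² ≤ |t| < 1 the heat kernel expression integrates to
0 and may be subtracted for free; the difference is integrable on the whole slab, so the inner
cutoff can be removed. -/
theorem exists_tendsto_setIntegral_bareLogInt (ρ : Mollifier) (K : CutoffKernel) : ∃ c : ℝ,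
    Tendsto (fun l : ℝ => ∫ w in {z : SpaceTime | l ^ 2 ≤ |z.1|}, bareLogInt K.deriv w)
      (𝓝[>] 0) (𝓝 c) := by
  obtain ⟨C1, h1⟩ := K.exists_isKer_deriv
  obtain ⟨C2, h2⟩ := K.exists_isKer_heatDeriv
  obtain ⟨C', hr⟩ := K.exists_isKer_deriv_sub
  have hk := h1.mono (le_max_left C1 C2)
  have hp := h2.mono (le_max_right C1 C2)
  set C := max C1 C2
  obtain ⟨D, H⟩ := exists_logBounds ρ C
  obtain ⟨M, hM⟩ := exists_bareLogInt_sub_le ρ hk hp hr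
  set M0 : ℝ≥0 := D ^ 3 + 4 * (D * (C * D)) with hM0
  have bk : ∀ w, ‖bareLogInt K.deriv w‖ₑ ≤ M0 * pw 3 w := fun w => by
    have := H.logInt_corr_le hk w
    rw [hM0]; push_cast; exact this
  have bp : ∀ w, ‖bareLogInt heatDeriv w‖ₑ ≤ M0 * pw 3 w := fun w => by
    have := H.logInt_corr_le hp w
    rw [hM0]; push_cast; exact this
  have mk := measurable_bareLogInt hk.measurable
  have mp := measurable_bareLogInt hp.measurable
  have hms : ∀ s : ℝ, MeasurableSet {z : SpaceTime | s ≤ |z.1|} :=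
    fun s => measurableSet_le measurable_const (by fun_prop)
  have hdiff : ∀ w, w ≠ 0 → ‖bareLogInt K.deriv w - bareLogInt heatDeriv w‖ₑ ≤
      ((M + 2 * M0 : ℝ≥0) : ℝ≥0∞) * slabWeight w := by
    intro w hw
    rcases le_or_gt (paraNorm w) 1 with h | h
    · rw [slabWeight_of_le h]
      refine (hM w hw).trans ?_
      gcongr
      exact le_self_add
    · rw [slabWeight_of_lt h]
      refine (enorm_sub_le).trans ((add_le_add (bk w) (bp w)).trans ?_)
      rw [← two_mul, ← mul_assoc]
      gcongr
      push_cast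
      exact le_add_self
  have hfin : ∫⁻ w in {z : SpaceTime | |z.1| < 1}, ((M + 2 * M0 : ℝ≥0) : ℝ≥0∞) * slabWeight w ≠ ⊤ := by
    rw [lintegral_const_mul' _ _ (by finiteness)]
    exact ENNReal.mul_ne_top (by finiteness) lintegral_slabWeight_lt_top.ne
  have T : Tendsto (fun l : ℝ => ∫ w in {z : SpaceTime | |z.1| < 1},
      {z : SpaceTime | l ^ 2 ≤ |z.1|}.indicator
        (fun w => bareLogInt K.deriv w - bareLogInt heatDeriv w) w) (𝓝[>] 0)
      (𝓝 (∫ w in {z : SpaceTime | |z.1| < 1}, (bareLogInt K.deriv w - bareLogInt heatDeriv w))) := by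
    refine tendsto_integral_of_enorm_le (measurable_slabWeight.const_mul _) hfin ?_ ?_ ?_
    · exact Eventually.of_forall fun l => ((mk.sub mp).indicator (hms _)).aestronglyMeasurable
    · refine Eventually.of_forall fun l => ?_
      filter_upwards [ae_restrict_of_ae ae_ne_zero] with w hw
      exact (enorm_indicator_le_enorm_self _ _).trans (hdiff w hw)
    · filter_upwards [ae_restrict_of_ae ae_fst_ne_zero] with w hw
      exact tendsto_indicator_annulus hw
  refine ⟨_, (T.const_add (∫ w in {z : SpaceTime | 1 ≤ |z.1|}, bareLogInt K.deriv w)).congr' ?_⟩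
  have h01 : Set.Ioo (0 : ℝ) 1 ∈ 𝓝[>] (0 : ℝ) := Ioo_mem_nhdsGT one_pos
  filter_upwards [h01] with l hl
  have hl0 : 0 < l := hl.1
  have ik := integrableOn_bareLogInt_slab hk.measurable bk hl0
  have ip := integrableOn_bareLogInt_slab hp.measurable bp hl0
  have ifar : IntegrableOn (bareLogInt K.deriv) {z : SpaceTime | 1 ≤ |z.1|} :=
    H.integrableOn_logInt_corr hk (R := 1) fun z hz => K.deriv_of_one_lt hz
  have hset : {z : SpaceTime | l ^ 2 ≤ |z.1|} =
      {z : SpaceTime | 1 ≤ |z.1|} ∪ {z : SpaceTime | l ^ 2 ≤ |z.1| ∧ |z.1| < 1} := by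
    ext z
    have hl1 : l ^ 2 ≤ 1 := by nlinarith [hl.1, hl.2]
    simp only [Set.mem_ofPred_eq, Set.mem_union]
    constructor
    · intro h
      rcases le_or_gt 1 |z.1| with h' | h'
      · exact Or.inl h'
      · exact Or.inr ⟨h, h'⟩
    · rintro (h | h)
      · exact hl1.trans h
      · exact h.1
  have hdisj : Disjoint {z : SpaceTime | 1 ≤ |z.1|} {z : SpaceTime | l ^ 2 ≤ |z.1| ∧ |z.1| < 1} := by
    rw [Set.disjoint_left]
    intro z hz hz'
    exact absurd hz'.2 (not_lt.mpr hz)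
  have hmA : MeasurableSet {z : SpaceTime | l ^ 2 ≤ |z.1| ∧ |z.1| < 1} :=
    (hms _).inter (measurableSet_slab 1)
  have hinter : {z : SpaceTime | |z.1| < 1} ∩ {z : SpaceTime | l ^ 2 ≤ |z.1|} =
      {z : SpaceTime | l ^ 2 ≤ |z.1| ∧ |z.1| < 1} := by
    ext z; simp [and_comm]
  rw [setIntegral_indicator (hms _), hinter, integral_sub ik ip,
    setIntegral_bareLogInt_heatDeriv hp (H.corr_le _ hp) (H.symConv_corr_le _ hp) bp hl0, sub_zero,
    hset, setIntegral_union hdisj hmA ifar ik]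

theorem exists_tendsto_integral_logInt (ρ : Mollifier) (K : CutoffKernel) : ∃ c : ℝ, Tendsto
    (fun l => ∫ w, logInt (scaleKer l K.deriv) (ρ.cov (scaleKer l K.deriv)) w) (𝓝[>] 0) (𝓝 c) := by
  obtain ⟨c1, h1⟩ := exists_tendsto_logInt_sub ρ K
  obtain ⟨c2, h2⟩ := exists_tendsto_setIntegral_bareLogInt ρ K
  refine ⟨c1 + c2, (h1.add h2).congr' ?_⟩
  filter_upwards [self_mem_nhdsWithin] with l hl
  rw [integral_logInt_corr_scale hl, bareLogInt]
  ring

/-! ### Scaling of the regularised kernel -/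

/-- Zooming in by ε turns mollification at scale ε into mollification at scale 1, leaving K' as the
only object that depends on ε. -/
theorem scaleKer_epsKernel (ρ : Mollifier) (K : CutoffKernel) {ε : ℝ} (hε : 0 < ε) :
    scaleKer ε (epsKernel ρ K ε) = ρ.moll (scaleKer ε K.deriv) := by
  funext z
  have h := integral_comp_dil hε fun u => ρ.scaled ε u * K.deriv (dil ε z - u)
  have h' : ∫ u, ρ.scaled ε u * K.deriv (dil ε z - u) =
      ε ^ 3 * ∫ v, ρ.scaled ε (dil ε v) * K.deriv (dil ε z - dil ε v) := by
    rw [h]; field_simp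
  rw [scaleKer, epsKernel, conv_apply, h', Mollifier.moll, conv_apply, ← integral_const_mul,
    ← integral_const_mul]
  congr 1; ext v
  have hv : ρ.scaled ε (dil ε v) = (ε ^ 3)⁻¹ * ρ.toFun v := by
    rw [Mollifier.scaled]
    congr 2
    ext <;> simp [dil] <;> field_simp
  rw [hv, ← dil_sub, scaleKer]
  field_simp

/-- The covariance of the regularised linearised solution. -/
def epsCov (ρ : Mollifier) (K : CutoffKernel) (ε : ℝ) : SpaceTime → ℝ :=
  corr (epsKernel ρ K ε) (epsKernel ρ K ε)

theorem cov_scaleKer (ρ : Mollifier) (K : CutoffKernel) {ε : ℝ} (hε : 0 < ε) :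
    ρ.cov (scaleKer ε K.deriv) = fun z => ε * epsCov ρ K ε (dil ε z) := by
  funext z
  rw [Mollifier.cov, ← scaleKer_epsKernel ρ K hε, corr_scale hε, epsCov]

theorem Mollifier.continuous_scaled (ρ : Mollifier) (ε : ℝ) : Continuous (ρ.scaled ε) := by
  unfold Mollifier.scaled
  have := ρ.continuous
  fun_prop

theorem Mollifier.hasCompactSupport_scaled (ρ : Mollifier) (ε : ℝ) :
    HasCompactSupport (ρ.scaled ε) := by
  have := (ρ.hasCompactSupport_test ε 0).comp_homeomorph (Homeomorph.neg SpaceTime)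
  convert this using 1
  ext z
  simp

theorem Mollifier.integrable_scaled (ρ : Mollifier) (ε : ℝ) : Integrable (ρ.scaled ε) :=
  (ρ.continuous_scaled ε).integrable_of_hasCompactSupport (ρ.hasCompactSupport_scaled ε)

/-! ### Boundedness, integrability and covariance of the regularised kernel. -/

section EpsKernel

variable (ρ : Mollifier) (K : CutoffKernel) (ε : ℝ)

theorem integrable_epsKernel : Integrable (epsKernel ρ K ε) :=
  (ρ.integrable_scaled ε).integrable_convolution _ K.integrable_deriv

theorem continuous_epsKernel : Continuous (epsKernel ρ K ε) :=
  (ρ.hasCompactSupport_scaled ε).continuous_convolution_left _ (ρ.continuous_scaled ε)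
    K.integrable_deriv.locallyIntegrable

theorem measurable_epsKernel : Measurable (epsKernel ρ K ε) :=
  (continuous_epsKernel ρ K ε).measurable

theorem exists_epsKernel_le : ∃ B : ℝ, ∀ z, ‖epsKernel ρ K ε z‖ ≤ B := by
  obtain ⟨M, hM⟩ := (ρ.hasCompactSupport_scaled ε).exists_bound_of_continuous (ρ.continuous_scaled ε)
  refine ⟨M * ∫ u, ‖K.deriv u‖, fun z => ?_⟩
  rw [epsKernel, conv_apply]
  refine (norm_integral_le_integral_norm _).trans ?_
  rw [← integral_sub_left_eq_self (fun u => ‖K.deriv u‖) volume z, ← integral_const_mul]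
  refine integral_mono_of_nonneg (Eventually.of_forall fun u => norm_nonneg _) ?_
    (Eventually.of_forall fun u => ?_)
  · exact (K.integrable_deriv.norm.comp_sub_left z).const_mul M
  · simp only [norm_mul]
    gcongr
    exact hM u

theorem measurable_epsCov : Measurable (epsCov ρ K ε) :=
  measurable_corr (measurable_epsKernel ρ K ε) (measurable_epsKernel ρ K ε)

theorem epsCov_neg (z : SpaceTime) : epsCov ρ K ε (-z) = epsCov ρ K ε z := corr_neg _ z

/-- A noise vertex joined to two points by regularised edges integrates to the covariance of the
field at these points. -/
theorem integral_epsKernel_mul (z w : SpaceTime) :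
    ∫ u, epsKernel ρ K ε (z - u) * epsKernel ρ K ε (w - u) = epsCov ρ K ε (z - w) := by
  rw [epsCov, corr, ← integral_sub_left_eq_self (fun u => epsKernel ρ K ε (z - w + u) * _) volume w]
  congr 1; ext u
  rw [show z - w + (w - u) = z - u by abel]

theorem exists_lintegral_epsKernel_mul_le : ∃ M : ℝ≥0, ∀ z w : SpaceTime,
    ∫⁻ u, ‖epsKernel ρ K ε (z - u) * epsKernel ρ K ε (w - u)‖ₑ ≤ M := by
  obtain ⟨B, hB⟩ := exists_epsKernel_le ρ K ε
  have hB0 : 0 ≤ B := (norm_nonneg _).trans (hB 0)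
  lift B to ℝ≥0 using hB0
  have hi := (integrable_epsKernel ρ K ε).2
  rw [hasFiniteIntegral_iff_enorm] at hi
  refine ⟨B * (∫⁻ u, ‖epsKernel ρ K ε u‖ₑ).toNNReal, fun z w => ?_⟩
  rw [ENNReal.coe_mul, ENNReal.coe_toNNReal hi.ne,
    ← lintegral_sub_left_eq_self (fun u => ‖epsKernel ρ K ε u‖ₑ) w,
    ← lintegral_const_mul' _ _ ENNReal.coe_ne_top]
  refine lintegral_mono fun u => ?_
  rw [enorm_mul]
  gcongr
  have := hB (z - u)
  rw [← ofReal_norm]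
  exact (ENNReal.ofReal_le_ofReal this).trans (by simp)

end EpsKernel

/-! ### Fubini for the graphs -/

theorem integrable_triA {k Q : SpaceTime → ℝ} (hk : Integrable k) (mQ : Measurable Q) {B : ℝ≥0}
    (hQ : ∀ z, ‖Q z‖ ≤ B) (a b c : ℕ) : Integrable (triA k Q a b c) := by
  have h := hk.mul_prod hk
  unfold triA
  simp_rw [mul_comm _ (Q _ ^ a * Q _ ^ b * Q _ ^ c)]
  refine h.bdd_mul (c := B ^ a * B ^ b * B ^ c) (by fun_prop) (Eventually.of_forall fun p => ?_)
  rw [norm_mul, norm_mul, norm_pow, norm_pow, norm_pow]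
  gcongr <;> exact hQ _

/-- With the difference w of the two vertices as a new variable, the product of the two kernel edges
integrates to their correlation at w. -/
theorem integral_triA_zero_zero {k Q : SpaceTime → ℝ} (hk : Integrable k) (mQ : Measurable Q) {B : ℝ≥0}
    (hQ : ∀ z, ‖Q z‖ ≤ B) (c : ℕ) : Integrable (fun w => corr k k w * Q w ^ c) ∧
      ∫ p, triA k Q 0 0 c p = ∫ w, corr k k w * Q w ^ c := by
  have hi := integrable_triA hk mQ hQ 0 0 c
  have he : MeasurePreserving (fun p : SpaceTime × SpaceTime => (p.1 + p.2, p.2)) volume volume := by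
    have h1 : MeasurePreserving (fun p : SpaceTime × SpaceTime => (p.1, p.2 + p.1))
        volume volume := by
      refine MeasurePreserving.skew_product (g := fun x y : SpaceTime => y + x)
        (MeasurePreserving.id volume) (by unfold Function.uncurry; fun_prop) ?_
      exact Eventually.of_forall fun x => (measurePreserving_add_right volume x).map_eq
    exact Measure.measurePreserving_swap.comp (h1.comp Measure.measurePreserving_swap)
  have hi' := (he.integrable_comp hi.aestronglyMeasurable).mpr hi
  have hfun : (triA k Q 0 0 c ∘ fun p : SpaceTime × SpaceTime => (p.1 + p.2, p.2)) =
      fun p => k (p.1 + p.2) * k p.2 * Q p.1 ^ c := by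
    funext p
    simp [triA]
  rw [hfun] at hi'
  have e : ∀ w, ∫ z, k (w + z) * k z * Q w ^ c = corr k k w * Q w ^ c := fun w => by
    rw [integral_mul_const, corr]
  refine ⟨?_, ?_⟩
  · have := hi'.integral_prod_left
    simpa only [e] using this
  · have h2 : ∫ p, triA k Q 0 0 c p =
        ∫ p, (triA k Q 0 0 c ∘ fun p : SpaceTime × SpaceTime => (p.1 + p.2, p.2)) p := by
      conv_lhs => rw [← he.map_eq]
      rw [integral_map he.measurable.aemeasurable (by rw [he.map_eq]; exact hi.aestronglyMeasurable)]
      rfl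
    rw [h2, hfun]
    refine (integral_prod _ hi').trans ?_
    simp only [e]

/-- Each of the two kernels contributes l², each covariance contributes l, and the Jacobian of two
vertices is l⁻⁶. -/
theorem integral_triA_scale {k Q : SpaceTime → ℝ} {l : ℝ} (hl : 0 < l) (a b c : ℕ) :
    ∫ p, triA (scaleKer l k) (fun z => l * Q (dil l z)) a b c p =
      l ^ (a + b + c + 4) * (l ^ 6)⁻¹ * ∫ p, triA k Q a b c p := by
  rw [mul_assoc, ← integral_prod_comp_dil hl, ← integral_const_mul]
  congr 1; ext p
  simp only [triA, scaleKer, dil_sub]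
  ring

theorem integral_triB_scale {k Q : SpaceTime → ℝ} {l : ℝ} (hl : 0 < l) (a b c : ℕ) :
    ∫ p, triB (scaleKer l k) (fun z => l * Q (dil l z)) a b c p =
      l ^ (a + b + c + 4) * (l ^ 6)⁻¹ * ∫ p, triB k Q a b c p := by
  rw [mul_assoc, ← integral_prod_comp_dil hl, ← integral_const_mul]
  congr 1; ext p
  simp only [triB, scaleKer, dil_add]
  ring

/-- Given the kernel vertices, the two noise vertices are integrated independently. Uniform bounds
on the fibre integrals leave absolute convergence to the factor h alone. -/
theorem integral_fiber_mul {α β : Type*} [MeasurableSpace α] [MeasurableSpace β] {μ : Measure α}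
    {ν : Measure β} [SFinite μ] [SFinite ν] {h : α → ℝ} {f g : α → β → ℝ} (mh : Measurable h)
    (hh : Integrable h μ) (mf : Measurable (Function.uncurry f)) (mg : Measurable (Function.uncurry g))
    {M : ℝ≥0} (hf : ∀ p, ∫⁻ z, ‖f p z‖ₑ ∂ν ≤ M) (hg : ∀ p, ∫⁻ z, ‖g p z‖ₑ ∂ν ≤ M) :
    Integrable (fun q : α × β × β => h q.1 * (f q.1 q.2.1 * g q.1 q.2.2)) (μ.prod (ν.prod ν)) ∧
      ∫ q, h q.1 * (f q.1 q.2.1 * g q.1 q.2.2) ∂(μ.prod (ν.prod ν)) =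
        ∫ p, h p * ((∫ z, f p z ∂ν) * ∫ z, g p z ∂ν) ∂μ := by
  have mf' : Measurable fun q : α × β × β => f q.1 q.2.1 :=
    mf.comp (measurable_fst.prodMk (measurable_fst.comp measurable_snd))
  have mg' : Measurable fun q : α × β × β => g q.1 q.2.2 :=
    mg.comp (measurable_fst.prodMk (measurable_snd.comp measurable_snd))
  have m : Measurable fun q : α × β × β => h q.1 * (f q.1 q.2.1 * g q.1 q.2.2) :=
    (mh.comp measurable_fst).mul (mf'.mul mg')
  have hi : Integrable (fun q : α × β × β => h q.1 * (f q.1 q.2.1 * g q.1 q.2.2))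
      (μ.prod (ν.prod ν)) := by
    refine ⟨m.aestronglyMeasurable, ?_⟩
    rw [hasFiniteIntegral_iff_enorm, lintegral_prod _ m.enorm.aemeasurable]
    have hh2 := hh.2
    rw [hasFiniteIntegral_iff_enorm] at hh2
    calc _ ≤ ∫⁻ p, ‖h p‖ₑ * (M * M) ∂μ := by
          refine lintegral_mono fun p => ?_
          simp only [enorm_mul]
          rw [lintegral_const_mul' _ _ enorm_ne_top]
          gcongr
          have := lintegral_prod_mul (μ := ν) (ν := ν) (f := fun z => ‖f p z‖ₑ)
            (g := fun z => ‖g p z‖ₑ)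
            (mf.comp measurable_prodMk_left).enorm.aemeasurable
            (mg.comp measurable_prodMk_left).enorm.aemeasurable
          rw [this]
          exact mul_le_mul' (hf p) (hg p)
      _ < ⊤ := by
          rw [lintegral_mul_const' _ _ (by finiteness)]
          exact ENNReal.mul_lt_top hh2 (by finiteness)
  refine ⟨hi, ?_⟩
  rw [integral_prod _ hi]
  congr 1; ext p
  simp only
  rw [integral_const_mul]
  congr 1
  exact integral_prod_mul (f p) (g p)

theorem integral_comp_of_measurePreserving {α β : Type*} [MeasurableSpace α] [MeasurableSpace β]
    {μ : Measure α} {ν : Measure β} {e : α → β} (he : MeasurePreserving e μ ν) {f : β → ℝ}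
    (hf : Measurable f) : ∫ a, f (e a) ∂μ = ∫ b, f b ∂ν := by
  rw [← he.map_eq, integral_map he.measurable.aemeasurable hf.aestronglyMeasurable]

/-- Both noise vertices z₃ and z₄ connect z₁ with z₂, so they produce the square of the covariance
at z₁ - z₂. -/
theorem C3Integrand_integrable_and_eq (ρ : Mollifier) (K : CutoffKernel) (ε : ℝ) :
    Integrable (C3Integrand ρ K ε) ∧ C3 ρ K ε = ∫ p, triA K.deriv (epsCov ρ K ε) 0 0 2 p := by
  set A := epsKernel ρ K ε with hA
  have mA := measurable_epsKernel ρ K ε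
  have mk := K.measurable_deriv
  obtain ⟨M, hM⟩ := exists_lintegral_epsKernel_mul_le ρ K ε
  have hh : Integrable fun p : SpaceTime × SpaceTime => K.deriv (-p.1) * K.deriv (-p.2) :=
    K.integrable_deriv.comp_neg.mul_prod K.integrable_deriv.comp_neg
  have mf : Measurable (Function.uncurry fun (p : SpaceTime × SpaceTime) (z : SpaceTime) =>
      A (p.1 - z) * A (p.2 - z)) := by
    unfold Function.uncurry; fun_prop
  obtain ⟨h1, h2⟩ := integral_fiber_mul (ν := volume) (by fun_prop) hh mf mf
    (fun p => hM p.1 p.2) (fun p => hM p.1 p.2)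
  have he : MeasurePreserving (MeasurableEquiv.prodAssoc.symm :
      SpaceTime × SpaceTime × SpaceTime × SpaceTime → (SpaceTime × SpaceTime) × SpaceTime × SpaceTime)
      volume volume := (measurePreserving_prodAssoc volume volume volume).symm
  have e : C3Integrand ρ K ε = (fun q : (SpaceTime × SpaceTime) × SpaceTime × SpaceTime =>
      K.deriv (-q.1.1) * K.deriv (-q.1.2) * (A (q.1.1 - q.2.1) * A (q.1.2 - q.2.1) *
        (A (q.1.1 - q.2.2) * A (q.1.2 - q.2.2)))) ∘ MeasurableEquiv.prodAssoc.symm := by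
    funext z
    simp only [C3Integrand, arrow, Function.comp, MeasurableEquiv.prodAssoc, MeasurableEquiv.symm_mk,
      MeasurableEquiv.coe_mk, Equiv.prodAssoc_symm_apply, zero_sub, hA]
    ring
  have m : Measurable (fun q : (SpaceTime × SpaceTime) × SpaceTime × SpaceTime =>
      K.deriv (-q.1.1) * K.deriv (-q.1.2) * (A (q.1.1 - q.2.1) * A (q.1.2 - q.2.1) *
        (A (q.1.1 - q.2.2) * A (q.1.2 - q.2.2)))) := by fun_prop
  refine ⟨?_, ?_⟩
  · rw [e]
    exact (he.integrable_comp m.aestronglyMeasurable).mpr h1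
  · rw [C3, e]
    simp only [Function.comp_def]
    rw [integral_comp_of_measurePreserving he m]
    refine h2.trans ?_
    simp only [hA, integral_epsKernel_mul]
    have hn : MeasurePreserving (fun p : SpaceTime × SpaceTime => (-p.1, -p.2)) volume volume :=
      (Measure.measurePreserving_neg volume).prod (Measure.measurePreserving_neg volume)
    have mt : Measurable (triA K.deriv (epsCov ρ K ε) 0 0 2) :=
      measurable_triA mk (measurable_epsCov ρ K ε) 0 0 2
    rw [← integral_comp_of_measurePreserving hn mt]
    congr 1; ext p
    have : -p.1 - -p.2 = -(p.1 - p.2) := by abel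
    simp only [triA, this, epsCov_neg]
    ring

/-- The noise vertex z₂ connects 0 with z₃, and z₄ connects z₁ with z₃; the kernel edges form the
chain 0, z₁, z₃. -/
theorem C2Integrand_integrable_and_eq (ρ : Mollifier) (K : CutoffKernel) (ε : ℝ) :
    Integrable (C2Integrand ρ K ε) ∧ C2 ρ K ε = ∫ p, triB K.deriv (epsCov ρ K ε) 0 1 1 p := by
  set A := epsKernel ρ K ε with hA
  have mA := measurable_epsKernel ρ K ε
  have mk := K.measurable_deriv
  have mQ := measurable_epsCov ρ K ε
  obtain ⟨M, hM⟩ := exists_lintegral_epsKernel_mul_le ρ K ε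
  have hh : Integrable fun p : SpaceTime × SpaceTime => K.deriv (-p.1) * K.deriv (p.1 - p.2) := by
    have := (K.integrable_deriv.comp_neg.convolution_integrand (ContinuousLinearMap.mul ℝ ℝ)
      K.integrable_deriv.comp_neg).swap
    refine this.congr (Eventually.of_forall fun p => ?_)
    simp
  have mf : Measurable (Function.uncurry fun (p : SpaceTime × SpaceTime) (z : SpaceTime) =>
      A (0 - z) * A (p.2 - z)) := by
    unfold Function.uncurry; fun_prop
  have mg : Measurable (Function.uncurry fun (p : SpaceTime × SpaceTime) (z : SpaceTime) =>
      A (p.1 - z) * A (p.2 - z)) := by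
    unfold Function.uncurry; fun_prop
  obtain ⟨h1, h2⟩ := integral_fiber_mul (ν := volume) (by fun_prop) hh mf mg
    (fun p => hM 0 p.2) (fun p => hM p.1 p.2)
  have hperm : MeasurePreserving (fun z : SpaceTime × SpaceTime × SpaceTime => (z.2.1, z.1, z.2.2))
      volume volume :=
    (measurePreserving_prodAssoc volume volume volume).comp
      ((Measure.measurePreserving_swap.prod (MeasurePreserving.id volume)).comp
        (measurePreserving_prodAssoc volume volume volume).symm)
  have he : MeasurePreserving (fun z : SpaceTime × SpaceTime × SpaceTime × SpaceTime =>
      (((z.1, z.2.2.1), (z.2.1, z.2.2.2)) : (SpaceTime × SpaceTime) × SpaceTime × SpaceTime))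
      volume volume :=
    (measurePreserving_prodAssoc volume volume volume).symm.comp
      ((MeasurePreserving.id volume).prod hperm)
  have e : C2Integrand ρ K ε = (fun q : (SpaceTime × SpaceTime) × SpaceTime × SpaceTime =>
      K.deriv (-q.1.1) * K.deriv (q.1.1 - q.1.2) * (A (0 - q.2.1) * A (q.1.2 - q.2.1) *
        (A (q.1.1 - q.2.2) * A (q.1.2 - q.2.2)))) ∘ (fun z : SpaceTime × SpaceTime × SpaceTime × SpaceTime =>
      (((z.1, z.2.2.1), (z.2.1, z.2.2.2)) : (SpaceTime × SpaceTime) × SpaceTime × SpaceTime)) := by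
    funext z
    simp only [C2Integrand, arrow, Function.comp, zero_sub, hA]
    ring
  have m : Measurable (fun q : (SpaceTime × SpaceTime) × SpaceTime × SpaceTime =>
      K.deriv (-q.1.1) * K.deriv (q.1.1 - q.1.2) * (A (0 - q.2.1) * A (q.1.2 - q.2.1) *
        (A (q.1.1 - q.2.2) * A (q.1.2 - q.2.2)))) := by fun_prop
  refine ⟨?_, ?_⟩
  · rw [e]
    exact (he.integrable_comp m.aestronglyMeasurable).mpr h1
  · rw [C2, e]
    simp only [Function.comp_def]
    rw [integral_comp_of_measurePreserving he m]
    refine h2.trans ?_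
    simp only [hA, integral_epsKernel_mul]
    simp only [zero_sub, epsCov_neg]
    -- The new variables are the two kernel edges -z₁ and z₁ - z₃; up to sign, z₃ is their sum.
    have hn : MeasurePreserving (fun p : SpaceTime × SpaceTime => (-p.1, p.1 - p.2)) volume volume := by
      have h1 : MeasurePreserving (fun p : SpaceTime × SpaceTime => (p.1, p.1 - p.2))
          volume volume := by
        refine MeasurePreserving.skew_product (g := fun x y : SpaceTime => x - y)
          (MeasurePreserving.id volume) (by unfold Function.uncurry; fun_prop) ?_
        exact Eventually.of_forall fun x => (Measure.measurePreserving_sub_left volume x).map_eq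
      exact ((Measure.measurePreserving_neg volume).prod (MeasurePreserving.id volume)).comp h1
    have mt : Measurable (triB K.deriv (epsCov ρ K ε) 0 1 1) := measurable_triB mk mQ 0 1 1
    rw [← integral_comp_of_measurePreserving hn mt]
    congr 1; ext p
    have : -p.1 + (p.1 - p.2) = -p.2 := by abel
    simp only [triB, this, epsCov_neg]
    ring

/-- Both graphs contain two covariances, so their scaling factor is ε⁶ ε⁻⁶ = 1, and both constants
may be computed with the rescaled kernel. -/
theorem C3_add_four_C2 (ρ : Mollifier) (K : CutoffKernel) {ε : ℝ} (hε : 0 < ε) :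
    C3 ρ K ε + 4 * C2 ρ K ε =
      ∫ w, logInt (scaleKer ε K.deriv) (ρ.cov (scaleKer ε K.deriv)) w := by
  obtain ⟨C, -, hC⟩ := K.exists_isKer_scaleKer
  have hk := hC ε hε
  obtain ⟨D, H⟩ := exists_logBounds ρ C
  set k := scaleKer ε K.deriv with hkdef
  set Q := ρ.cov k with hQdef
  have mk := hk.measurable
  have mQ : Measurable Q := ρ.measurable_cov mk
  have ik : Integrable k := integrable_scaleKer K.integrable_deriv hε
  have hQ : ∀ z, ‖Q z‖ ≤ D := fun z => by
    have := (H.cov_le k hk z).trans (mul_le_of_le_one_right' (qw_le_one z))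
    rw [← ofReal_norm] at this
    simpa using this
  have hF : ∀ z, ‖symConv k Q z‖ ≤ D := fun z => by
    have := H.symConv_cov_le k hk z
    rw [← ofReal_norm] at this
    simpa using this
  have e3 : C3 ρ K ε = ∫ w, corr k k w * Q w ^ 2 := by
    rw [(C3Integrand_integrable_and_eq ρ K ε).2, ← (integral_triA_zero_zero ik mQ hQ 2).2, hQdef, hkdef,
      cov_scaleKer ρ K hε, integral_triA_scale hε]
    field_simp
  have e2 : C2 ρ K ε = ∫ w, symConv k Q w * (k w * Q w ^ 1) := by
    rw [(C2Integrand_integrable_and_eq ρ K ε).2, ← integral_triB_one hk ik mQ (H.cov_le k hk)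
      (ρ.cov_reflect hk.odd) (ρ.cov_neg k) 1]
    rw [hQdef, hkdef, cov_scaleKer ρ K hε, integral_triB_scale hε]
    field_simp
  have i1 := (integral_triA_zero_zero ik mQ hQ 2).1
  have i2 : Integrable fun w => symConv k Q w * (k w * Q w) := by
    refine Integrable.bdd_mul (c := D) ?_ (measurable_symConv mk mQ).aestronglyMeasurable
      (Eventually.of_forall hF)
    exact ik.mul_bdd (c := D) mQ.aestronglyMeasurable (Eventually.of_forall hQ)
  simp only [pow_one] at e2
  rw [e3, e2, ← integral_const_mul, ← integral_add i1 (i2.const_mul 4)]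
  rfl

namespace Symb

/-! ### The Wick map on products -/

/-- The bilinear extension of `τ, σ ↦ τ I'(σ)`. -/
def mulLin : (Symb →₀ ℝ) →ₗ[ℝ] (Symb →₀ ℝ) →ₗ[ℝ] (Symb →₀ ℝ) :=
  Finsupp.linearCombination ℝ fun τ => Finsupp.lmapDomain ℝ ℝ (mulI τ)

theorem mulLin_single_left (τ : Symb) (a : ℝ) (v : Symb →₀ ℝ) :
    mulLin (Finsupp.single τ a) v = a • v.mapDomain (mulI τ) := by
  simp [mulLin, Finsupp.linearCombination_single, Finsupp.lmapDomain_apply]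

theorem mulLin_single_right (u : Symb →₀ ℝ) (σ : Symb) (b : ℝ) :
    mulLin u (Finsupp.single σ b) = b • u.mapDomain fun τ => mulI τ σ := by
  induction u using Finsupp.induction_linear with
  | zero => simp
  | add u v hu hv => rw [map_add, LinearMap.add_apply, hu, hv, Finsupp.mapDomain_add, smul_add]
  | single τ a =>
    rw [mulLin_single_left, Finsupp.mapDomain_single, Finsupp.mapDomain_single, Finsupp.smul_single,
      Finsupp.smul_single, smul_eq_mul, smul_eq_mul, mul_comm]

theorem wickGen_single (τ : Symb) (a : ℝ) :
    wickGen (Finsupp.single τ a) = a • wickGenSymb τ := by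
  rw [wickGen, Finsupp.linearCombination_single]

/-- The generator is a derivation for the product that grafts one tree onto another, so its
exponential will be multiplicative. -/
theorem wickGen_mulLin (u v : Symb →₀ ℝ) :
    wickGen (mulLin u v) = mulLin (wickGen u) v + mulLin u (wickGen v) := by
  induction u using Finsupp.induction_linear with
  | zero => simp
  | add u u' hu hu' =>
    simp only [map_add, LinearMap.add_apply, hu, hu']; abel
  | single τ a =>
    induction v using Finsupp.induction_linear with
    | zero => simp
    | add v v' hv hv' =>
      simp only [map_add, hv, hv']; abel
    | single σ b =>
      rw [wickGen_single, wickGen_single, map_smul, map_smul, LinearMap.smul_apply,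
        mulLin_single_left, mulLin_single_left, Finsupp.mapDomain_single, map_smul,
        wickGen_single, wickGenSymb, smul_add, smul_add, mulLin_single_right, smul_comm b a]

theorem wickGen_mapDomain_eps (u : Symb →₀ ℝ) :
    wickGen (u.mapDomain eps) = (wickGen u).mapDomain eps := by
  induction u using Finsupp.induction_linear with
  | zero => simp
  | add u v hu hv => rw [Finsupp.mapDomain_add, map_add, map_add, hu, hv, Finsupp.mapDomain_add]
  | single τ a =>
    rw [Finsupp.mapDomain_single, wickGen_single, wickGen_single, wickGenSymb, Finsupp.mapDomain_smul]

theorem wickGen_pow_mapDomain_eps (k : ℕ) (u : Symb →₀ ℝ) :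
    (wickGen ^ k) (u.mapDomain eps) = ((wickGen ^ k) u).mapDomain eps := by
  induction k with
  | zero => simp
  | succ k ih =>
    rw [pow_succ', Module.End.mul_apply, ih, wickGen_mapDomain_eps, Module.End.mul_apply]

/-- Divided powers of the generator. -/
def wickDiv (k : ℕ) (u : Symb →₀ ℝ) : Symb →₀ ℝ := ((k.factorial : ℝ)⁻¹) • (wickGen ^ k) u

theorem wickGen_wickDiv (k : ℕ) (u : Symb →₀ ℝ) :
    wickGen (wickDiv k u) = ((k + 1 : ℕ) : ℝ) • wickDiv (k + 1) u := by
  have h : ((k.factorial : ℝ)) ≠ 0 := by positivity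
  rw [wickDiv, wickDiv, map_smul, pow_succ', Module.End.mul_apply, smul_smul, Nat.factorial_succ]
  congr 1
  push_cast
  field_simp

theorem wickDiv_mulLin (k : ℕ) (u v : Symb →₀ ℝ) : wickDiv k (mulLin u v) =
    ∑ p ∈ Finset.HasAntidiagonal.antidiagonal k, mulLin (wickDiv p.1 u) (wickDiv p.2 v) := by
  induction k with
  | zero => simp [wickDiv]
  | succ k ih =>
    have hk : ((k + 1 : ℕ) : ℝ) ≠ 0 := by positivity
    -- The identity is proved after multiplication by k + 1, which makes one application of the
    -- generator to the previous case available; on the right k + 1 is split as the sum of the two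
    -- indices.
    have h1 : ((k + 1 : ℕ) : ℝ) • wickDiv (k + 1) (mulLin u v) = ((k + 1 : ℕ) : ℝ) •
        ∑ p ∈ Finset.HasAntidiagonal.antidiagonal (k + 1), mulLin (wickDiv p.1 u) (wickDiv p.2 v) := by
      rw [← wickGen_wickDiv, ih, map_sum]
      have h2 : ((k + 1 : ℕ) : ℝ) •
          ∑ p ∈ Finset.HasAntidiagonal.antidiagonal (k + 1), mulLin (wickDiv p.1 u) (wickDiv p.2 v) =
          (∑ p ∈ Finset.HasAntidiagonal.antidiagonal (k + 1), (p.1 : ℝ) • mulLin (wickDiv p.1 u) (wickDiv p.2 v)) +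
          ∑ p ∈ Finset.HasAntidiagonal.antidiagonal (k + 1), (p.2 : ℝ) • mulLin (wickDiv p.1 u) (wickDiv p.2 v) := by
        rw [Finset.smul_sum, ← Finset.sum_add_distrib]
        refine Finset.sum_congr rfl fun p hp => ?_
        rw [← add_smul, ← Finset.HasAntidiagonal.mem_antidiagonal.mp hp]
        push_cast
        rfl
      rw [h2, Finset.Nat.sum_antidiagonal_succ, Finset.Nat.sum_antidiagonal_succ']
      simp only [Nat.cast_zero, zero_smul, zero_add]
      rw [← Finset.sum_add_distrib]
      refine Finset.sum_congr rfl fun p _ => ?_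
      rw [wickGen_mulLin, wickGen_wickDiv, wickGen_wickDiv, map_smul, map_smul, LinearMap.smul_apply]
    exact smul_right_injective _ hk h1

theorem finite_support_wickDiv (C : ℝ) (u : Symb →₀ ℝ) (φ : (Symb →₀ ℝ) →ₗ[ℝ] ℝ) :
    (Function.support fun k : ℕ => (-C) ^ k * φ (wickDiv k u)).Finite := by
  refine (wickGen_pow_support_finite C u).subset fun k hk h => hk ?_
  simp only at h ⊢
  rw [wickDiv, ← smul_eq_mul, ← map_smul, smul_smul, ← div_eq_mul_inv, h, map_zero]

theorem apply_wickMap (C : ℝ) (u : Symb →₀ ℝ) (φ : (Symb →₀ ℝ) →ₗ[ℝ] ℝ) :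
    φ (wickMap C u) = ∑' k : ℕ, (-C) ^ k * φ (wickDiv k u) := by
  rw [wickMap, finsum_eq_sum _ (wickGen_pow_support_finite C u), map_sum, tsum_eq_sum]
  · refine Finset.sum_congr rfl fun k _ => ?_
    rw [wickDiv, ← smul_eq_mul, ← map_smul φ ((-C) ^ k), smul_smul, div_eq_mul_inv]
  · intro k hk
    rw [Set.Finite.mem_toFinset, Function.notMem_support] at hk
    rw [wickDiv, ← smul_eq_mul, ← map_smul, smul_smul, ← div_eq_mul_inv, hk, map_zero]

theorem summable_wickDiv (C : ℝ) (u : Symb →₀ ℝ) (φ : (Symb →₀ ℝ) →ₗ[ℝ] ℝ) :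
    Summable fun k : ℕ => ‖(-C) ^ k * φ (wickDiv k u)‖ :=
  summable_of_hasFiniteSupport ((finite_support_wickDiv C u φ).subset fun k hk h => hk (by simp [h]))

/-- The exponential of a derivation is multiplicative: the Leibniz rule for divided powers is a
Cauchy product, and all series have finitely many nonzero terms. Three functionals occur because the
grafted factor is evaluated after convolution with K'. -/
theorem apply_wickMap_mulLin (C : ℝ) (u v : Symb →₀ ℝ) (φ ψ χ : (Symb →₀ ℝ) →ₗ[ℝ] ℝ)
    (h : ∀ u v, χ (mulLin u v) = φ u * ψ v) :
    χ (wickMap C (mulLin u v)) = φ (wickMap C u) * ψ (wickMap C v) := by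
  rw [apply_wickMap, apply_wickMap, apply_wickMap,
    tsum_mul_tsum_eq_tsum_sum_antidiagonal_of_summable_norm (summable_wickDiv C u φ)
      (summable_wickDiv C v ψ)]
  congr 1; ext k
  rw [wickDiv_mulLin, map_sum, Finset.mul_sum]
  refine Finset.sum_congr rfl fun p hp => ?_
  rw [h, ← Finset.HasAntidiagonal.mem_antidiagonal.mp hp, pow_add]
  ring

theorem apply_wickMap_eps (C ε : ℝ) (u : Symb →₀ ℝ) (φ : (Symb →₀ ℝ) →ₗ[ℝ] ℝ)
    (h : ∀ u, φ (u.mapDomain eps) = ε * φ u) :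
    φ (wickMap C (u.mapDomain eps)) = ε * φ (wickMap C u) := by
  rw [apply_wickMap, apply_wickMap, ← tsum_mul_left]
  congr 1; ext k
  rw [wickDiv, wickGen_pow_mapDomain_eps, ← Finsupp.mapDomain_smul, h, wickDiv]
  ring

/-! ### Wick powers -/

theorem wickGen_pow_psiPow (j k : ℕ) : (wickGen ^ k) (Finsupp.single (psiPow j) 1) =
    Finsupp.single (psiPow (j - 2 * k)) ((j.descFactorial (2 * k) : ℝ) / 2 ^ k) := by
  induction k with
  | zero => simp
  | succ k ih =>
    rw [pow_succ', Module.End.mul_apply, ih, wickGen_single, wickGenSymb, Finsupp.smul_single,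
      show j - 2 * (k + 1) = j - 2 * k - 2 by omega]
    congr 1
    rw [show 2 * (k + 1) = 2 * k + 1 + 1 by ring, Nat.descFactorial_succ, Nat.descFactorial_succ,
      smul_eq_mul, Nat.cast_choose_two]
    rcases Nat.eq_zero_or_pos (j - 2 * k) with h | h
    · simp [h]
    · rw [show j - (2 * k + 1) = (j - 2 * k) - 1 by omega]
      push_cast [Nat.cast_sub h]
      field_simp
      ring

end Symb

/-- The Wick powers: Hermite polynomials with variance `C`. -/
def wickPow (C : ℝ) : ℕ → ℝ → ℝ
  | 0, _ => 1
  | 1, x => x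
  | j + 2, x => x * wickPow C (j + 1) x - (j + 1) * C * wickPow C j x

/-- The terms of the expansion of a Wick power. -/
def wickTerm (C : ℝ) (j k : ℕ) (x : ℝ) : ℝ :=
  (-C) ^ k * ((k.factorial : ℝ)⁻¹ * ((j.descFactorial (2 * k) : ℝ) / 2 ^ k * x ^ (j - 2 * k)))

/-- The Hermite recursion holds term by term in the explicit expansion. -/
theorem wickTerm_succ (C : ℝ) (j k : ℕ) (x : ℝ) : wickTerm C (j + 2) (k + 1) x =
    x * wickTerm C (j + 1) (k + 1) x - (j + 1) * C * wickTerm C j k x := by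
  have hk : (k.factorial : ℝ) ≠ 0 := by positivity
  have hk1 : (k : ℝ) + 1 ≠ 0 := by positivity
  have e1 : (j + 2).descFactorial (2 * (k + 1)) = (j + 2) * ((j + 1) * j.descFactorial (2 * k)) := by
    rw [show 2 * (k + 1) = 2 * k + 1 + 1 by ring, Nat.succ_descFactorial_succ,
      Nat.succ_descFactorial_succ]
  have e2 : (j + 1).descFactorial (2 * (k + 1)) = (j + 1) * ((j - 2 * k) * j.descFactorial (2 * k)) := by
    rw [show 2 * (k + 1) = 2 * k + 1 + 1 by ring, Nat.succ_descFactorial_succ, Nat.descFactorial_succ]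
  have e3 : j + 2 - 2 * (k + 1) = j - 2 * k := by omega
  unfold wickTerm
  rw [e1, e2, e3, Nat.factorial_succ]
  -- The truncated exponents force a distinction: for j < 2k all coefficients vanish, for j = 2k the
  -- term of the middle polynomial vanishes, and otherwise no subtraction is truncated.
  rcases lt_or_ge j (2 * k) with h | h
  · simp [Nat.descFactorial_eq_zero_iff_lt.mpr h]
  · rcases h.eq_or_lt with h' | h'
    · rw [← h']
      simp only [Nat.sub_self, pow_zero, Nat.cast_zero, zero_mul, mul_zero]
      field_simp
      push_cast
      ring
    · rw [show j + 1 - 2 * (k + 1) = j - 2 * k - 1 by omega]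
      obtain ⟨m, rfl⟩ : ∃ m, j = 2 * k + m + 1 := ⟨j - 2 * k - 1, by omega⟩
      rw [show 2 * k + m + 1 - 2 * k = m + 1 by omega, Nat.add_sub_cancel]
      push_cast
      field_simp
      ring

/-- Terms with 2k > j vanish, so any upper limit above j gives the same sum; this freedom aligns the
three sums of the recursion. -/
theorem sum_wickTerm (C : ℝ) (x : ℝ) (j : ℕ) : ∀ N, j < N →
    ∑ k ∈ Finset.range N, wickTerm C j k x = wickPow C j x := by
  induction j using Nat.twoStepInduction with
  | zero =>
    intro N hN
    obtain ⟨N, rfl⟩ : ∃ M, N = M + 1 := ⟨N - 1, by omega⟩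
    rw [Finset.sum_range_succ', Finset.sum_eq_zero]
    · simp [wickTerm, wickPow]
    · intro k _
      simp [wickTerm, Nat.descFactorial_eq_zero_iff_lt.mpr (show 0 < 2 * (k + 1) by omega)]
  | one =>
    intro N hN
    obtain ⟨N, rfl⟩ : ∃ M, N = M + 1 := ⟨N - 1, by omega⟩
    rw [Finset.sum_range_succ', Finset.sum_eq_zero]
    · simp [wickTerm, wickPow]
    · intro k _
      simp [wickTerm, Nat.descFactorial_eq_zero_iff_lt.mpr (show 1 < 2 * (k + 1) by omega)]
  | more j ih1 ih2 =>
    intro N hN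
    obtain ⟨N, rfl⟩ : ∃ M, N = M + 1 := ⟨N - 1, by omega⟩
    have h2 := ih2 (N + 1) (by omega)
    rw [Finset.sum_range_succ'] at h2 ⊢
    simp only [wickTerm_succ]
    rw [Finset.sum_sub_distrib, ← Finset.mul_sum, ← Finset.mul_sum, ih1 N (by omega), wickPow, ← h2]
    have e : wickTerm C (j + 2) 0 x = x * wickTerm C (j + 1) 0 x := by
      simp [wickTerm]; ring
    rw [e]; ring

theorem continuous_wickPow (C : ℝ) (j : ℕ) : Continuous (wickPow C j) := by
  induction j using Nat.twoStepInduction with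
  | zero => exact continuous_const
  | one => exact continuous_id
  | more j ih1 ih2 => exact (continuous_id.mul ih2).sub (continuous_const.mul ih1)

/-! ### Realisation of the renormalised symbols -/

theorem CutoffKernel.deriv_eq_zero_of_norm (K : CutoffKernel) {u : SpaceTime} (hu : 1 < ‖u‖) :
    K.deriv u = 0 := by
  refine K.deriv_of_one_lt ?_
  by_contra hc
  exact not_le.mpr hu (CutoffKernel.norm_le_one_of_paraNorm_le_one (not_lt.mp hc))

namespace Symb

theorem conv_deriv_integrable (K : CutoffKernel) {f : SpaceTime → ℝ} (hf : Continuous f)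
    (z : SpaceTime) : Integrable fun u => K.deriv u * f (z - u) := by
  obtain ⟨M, hM⟩ := (isCompact_closedBall z (1 : ℝ)).exists_bound_of_continuousOn hf.continuousOn
  have h : (fun u => K.deriv u * f (z - u)) =
      fun u => K.deriv u * (Metric.closedBall (0 : SpaceTime) 1).indicator (fun u => f (z - u)) u := by
    funext u
    by_cases hu : u ∈ Metric.closedBall (0 : SpaceTime) 1
    · rw [Set.indicator_of_mem hu]
    · rw [K.deriv_eq_zero_of_norm (by simpa using hu), zero_mul, zero_mul]
  rw [h]
  refine K.integrable_deriv.mul_bdd (c := M) ?_ (Eventually.of_forall fun u => ?_)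
  · refine (Measurable.indicator ?_ Metric.isClosed_closedBall.measurableSet).aestronglyMeasurable
    exact (hf.comp (by fun_prop)).measurable
  · by_cases hu : u ∈ Metric.closedBall (0 : SpaceTime) 1
    · rw [Set.indicator_of_mem hu]
      refine hM _ ?_
      simpa [dist_eq_norm] using hu
    · rw [Set.indicator_of_notMem hu, norm_zero]
      exact (norm_nonneg _).trans (hM z (Metric.mem_closedBall_self zero_le_one))

theorem continuous_conv_deriv (K : CutoffKernel) {f : SpaceTime → ℝ} (hf : Continuous f) :
    Continuous (conv K.deriv f) := by
  refine continuous_iff_continuousAt.mpr fun z₀ => ?_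
  obtain ⟨M, hM⟩ := (isCompact_closedBall z₀ (2 : ℝ)).exists_bound_of_continuousOn hf.continuousOn
  have h : conv K.deriv f = fun z => ∫ u, K.deriv u * f (z - u) := funext fun z => conv_apply _ _ z
  rw [h]
  refine continuousAt_of_dominated (bound := fun u => ‖K.deriv u‖ * M)
    (Eventually.of_forall fun z => (conv_deriv_integrable K hf z).aestronglyMeasurable) ?_
    (K.integrable_deriv.norm.mul_const M) (Eventually.of_forall fun u => ?_)
  · filter_upwards [Metric.closedBall_mem_nhds z₀ one_pos] with z hz
    refine Eventually.of_forall fun u => ?_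
    rw [norm_mul]
    by_cases hu : ‖u‖ ≤ 1
    · gcongr
      refine hM _ ?_
      rw [Metric.mem_closedBall, dist_eq_norm] at hz ⊢
      calc ‖z - u - z₀‖ = ‖(z - z₀) - u‖ := by congr 1; abel
        _ ≤ ‖z - z₀‖ + ‖u‖ := norm_sub_le _ _
        _ ≤ 2 := by linarith
    · rw [K.deriv_eq_zero_of_norm (not_le.mp hu)]
      simp
  · exact (continuous_const.mul (hf.comp (by fun_prop))).continuousAt

theorem continuous_realise (K : CutoffKernel) (ε : ℝ) {ζ : SpaceTime → ℝ} (hζ : Continuous ζ)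
    (τ : Symb) : Continuous (realise K ε ζ τ) := by
  induction τ with
  | psiPow j => exact (continuous_conv_deriv K hζ).pow j
  | mulI τ σ ihτ ihσ => exact ihτ.mul (continuous_conv_deriv K ihσ)
  | eps τ ih => exact continuous_const.mul ih

/-- `realiseLin` as a linear functional. -/
def realiseFun (K : CutoffKernel) (ε : ℝ) (ζ : SpaceTime → ℝ) (z : SpaceTime) :
    (Symb →₀ ℝ) →ₗ[ℝ] ℝ := Finsupp.linearCombination ℝ fun τ => realise K ε ζ τ z

/-- The convolution of `K'` with `realiseLin` as a linear functional. -/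
def convFun (K : CutoffKernel) (ε : ℝ) (ζ : SpaceTime → ℝ) (z : SpaceTime) :
    (Symb →₀ ℝ) →ₗ[ℝ] ℝ := Finsupp.linearCombination ℝ fun τ => conv K.deriv (realise K ε ζ τ) z

theorem realiseLin_eq (K : CutoffKernel) (ε : ℝ) (ζ : SpaceTime → ℝ) (u : Symb →₀ ℝ) (z : SpaceTime) :
    realiseLin K ε ζ u z = realiseFun K ε ζ z u := rfl

theorem continuous_realiseFun (K : CutoffKernel) (ε : ℝ) {ζ : SpaceTime → ℝ} (hζ : Continuous ζ)
    (u : Symb →₀ ℝ) : Continuous fun z => realiseFun K ε ζ z u := by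
  simp only [realiseFun, Finsupp.linearCombination_apply, Finsupp.sum]
  exact continuous_finsetSum _ fun τ _ => continuous_const.mul (continuous_realise K ε hζ τ)

/-- Additivity of the convolution requires integrability, which holds because the realisations are
continuous and K' is integrable with compact support. -/
theorem convFun_apply (K : CutoffKernel) (ε : ℝ) {ζ : SpaceTime → ℝ} (hζ : Continuous ζ)
    (z : SpaceTime) (u : Symb →₀ ℝ) :
    convFun K ε ζ z u = conv K.deriv (fun y => realiseFun K ε ζ y u) z := by
  induction u using Finsupp.induction_linear with
  | zero => simp [conv_apply]
  | add u v hu hv =>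
    rw [map_add, hu, hv, conv_apply, conv_apply, conv_apply,
      ← integral_add (conv_deriv_integrable K (continuous_realiseFun K ε hζ u) z)
        (conv_deriv_integrable K (continuous_realiseFun K ε hζ v) z)]
    congr 1; ext y
    rw [map_add]; ring
  | single τ a =>
    simp only [convFun, realiseFun, Finsupp.linearCombination_single, smul_eq_mul, conv_apply]
    rw [← integral_const_mul]
    congr 1; ext y; ring

/-- The realisation with all powers of `Ψ` replaced by Wick powers. -/
def wickRealise (K : CutoffKernel) (ε C : ℝ) (ζ : SpaceTime → ℝ) : Symb → SpaceTime → ℝ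
  | psiPow j => fun z => wickPow C j (conv K.deriv ζ z)
  | mulI τ σ => fun z => wickRealise K ε C ζ τ z * conv K.deriv (wickRealise K ε C ζ σ) z
  | eps τ => fun z => ε * wickRealise K ε C ζ τ z

/-- Since the exponential is multiplicative over grafting and commutes with `eps`, it acts on every
power of Ψ separately, where its expansion is that of the Hermite polynomial. -/
theorem realiseFun_wickMap (K : CutoffKernel) (ε C : ℝ) {ζ : SpaceTime → ℝ} (hζ : Continuous ζ)
    (τ : Symb) (z : SpaceTime) :
    realiseFun K ε ζ z (wickMap C (Finsupp.single τ 1)) = wickRealise K ε C ζ τ z := by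
  induction τ generalizing z with
  | psiPow j =>
    show _ = wickPow C j (conv K.deriv ζ z)
    rw [apply_wickMap, ← sum_wickTerm C _ j (j + 1) (Nat.lt_succ_self j), tsum_eq_sum]
    · refine Finset.sum_congr rfl fun k _ => ?_
      rw [wickDiv, wickGen_pow_psiPow, Finsupp.smul_single, realiseFun,
        Finsupp.linearCombination_single, realise, wickTerm, smul_eq_mul, smul_eq_mul, mul_assoc]
    · intro k hk
      have : j < 2 * k := by simp at hk; omega
      rw [wickDiv, wickGen_pow_psiPow, Nat.descFactorial_eq_zero_iff_lt.mpr this]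
      simp
  | mulI τ σ ihτ ihσ =>
    have h : ∀ u v, realiseFun K ε ζ z (mulLin u v) = realiseFun K ε ζ z u * convFun K ε ζ z v := by
      intro u v
      induction u using Finsupp.induction_linear with
      | zero => simp
      | add u u' hu hu' => simp only [map_add, LinearMap.add_apply, hu, hu']; ring
      | single τ a =>
        induction v using Finsupp.induction_linear with
        | zero => simp
        | add v v' hv hv' => simp only [map_add, hv, hv']; ring
        | single σ b =>
          rw [mulLin_single_left, Finsupp.mapDomain_single]
          simp only [realiseFun, convFun, map_smul, Finsupp.linearCombination_single, smul_eq_mul,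
            realise]
          ring
    have e : Finsupp.single (mulI τ σ) (1 : ℝ) = mulLin (Finsupp.single τ 1) (Finsupp.single σ 1) := by
      rw [mulLin_single_left, Finsupp.mapDomain_single, one_smul]
    rw [e, apply_wickMap_mulLin C _ _ _ _ _ h, ihτ, convFun_apply K ε hζ]
    simp only [ihσ, wickRealise]
  | eps τ ih =>
    have h : ∀ u, realiseFun K ε ζ z (u.mapDomain eps) = ε * realiseFun K ε ζ z u := by
      intro u
      induction u using Finsupp.induction_linear with
      | zero => simp
      | add u u' hu hu' => simp only [Finsupp.mapDomain_add, map_add, hu, hu']; ring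
      | single τ a =>
        rw [Finsupp.mapDomain_single]
        simp only [realiseFun, Finsupp.linearCombination_single, smul_eq_mul, realise]
        ring
    rw [← Finsupp.mapDomain_single (f := eps) (a := τ) (b := (1 : ℝ)), apply_wickMap_eps C ε _ _ h, ih]
    rfl

theorem wickRealise_epsPow (K : CutoffKernel) (ε C : ℝ) (ζ : SpaceTime → ℝ) (k : ℕ) (τ : Symb) :
    wickRealise K ε C ζ (epsPow k τ) = fun z => ε ^ k * wickRealise K ε C ζ τ z := by
  induction k with
  | zero => simp [epsPow]
  | succ k ih =>
    rw [epsPow, Function.iterate_succ_apply', ← epsPow, wickRealise, ih]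
    funext z; ring

end Symb

/-! ### Random variables with all moments -/

/-- `F` has moments of all orders. -/
def HasMoments {Ω : Type*} [MeasurableSpace Ω] (P : Measure Ω) (F : Ω → ℝ) : Prop :=
  ∀ p : ℝ≥0, MemLp F p P

section Moments

variable {Ω : Type*} [MeasurableSpace Ω] {P : Measure Ω}

theorem HasMoments.mul {F G : Ω → ℝ} (hF : HasMoments P F) (hG : HasMoments P G) :
    HasMoments P fun ω => F ω * G ω := by
  intro p
  have : ENNReal.HolderTriple ((2 * p : ℝ≥0) : ℝ≥0∞) ((2 * p : ℝ≥0) : ℝ≥0∞) (p : ℝ≥0∞) := by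
    constructor
    rw [ENNReal.coe_mul, ENNReal.mul_inv (by simp) (by simp), ← add_mul]
    simp [ENNReal.inv_two_add_inv_two]
  exact (hG (2 * p)).mul (hF (2 * p))

theorem HasMoments.add {F G : Ω → ℝ} (hF : HasMoments P F) (hG : HasMoments P G) :
    HasMoments P fun ω => F ω + G ω := fun p => (hF p).add (hG p)

theorem hasMoments_const [IsFiniteMeasure P] (c : ℝ) : HasMoments P fun _ => c :=
  fun _ => memLp_const c

theorem HasMoments.pow [IsFiniteMeasure P] {F : Ω → ℝ} (hF : HasMoments P F) (n : ℕ) :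
    HasMoments P fun ω => F ω ^ n := by
  induction n with
  | zero => simpa using hasMoments_const (P := P) 1
  | succ n ih => simpa only [pow_succ] using ih.mul hF

theorem HasMoments.integrable {F : Ω → ℝ} (hF : HasMoments P F) : Integrable F P := by
  have := hF 1
  exact memLp_one_iff_integrable.mp (by simpa using this)

theorem HasMoments.eval [IsFiniteMeasure P] {F : Ω → ℝ} (hF : HasMoments P F) (p : Polynomial ℝ) :
    HasMoments P fun ω => p.eval (F ω) := by
  induction p using Polynomial.induction_on' with
  | add p q hp hq => simpa using hp.add hq
  | monomial n a => simpa using (hasMoments_const a).mul (hF.pow n)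

end Moments

/-! ### Moments of Gaussian variables -/

/-- Integration by parts: the derivative of x^{n+1} times the density integrates to 0. The density
is the heat kernel at time v/2, which reuses its derivative and its moments. -/
theorem integral_pow_gaussianReal (v : ℝ≥0) (n : ℕ) :
    ∫ x, x ^ (n + 2) ∂(gaussianReal 0 v) = (n + 1) * v * ∫ x, x ^ n ∂(gaussianReal 0 v) := by
  rcases eq_or_ne v 0 with rfl | hv
  · simp [gaussianReal_zero_var]
  · have hv0 : 0 < (v : ℝ) / 2 := by positivity
    have hv' : Real.toNNReal (2 * ((v : ℝ) / 2)) = v := by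
      rw [mul_div_cancel₀ _ two_ne_zero, Real.toNNReal_coe]
    have h := fun f => integral_gaussian_mul hv0 f
    rw [hv'] at h
    rw [← h (fun x => x ^ (n + 2)), ← h (fun x => x ^ n)]
    have i1 := integrable_pow_mul_heatKernel hv0 n
    have i2 := integrable_pow_mul_heatKernel hv0 (n + 1)
    have i3 := integrable_pow_mul_heatKernel hv0 (n + 2)
    have hint : Integrable fun x => ((n : ℝ) + 1) * (x ^ n * heatKernel ((v : ℝ) / 2, x)) -
        (1 / (v : ℝ)) * (x ^ (n + 2) * heatKernel ((v : ℝ) / 2, x)) :=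
      (i1.const_mul _).sub (i3.const_mul _)
    have key := integral_eq_zero_of_hasDerivAt_of_integrable
      (f := fun x => x ^ (n + 1) * heatKernel ((v : ℝ) / 2, x)) (fun x => by
        refine ((hasDerivAt_pow (n + 1) x).mul (hasDerivAt_heatKernel hv0 x)).congr_deriv
          (g' := ((n : ℝ) + 1) * (x ^ n * heatKernel ((v : ℝ) / 2, x)) -
            (1 / (v : ℝ)) * (x ^ (n + 2) * heatKernel ((v : ℝ) / 2, x))) ?_
        have : (v : ℝ) ≠ 0 := by exact_mod_cast hv
        simp only [Nat.cast_add, Nat.cast_one, Nat.add_sub_cancel]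
        field_simp
        ring) hint i2
    rw [integral_sub (i1.const_mul _) (i3.const_mul _), integral_const_mul, integral_const_mul] at key
    have : (v : ℝ) ≠ 0 := by exact_mod_cast hv
    field_simp at key ⊢
    linarith

/-- A linear family of centred Gaussian variables with covariance `b`. -/
structure IsGaussField {Ω V : Type*} [MeasurableSpace Ω] [AddCommGroup V] [Module ℝ V]
    (P : Measure Ω) (X : V →ₗ[ℝ] (Ω → ℝ)) (b : V →ₗ[ℝ] V →ₗ[ℝ] ℝ) : Prop where
  measurable : ∀ v, Measurable (X v)
  symm : ∀ u v, b u v = b v u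
  nonneg : ∀ v, 0 ≤ b v v
  law : ∀ v, P.map (X v) = gaussianReal 0 (Real.toNNReal (b v v))

/-! ### Joint moments from the one-dimensional laws of linear combinations. -/

section Polarisation

variable {Ω : Type*} [MeasurableSpace Ω] (P : Measure Ω)

/-- The polynomial `s ↦ 𝐄 A (V + s Y)^N`. -/
def momentPoly (A V Y : Ω → ℝ) (N : ℕ) : Polynomial ℝ :=
  ∑ k ∈ Finset.range (N + 1),
    Polynomial.C ((N.choose k : ℝ) * ∫ ω, A ω * (V ω ^ (N - k) * Y ω ^ k) ∂P) * Polynomial.X ^ k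

theorem coeff_momentPoly (A V Y : Ω → ℝ) (N k : ℕ) : (momentPoly P A V Y N).coeff k =
    (N.choose k : ℝ) * ∫ ω, A ω * (V ω ^ (N - k) * Y ω ^ k) ∂P := by
  unfold momentPoly
  simp only [Polynomial.finsetSum_coeff, Polynomial.coeff_C_mul_X_pow]
  rw [Finset.sum_ite_eq]
  split_ifs with h
  · rfl
  · rw [Nat.choose_eq_zero_of_lt (by simpa using h)]; simp

variable {P} [IsProbabilityMeasure P]

theorem eval_momentPoly {A V Y : Ω → ℝ} (hA : HasMoments P A) (hV : HasMoments P V)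
    (hY : HasMoments P Y) (N : ℕ) (s : ℝ) :
    (momentPoly P A V Y N).eval s = ∫ ω, A ω * (V ω + s * Y ω) ^ N ∂P := by
  have e : ∀ ω, A ω * (V ω + s * Y ω) ^ N = ∑ k ∈ Finset.range (N + 1),
      ((N.choose k : ℝ) * s ^ k) * (A ω * (V ω ^ (N - k) * Y ω ^ k)) := by
    intro ω
    rw [add_comm, add_pow, Finset.mul_sum]
    refine Finset.sum_congr rfl fun k _ => ?_
    rw [mul_pow]; ring
  simp_rw [e]
  rw [integral_finsetSum _ fun k _ =>
    ((hA.mul ((hV.pow (N - k)).mul (hY.pow k))).integrable.const_mul _)]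
  simp only [momentPoly, Polynomial.eval_finsetSum, Polynomial.eval_mul, Polynomial.eval_C,
    Polynomial.eval_pow, Polynomial.eval_X, integral_const_mul]
  refine Finset.sum_congr rfl fun k _ => ?_
  ring

/-- Polarisation of an identity that holds for all powers of `V + s Y`. -/
theorem integral_polarise {A B D V Y : Ω → ℝ} (hA : HasMoments P A) (hB : HasMoments P B)
    (hD : HasMoments P D) (hV : HasMoments P V) (hY : HasMoments P Y) {α β : ℝ}
    (h : ∀ (s : ℝ) (N : ℕ), ∫ ω, A ω * (V ω + s * Y ω) ^ N ∂P =
      ∫ ω, B ω * (V ω + s * Y ω) ^ N ∂P +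
        N * (α + s * β) * ∫ ω, D ω * (V ω + s * Y ω) ^ (N - 1) ∂P) (j k : ℕ) :
    ∫ ω, A ω * (V ω ^ j * Y ω ^ k) ∂P = ∫ ω, B ω * (V ω ^ j * Y ω ^ k) ∂P +
      j * α * ∫ ω, D ω * (V ω ^ (j - 1) * Y ω ^ k) ∂P +
      k * β * ∫ ω, D ω * (V ω ^ j * Y ω ^ (k - 1)) ∂P := by
  set N := j + k with hN
  have hp : momentPoly P A V Y N = momentPoly P B V Y N +
      (Polynomial.C ((N : ℝ) * α) * momentPoly P D V Y (N - 1) +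
        Polynomial.C ((N : ℝ) * β) * (momentPoly P D V Y (N - 1) * Polynomial.X)) := by
    refine Polynomial.funext fun s => ?_
    simp only [Polynomial.eval_add, Polynomial.eval_mul, Polynomial.eval_C, Polynomial.eval_X]
    rw [eval_momentPoly hA hV hY, eval_momentPoly hB hV hY, eval_momentPoly hD hV hY, h]
    ring
  have hc := congrArg (fun p => Polynomial.coeff p k) hp
  simp only [Polynomial.coeff_add, Polynomial.coeff_C_mul] at hc
  have hch : (N.choose k : ℝ) ≠ 0 := by
    have : 0 < N.choose k := Nat.choose_pos (by omega)
    positivity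
  -- This is N · C(N-1, k) = C(N, k) (N - k) with N - k = j; it turns the factor N from
  -- differentiating an N-th power into j after extraction of the coefficient of s^k.
  have e1 : (N : ℝ) * (((N - 1).choose k : ℝ)) = (N.choose k : ℝ) * j := by
    rcases Nat.eq_zero_or_pos N with h0 | h0
    · have : j = 0 := by omega
      simp [h0, this]
    · obtain ⟨n, hn⟩ : ∃ n, N = n + 1 := ⟨N - 1, by omega⟩
      have := Nat.choose_mul_succ_eq n k
      rw [hn, Nat.add_sub_cancel]
      have hj : n + 1 - k = j := by omega
      rw [hj] at this
      have h' : ((n.choose k * (n + 1) : ℕ) : ℝ) = (((n + 1).choose k * j : ℕ) : ℝ) := by rw [this]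
      push_cast at h' ⊢
      linarith
  have eNk : N - k = j := by omega
  have eN1k : N - 1 - k = j - 1 := by omega
  rcases k with _ | k
  · simp only [Polynomial.mul_coeff_zero, Polynomial.coeff_X_zero, mul_zero, add_zero] at hc
    rw [coeff_momentPoly, coeff_momentPoly, coeff_momentPoly, eNk, eN1k] at hc
    have e1' : (N : ℝ) * α * (((N - 1).choose 0 : ℝ) * ∫ ω, D ω * (V ω ^ (j - 1) * Y ω ^ 0) ∂P) =
        (N.choose 0 : ℝ) * (j * α * ∫ ω, D ω * (V ω ^ (j - 1) * Y ω ^ 0) ∂P) := by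
      linear_combination (α * ∫ ω, D ω * (V ω ^ (j - 1) * Y ω ^ 0) ∂P) * e1
    rw [e1', ← mul_add] at hc
    have := mul_left_cancel₀ hch hc
    rw [this]; simp
  · rw [Polynomial.coeff_mul_X, coeff_momentPoly, coeff_momentPoly, coeff_momentPoly,
      coeff_momentPoly, eNk, eN1k] at hc
    have eN1k' : N - 1 - k = j := by omega
    have e2 : (N : ℝ) * (((N - 1).choose k : ℝ)) = (N.choose (k + 1) : ℝ) * (k + 1) := by
      obtain ⟨n, hn⟩ : ∃ n, N = n + 1 := ⟨N - 1, by omega⟩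
      have := Nat.add_one_mul_choose_eq n k
      rw [hn, Nat.add_sub_cancel]
      have h' : (((n + 1) * n.choose k : ℕ) : ℝ) = (((n + 1).choose (k + 1) * (k + 1) : ℕ) : ℝ) := by
        rw [← this]
      push_cast at h' ⊢
      linarith
    rw [eN1k'] at hc
    rw [Nat.add_sub_cancel]
    push_cast
    refine mul_left_cancel₀ hch ?_
    linear_combination hc + (α * ∫ ω, D ω * (V ω ^ (j - 1) * Y ω ^ (k + 1)) ∂P) * e1 +
      (β * ∫ ω, D ω * (V ω ^ j * Y ω ^ k) ∂P) * e2

end Polarisation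

theorem apply_add_smul {Ω V : Type*} [AddCommGroup V] [Module ℝ V] (X : V →ₗ[ℝ] (Ω → ℝ)) (u v : V) (s : ℝ) (ω : Ω) :
    X (v + s • u) ω = X v ω + s * X u ω := by
  simp

/-! ### Gaussian integration by parts. -/

namespace IsGaussField

variable {Ω V : Type*} [MeasurableSpace Ω] [AddCommGroup V] [Module ℝ V]
  {P : Measure Ω} {X : V →ₗ[ℝ] (Ω → ℝ)} {b : V →ₗ[ℝ] V →ₗ[ℝ] ℝ}

theorem hasMoments (hX : IsGaussField P X b) (v : V) : HasMoments P (X v) := by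
  intro p
  have h : MemLp id p (P.map (X v)) := by rw [hX.law v]; exact memLp_id_gaussianReal p
  exact (memLp_map_measure_iff aestronglyMeasurable_id (hX.measurable v).aemeasurable).mp h

theorem integral_pow (hX : IsGaussField P X b) (v : V) (n : ℕ) :
    ∫ ω, X v ω ^ (n + 2) ∂P = (n + 1) * b v v * ∫ ω, X v ω ^ n ∂P := by
  have e : ∀ n : ℕ, ∫ ω, X v ω ^ n ∂P = ∫ x, x ^ n ∂(gaussianReal 0 (Real.toNNReal (b v v))) := by
    intro n
    rw [← hX.law v, integral_map (hX.measurable v).aemeasurable (by fun_prop)]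
  rw [e, e, integral_pow_gaussianReal, Real.coe_toNNReal _ (hX.nonneg v)]

theorem integral_eq_zero (hX : IsGaussField P X b) (v : V) : ∫ ω, X v ω ∂P = 0 := by
  have : ∫ ω, X v ω ∂P = ∫ x, x ∂(gaussianReal 0 (Real.toNNReal (b v v))) := by
    rw [← hX.law v, integral_map (hX.measurable v).aemeasurable (by fun_prop)]
  rw [this, integral_id_gaussianReal]

theorem cov_add_smul (hX : IsGaussField P X b) (u v : V) (s : ℝ) :
    b (v + s • u) (v + s • u) = b v v + s * (2 * b u v) + s ^ 2 * b u u := by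
  simp only [map_add, map_smul, LinearMap.add_apply, LinearMap.smul_apply, smul_eq_mul, hX.symm v u]
  ring

variable [IsProbabilityMeasure P]

/-- Only the laws of single variables are given. The moments of X(v + s u) satisfy the Gaussian
recursion for every s, with variance quadratic in s; comparing the coefficients of s gives a
recursion for the mixed moments, which induction solves. -/
theorem integral_mul_pow (hX : IsGaussField P X b) (u v : V) (n : ℕ) :
    ∫ ω, X u ω * X v ω ^ n ∂P = n * b u v * ∫ ω, X v ω ^ (n - 1) ∂P := by
  have h1 : HasMoments P fun _ : Ω => (1 : ℝ) := hasMoments_const 1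
  have hu := hX.hasMoments u
  have hv := hX.hasMoments v
  have hp : ∀ n : ℕ, momentPoly P (fun _ => 1) (X v) (X u) (n + 2) =
      Polynomial.C (((n : ℝ) + 1) * b v v) * momentPoly P (fun _ => 1) (X v) (X u) n +
      Polynomial.C (((n : ℝ) + 1) * (2 * b u v)) *
        (momentPoly P (fun _ => 1) (X v) (X u) n * Polynomial.X) +
      Polynomial.C (((n : ℝ) + 1) * b u u) *
        (momentPoly P (fun _ => 1) (X v) (X u) n * Polynomial.X * Polynomial.X) := by
    intro n
    refine Polynomial.funext fun s => ?_
    simp only [Polynomial.eval_add, Polynomial.eval_mul, Polynomial.eval_C, Polynomial.eval_X]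
    rw [eval_momentPoly h1 hv hu, eval_momentPoly h1 hv hu]
    simp only [one_mul, ← apply_add_smul X u v s]
    rw [hX.integral_pow, hX.cov_add_smul]
    ring
  have hc : ∀ n : ℕ, ((n : ℝ) + 2) * ∫ ω, X u ω * X v ω ^ (n + 1) ∂P =
      ((n : ℝ) + 1) * b v v * (n * ∫ ω, X u ω * X v ω ^ (n - 1) ∂P) +
        ((n : ℝ) + 1) * (2 * b u v) * ∫ ω, X v ω ^ n ∂P := by
    intro n
    have := congrArg (fun p => Polynomial.coeff p 1) (hp n)
    simp only [Polynomial.coeff_add, Polynomial.coeff_C_mul] at this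
    rw [Polynomial.coeff_mul_X, Polynomial.coeff_mul_X, Polynomial.mul_coeff_zero,
      Polynomial.coeff_X_zero, coeff_momentPoly, coeff_momentPoly, coeff_momentPoly] at this
    simp only [Nat.choose_one_right, one_mul, pow_one, pow_zero, mul_one, mul_zero, add_zero,
      Nat.choose_zero_right, Nat.cast_one, Nat.sub_zero, Nat.cast_add, Nat.cast_ofNat] at this
    rw [show n + 2 - 1 = n + 1 by omega] at this
    simp only [mul_comm (X v _ ^ _) (X u _)] at this
    exact this
  induction n using Nat.strong_induction_on with
  | _ n ih =>
    rcases n with _ | n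
    · simp [hX.integral_eq_zero]
    · have h := hc n
      rw [Nat.add_sub_cancel]
      have h2 : ((n : ℝ) + 2) ≠ 0 := by positivity
      refine mul_left_cancel₀ h2 (h.trans ?_)
      rcases n with _ | m
      · simp
      · rw [Nat.add_sub_cancel, ih m (by omega)]
        rcases m with _ | l
        · have := hX.integral_pow v 0
          simp only [hX.integral_eq_zero, pow_one, zero_add]
          push_cast
          simp
        · have := hX.integral_pow v l
          rw [Nat.add_sub_cancel, this]
          push_cast
          ring

/-- Polarising once splits the power into two variables, and polarising the result splits it into
three. -/
theorem integral_mul_monomial (hX : IsGaussField P X b) (u w v y : V) (m j k : ℕ) :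
    ∫ ω, X u ω * (X w ω ^ m * (X v ω ^ j * X y ω ^ k)) ∂P =
      m * b u w * ∫ ω, X w ω ^ (m - 1) * (X v ω ^ j * X y ω ^ k) ∂P +
      j * b u v * ∫ ω, X w ω ^ m * (X v ω ^ (j - 1) * X y ω ^ k) ∂P +
      k * b u y * ∫ ω, X w ω ^ m * (X v ω ^ j * X y ω ^ (k - 1)) ∂P := by
  have h1 : HasMoments P fun _ : Ω => (1 : ℝ) := hasMoments_const 1
  have h0 : HasMoments P fun _ : Ω => (0 : ℝ) := hasMoments_const 0
  have hm := fun v => hX.hasMoments v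
  have step : ∀ (v : V) (j m : ℕ), ∫ ω, X u ω * (X v ω ^ j * X w ω ^ m) ∂P =
      j * b u v * ∫ ω, X v ω ^ (j - 1) * X w ω ^ m ∂P +
      m * b u w * ∫ ω, X v ω ^ j * X w ω ^ (m - 1) ∂P := by
    intro v j m
    have := integral_polarise (hm u) h0 h1 (hm v) (hm w) (α := b u v) (β := b u w) (fun s N => by
      simp only [one_mul, zero_mul, integral_zero, zero_add, ← apply_add_smul X w v s]
      rw [hX.integral_mul_pow]
      simp) j m
    simpa using this
  have := integral_polarise (A := fun ω => X u ω * X w ω ^ m)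
    (B := fun ω => (m * b u w) * X w ω ^ (m - 1)) (D := fun ω => X w ω ^ m)
    ((hm u).mul ((hm w).pow m)) ((hasMoments_const _).mul ((hm w).pow (m - 1))) ((hm w).pow m)
    (hm v) (hm y) (α := b u v) (β := b u y) (fun s N => by
      simp only [← apply_add_smul X y v s, mul_assoc]
      have h := step (v + s • y) N m
      simp only [mul_comm (X (v + s • y) _ ^ _) (X w _ ^ _)] at h
      rw [h]
      simp only [mul_assoc, integral_const_mul, map_add, map_smul, smul_eq_mul]
      ring) j k
  simp only [mul_assoc, integral_const_mul] at this ⊢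
  linarith

theorem integral_mul_eval (hX : IsGaussField P X b) (u v y : V) (p q r : Polynomial ℝ) :
    ∫ ω, X u ω * (p.eval (X u ω) * (q.eval (X v ω) * r.eval (X y ω))) ∂P =
      b u u * ∫ ω, p.derivative.eval (X u ω) * (q.eval (X v ω) * r.eval (X y ω)) ∂P +
      b u v * ∫ ω, p.eval (X u ω) * (q.derivative.eval (X v ω) * r.eval (X y ω)) ∂P +
      b u y * ∫ ω, p.eval (X u ω) * (q.eval (X v ω) * r.derivative.eval (X y ω)) ∂P := by
  have hm := fun v => hX.hasMoments v
  have hI : ∀ p q r : Polynomial ℝ,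
      Integrable (fun ω => p.eval (X u ω) * (q.eval (X v ω) * r.eval (X y ω))) P := fun p q r =>
    (((hm u).eval p).mul (((hm v).eval q).mul ((hm y).eval r))).integrable
  have hJ : ∀ p q r : Polynomial ℝ,
      Integrable (fun ω => X u ω * (p.eval (X u ω) * (q.eval (X v ω) * r.eval (X y ω)))) P :=
    fun p q r => ((hm u).mul (((hm u).eval p).mul (((hm v).eval q).mul ((hm y).eval r)))).integrable
  induction p using Polynomial.induction_on' with
  | add p p' hp hp' =>
    simp only [Polynomial.eval_add, Polynomial.derivative_add, add_mul, mul_add] at hp hp' ⊢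
    rw [integral_add (hJ p q r) (hJ p' q r), integral_add (hI _ _ _) (hI _ _ _),
      integral_add (hI _ _ _) (hI _ _ _), integral_add (hI _ _ _) (hI _ _ _), hp, hp']
    ring
  | monomial m a =>
    induction q using Polynomial.induction_on' with
    | add q q' hq hq' =>
      simp only [Polynomial.eval_add, Polynomial.derivative_add, add_mul, mul_add] at hq hq' ⊢
      rw [integral_add (hJ _ q r) (hJ _ q' r), integral_add (hI _ _ _) (hI _ _ _),
        integral_add (hI _ _ _) (hI _ _ _), integral_add (hI _ _ _) (hI _ _ _), hq, hq']
      ring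
    | monomial j a' =>
      induction r using Polynomial.induction_on' with
      | add r r' hr hr' =>
        simp only [Polynomial.eval_add, Polynomial.derivative_add, mul_add] at hr hr' ⊢
        rw [integral_add (hJ _ _ r) (hJ _ _ r'), integral_add (hI _ _ _) (hI _ _ _),
          integral_add (hI _ _ _) (hI _ _ _), integral_add (hI _ _ _) (hI _ _ _), hr, hr']
        ring
      | monomial k a'' =>
        have h := hX.integral_mul_monomial u u v y m j k
        simp only [Polynomial.derivative_monomial, Polynomial.eval_monomial]
        have e : ∀ (f : Ω → ℝ) (c : ℝ) (g : Ω → ℝ), (∀ ω, f ω = c * g ω) →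
            ∫ ω, f ω ∂P = c * ∫ ω, g ω ∂P := fun f c g hfg => by
          rw [← integral_const_mul]; congr 1; ext ω; exact hfg ω
        rw [e (fun ω => X u ω * (a * X u ω ^ m * (a' * X v ω ^ j * (a'' * X y ω ^ k)))) (a * a' * a'')
            (fun ω => X u ω * (X u ω ^ m * (X v ω ^ j * X y ω ^ k))) (fun ω => by ring),
          e (fun ω => a * m * X u ω ^ (m - 1) * (a' * X v ω ^ j * (a'' * X y ω ^ k)))
            (a * m * a' * a'') (fun ω => X u ω ^ (m - 1) * (X v ω ^ j * X y ω ^ k)) (fun ω => by ring),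
          e (fun ω => a * X u ω ^ m * (a' * j * X v ω ^ (j - 1) * (a'' * X y ω ^ k)))
            (a * a' * j * a'') (fun ω => X u ω ^ m * (X v ω ^ (j - 1) * X y ω ^ k)) (fun ω => by ring),
          e (fun ω => a * X u ω ^ m * (a' * X v ω ^ j * (a'' * k * X y ω ^ (k - 1))))
            (a * a' * a'' * k) (fun ω => X u ω ^ m * (X v ω ^ j * X y ω ^ (k - 1))) (fun ω => by ring),
          h]
        ring

end IsGaussField

/-! ### Expectations of products of Wick powers -/

/-- Wick powers as polynomials. -/
def wickPoly (C : ℝ) : ℕ → Polynomial ℝ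
  | 0 => 1
  | 1 => Polynomial.X
  | j + 2 => Polynomial.X * wickPoly C (j + 1) - Polynomial.C ((j + 1) * C) * wickPoly C j

theorem eval_wickPoly (C : ℝ) (j : ℕ) (x : ℝ) : (wickPoly C j).eval x = wickPow C j x := by
  induction j using Nat.twoStepInduction with
  | zero => simp [wickPoly, wickPow]
  | one => simp [wickPoly, wickPow]
  | more j ih1 ih2 =>
    rw [wickPoly, wickPow, Polynomial.eval_sub, Polynomial.eval_mul, Polynomial.eval_mul, ih1, ih2]
    simp

theorem wickPoly_succ (C : ℝ) (j : ℕ) : wickPoly C (j + 1) =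
    Polynomial.X * wickPoly C j - Polynomial.C (j * C) * wickPoly C (j - 1) := by
  rcases j with _ | j
  · simp [wickPoly]
  · rw [wickPoly, Nat.add_sub_cancel]; push_cast; rfl

theorem derivative_wickPoly (C : ℝ) (j : ℕ) :
    (wickPoly C j).derivative = Polynomial.C (j : ℝ) * wickPoly C (j - 1) := by
  induction j using Nat.twoStepInduction with
  | zero => simp [wickPoly]
  | one => simp [wickPoly]
  | more j ih1 ih2 =>
    rw [wickPoly, Polynomial.derivative_sub, Polynomial.derivative_mul, Polynomial.derivative_C_mul, ih1,
      ih2, Polynomial.derivative_X, Nat.add_sub_cancel, show j + 2 - 1 = j + 1 by omega,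
      wickPoly_succ C j]
    simp only [Nat.cast_add, Nat.cast_one, Nat.cast_ofNat, Polynomial.C_add, Polynomial.C_mul,
      Polynomial.C_1]
    rw [show (Polynomial.C (2 : ℝ)) = 2 from rfl]
    ring

/-- The expectation of a product of three Wick powers with covariances `x`, `y`, `z`. -/
def tripleWick (x y z : ℝ) : ℕ → ℕ → ℕ → ℝ
  | 0, 0, k => if k = 0 then 1 else 0
  | 0, j + 1, k => z * k * tripleWick x y z 0 j (k - 1)
  | i + 1, j, k => x * j * tripleWick x y z i (j - 1) k + y * k * tripleWick x y z i j (k - 1)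

/-- The subtracted term of the Hermite recursion is exactly the self-contraction b(u, u) times the
derivative of `wickPoly C i`, because b(u, u) = C. Only contractions with the other two points
survive. -/
theorem IsGaussField.integral_wickPoly_succ {Ω V : Type*} [MeasurableSpace Ω] [AddCommGroup V]
    [Module ℝ V] {P : Measure Ω} [IsProbabilityMeasure P] {X : V →ₗ[ℝ] (Ω → ℝ)}
    {b : V →ₗ[ℝ] V →ₗ[ℝ] ℝ} (hX : IsGaussField P X b) {u v y : V} {C : ℝ} (hu : b u u = C)
    (i j k : ℕ) :
    ∫ ω, (wickPoly C (i + 1)).eval (X u ω) *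
        ((wickPoly C j).eval (X v ω) * (wickPoly C k).eval (X y ω)) ∂P =
      b u v * j * (∫ ω, (wickPoly C i).eval (X u ω) *
        ((wickPoly C (j - 1)).eval (X v ω) * (wickPoly C k).eval (X y ω)) ∂P) +
      b u y * k * ∫ ω, (wickPoly C i).eval (X u ω) *
        ((wickPoly C j).eval (X v ω) * (wickPoly C (k - 1)).eval (X y ω)) ∂P := by
  have hm := fun v => hX.hasMoments v
  have h := hX.integral_mul_eval u v y (wickPoly C i) (wickPoly C j) (wickPoly C k)
  rw [wickPoly_succ]
  simp only [Polynomial.eval_sub, Polynomial.eval_mul, Polynomial.eval_X, Polynomial.eval_C, sub_mul,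
    mul_assoc, derivative_wickPoly] at h ⊢
  have hI : ∀ p q r : Polynomial ℝ,
      Integrable (fun ω => p.eval (X u ω) * (q.eval (X v ω) * r.eval (X y ω))) P := fun p q r =>
    (((hm u).eval p).mul (((hm v).eval q).mul ((hm y).eval r))).integrable
  rw [integral_sub ((hm u).mul (((hm u).eval _).mul (((hm v).eval _).mul ((hm y).eval _)))).integrable
    (((hI _ _ _).const_mul C).const_mul _), h]
  simp only [integral_const_mul, mul_left_comm (Polynomial.eval _ _) (Nat.cast _ : ℝ), hu]
  ring

theorem IsGaussField.integral_wickPow {Ω V : Type*} [MeasurableSpace Ω] [AddCommGroup V] [Module ℝ V]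
    {P : Measure Ω} [IsProbabilityMeasure P] {X : V →ₗ[ℝ] (Ω → ℝ)} {b : V →ₗ[ℝ] V →ₗ[ℝ] ℝ}
    (hX : IsGaussField P X b) {u v y : V} {C : ℝ} (hu : b u u = C) (hv : b v v = C) (hy : b y y = C)
    (i j k : ℕ) :
    ∫ ω, wickPow C i (X u ω) * (wickPow C j (X v ω) * wickPow C k (X y ω)) ∂P =
      tripleWick (b u v) (b u y) (b v y) i j k := by
  simp only [← eval_wickPoly]
  induction i generalizing j k with
  | succ i ih =>
    rw [hX.integral_wickPoly_succ hu, ih, ih, tripleWick]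
  | zero =>
    induction j generalizing k with
    | succ j ih =>
      have h := hX.integral_wickPoly_succ (v := v) (y := y) hv j 0 k
      rw [tripleWick, ← ih]
      simp only [wickPoly, Polynomial.eval_one, one_mul, Nat.cast_zero, mul_zero, zero_mul,
        zero_add] at h ⊢
      exact h
    | zero =>
      rcases k with _ | k
      · simp [wickPoly, tripleWick]
      · have h := hX.integral_wickPoly_succ (v := v) (y := y) hy k 0 0
        simp only [wickPoly, Polynomial.eval_one, one_mul, mul_one, Nat.cast_zero, mul_zero, zero_mul,
          zero_add] at h ⊢
        rw [h]
        simp [tripleWick]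

/-- The pairings of three Wick powers: only one configuration contributes. -/
theorem tripleWick_eq (i j k : ℕ) :
    (∃ a b c : ℕ, i = a + b ∧ j = a + c ∧ k = b + c ∧
      ∀ x y z, tripleWick x y z i j k = tripleWick 1 1 1 i j k * (x ^ a * y ^ b * z ^ c)) ∨
    ∀ x y z, tripleWick x y z i j k = 0 := by
  induction i generalizing j k with
  | zero =>
    induction j generalizing k with
    | zero =>
      rcases k with _ | k
      · exact Or.inl ⟨0, 0, 0, rfl, rfl, rfl, fun x y z => by simp [tripleWick]⟩
      · exact Or.inr fun x y z => by simp [tripleWick]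
    | succ j ih =>
      rcases k with _ | k
      · exact Or.inr fun x y z => by simp [tripleWick]
      · rcases ih k with ⟨a, b, c, h1, h2, h3, h⟩ | h
        · refine Or.inl ⟨a, b, c + 1, h1, by omega, by omega, fun x y z => ?_⟩
          rw [tripleWick, tripleWick, Nat.add_sub_cancel, h x y z]
          ring
        · refine Or.inr fun x y z => ?_
          rw [tripleWick, Nat.add_sub_cancel, h x y z, mul_zero]
  | succ i ih =>
    have h1 : (∃ a b c : ℕ, i + 1 = a + b ∧ j = a + c ∧ k = b + c ∧ ∀ x y z : ℝ,
        x * j * tripleWick x y z i (j - 1) k =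
          j * tripleWick 1 1 1 i (j - 1) k * (x ^ a * y ^ b * z ^ c)) ∨
        ∀ x y z : ℝ, x * j * tripleWick x y z i (j - 1) k = 0 := by
      rcases j with _ | j
      · exact Or.inr fun x y z => by simp
      · rcases ih j k with ⟨a, b, c, h1, h2, h3, h⟩ | h
        · refine Or.inl ⟨a + 1, b, c, by omega, by omega, h3, fun x y z => ?_⟩
          rw [Nat.add_sub_cancel, h x y z]; ring
        · exact Or.inr fun x y z => by rw [Nat.add_sub_cancel, h x y z, mul_zero]
    have h2 : (∃ a b c : ℕ, i + 1 = a + b ∧ j = a + c ∧ k = b + c ∧ ∀ x y z : ℝ,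
        y * k * tripleWick x y z i j (k - 1) =
          k * tripleWick 1 1 1 i j (k - 1) * (x ^ a * y ^ b * z ^ c)) ∨
        ∀ x y z : ℝ, y * k * tripleWick x y z i j (k - 1) = 0 := by
      rcases k with _ | k
      · exact Or.inr fun x y z => by simp
      · rcases ih j k with ⟨a, b, c, h1, h2, h3, h⟩ | h
        · refine Or.inl ⟨a, b + 1, c, by omega, h2, by omega, fun x y z => ?_⟩
          rw [Nat.add_sub_cancel, h x y z]; ring
        · exact Or.inr fun x y z => by rw [Nat.add_sub_cancel, h x y z, mul_zero]
    rcases h1 with ⟨a, b, c, e1, e2, e3, h⟩ | h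
    · rcases h2 with ⟨a', b', c', e1', e2', e3', h'⟩ | h'
      -- The numbers i + 1, j, k determine the multiplicities of the three edges, so both branches
      -- of the recursion carry the same monomial.
      · obtain rfl : a' = a := by omega
        obtain rfl : b' = b := by omega
        obtain rfl : c' = c := by omega
        refine Or.inl ⟨a', b', c', e1, e2, e3, fun x y z => ?_⟩
        rw [tripleWick, tripleWick, h, h']; ring
      · refine Or.inl ⟨a, b, c, e1, e2, e3, fun x y z => ?_⟩
        rw [tripleWick, tripleWick, h, h', h']; ring
    · rcases h2 with ⟨a', b', c', e1', e2', e3', h'⟩ | h'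
      · refine Or.inl ⟨a', b', c', e1', e2', e3', fun x y z => ?_⟩
        rw [tripleWick, tripleWick, h, h', h]; ring
      · exact Or.inr fun x y z => by rw [tripleWick, h, h', add_zero]

/-! ### The regularised noise is continuous -/

theorem Mollifier.contDiff_scaled (ρ : Mollifier) (ε : ℝ) :
    ContDiff ℝ ((⊤ : ℕ∞) : WithTop ℕ∞) (ρ.scaled ε) := by
  unfold Mollifier.scaled
  refine contDiff_const.mul (ρ.smooth.comp ?_)
  fun_prop

/-- Translates of a fixed test function depend continuously on the shift in every Schwartz seminorm:
the derivatives are uniformly continuous, and for nearby shifts they vanish outside a common ball.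
This gives continuity of the regularised noise and hence its joint measurability in space-time and
chance. -/
theorem Mollifier.continuous_test (ρ : Mollifier) (ε : ℝ) : Continuous (ρ.test ε) := by
  refine continuous_iff_continuousAt.mpr fun z₀ => ?_
  rw [ContinuousAt, (schwartz_withSeminorms ℝ SpaceTime ℝ).tendsto_nhds]
  rintro ⟨k, n⟩ η hη
  set g : SpaceTime → ℝ := fun w => ρ.scaled ε (0 - w) with hg
  have hgs : ContDiff ℝ ((⊤ : ℕ∞) : WithTop ℕ∞) g := ρ.contDiff_test ε 0
  have hgc : HasCompactSupport g := ρ.hasCompactSupport_test ε 0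
  have hDc : HasCompactSupport (iteratedFDeriv ℝ n g) := hgc.iteratedFDeriv n
  have hDcont : Continuous (iteratedFDeriv ℝ n g) :=
    hgs.continuous_iteratedFDeriv (by exact_mod_cast le_top)
  have huc := hDc.uniformContinuous_of_continuous hDcont
  obtain ⟨R, hR⟩ := hDc.isCompact.isBounded.subset_closedBall (0 : SpaceTime)
  have hD0 : ∀ w, R < ‖w‖ → iteratedFDeriv ℝ n g w = 0 := fun w hw => by
    refine image_eq_zero_of_notMem_tsupport fun h => ?_
    have := hR h
    rw [mem_closedBall_zero_iff] at this
    linarith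
  -- Beyond this radius both translates vanish as long as z is within distance 1 of z₀.
  set B : ℝ := |R| + ‖z₀‖ + 1 with hB
  have hB0 : 0 < B := by positivity
  obtain ⟨δ, hδ, hδ'⟩ := Metric.uniformContinuous_iff.mp huc (η / 2 / B ^ k) (by positivity)
  filter_upwards [Metric.ball_mem_nhds z₀ (lt_min hδ one_pos)] with z hz
  rw [Metric.mem_ball, lt_min_iff] at hz
  refine lt_of_le_of_lt (SchwartzMap.seminorm_le_bound ℝ k n _ (by positivity : 0 ≤ η / 2)
    fun w => ?_) (half_lt_self hη)
  have hfun : ∀ z : SpaceTime, (⇑(ρ.test ε z) : SpaceTime → ℝ) = fun w => g (w - z) := by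
    intro z
    funext w
    simp only [hg, Mollifier.test]
    show ρ.scaled ε (z - w) = _
    congr 1
    abel
  have hD : iteratedFDeriv ℝ n (⇑(ρ.test ε z - ρ.test ε z₀)) w =
      iteratedFDeriv ℝ n g (w - z) - iteratedFDeriv ℝ n g (w - z₀) := by
    have e : (⇑(ρ.test ε z - ρ.test ε z₀) : SpaceTime → ℝ) =
        (fun w => g (w - z)) - fun w => g (w - z₀) := by
      rw [← hfun z, ← hfun z₀]; rfl
    have hs : ∀ z : SpaceTime, ContDiffAt ℝ (n : WithTop ℕ∞) (fun w => g (w - z)) w := fun z =>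
      ((hgs.comp (contDiff_id.sub contDiff_const)).contDiffAt).of_le (by exact_mod_cast le_top)
    rw [e, iteratedFDeriv_sub_apply (hs z) (hs z₀), iteratedFDeriv_comp_sub, iteratedFDeriv_comp_sub]
  rw [hD]
  rcases le_or_gt ‖w‖ B with hw | hw
  · have h1 : dist (w - z) (w - z₀) < δ := by
      rw [dist_eq_norm, sub_sub_sub_cancel_left, ← dist_eq_norm, dist_comm]
      exact hz.1
    have h2 := hδ' h1
    rw [dist_eq_norm] at h2
    calc _ ≤ B ^ k * (η / 2 / B ^ k) := by gcongr
      _ = η / 2 := by field_simp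
  · have hzz : ‖z‖ ≤ ‖z₀‖ + 1 := by
      have := norm_sub_norm_le z z₀
      have h2 := hz.2
      rw [dist_eq_norm] at h2
      linarith
    have hRR := le_abs_self R
    have h1 : R < ‖w - z‖ := by
      have := norm_sub_norm_le w z
      linarith
    have h2 : R < ‖w - z₀‖ := by
      have := norm_sub_norm_le w z₀
      linarith
    rw [hD0 _ h1, hD0 _ h2, sub_zero, norm_zero, mul_zero]
    positivity

theorem continuous_regularise (ρ : Mollifier) (ε : ℝ) (ξ : 𝓢(SpaceTime, ℝ) →L[ℝ] ℝ) :
    Continuous (regularise ρ ε ξ) := ξ.continuous.comp (ρ.continuous_test ε)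

theorem renormVariable_eq (ρ : Mollifier) (K : CutoffKernel) (ε : ℝ) (τ : Symb)
    (ξ : 𝓢(SpaceTime, ℝ) →L[ℝ] ℝ) : renormVariable ρ K ε τ ξ =
      Symb.wickRealise K ε (C0 ρ K ε) (regularise ρ ε ξ) τ 0 := by
  rw [renormVariable, Symb.realiseLin_eq, Symb.realiseFun_wickMap K ε _ (continuous_regularise ρ ε ξ)]

/-! ### White noise as a Gaussian field -/

/-- The `L²` pairing of test functions. -/
def pairing : 𝓢(SpaceTime, ℝ) →ₗ[ℝ] 𝓢(SpaceTime, ℝ) →ₗ[ℝ] ℝ :=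
  LinearMap.mk₂ ℝ (fun φ ψ => ∫ z, φ z * ψ z)
    (fun φ φ' ψ => by
      have h : ∀ φ : 𝓢(SpaceTime, ℝ), Integrable fun z => φ z * ψ z := fun φ =>
        (φ.memLp 2).integrable_mul (ψ.memLp 2)
      rw [← integral_add (h φ) (h φ')]
      simp [add_mul])
    (fun c φ ψ => by
      rw [smul_eq_mul, ← integral_const_mul]
      simp [mul_assoc])
    (fun φ ψ ψ' => by
      have h : ∀ ψ : 𝓢(SpaceTime, ℝ), Integrable fun z => φ z * ψ z := fun ψ =>
        (φ.memLp 2).integrable_mul (ψ.memLp 2)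
      rw [← integral_add (h ψ) (h ψ')]
      simp [mul_add])
    (fun c φ ψ => by
      rw [smul_eq_mul, ← integral_const_mul]
      simp [mul_left_comm])

theorem pairing_apply (φ ψ : 𝓢(SpaceTime, ℝ)) : pairing φ ψ = ∫ z, φ z * ψ z := rfl

/-- A random distribution as a linear family of random variables. -/
def noiseMap {Ω : Type*} (ξ : Ω → (𝓢(SpaceTime, ℝ) →L[ℝ] ℝ)) : 𝓢(SpaceTime, ℝ) →ₗ[ℝ] (Ω → ℝ) where
  toFun φ ω := ξ ω φ
  map_add' φ ψ := by funext ω; simp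
  map_smul' c φ := by funext ω; simp

theorem IsWhiteNoise.isGaussField {Ω : Type*} [MeasurableSpace Ω] {P : Measure Ω}
    {ξ : Ω → (𝓢(SpaceTime, ℝ) →L[ℝ] ℝ)} (hξ : IsWhiteNoise P ξ) :
    IsGaussField P (noiseMap ξ) pairing where
  measurable := hξ.measurable
  symm φ ψ := by simp only [pairing_apply, mul_comm]
  nonneg φ := by
    rw [pairing_apply]
    exact integral_nonneg fun z => mul_self_nonneg _
  law φ := by
    have := hξ.law φ
    simp only [pow_two] at this
    exact this

theorem IsGaussField.integral_mul {Ω V : Type*} [MeasurableSpace Ω] [AddCommGroup V] [Module ℝ V]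
    {P : Measure Ω} [IsProbabilityMeasure P] {X : V →ₗ[ℝ] (Ω → ℝ)} {b : V →ₗ[ℝ] V →ₗ[ℝ] ℝ}
    (hX : IsGaussField P X b) (u v : V) : ∫ ω, X u ω * X v ω ∂P = b u v := by
  have := hX.integral_mul_pow u v 1
  simpa using this

theorem IsGaussField.lintegral_mul_le {Ω V : Type*} [MeasurableSpace Ω] [AddCommGroup V] [Module ℝ V]
    {P : Measure Ω} [IsProbabilityMeasure P] {X : V →ₗ[ℝ] (Ω → ℝ)} {b : V →ₗ[ℝ] V →ₗ[ℝ] ℝ}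
    (hX : IsGaussField P X b) (u v : V) :
    ∫⁻ ω, ‖X u ω * X v ω‖ₑ ∂P ≤ ENNReal.ofReal (b u u + b v v) := by
  have hi := fun u v => ((hX.hasMoments u).mul (hX.hasMoments v)).integrable
  rw [← ofReal_integral_norm_eq_lintegral_enorm (hi u v), ← hX.integral_mul u u, ← hX.integral_mul v v,
    ← integral_add (hi u u) (hi v v)]
  refine ENNReal.ofReal_le_ofReal (integral_mono (hi u v).norm ((hi u u).add (hi v v)) fun ω => ?_)
  simp only [Real.norm_eq_abs, abs_mul]
  nlinarith [sq_nonneg (|X u ω| - |X v ω|), sq_abs (X u ω), sq_abs (X v ω), sq_nonneg (X u ω),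
    sq_nonneg (X v ω)]

/-- Fubini for a mixture of random variables that are bounded in `L¹`. -/
theorem integral_mixture {T Ω : Type*} [MeasurableSpace T] [MeasurableSpace Ω] {ν : Measure T}
    {P : Measure Ω} [SFinite ν] [SFinite P] {κ : T → ℝ} (hκ : Integrable κ ν) (mκ : Measurable κ)
    {G : T → Ω → ℝ} (mG : Measurable (Function.uncurry G)) {M : ℝ≥0}
    (hG : ∀ t, ∫⁻ ω, ‖G t ω‖ₑ ∂P ≤ M) :
    (∀ᵐ ω ∂P, Integrable (fun t => κ t * G t ω) ν) ∧
      Integrable (fun ω => ∫ t, κ t * G t ω ∂ν) P ∧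
      Integrable (fun t => κ t * ∫ ω, G t ω ∂P) ν ∧
      ∫ ω, ∫ t, κ t * G t ω ∂ν ∂P = ∫ t, κ t * ∫ ω, G t ω ∂P ∂ν := by
  have m : Measurable fun q : T × Ω => κ q.1 * G q.1 q.2 :=
    (mκ.comp measurable_fst).mul mG
  have hi : Integrable (Function.uncurry fun t ω => κ t * G t ω) (ν.prod P) := by
    refine ⟨m.aestronglyMeasurable, ?_⟩
    rw [hasFiniteIntegral_iff_enorm]
    have h2 := hκ.2
    rw [hasFiniteIntegral_iff_enorm] at h2
    calc ∫⁻ q, ‖κ q.1 * G q.1 q.2‖ₑ ∂(ν.prod P) ≤ ∫⁻ t, ‖κ t‖ₑ * M ∂ν := by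
          rw [lintegral_prod _ m.enorm.aemeasurable]
          refine lintegral_mono fun t => ?_
          simp only [enorm_mul]
          rw [lintegral_const_mul' _ _ enorm_ne_top]
          gcongr
          exact hG t
      _ < ⊤ := by
          rw [lintegral_mul_const' _ _ (by finiteness)]
          exact ENNReal.mul_lt_top h2 (by finiteness)
  refine ⟨hi.prod_left_ae, hi.integral_prod_right, ?_, ?_⟩
  · have := hi.integral_prod_left
    simp only [Function.uncurry_apply_pair, integral_const_mul] at this
    exact this
  · rw [← integral_integral_swap hi]
    simp only [integral_const_mul]

/-! ### The linearised solution as a functional of the noise -/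

theorem CutoffKernel.hasCompactSupport_deriv (K : CutoffKernel) : HasCompactSupport K.deriv :=
  HasCompactSupport.intro (isCompact_closedBall (0 : SpaceTime) 1) fun u hu =>
    K.deriv_eq_zero_of_norm (by simpa using hu)

/-- The test function `u ↦ K'_ε(z - u)`. -/
def epsTest (ρ : Mollifier) (K : CutoffKernel) (ε : ℝ) (z : SpaceTime) : 𝓢(SpaceTime, ℝ) :=
  HasCompactSupport.toSchwartzMap (f := fun u => epsKernel ρ K ε (z - u))
    (((ρ.hasCompactSupport_scaled ε).convolution _ K.hasCompactSupport_deriv).comp_homeomorph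
      (Homeomorph.subLeft z))
    (((ρ.hasCompactSupport_scaled ε).contDiff_convolution_left _ (ρ.contDiff_scaled ε)
      K.integrable_deriv.locallyIntegrable).comp (contDiff_const.sub contDiff_id))

theorem epsTest_apply (ρ : Mollifier) (K : CutoffKernel) (ε : ℝ) (z u : SpaceTime) :
    epsTest ρ K ε z u = epsKernel ρ K ε (z - u) := rfl

theorem pairing_epsTest (ρ : Mollifier) (K : CutoffKernel) (ε : ℝ) (z w : SpaceTime) :
    pairing (epsTest ρ K ε z) (epsTest ρ K ε w) = epsCov ρ K ε (z - w) :=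
  integral_epsKernel_mul ρ K ε z w

theorem pairing_test_self (ρ : Mollifier) (ε : ℝ) (z : SpaceTime) :
    pairing (ρ.test ε z) (ρ.test ε z) = ∫ u, ρ.scaled ε u * ρ.scaled ε u :=
  integral_sub_left_eq_self (fun u => ρ.scaled ε u * ρ.scaled ε u) volume z

theorem C0_eq (ρ : Mollifier) (K : CutoffKernel) (ε : ℝ) : C0 ρ K ε = epsCov ρ K ε 0 := by
  have := integral_epsKernel_mul ρ K ε 0 0
  rw [sub_zero] at this
  exact this

/-- Tested against a fixed θ, averaging the shifted mollifiers with weight K' is Fubini's theorem,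
and it produces the kernel K'_ε. -/
theorem integral_deriv_mul_pairing (ρ : Mollifier) (K : CutoffKernel) (ε : ℝ) (z : SpaceTime)
    (θ : 𝓢(SpaceTime, ℝ)) :
    ∫ u, K.deriv u * pairing (ρ.test ε (z - u)) θ = pairing (epsTest ρ K ε z) θ := by
  obtain ⟨B, hB⟩ := (ρ.hasCompactSupport_scaled ε).exists_bound_of_continuous (ρ.continuous_scaled ε)
  have hB0 : 0 ≤ B := (norm_nonneg _).trans (hB 0)
  lift B to ℝ≥0 using hB0
  have hθ := θ.integrable (μ := volume).2
  rw [hasFiniteIntegral_iff_enorm] at hθ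
  have mρ := (ρ.continuous_scaled ε).measurable
  have mθ := θ.continuous.measurable
  have mG : Measurable (Function.uncurry fun (u y : SpaceTime) => ρ.scaled ε (z - u - y) * θ y) := by
    unfold Function.uncurry
    exact (mρ.comp (by fun_prop)).mul (mθ.comp measurable_snd)
  obtain ⟨-, -, -, h⟩ := integral_mixture (P := volume) K.integrable_deriv K.measurable_deriv mG
    (M := B * (∫⁻ y, ‖θ y‖ₑ).toNNReal) (fun u => by
      rw [ENNReal.coe_mul, ENNReal.coe_toNNReal hθ.ne, ← lintegral_const_mul' _ _ ENNReal.coe_ne_top]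
      refine lintegral_mono fun y => ?_
      rw [enorm_mul]
      gcongr
      rw [← ofReal_norm]
      exact (ENNReal.ofReal_le_ofReal (hB _)).trans (by simp))
  rw [pairing_apply]
  refine Eq.trans ?_ (h.symm.trans ?_)
  · rfl
  · congr 1; ext y
    rw [epsTest_apply, epsKernel, conv_apply, ← integral_sub_left_eq_self _ volume (z - y),
      ← integral_mul_const]
    congr 1; ext u
    rw [show z - (z - y - u) - y = u by abel]
    ring

section Noise

variable (ρ : Mollifier) (K : CutoffKernel) (ε : ℝ) {Ω : Type*} [MeasurableSpace Ω]
  {P : Measure Ω} {ξ : Ω → (𝓢(SpaceTime, ℝ) →L[ℝ] ℝ)}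

theorem measurable_regularise (hξ : IsWhiteNoise P ξ) :
    Measurable (Function.uncurry fun (z : SpaceTime) (ω : Ω) => regularise ρ ε (ξ ω) z) :=
  measurable_uncurry_of_continuous_of_measurable (fun ω => continuous_regularise ρ ε (ξ ω))
    fun z => hξ.measurable (ρ.test ε z)

theorem measurable_conv_regularise (hξ : IsWhiteNoise P ξ) :
    Measurable (Function.uncurry fun (z : SpaceTime) (ω : Ω) =>
      conv K.deriv (regularise ρ ε (ξ ω)) z) := by
  refine measurable_uncurry_of_continuous_of_measurable
    (fun ω => Symb.continuous_conv_deriv K (continuous_regularise ρ ε (ξ ω))) fun z => ?_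
  simp only [conv_apply]
  have m : Measurable fun q : Ω × SpaceTime => K.deriv q.2 * regularise ρ ε (ξ q.1) (z - q.2) := by
    refine (K.measurable_deriv.comp measurable_snd).mul ?_
    exact (measurable_regularise ρ ε hξ).comp
      (f := fun q : Ω × SpaceTime => (z - q.2, q.1)) (by fun_prop)
  exact m.stronglyMeasurable.integral_prod_right'.measurable

/-- The distribution would have to be exchanged with an integral of test functions. Instead the L²
distance is computed: both variables and their product have the same second moment, the pairing of
the test function with itself, so the difference has mean square 0. The null set may depend on z,
which Fubini tolerates. -/
theorem conv_regularise_ae_eq [IsProbabilityMeasure P] (hξ : IsWhiteNoise P ξ) (z : SpaceTime) :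
    ∀ᵐ ω ∂P, conv K.deriv (regularise ρ ε (ξ ω)) z = ξ ω (epsTest ρ K ε z) := by
  have hX := hξ.isGaussField
  set X := noiseMap ξ with hXdef
  set φ := epsTest ρ K ε z with hφ
  set Y : Ω → ℝ := fun ω => conv K.deriv (regularise ρ ε (ξ ω)) z with hY
  have hYeq : ∀ ω, Y ω = ∫ u, K.deriv u * X (ρ.test ε (z - u)) ω := fun ω => conv_apply _ _ z
  set R := ∫ u, ρ.scaled ε u * ρ.scaled ε u with hR
  have mreg := measurable_regularise ρ ε hξ
  have mX : ∀ {T : Type} [MeasurableSpace T] {f : T → SpaceTime}, Measurable f →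
      Measurable (Function.uncurry fun (t : T) (ω : Ω) => X (ρ.test ε (z - f t)) ω) := by
    intro T _ f hf
    exact mreg.comp (f := fun q : T × Ω => (z - f q.1, q.2)) (by fun_prop)
  have mlin : ∀ θ : 𝓢(SpaceTime, ℝ), Integrable (fun ω => Y ω * X θ ω) P ∧
      ∫ ω, Y ω * X θ ω ∂P = pairing φ θ := by
    intro θ
    have mG : Measurable (Function.uncurry fun (u : SpaceTime) (ω : Ω) =>
        X (ρ.test ε (z - u)) ω * X θ ω) :=
      (mX measurable_id).mul ((hX.measurable θ).comp measurable_snd)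
    obtain ⟨-, h1, -, h2⟩ := integral_mixture (P := P) K.integrable_deriv K.measurable_deriv mG
      (M := Real.toNNReal (R + pairing θ θ)) (fun u => by
        have := hX.lintegral_mul_le (ρ.test ε (z - u)) θ
        rwa [pairing_test_self] at this)
    have e : ∀ ω, ∫ u, K.deriv u * (X (ρ.test ε (z - u)) ω * X θ ω) = Y ω * X θ ω := fun ω => by
      rw [hYeq, ← integral_mul_const]
      congr 1; ext u; ring
    simp only [e] at h1 h2
    refine ⟨h1, h2.trans ?_⟩
    simp only [hX.integral_mul]
    exact integral_deriv_mul_pairing ρ K ε z θ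
  have hquad : Integrable (fun ω => Y ω * Y ω) P ∧ ∫ ω, Y ω * Y ω ∂P = pairing φ φ := by
    have mG : Measurable (Function.uncurry fun (p : SpaceTime × SpaceTime) (ω : Ω) =>
        X (ρ.test ε (z - p.1)) ω * X (ρ.test ε (z - p.2)) ω) :=
      (mX measurable_fst).mul (mX measurable_snd)
    have hκ := K.integrable_deriv.mul_prod K.integrable_deriv
    have mκ : Measurable fun p : SpaceTime × SpaceTime => K.deriv p.1 * K.deriv p.2 :=
      (K.measurable_deriv.comp measurable_fst).mul (K.measurable_deriv.comp measurable_snd)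
    obtain ⟨-, h1, h3, h2⟩ := integral_mixture (P := P) hκ mκ mG
      (M := Real.toNNReal (R + R)) (fun p => by
        have := hX.lintegral_mul_le (ρ.test ε (z - p.1)) (ρ.test ε (z - p.2))
        rwa [pairing_test_self, pairing_test_self] at this)
    have e : ∀ ω, ∫ p : SpaceTime × SpaceTime, K.deriv p.1 * K.deriv p.2 *
        (X (ρ.test ε (z - p.1)) ω * X (ρ.test ε (z - p.2)) ω) ∂(volume.prod volume) = Y ω * Y ω := fun ω => by
      rw [hYeq, ← integral_prod_mul]
      congr 1; ext p; ring
    simp only [e] at h1 h2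
    refine ⟨h1, h2.trans ?_⟩
    simp only [hX.integral_mul] at h3 ⊢
    rw [integral_prod _ h3]
    have e2 : ∀ u, ∫ v, K.deriv u * K.deriv v * pairing (ρ.test ε (z - u)) (ρ.test ε (z - v)) =
        K.deriv u * pairing (ρ.test ε (z - u)) φ := fun u => by
      simp only [mul_assoc, integral_const_mul]
      congr 1
      rw [hX.symm _ φ, hφ, ← integral_deriv_mul_pairing ρ K ε z]
      congr 1; ext v
      rw [hX.symm]
    simp only [e2]
    exact integral_deriv_mul_pairing ρ K ε z φ
  have hφφ : Integrable (fun ω => X φ ω * X φ ω) P :=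
    ((hX.hasMoments φ).mul (hX.hasMoments φ)).integrable
  have hexp : ∀ ω, (Y ω - X φ ω) ^ 2 = Y ω * Y ω - 2 * (Y ω * X φ ω) + X φ ω * X φ ω := fun ω => by
    ring
  have hi1 : Integrable (fun ω => Y ω * Y ω - 2 * (Y ω * X φ ω)) P :=
    hquad.1.sub ((mlin φ).1.const_mul 2)
  have hi : Integrable (fun ω => (Y ω - X φ ω) ^ 2) P := by
    simp only [hexp]
    exact hi1.add hφφ
  have h0 : ∫ ω, (Y ω - X φ ω) ^ 2 ∂P = 0 := by
    simp only [hexp]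
    rw [integral_add hi1 hφφ, integral_sub hquad.1 ((mlin φ).1.const_mul 2), integral_const_mul,
      hquad.2, (mlin φ).2, hX.integral_mul]
    ring
  have := (integral_eq_zero_iff_of_nonneg (fun ω => sq_nonneg _) hi).mp h0
  filter_upwards [this] with ω hω
  have h : (Y ω - X φ ω) ^ 2 = 0 := hω
  have h' := pow_eq_zero_iff (two_ne_zero) |>.mp h
  exact sub_eq_zero.mp h'

end Noise

/-! ### The constants as integrals over two vertices -/

/-- Moments of a single Wick power depend only on the common variance, and |pqr| ≤ p² + q⁴ + r⁴. The
bound is therefore uniform in the three points, as the exchange of expectation and space integrals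
requires. -/
theorem IsGaussField.exists_lintegral_wickPow_le {Ω V : Type*} [MeasurableSpace Ω] [AddCommGroup V]
    [Module ℝ V] {P : Measure Ω} [IsProbabilityMeasure P] {X : V →ₗ[ℝ] (Ω → ℝ)}
    {b : V →ₗ[ℝ] V →ₗ[ℝ] ℝ} (hX : IsGaussField P X b) (C : ℝ) (i j k : ℕ) :
    ∃ M : ℝ≥0, ∀ u v y, b u u = C → b v v = C → b y y = C →
      ∫⁻ ω, ‖wickPow C i (X u ω) * (wickPow C j (X v ω) * wickPow C k (X y ω))‖ₑ ∂P ≤ M := by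
  set m : ℕ → ℕ → ℝ := fun i n => ∫ x, wickPow C i x ^ n ∂(gaussianReal 0 (Real.toNNReal C)) with hm
  refine ⟨Real.toNNReal (m i 2 + m j 4 + m k 4), fun u v y hu hv hy => ?_⟩
  have hw : ∀ i v, HasMoments P fun ω => wickPow C i (X v ω) := fun i v => by
    simpa only [eval_wickPoly] using (hX.hasMoments v).eval (wickPoly C i)
  have e : ∀ i n v, b v v = C → ∫ ω, wickPow C i (X v ω) ^ n ∂P = m i n := fun i n v hv => by
    rw [hm]
    simp only
    rw [← hv, ← hX.law v, integral_map (hX.measurable v).aemeasurable]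
    exact ((continuous_wickPow _ i).pow n).aestronglyMeasurable
  have i1 := ((hw i u).pow 2).integrable
  have i2 := ((hw j v).pow 4).integrable
  have i3 := ((hw k y).pow 4).integrable
  have i12 : Integrable (fun ω => wickPow C i (X u ω) ^ 2 + wickPow C j (X v ω) ^ 4) P := i1.add i2
  have i4 := ((hw i u).mul ((hw j v).mul (hw k y))).integrable
  rw [← ofReal_integral_norm_eq_lintegral_enorm i4]
  refine ENNReal.ofReal_le_ofReal ?_
  rw [← e i 2 u hu, ← e j 4 v hv, ← e k 4 y hy, ← integral_add i1 i2, ← integral_add i12 i3]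
  refine integral_mono i4.norm (i12.add i3) fun ω => ?_
  simp only [Real.norm_eq_abs]
  generalize wickPow C i (X u ω) = p
  generalize wickPow C j (X v ω) = q
  generalize wickPow C k (X y ω) = r
  rw [abs_le]
  constructor <;>
    nlinarith [sq_nonneg (p - q * r), sq_nonneg (p + q * r), sq_nonneg (q ^ 2 - r ^ 2),
      sq_nonneg (q ^ 2), sq_nonneg (r ^ 2), sq_nonneg p]

/-! ### Expectations of the renormalised symbols. -/

section Noise

variable (ρ : Mollifier) (K : CutoffKernel) (ε : ℝ) {Ω : Type*} [MeasurableSpace Ω]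
  {P : Measure Ω} [IsProbabilityMeasure P] {ξ : Ω → (𝓢(SpaceTime, ℝ) →L[ℝ] ℝ)}

/-- The product of the Wick powers of `K' * ξ_ε` at the points `0`, `y` and `z`. -/
def wickTriple (ξ : 𝓢(SpaceTime, ℝ) →L[ℝ] ℝ) (i j k : ℕ) (y z : SpaceTime) : ℝ :=
  wickPow (C0 ρ K ε) i (conv K.deriv (regularise ρ ε ξ) 0) *
    (wickPow (C0 ρ K ε) j (conv K.deriv (regularise ρ ε ξ) y) *
      wickPow (C0 ρ K ε) k (conv K.deriv (regularise ρ ε ξ) z))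

theorem wickTriple_ae_eq (hξ : IsWhiteNoise P ξ) (i j k : ℕ) (y z : SpaceTime) :
    (fun ω => wickTriple ρ K ε (ξ ω) i j k y z) =ᵐ[P] fun ω =>
      wickPow (C0 ρ K ε) i (noiseMap ξ (epsTest ρ K ε 0) ω) *
        (wickPow (C0 ρ K ε) j (noiseMap ξ (epsTest ρ K ε y) ω) *
          wickPow (C0 ρ K ε) k (noiseMap ξ (epsTest ρ K ε z) ω)) := by
  filter_upwards [conv_regularise_ae_eq ρ K ε hξ 0, conv_regularise_ae_eq ρ K ε hξ y,
    conv_regularise_ae_eq ρ K ε hξ z] with ω h0 hy hz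
  rw [wickTriple, h0, hy, hz]
  rfl

/-- By stationarity the variance is the same at all points, and it equals the constant used in the
Wick map; the self-contractions therefore cancel exactly. -/
theorem pairing_epsTest_self (z : SpaceTime) :
    pairing (epsTest ρ K ε z) (epsTest ρ K ε z) = C0 ρ K ε := by
  rw [pairing_epsTest, sub_self, C0_eq]

theorem integral_wickTriple (hξ : IsWhiteNoise P ξ) (i j k : ℕ) (y z : SpaceTime) :
    ∫ ω, wickTriple ρ K ε (ξ ω) i j k y z ∂P =
      tripleWick (epsCov ρ K ε y) (epsCov ρ K ε z) (epsCov ρ K ε (y - z)) i j k := by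
  rw [integral_congr_ae (wickTriple_ae_eq ρ K ε hξ i j k y z),
    hξ.isGaussField.integral_wickPow (pairing_epsTest_self ρ K ε _) (pairing_epsTest_self ρ K ε _)
      (pairing_epsTest_self ρ K ε _)]
  simp only [pairing_epsTest, zero_sub, epsCov_neg]

theorem integral_mixture_wickTriple (hξ : IsWhiteNoise P ξ) (i j k : ℕ)
    {f g : SpaceTime × SpaceTime → SpaceTime} (mf : Measurable f) (mg : Measurable g) :
    (∀ᵐ ω ∂P, Integrable fun p : SpaceTime × SpaceTime =>
      K.deriv p.1 * K.deriv p.2 * wickTriple ρ K ε (ξ ω) i j k (f p) (g p)) ∧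
    Integrable (fun ω => ∫ p : SpaceTime × SpaceTime,
      K.deriv p.1 * K.deriv p.2 * wickTriple ρ K ε (ξ ω) i j k (f p) (g p)) P ∧
    ∫ ω, (∫ p : SpaceTime × SpaceTime,
      K.deriv p.1 * K.deriv p.2 * wickTriple ρ K ε (ξ ω) i j k (f p) (g p)) ∂P =
      ∫ p : SpaceTime × SpaceTime, K.deriv p.1 * K.deriv p.2 *
        tripleWick (epsCov ρ K ε (f p)) (epsCov ρ K ε (g p)) (epsCov ρ K ε (f p - g p)) i j k := by
  obtain ⟨M, hM⟩ := hξ.isGaussField.exists_lintegral_wickPow_le (C0 ρ K ε) i j k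
  have mΨ := measurable_conv_regularise ρ K ε hξ
  have hw : ∀ (j : ℕ) {f : SpaceTime × SpaceTime → SpaceTime}, Measurable f →
      Measurable fun q : (SpaceTime × SpaceTime) × Ω =>
        wickPow (C0 ρ K ε) j (conv K.deriv (regularise ρ ε (ξ q.2)) (f q.1)) := fun j f mf =>
    (continuous_wickPow _ j).measurable.comp
      (mΨ.comp (f := fun q : (SpaceTime × SpaceTime) × Ω => (f q.1, q.2)) (by fun_prop))
  have mG : Measurable (Function.uncurry fun (p : SpaceTime × SpaceTime) (ω : Ω) =>
      wickTriple ρ K ε (ξ ω) i j k (f p) (g p)) :=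
    (hw i measurable_const).mul ((hw j mf).mul (hw k mg))
  have mκ : Measurable fun p : SpaceTime × SpaceTime => K.deriv p.1 * K.deriv p.2 :=
    (K.measurable_deriv.comp measurable_fst).mul (K.measurable_deriv.comp measurable_snd)
  obtain ⟨h1, h2, -, h3⟩ := integral_mixture (ν := volume) (P := P)
    (K.integrable_deriv.mul_prod K.integrable_deriv) mκ mG (M := M) (fun p => by
      refine (lintegral_congr_ae ((wickTriple_ae_eq ρ K ε hξ i j k (f p) (g p)).fun_comp
        (‖·‖ₑ))).trans_le ?_
      exact hM _ _ _ (pairing_epsTest_self ρ K ε _) (pairing_epsTest_self ρ K ε _)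
        (pairing_epsTest_self ρ K ε _))
  refine ⟨h1, h2, h3.trans ?_⟩
  simp only [integral_wickTriple ρ K ε hξ]

theorem renormVariable_typeA (ℓ m n : ℕ) (ξ : 𝓢(SpaceTime, ℝ) →L[ℝ] ℝ) :
    renormVariable ρ K ε (Symb.typeA ℓ m n) ξ = ε ^ (ℓ + m + n) * ∫ p : SpaceTime × SpaceTime,
      K.deriv p.1 * K.deriv p.2 *
        wickTriple ρ K ε ξ (2 * ℓ) (2 * m + 2) (2 * n + 2) (-p.1) (-p.2) := by
  rw [renormVariable_eq, Symb.typeA, Symb.wickRealise_epsPow]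
  simp only [Symb.wickRealise, Symb.wickRealise_epsPow, conv_apply (K.deriv) (fun z => _ * _), zero_sub]
  simp only [mul_left_comm (K.deriv _) (ε ^ _), integral_const_mul]
  set Ψ := conv K.deriv (regularise ρ ε ξ) with hΨ
  set C := C0 ρ K ε
  have := integral_prod_mul (μ := volume) (ν := volume)
    (fun u : SpaceTime => K.deriv u * wickPow C (2 * m + 2) (Ψ (-u)))
    (fun v : SpaceTime => K.deriv v * wickPow C (2 * n + 2) (Ψ (-v)))
  have e : ∀ p : SpaceTime × SpaceTime, K.deriv p.1 * K.deriv p.2 *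
        wickTriple ρ K ε ξ (2 * ℓ) (2 * m + 2) (2 * n + 2) (-p.1) (-p.2) =
      wickPow C (2 * ℓ) (Ψ 0) * ((K.deriv p.1 * wickPow C (2 * m + 2) (Ψ (-p.1))) *
        (K.deriv p.2 * wickPow C (2 * n + 2) (Ψ (-p.2)))) := fun p => by
    rw [wickTriple]; ring
  simp only [e, integral_const_mul]
  rw [Measure.volume_eq_prod SpaceTime SpaceTime, this]
  ring

/-- The nested convolutions form an iterated integral, so Fubini needs absolute convergence, which
is available for almost every noise. In the other family the two convolutions are a genuine product
and no such condition arises. -/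
theorem renormVariable_typeB (ℓ m n : ℕ) (ξ : 𝓢(SpaceTime, ℝ) →L[ℝ] ℝ)
    (h : Integrable fun p : SpaceTime × SpaceTime => K.deriv p.1 * K.deriv p.2 *
        wickTriple ρ K ε ξ (2 * ℓ + 1) (2 * m + 1) (2 * n + 2) (-p.1) (-p.1 - p.2)) :
    renormVariable ρ K ε (Symb.typeB ℓ m n) ξ = ε ^ (ℓ + m + n) * ∫ p : SpaceTime × SpaceTime,
      K.deriv p.1 * K.deriv p.2 *
        wickTriple ρ K ε ξ (2 * ℓ + 1) (2 * m + 1) (2 * n + 2) (-p.1) (-p.1 - p.2) := by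
  rw [Measure.volume_eq_prod] at h ⊢
  rw [integral_prod _ h, renormVariable_eq, Symb.typeB, Symb.wickRealise_epsPow]
  simp only [Symb.wickRealise, Symb.wickRealise_epsPow, conv_apply (K.deriv) (fun z => _ * _), zero_sub]
  simp only [wickTriple, ← integral_const_mul, ← mul_assoc]
  congr 1; ext u
  congr 1; ext v
  ring

theorem Ctau_typeA (hξ : IsWhiteNoise P ξ) (ℓ m n : ℕ) :
    Integrable (fun ω => renormVariable ρ K ε (Symb.typeA ℓ m n) (ξ ω)) P ∧
    Ctau P ξ ρ K ε (Symb.typeA ℓ m n) = ε ^ (ℓ + m + n) * ∫ p : SpaceTime × SpaceTime,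
      K.deriv p.1 * K.deriv p.2 * tripleWick (epsCov ρ K ε p.1) (epsCov ρ K ε p.2)
        (epsCov ρ K ε (p.1 - p.2)) (2 * ℓ) (2 * m + 2) (2 * n + 2) := by
  obtain ⟨-, h1, h2⟩ := integral_mixture_wickTriple ρ K ε hξ (2 * ℓ) (2 * m + 2) (2 * n + 2)
    (f := fun p => -p.1) (g := fun p => -p.2) (by fun_prop) (by fun_prop)
  refine ⟨?_, ?_⟩
  · simp only [renormVariable_typeA]
    exact h1.const_mul _
  · simp only [Ctau, renormVariable_typeA]
    rw [integral_const_mul, h2]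
    have e : ∀ p : SpaceTime × SpaceTime, -p.1 - -p.2 = -(p.1 - p.2) := fun p => by abel
    simp only [e, epsCov_neg]

theorem Ctau_typeB (hξ : IsWhiteNoise P ξ) (ℓ m n : ℕ) :
    Integrable (fun ω => renormVariable ρ K ε (Symb.typeB ℓ m n) (ξ ω)) P ∧
    Ctau P ξ ρ K ε (Symb.typeB ℓ m n) = ε ^ (ℓ + m + n) * ∫ p : SpaceTime × SpaceTime,
      K.deriv p.1 * K.deriv p.2 * tripleWick (epsCov ρ K ε p.1) (epsCov ρ K ε (p.1 + p.2))
        (epsCov ρ K ε p.2) (2 * ℓ + 1) (2 * m + 1) (2 * n + 2) := by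
  obtain ⟨h0, h1, h2⟩ := integral_mixture_wickTriple ρ K ε hξ (2 * ℓ + 1) (2 * m + 1) (2 * n + 2)
    (f := fun p => -p.1) (g := fun p => -p.1 - p.2) (by fun_prop) (by fun_prop)
  have h := h0.mono fun ω hω => renormVariable_typeB ρ K ε ℓ m n (ξ ω) hω
  refine ⟨(h1.const_mul _).congr (h.mono fun ω hω => hω.symm), ?_⟩
  rw [Ctau, integral_congr_ae h, integral_const_mul, h2]
  have e1 : ∀ p : SpaceTime × SpaceTime, -p.1 - p.2 = -(p.1 + p.2) := fun p => by abel
  have e2 : ∀ p : SpaceTime × SpaceTime, -p.1 - -(p.1 + p.2) = p.2 := fun p => by abel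
  simp only [e1, e2, epsCov_neg]

variable {ε} in
-- Counting pairings gives a + b + c = ℓ + m + n + 2. The scaling factor ε^{a+b+c+4-6} then
-- coincides with the prefactor ε^{ℓ+m+n} from the symbols `eps`, so no power of ε is left.
theorem Ctau_typeA_eq (hε : 0 < ε) (hξ : IsWhiteNoise P ξ) {ℓ m n a b c : ℕ} {κ : ℝ}
    (hd : a + b + c = ℓ + m + n + 2) (h : ∀ x y z : ℝ,
      tripleWick x y z (2 * ℓ) (2 * m + 2) (2 * n + 2) = κ * (x ^ a * y ^ b * z ^ c)) :
    Ctau P ξ ρ K ε (Symb.typeA ℓ m n) =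
      κ * ∫ p, triA (scaleKer ε K.deriv) (ρ.cov (scaleKer ε K.deriv)) a b c p := by
  rw [(Ctau_typeA ρ K ε hξ ℓ m n).2, cov_scaleKer ρ K hε, integral_triA_scale hε,
    show a + b + c + 4 = ℓ + m + n + 6 by omega, pow_add ε (ℓ + m + n) 6, mul_inv_cancel_right₀ (by positivity),
    mul_left_comm, ← integral_const_mul κ]
  congr 2; ext p
  rw [h, triA]
  ring

variable {ε} in
theorem Ctau_typeB_eq (hε : 0 < ε) (hξ : IsWhiteNoise P ξ) {ℓ m n a b c : ℕ} {κ : ℝ}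
    (hd : a + b + c = ℓ + m + n + 2) (h : ∀ x y z : ℝ,
      tripleWick x y z (2 * ℓ + 1) (2 * m + 1) (2 * n + 2) = κ * (x ^ a * y ^ b * z ^ c)) :
    Ctau P ξ ρ K ε (Symb.typeB ℓ m n) =
      κ * ∫ p, triB (scaleKer ε K.deriv) (ρ.cov (scaleKer ε K.deriv)) a b c p := by
  rw [(Ctau_typeB ρ K ε hξ ℓ m n).2, cov_scaleKer ρ K hε, integral_triB_scale hε,
    show a + b + c + 4 = ℓ + m + n + 6 by omega, pow_add ε (ℓ + m + n) 6, mul_inv_cancel_right₀ (by positivity),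
    mul_left_comm, ← integral_const_mul κ]
  congr 2; ext p
  rw [h, triB]
  ring

end Noise

/-- The limit of the integral of `triB` exists, with a value that does not depend on the cutoff. -/
theorem exists_tendsto_integral_triB (ρ : Mollifier) {a b c : ℕ} (hab : Odd (a + b))
    (hac : Odd (a + c)) (hbc : Even (b + c)) (h2 : 2 ≤ b + c) (h3 : 3 ≤ a + b + c) :
    ∃ r : ℝ, ∀ K : CutoffKernel, Tendsto
      (fun l => ∫ p, triB (scaleKer l K.deriv) (ρ.cov (scaleKer l K.deriv)) a b c p)
      (𝓝[>] 0) (𝓝 r) := by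
  rcases Nat.eq_zero_or_pos b with rfl | hb
  · refine ⟨0, fun K => ?_⟩
    obtain ⟨C, -, hC⟩ := K.exists_eventually_isKer
    refine tendsto_const_nhds.congr' ?_
    filter_upwards [hC] with l hl
    exact (integral_triB_zero hl.odd (ρ.cov_reflect hl.odd) a c).symm
  -- In this case parity makes c odd, and the total of at least 3 then gives c ≥ 3.
  by_cases h1 : a = 0 ∧ b = 1
  · obtain ⟨rfl, rfl⟩ := h1
    exact ⟨_, fun K => tendsto_integral_triB_one ρ K (by obtain ⟨r, hr⟩ := hac; omega)⟩
  -- For b ≥ 3 the count is immediate. If b = 2 then a is odd, hence a ≥ 1. If b = 1 then a is even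
  -- and nonzero and c is odd, so all three factors are present.
  · refine ⟨_, fun K => tendsto_integral_triB ρ K ?_⟩
    obtain ⟨r, hr⟩ := hab
    obtain ⟨s, hs⟩ := hac
    obtain ⟨t, ht⟩ := hbc
    omega

/-- Here a, b, c have the same parity. If they are odd, all three factors occur. If they are even,
then c ≥ 4 is immediate, c = 2 leaves a or b at least 2 because (0, 0, 2) is the excluded symbol,
and c = 0 forces a, b ≥ 2. -/
theorem exists_tendsto_Ctau_typeA (ρ : Mollifier) {ℓ m n : ℕ}
    (h0 : Symb.typeA ℓ m n ≠ Symb.tree22) : ∃ r : ℝ, ∀ (K : CutoffKernel) (Ω : Type*)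
      [MeasurableSpace Ω] (P : Measure Ω) [IsProbabilityMeasure P]
      (ξ : Ω → (𝓢(SpaceTime, ℝ) →L[ℝ] ℝ)), IsWhiteNoise P ξ →
      Tendsto (fun ε : ℝ => Ctau P ξ ρ K ε (Symb.typeA ℓ m n)) (𝓝[>] 0) (𝓝 r) := by
  have hpos : ¬ (ℓ = 0 ∧ m = 0 ∧ n = 0) := by
    rintro ⟨rfl, rfl, rfl⟩
    exact h0 rfl
  rcases tripleWick_eq (2 * ℓ) (2 * m + 2) (2 * n + 2) with ⟨a, b, c, hi, hj, hk, h⟩ | h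
  · refine ⟨tripleWick 1 1 1 (2 * ℓ) (2 * m + 2) (2 * n + 2) *
      ∫ p, triA heatDeriv (ρ.cov heatDeriv) a b c p, fun K Ω _ P _ ξ hξ => ?_⟩
    refine ((tendsto_integral_triA ρ K (a := a) (b := b) (c := c) (by omega)).const_mul
      _).congr' ?_
    filter_upwards [self_mem_nhdsWithin] with ε hε
    exact (Ctau_typeA_eq ρ K hε hξ (by omega) h).symm
  · refine ⟨0, fun K Ω _ P _ ξ hξ => tendsto_const_nhds.congr fun ε => ?_⟩
    simp [(Ctau_typeA ρ K ε hξ ℓ m n).2, h]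

/-- The excluded symbol is the pairing (0, 1, 1), which is the graph of C₂; excluding it gives a + b
+ c ≥ 3. The parities of the Wick powers decide which of the three convergence arguments applies. -/
theorem exists_tendsto_Ctau_typeB (ρ : Mollifier) {ℓ m n : ℕ}
    (h0 : Symb.typeB ℓ m n ≠ Symb.tree211) : ∃ r : ℝ, ∀ (K : CutoffKernel) (Ω : Type*)
      [MeasurableSpace Ω] (P : Measure Ω) [IsProbabilityMeasure P]
      (ξ : Ω → (𝓢(SpaceTime, ℝ) →L[ℝ] ℝ)), IsWhiteNoise P ξ →
      Tendsto (fun ε : ℝ => Ctau P ξ ρ K ε (Symb.typeB ℓ m n)) (𝓝[>] 0) (𝓝 r) := by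
  have hpos : ¬ (ℓ = 0 ∧ m = 0 ∧ n = 0) := by
    rintro ⟨rfl, rfl, rfl⟩
    exact h0 rfl
  rcases tripleWick_eq (2 * ℓ + 1) (2 * m + 1) (2 * n + 2) with ⟨a, b, c, hi, hj, hk, h⟩ | h
  · obtain ⟨r, hr⟩ := exists_tendsto_integral_triB ρ (a := a) (b := b) (c := c) ⟨ℓ, hi.symm⟩
      ⟨m, hj.symm⟩ ⟨n + 1, by omega⟩ (by omega) (by omega)
    refine ⟨tripleWick 1 1 1 (2 * ℓ + 1) (2 * m + 1) (2 * n + 2) * r, fun K Ω _ P _ ξ hξ => ?_⟩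
    refine ((hr K).const_mul _).congr' ?_
    filter_upwards [self_mem_nhdsWithin] with ε hε
    exact (Ctau_typeB_eq ρ K hε hξ (by omega) h).symm
  · refine ⟨0, fun K Ω _ P _ ξ hξ => tendsto_const_nhds.congr fun ε => ?_⟩
    simp [(Ctau_typeB ρ K ε hξ ℓ m n).2, h]

end KPZLogs

end

theorem mainTheorem5 (ρ : KPZLogs.Mollifier) :
    (∀ K : KPZLogs.CutoffKernel,
      (∀ ε : ℝ, 0 < ε → Integrable (KPZLogs.C2Integrand ρ K ε) ∧
        Integrable (KPZLogs.C3Integrand ρ K ε)) ∧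
      ∃ c : ℝ, Tendsto (fun ε : ℝ => KPZLogs.C3 ρ K ε + 4 * KPZLogs.C2 ρ K ε)
        (𝓝[>] 0) (𝓝 c)) ∧
    (∀ τ ∈ KPZLogs.Symb.setB \ {KPZLogs.Symb.tree22, KPZLogs.Symb.tree211},
      ∃ cτ : ℝ, ∀ K : KPZLogs.CutoffKernel,
        ∀ (Ω : Type*) [MeasurableSpace Ω] (P : Measure Ω) [IsProbabilityMeasure P]
          (ξ : Ω → (𝓢(KPZLogs.SpaceTime, ℝ) →L[ℝ] ℝ)), KPZLogs.IsWhiteNoise P ξ →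
          (∀ ε : ℝ, 0 < ε → Integrable (fun ω => KPZLogs.renormVariable ρ K ε τ (ξ ω)) P) ∧
          Tendsto (fun ε : ℝ => KPZLogs.Ctau P ξ ρ K ε τ) (𝓝[>] 0) (𝓝 cτ)) := by
  refine ⟨fun K => ⟨fun ε _ => ⟨(KPZLogs.C2Integrand_integrable_and_eq ρ K ε).1,
    (KPZLogs.C3Integrand_integrable_and_eq ρ K ε).1⟩, ?_⟩, ?_⟩
  · obtain ⟨c, hc⟩ := KPZLogs.exists_tendsto_integral_logInt ρ K
    refine ⟨c, hc.congr' ?_⟩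
    filter_upwards [self_mem_nhdsWithin] with ε hε
    exact (KPZLogs.C3_add_four_C2 ρ K hε).symm
  · rintro τ ⟨⟨ℓ, m, n, rfl | rfl⟩, hτ⟩
    · obtain ⟨r, hr⟩ := KPZLogs.exists_tendsto_Ctau_typeA ρ (ℓ := ℓ) (m := m) (n := n)
        fun h => hτ (Or.inl h)
      exact ⟨r, fun K Ω _ P _ ξ hξ => ⟨fun ε _ => (KPZLogs.Ctau_typeA ρ K ε hξ ℓ m n).1,
        hr K Ω P ξ hξ⟩⟩
    · obtain ⟨r, hr⟩ := KPZLogs.exists_tendsto_Ctau_typeB ρ (ℓ := ℓ) (m := m) (n := n)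
        fun h => hτ (Or.inr h)
      exact ⟨r, fun K Ω _ P _ ξ hξ => ⟨fun ε _ => (KPZLogs.Ctau_typeB ρ K ε hξ ℓ m n).1,
        hr K Ω P ξ hξ⟩⟩
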